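/- **Notation and parameters.** Let $p$ be a prime, $k$ a finite field of characteristic $p$, $N_0=[k:\mathbb F_p]$, $\mathcal K=k((t))$, $\sigma$ the $p$-th power map on $k$ and on $\mathcal K$, and $\alpha_0\in k$ with $\operatorname{Tr}_{k/\mathbb F_p}\alpha_0=1$. For an $\mathbb F_p$-vector space $L$ write $L_k=L\otimes k$, $L_{\mathcal K}=L\otimes\mathcal K$, with $\sigma$ acting as $\mathrm{id}\otimes\sigma$. Let $\widetilde{\exp}(x)=\sum_{0\le i<p}x^i/i!$. For a Lie algebra of nilpotency class $<p$ with enveloping algebra whose augmentation ideal is $J$, let $x\circ y$ be the Campbell–Hausdorff composition, i.e. $\widetilde{\exp}(x)\widetilde{\exp}(y)\equiv\widetilde{\exp}(x\circ y)\bmod J^p$; $C_2$ denotes the commutator subalgebra. Fix a real $v_0>0$; put $u^*=(p-1)(p-2)+1$. Let $A[u,M]$ be the set of all $\sum_{i=1}^u a_ip^{-n_i}$ with $0=n_1\le\dots\le n_u\le M$ and integers $a_i\in[0,(p-1)v_0)$, and $A[u]=\bigcup_MA[u,M]$. Let $\delta_0$ be the minimum of the positive values of $v_0-\alpha/s$ with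 $1\le s<p$, $\alpha\in A[u]$, $1\le u\le u^*$. Let $r^*=b_0^*/(p^{N_0^*}-1)\in(v_0-\delta_0,v_0)$, where $N_0^*\ge2$, $b_0^*\in\mathbb N$ and $\gcd(b_0^*,p(p^{N_0^*}-1))=1$. Let $B[u,M]$ be the set of all $r^*\sum_{i=1}^u b_ip^{-m_i}$ with $0=m_1\le\dots\le m_u\le M$, integers $b_i\ge0$, $b_1\ne0$, $\sum b_i<p$, and $B[u]=\bigcup_MB[u,M]$. Let $N^*\ge1$ be divisible by $N_0^*$ and by $N_0$, with $p^{N^*}|\alpha-\beta|\ge2r^*(p-1)$ for all $\alpha\in A[u^*]$, $\beta\in B[u^*]$, and $r^*(1-p^{-N^*})\in(v_0-\delta_0,v_0)$. Put $q=p^{N^*}$, $b^*=r^*(q-1)\in\mathbb N$. Let $\mathfrak A^0$ be the set of integers $\iota=p^m(q\alpha-(q-1)\beta)$ with $m\ge0$, $\alpha\in A[u^*,m]$, $\beta\in B[u^*,m]\cup\{0\}$, $|\iota|\le(p-1)b^*$. The integers $p^m\alpha$ and $p^m\beta/r^*$ and the sum $\operatorname{ch}(\iota)$ of the digits $b_i$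 of $\beta/r^*$ depend only on $\iota$. Let $\kappa(\iota)$ be the least $u\ge1$ such that $\alpha\in A[u,m]$ for some such presentation of $\iota$, and $w^0(\iota)$ the least natural number with $\iota<w^0(\iota)b^*$. Let $\mathfrak A^+(p)$ be the set of $\iota\in\mathfrak A^0$ with $\iota>0$, $\gcd(p^m\alpha,p^m\beta/r^*,p)=1$, $w^0(\iota)+\operatorname{ch}(\iota)\le p-1$, $\kappa(\iota)\le(p-2)\operatorname{ch}(\iota)+w^0(\iota)$; let $\mathfrak A^0(p)=\mathfrak A^+(p)\cup\{0\}$ and $\mathfrak A^0_1(p)=\{\iota\in\mathfrak A^0(p):\operatorname{ch}(\iota)=1\}$. Every $\iota\in\mathfrak A_1^0(p)$ is uniquely of the form $\iota=p^{m}(q\alpha-b^*)$ with $\alpha\in A[u^*,m]$; write $m=m[\iota]$, $\alpha=\alpha[\iota]$. Let $m(\iota)$ be the maximal $n\geq 0$ with $\iota p^{n}\le(p-1)b^*$. **Lie algebras.** Let $\mathbb Z^+(p)$ be the set of positive integers prime to $p$ and $\mathbb Z^0(p)=\mathbb Z^+(p)\cup\{0\}$. Let $\mathcal L$ be the free Lie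 $\mathbb F_p$-algebra modulo its $p$-th commutator ideal such that $\mathcal L_k$ has free generators $D_{an}$ ($a\in\mathbb Z^+(p)$, $n\in\mathbb Z/N_0$) and $D_0$, with $\sigma D_{an}=D_{a,n+1}$, $D_0\in\mathcal L$; put $D_{0n}=\sigma^n(\alpha_0)D_0$. Give $D_{an}$ the weight $s$ if $(s-1)v_0\le a<sv_0$, and let $\bar{\mathcal L}$ be the quotient of $\mathcal L$ by the ideal spanned by the commutators of generators of total weight $\ge p$. Let $\bar{\mathcal L}^\dagger$ be constructed in the same way from generators $D^\dagger_{\iota n}$ ($\iota\in\mathfrak A^+(p)$), $D_0^\dagger$, where $D^\dagger_{\iota n}$, $\iota\in\mathfrak A^0(p)$, has weight $w^0(\iota)+\operatorname{ch}(\iota)$; let $\bar{\mathcal L}^\dagger(s)$ be its ideal spanned by the commutators of weight $\ge s$, and $\bar{\mathcal L}^\dagger=\bigoplus_m\bar{\mathcal L}^\dagger[m]$ the grading for which $D^\dagger_{\iota n}$ has degree $\operatorname{ch}(\iota)$. The elements $\iota\in\mathfrak A^+(p)$ with $\operatorname{ch}(\iota)=0$ are the $qa$, $a\in\mathbb Z^+(p)$,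 $a<(p-1)v_0$; let $\mathcal V:\bar{\mathcal L}^\dagger\to\bar{\mathcal L}$ be the epimorphism with $D^\dagger_{qa,n}\mapsto D_{an}$, $D_0^\dagger\mapsto D_0$, and $D^\dagger_{\iota n}\mapsto0$ if $\operatorname{ch}(\iota)\ge1$. **The ideal $\bar{\mathcal L}[v_0]$.** Let $\bar{\mathcal N}^\dagger\subset\bar{\mathcal L}^\dagger_{\mathcal K}$ be the $k$-span of all $t^{-a}l$ with $l\in\bar{\mathcal L}^\dagger(s)_k$, $s\ge1$, $a<sb^*$, and $\widetilde{\mathcal N}^\dagger=\bar{\mathcal N}^\dagger/t^{(p-1)b^*}\bar{\mathcal N}^\dagger$. For $j\ge0$ let $\widetilde{\mathcal N}^{sp}\langle j\rangle\subset\widetilde{\mathcal N}^\dagger$ be the $k$-span of the images of all $t^{-\iota}l$ with $l\in(\bar{\mathcal L}^\dagger(s)\cap\bar{\mathcal L}^\dagger[m])_k$, $s\ge 1$, $\iota\in\mathfrak A^0$, $\iota+\operatorname{ch}(\iota)b^*<sb^*$, $\operatorname{ch}(\iota)\ge m+j$, $\kappa(\iota)\le(p-3)m+s$; put $\widetilde{\mathcal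 N}^{sp}=\widetilde{\mathcal N}^{sp}\langle0\rangle$. For $\gamma\in\mathbb Z/p$ let $\Omega_\gamma$ act on $\widetilde{\mathcal N}^{sp}$ by $t^{-\iota}l\mapsto t^{-\iota}\,\widetilde{\exp}(\gamma\,(p^m\alpha)\,t^{b^*})\,l$ for $\iota=p^m(q\alpha-(q-1)\beta)\in\mathfrak A^0$. For $\bar e\in\bar{\mathcal L}_{\mathcal K}$ let $\bar e^{(q)}$ be obtained from $\bar e$ by the substitution $t\mapsto t^q$. Call $\bar e^{sp}\in\bar{\mathcal N}^\dagger$ *admissible for* $\bar e$ if $\bar e^{sp}\equiv\sum_{\iota\in\mathfrak A^0(p)}t^{-\iota}D^\dagger_{\iota0}\bmod C_2(\bar{\mathcal L}^\dagger_{\mathcal K})$, its image $\tilde e^{sp}$ in $\widetilde{\mathcal N}^\dagger$ lies in $\widetilde{\mathcal N}^{sp}$, and $\mathcal V_{\mathcal K}(\bar e^{sp})=\bar e^{(q)}$. Given such $\bar e^{sp}$, say that $A\in\operatorname{Aut}_{\mathrm{Lie}}\bar{\mathcal L}^\dagger$ is *conjugate to* $\Omega_\gamma$ if * there is $\tilde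 c\in\widetilde{\mathcal N}^{sp}\langle1\rangle$ with $\sigma\tilde c\in\widetilde{\mathcal N}^{sp}\langle1\rangle$ and $\Omega_\gamma(\tilde e^{sp})=(\sigma\tilde c)\circ(A\otimes\mathrm{id}_{\mathcal K})\tilde e^{sp}\circ(-\tilde c)$, and * $A(D^\dagger_{\iota0})-D^\dagger_{\iota0}\in\bigoplus_{m<\operatorname{ch}(\iota)}\bar{\mathcal L}^\dagger[m]_k$ for all $\iota\in\mathfrak A^0(p)$. If, for every $\gamma\in\mathbb Z/p$, $A^\dagger_\gamma$ is conjugate to $\Omega_\gamma$, let $\bar{\mathcal L}[v_0]=\mathcal V(\bar{\mathcal L}^\dagger[v_0])$, where $\bar{\mathcal L}^\dagger[v_0]$ is the minimal ideal of $\bar{\mathcal L}^\dagger$ containing $A_\gamma^\dagger(\operatorname{Ker}\mathcal V)$ for all $\gamma\in\mathbb Z/p$. **Structural constants.** Let elements $\eta(a_1,\dots,a_s)\in k$ ($0\le s<p$, $a_i\in\mathbb Z^0(p)$; value $1$ for $s=0$) satisfy $\eta(a_1)=1$ and, for all $0\le s_1\le s<p$, $$\eta(a_1,\dots,a_{s_1})\,\eta(a_{s_1+1},\dots,a_s)=\sum_{\pi}\eta(a_{\pi(1)},\dots,a_{\pi(s)}),$$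 $\pi$ running over the permutations of $\{1,\dots,s\}$ for which the sequences $\pi^{-1}(1),\dots,\pi^{-1}(s_1)$ and $\pi^{-1}(s_1+1),\dots,\pi^{-1}(s)$ are increasing. Let $\bar e\in\bar{\mathcal L}_{\mathcal K}$ satisfy $$\widetilde{\exp}\,\bar e\equiv1+\sum_{1\le s<p}\ \sum_{a_1,\dots,a_s\in\mathbb Z^0(p)}\eta(a_1,\dots,a_s)\,t^{-(a_1+\dots+a_s)}D_{a_10}\cdots D_{a_s0}\bmod\bar{\mathcal J}^p_{\mathcal K},\qquad(4.1)$$ $\bar{\mathcal J}$ being the augmentation ideal of the enveloping algebra of $\bar{\mathcal L}$. For $\bar a=(a_1,\dots,a_s)$ and $\bar n\in\mathbb Z^s$ with $n_1\ge\dots\ge n_s$, let $\eta(\bar a,\bar n)=\prod_j\sigma^{m_j}\eta(\bar a^{(j)})$, where $m_1>m_2>\dots$ are the distinct values of $\bar n$ and $\bar a^{(j)}$ is the block of the $a_i$ with $n_i=m_j$; let $\eta(\bar a,\bar n)=0$ for the other $\bar n$. For $\alpha\ge0$ and an integer $N\ge0$ let $$\bar{\mathcal F}^0_{\alpha,-N}=\sum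 a_1\,\eta(\bar a,\bar n)\,[\dots[D_{a_1n_1},D_{a_2n_2}],\dots,D_{a_sn_s}]\in\bar{\mathcal L}_k,$$ the sum over $1\le s<p$, $a_i\in\mathbb Z^0(p)$, $n_1=0$, $n_i\ge-N$, with $a_1p^{n_1}+\dots+a_sp^{n_s}=\alpha$. **Theorem.** Fix, for every $\iota\in\mathfrak A^0_1(p)$, an integer $m_\iota\ge m(\iota)$. 1. There is an $\bar e^{sp}$ admissible for $\bar e$ such that for every $\gamma\in\mathbb Z/p$ there is exactly one automorphism $A^\dagger_\gamma$ of $\bar{\mathcal L}^\dagger$ conjugate to $\Omega_\gamma$. 2. For every $\bar e^{sp}$ admissible for $\bar e$ and all automorphisms $A^\dagger_\gamma$ conjugate to $\Omega_\gamma$ ($\gamma\in\mathbb Z/p$), the ideal $\bar{\mathcal L}[v_0]$ is the minimal ideal of $\bar{\mathcal L}$ such that $\bar{\mathcal F}^0_{\alpha[\iota],-(m[\iota]+m_\iota)}\in\bar{\mathcal L}[v_0]_k$ for all $\iota\in\mathfrak A^0_1(p)$. That is, it has this property and is contained in every ideal of $\bar{\mathcal L}$ that has it. -/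

import Mathlib

open scoped TensorProduct

namespace NilpAS

noncomputable section

/-! ### Weighted truncated free Lie algebras -/

/-- The left-normed bracket `[…[[x₁, x₂], x₃], …, xᵣ]` of a list (`0` for the empty list). -/
def lnb {L : Type*} [LieRing L] : List L → L
  | [] => 0
  | x :: xs => xs.foldl (fun l y => ⁅l, y⁆) x

/-- Free generators: `none` stands for `D₀`; for every `a ∈ S` there are `N` further generators
of index `a`, a basis of the `𝔽_p`-dual of `k t^{-a}`, where `N = [k : 𝔽_p]`. -/
abbrev Gen (S : Set ℤ) (N : ℕ) : Type := Option (S × Fin N)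

/-- The index of a generator (`0` for `D₀`). -/
def Gen.index {S : Set ℤ} {N : ℕ} : Gen S N → ℤ
  | none => 0
  | some x => x.1

/-- Total value of `f` on the indices of a word in the generators. -/
def wtSum {S : Set ℤ} {N : ℕ} (f : ℤ → ℕ) (l : List (Gen S N)) : ℕ :=
  (l.map fun g => f g.index).sum

/-- The ideal generated by all left-normed brackets of total weight `≥ p`. -/
def heavyIdeal (p : ℕ) (S : Set ℤ) (N : ℕ) (w : ℤ → ℕ) :
    LieIdeal (ZMod p) (FreeLieAlgebra (ZMod p) (Gen S N)) :=
  LieSubmodule.lieSpan (ZMod p) (FreeLieAlgebra (ZMod p) (Gen S N))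
    {x | ∃ l : List (Gen S N), p ≤ wtSum w l ∧ x = lnb (l.map (FreeLieAlgebra.of (ZMod p)))}

/-- The free Lie `𝔽_p`-algebra on the generators `Gen S N`, modulo all brackets of weight `≥ p`.
(In particular its nilpotency class is `< p` if all weights are positive, and generators of
weight `≥ p` vanish in it.) -/
def TLie (p : ℕ) (S : Set ℤ) (N : ℕ) (w : ℤ → ℕ) : Type :=
  FreeLieAlgebra (ZMod p) (Gen S N) ⧸ heavyIdeal p S N w

instance (p : ℕ) (S : Set ℤ) (N : ℕ) (w : ℤ → ℕ) : LieRing (TLie p S N w) :=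
  inferInstanceAs (LieRing (FreeLieAlgebra (ZMod p) (Gen S N) ⧸ heavyIdeal p S N w))

instance (p : ℕ) (S : Set ℤ) (N : ℕ) (w : ℤ → ℕ) : LieAlgebra (ZMod p) (TLie p S N w) :=
  inferInstanceAs (LieAlgebra (ZMod p)
    (FreeLieAlgebra (ZMod p) (Gen S N) ⧸ heavyIdeal p S N w))

/-- The image of a free generator. -/
def genElt (p : ℕ) {S : Set ℤ} {N : ℕ} (w : ℤ → ℕ) (g : Gen S N) : TLie p S N w :=
  LieSubmodule.Quotient.mk (N := heavyIdeal p S N w) (FreeLieAlgebra.of (ZMod p) g)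

open Classical in
/-- The `i`-th generator of index `a` (`0` if `a ∉ S`). -/
def xgen (p : ℕ) (S : Set ℤ) {N : ℕ} (w : ℤ → ℕ) (a : ℤ) (i : Fin N) : TLie p S N w :=
  if h : a ∈ S then genElt p w (some (⟨a, h⟩, i)) else 0

/-- The filtration by weight: the span of the brackets of total weight `≥ s`. -/
def filt (p : ℕ) (S : Set ℤ) (N : ℕ) (w : ℤ → ℕ) (s : ℕ) : Submodule (ZMod p) (TLie p S N w) :=
  Submodule.span (ZMod p) {z | ∃ l : List (Gen S N), s ≤ wtSum w l ∧ z = lnb (l.map (genElt p w))}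

/-- The grading by a second function `d` of the indices: the span of the brackets of total
degree `m`. -/
def grad (p : ℕ) (S : Set ℤ) (N : ℕ) (w d : ℤ → ℕ) (m : ℕ) :
    Submodule (ZMod p) (TLie p S N w) :=
  Submodule.span (ZMod p) {z | ∃ l : List (Gen S N), wtSum d l = m ∧ z = lnb (l.map (genElt p w))}

section Scalars

theorem coeff_C_mul {k : Type*} [Field k] (c : k) (g : HahnSeries ℤ k) (i : ℤ) :
    (HahnSeries.C c * g).coeff i = c * g.coeff i := by
  rw [HahnSeries.C_mul_eq_smul]
  rfl

variable (p : ℕ) [Fact p.Prime] (k : Type*) [Field k] [Finite k] [Algebra (ZMod p) k]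

/-- `N₀ = [k : 𝔽_p]`. -/
abbrev deg : ℕ := Module.finrank (ZMod p) k

/-- `σⁿ` on `k`, `σ` the `p`-th power map, `n` an integer. -/
def frobPow (n : ℤ) : k ≃ₐ[ZMod p] k :=
  (FiniteField.frobeniusAlgEquivOfAlgebraic (ZMod p) k) ^ n

variable {k}

open Classical in
/-- The element `D_{a n}` of the extension of scalars to `k`. For `a ≠ 0` it is
`∑ᵢ σⁿ(βᵢ) ⊗ βᵢ^*`, where `β` is a basis of `k` over `𝔽_p` and the free generators `βᵢ^*` of
index `a` are the dual basis; so, as an element of `Hom(k t^{-a}, k)`, it is `c t^{-a} ↦ σⁿ c`.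
Moreover `D_{0 n} = σⁿ(α₀) D₀`. It is `0` if `a` is neither `0` nor in the index set. -/
def Dgen (S : Set ℤ) (w : ℤ → ℕ) (α₀ : k) (a n : ℤ) : k ⊗[ZMod p] TLie p S (deg p k) w :=
  if a = 0 then frobPow p k n α₀ ⊗ₜ genElt p w none
  else ∑ i : Fin (deg p k),
    frobPow p k n (Module.finBasis (ZMod p) k i) ⊗ₜ xgen p S w a i

variable (k) in
/-- The field `𝒦 = k((t))` of Laurent series. (A type synonym, so that its only `𝔽_p`-module
structure is the one of an algebra.) -/
def Laur : Type _ := LaurentSeries k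

instance : Field (Laur k) := inferInstanceAs (Field (LaurentSeries k))

instance : Algebra k (Laur k) :=
  RingHom.toAlgebra (R := k) (S := Laur k) (HahnSeries.C : k →+* HahnSeries ℤ k)

instance : Algebra (ZMod p) (Laur k) :=
  ((algebraMap k (Laur k)).comp (algebraMap (ZMod p) k)).toAlgebra

instance : IsScalarTower (ZMod p) k (Laur k) := IsScalarTower.of_algebraMap_eq fun _ => rfl

instance : SMulCommClass (ZMod p) k (Laur k) := IsScalarTower.to_smulCommClass

theorem coeff_smul (c : ZMod p) (g : Laur k) (i : ℤ) :
    HahnSeries.coeff (Γ := ℤ) (R := k) (c • g) i =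
      algebraMap (ZMod p) k c * HahnSeries.coeff (Γ := ℤ) (R := k) g i :=
  coeff_C_mul (algebraMap (ZMod p) k c) g i

/-- The monomial `c t^n` of `𝒦`. -/
def mon (n : ℤ) (c : k) : Laur k := (HahnSeries.single n c : LaurentSeries k)

variable (k)
variable (L : Type*) [LieRing L] [LieAlgebra (ZMod p) L]

/-- `L_𝒦 = 𝒦 ⊗ L`. -/
abbrev LK : Type _ := Laur k ⊗[ZMod p] L

variable {k}

/-- The map `c ↦ c t^n` from `k` to `𝒦`. -/
def monLin (n : ℤ) : k →ₗ[ZMod p] Laur k where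
  toFun := mon n
  map_add' x y := HahnSeries.single_add n x y
  map_smul' c x := HahnSeries.ext (Γ := ℤ) (R := k) (funext fun i => by
    refine Eq.trans ?_ (coeff_smul p c (mon n x) i).symm
    change (HahnSeries.single n (c • x)).coeff i = _ * (HahnSeries.single n x).coeff i
    rw [Algebra.smul_def]
    by_cases h : i = n
    · subst h
      simp
    · simp [HahnSeries.coeff_single_of_ne h])

variable {L}

/-- `l ↦ t^{-b} l`, from `L_k` to `L_𝒦`. -/
def tneg (b : ℤ) : (k ⊗[ZMod p] L) →ₗ[ZMod p] LK p k L :=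
  LinearMap.rTensor L (monLin p (-b))

/-- `σ ⊗ id` on `L_𝒦`, where `σ` is the `p`-th power map of `𝒦`. -/
def sigmaK : LK p k L →ₗ[ZMod p] LK p k L :=
  LinearMap.rTensor L (FiniteField.frobeniusAlgHom (ZMod p) (Laur k)).toLinearMap

/-- Multiplication of exponents by a positive integer, as an order embedding. -/
def mulEmb (q : ℕ) (hq : 0 < q) : ℤ ↪o ℤ :=
  OrderEmbedding.ofStrictMono (fun i => (q : ℤ) * i)
    (fun _ _ h => mul_lt_mul_of_pos_left h (by exact_mod_cast hq))

/-- The substitution `t ↦ t^q` on `𝒦` (trivial on coefficients). -/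
def substLin (q : ℕ) (hq : 0 < q) : Laur k →ₗ[ZMod p] Laur k where
  toFun g := HahnSeries.embDomain (mulEmb q hq) (g : LaurentSeries k)
  map_add' x y := (HahnSeries.embDomainLinearMap (R := k) (mulEmb q hq)).map_add x y
  map_smul' c x := HahnSeries.ext (Γ := ℤ) (R := k) (funext fun i => by
    refine Eq.trans ?_ (coeff_smul p c (HahnSeries.embDomain (mulEmb q hq) (x : LaurentSeries k)) i).symm
    by_cases h : i ∈ Set.range (mulEmb q hq)
    · obtain ⟨j, rfl⟩ := h
      exact (HahnSeries.embDomain_coeff).trans ((coeff_smul p c x j).trans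
        (congrArg _ (HahnSeries.embDomain_coeff (f := mulEmb q hq) (x := x)).symm))
    · exact (HahnSeries.embDomain_of_notMem_range h).trans (((mul_zero _).symm).trans
        (congrArg _ (HahnSeries.embDomain_of_notMem_range (f := mulEmb q hq) (x := x) h).symm)))

/-- The substitution `t ↦ t^q` on `L_𝒦`. -/
def substK (q : ℕ) (hq : 0 < q) : LK p k L →ₗ[ZMod p] LK p k L :=
  LinearMap.rTensor L (substLin p q hq)

/-- The operator `∑ cᵢ t^{-i} ↦ ∑ f(i) cᵢ t^{-i}` on `𝒦`. -/
def diagFun (f : ℤ → ℕ) (g : LaurentSeries k) : LaurentSeries k where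
  coeff := fun i => (f (-i) : k) * g.coeff i
  isPWO_support' := g.isPWO_support.mono (by
    intro i hi h
    exact hi (by simp [h]))

/-- The same as a linear map. -/
def diagK (f : ℤ → ℕ) : Laur k →ₗ[ZMod p] Laur k where
  toFun g := diagFun f g
  map_add' g h := HahnSeries.ext (funext fun i => by
    change _ * (HahnSeries.coeff (Γ := ℤ) (R := k) _ i + HahnSeries.coeff (Γ := ℤ) (R := k) _ i) =
      _ * _ + _ * _
    rw [mul_add])
  map_smul' c g := HahnSeries.ext (Γ := ℤ) (R := k) (funext fun i => by
    refine Eq.trans ?_ (coeff_smul p c (diagFun f g) i).symm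
    change _ * HahnSeries.coeff (Γ := ℤ) (R := k) (c • g) i = _ * (_ * _)
    rw [coeff_smul, mul_left_comm])

/-- The operator `t^{-i} l ↦ t^{-i} exp~(γ f(i) t^b) l` on `L_𝒦`, where `exp~` is the
exponential series truncated at degree `p`. -/
def twistK (f : ℤ → ℕ) (b : ℕ) (γ : ZMod p) : LK p k L →ₗ[ZMod p] LK p k L :=
  LinearMap.rTensor L
    (∑ j ∈ Finset.range p, (γ ^ j * ((j.factorial : ℕ) : ZMod p)⁻¹) •
      ((LinearMap.mulLeft (ZMod p) (mon ((j * b : ℕ) : ℤ) (1 : k))).comp ((diagK p f) ^ j)))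

end Scalars

/-! ### Enveloping algebras and the Campbell-Hausdorff composition -/

section Enveloping

variable (F : Type*) [Field F] {L : Type*} [LieRing L] [LieAlgebra F L]

attribute [local instance 100] LieRing.ofAssociativeRing

/-- The `n`-th power `Jⁿ` of the augmentation ideal `J` of the enveloping algebra of `L`. -/
def augPow (L : Type*) [LieRing L] [LieAlgebra F L] (n : ℕ) :
    Submodule F (UniversalEnvelopingAlgebra F L) :=
  (LinearMap.ker (UniversalEnvelopingAlgebra.lift F (0 : L →ₗ⁅F⁆ F)).toLinearMap) ^ n

/-- The truncated exponential `∑_{i < p} lⁱ / i!` in the enveloping algebra. -/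
def texp (p : ℕ) (l : L) : UniversalEnvelopingAlgebra F L :=
  ∑ i ∈ Finset.range p, ((i.factorial : F)⁻¹) • (UniversalEnvelopingAlgebra.ι F l) ^ i

/-- `z = x ∘ y` for the Campbell-Hausdorff composition law of a Lie algebra of nilpotency class
`< p`: `exp~(x) exp~(y) ≡ exp~(z) mod J^p`. -/
def IsCH (p : ℕ) (x y z : L) : Prop :=
  texp F p x * texp F p y - texp F p z ∈ augPow F L p

end Enveloping

/-! ### The parameters -/

/-- `u^* = (p-1)(p-2)+1`. -/
def ustar (p : ℕ) : ℕ := (p - 1) * (p - 2) + 1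

/-- `A[u, M]`: all `∑ᵢ aᵢ p^{-nᵢ}` with `u` terms, `0 = n₁ ≤ ⋯ ≤ n_u ≤ M` and integers
`aᵢ ∈ [0, w)`. -/
def ASet (p : ℕ) (w : ℝ) (u M : ℕ) : Set ℚ :=
  {α | ∃ a n : Fin u → ℕ, Monotone n ∧ (∀ i, i.val = 0 → n i = 0) ∧ (∀ i, n i ≤ M) ∧
    (∀ i, (a i : ℝ) < w) ∧ α = ∑ i, (a i : ℚ) / (p : ℚ) ^ n i}

/-- The elements of `B[u, M]` of digit sum `c`: all `r ∑ᵢ bᵢ p^{-mᵢ}` with `u` terms,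
`0 = m₁ ≤ ⋯ ≤ m_u ≤ M`, `b₁ ≠ 0` and `b₁ + ⋯ + b_u = c < p`. -/
def BSet (p : ℕ) (r : ℚ) (u M c : ℕ) : Set ℚ :=
  {β | c < p ∧ ∃ b m : Fin u → ℕ, Monotone m ∧ (∀ i, i.val = 0 → m i = 0 ∧ b i ≠ 0) ∧
    (∀ i, m i ≤ M) ∧ ∑ i, b i = c ∧ β = r * ∑ i, (b i : ℚ) / (p : ℚ) ^ m i}

/-- `δ₀`: the minimum, over `1 ≤ s < p`, of the positive values of `v₀ - α / s`, where
`α = a₁ + a₂/p^{n₂} + ⋯ + a_u/p^{n_u}` with `u ≤ u^*` and integers `aᵢ ∈ [0, (p-1)v₀)`. -/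
def delta0 (p : ℕ) (v₀ : ℝ) : ℝ :=
  sInf {x | 0 < x ∧ ∃ s u M : ℕ, 1 ≤ s ∧ s < p ∧ 1 ≤ u ∧ u ≤ ustar p ∧
    ∃ α ∈ ASet p ((p - 1 : ℝ) * v₀) u M, x = v₀ - (α : ℝ) / s}

/-- `r^* = b₀^* / (p^{N₀^*} - 1)`. -/
def rStar (p b₀ M₀ : ℕ) : ℚ := (b₀ : ℚ) / ((p : ℚ) ^ M₀ - 1)

/-- The auxiliary parameters, for a residue field of degree `N₀` over `𝔽_p`:
`b₀ = b₀^*`, `M₀ = N₀^*`, `M = N^*`. -/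
structure Params (p N₀ : ℕ) where
  v₀ : ℝ
  b₀ : ℕ
  M₀ : ℕ
  M : ℕ
  v₀_pos : 0 < v₀
  two_le_M₀ : 2 ≤ M₀
  coprime_b₀ : Nat.Coprime b₀ (p * (p ^ M₀ - 1))
  rStar_gt : v₀ - delta0 p v₀ < (rStar p b₀ M₀ : ℝ)
  rStar_lt : (rStar p b₀ M₀ : ℝ) < v₀
  M_pos : 0 < M
  N₀_dvd : N₀ ∣ M
  M₀_dvd : M₀ ∣ M
  /-- `p^{N^*} ρ(A[u^*], B[u^*]) ≥ 2 r^* (p-1)`, `ρ` being the distance of the two sets. -/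
  dist_le : ∀ M₁ M₂ c : ℕ, ∀ α ∈ ASet p ((p - 1 : ℝ) * v₀) (ustar p) M₁,
    ∀ β ∈ BSet p (rStar p b₀ M₀) (ustar p) M₂ c,
      2 * rStar p b₀ M₀ * ((p : ℚ) - 1) ≤ (p : ℚ) ^ M * |α - β|
  rStar_gt' : v₀ - delta0 p v₀ < (rStar p b₀ M₀ : ℝ) * (1 - 1 / (p : ℝ) ^ M)
  rStar_lt' : (rStar p b₀ M₀ : ℝ) * (1 - 1 / (p : ℝ) ^ M) < v₀

namespace Params

variable {p N₀ : ℕ} (P : Params p N₀)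

/-- `r^*`. -/
def r : ℚ := rStar p P.b₀ P.M₀

/-- `q = p^{N^*}`. -/
def q : ℕ := p ^ P.M

/-- `b^* = b₀^* (q-1)/(q₀^*-1)` where `q₀^* = p^{N₀^*}` (an exact division, as `N₀^* ∣ N^*`);
so `r^* = b^*/(q-1)`. -/
def b : ℕ := P.b₀ * ((p ^ P.M - 1) / (p ^ P.M₀ - 1))

/-- `w^* = (p-1) v₀`. -/
def w : ℝ := (p - 1 : ℝ) * P.v₀

/-- `ι = p^m (q α - (q-1) β)`, where `α ∈ A[u, m]` with `1 ≤ u ≤ u^*`, and either `β = 0`,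
`c = 0`, or `β ∈ B[u^*, m]` has digit sum `c`. -/
def IsPres (ι : ℤ) (m u c : ℕ) (α β : ℚ) : Prop :=
  1 ≤ u ∧ u ≤ ustar p ∧ α ∈ ASet p P.w u m ∧
    ((β = 0 ∧ c = 0) ∨ β ∈ BSet p P.r (ustar p) m c) ∧
    (ι : ℚ) = (p : ℚ) ^ m * (P.q * α - (P.q - 1) * β)

/-- The set `𝔄⁰`. -/
def A0 : Set ℤ := {ι | |ι| ≤ P.b * ((p : ℤ) - 1) ∧ ∃ m u c α β, P.IsPres ι m u c α β}

/-- The integer `p^m α`, which depends only on `ι = p^m (q α - (q-1) β) ∈ 𝔄⁰`. -/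
def pa (ι : ℤ) : ℕ :=
  sInf {n | ∃ m u c α β, P.IsPres ι m u c α β ∧ (n : ℚ) = (p : ℚ) ^ m * α}

/-- The integer `p^m β / r^*`, which depends only on `ι = p^m (q α - (q-1) β) ∈ 𝔄⁰`. -/
def pb (ι : ℤ) : ℕ :=
  sInf {n | ∃ m u c α β, P.IsPres ι m u c α β ∧ (n : ℚ) * P.r = (p : ℚ) ^ m * β}

/-- `ch(ι)`: the sum of the `p`-digits of `β / r^*`, which depends only on `ι ∈ 𝔄⁰`. -/
def ch (ι : ℤ) : ℕ := sInf {c | ∃ m u α β, P.IsPres ι m u c α β}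

/-- `κ(ι)`: the least number `u` of terms in a presentation
`p^m α = a₁ p^{n₁} + ⋯ + a_u p^{n_u}` with `n₁ = m`, `0 ≤ nᵢ ≤ m` and integers
`aᵢ ∈ [0, (p-1) v₀)`. -/
def kap (ι : ℤ) : ℕ := sInf {u | ∃ m c α β, P.IsPres ι m u c α β}

/-- `w⁰(ι)`: the least natural number such that `ι < w⁰(ι) b^*` (it is used for `ι ≥ 0`). -/
def w0 (ι : ℤ) : ℕ := sInf {s : ℕ | ι < s * P.b}

/-- The set `𝔄⁺(p)`; thus `𝔄⁰(p) = 𝔄⁺(p) ∪ {0}`. -/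
def Ap : Set ℤ :=
  {ι | ι ∈ P.A0 ∧ 0 < ι ∧ Nat.gcd (Nat.gcd (P.pa ι) (P.pb ι)) p = 1 ∧
    P.w0 ι + P.ch ι ≤ p - 1 ∧ P.kap ι ≤ (p - 2) * P.ch ι + P.w0 ι}

/-- The set `𝔄⁰₁(p)` of the `ι ∈ 𝔄⁰(p)` with `ch(ι) = 1` (note that `ch(0) = 0`). -/
def A1p : Set ℤ := {ι | ι ∈ P.Ap ∧ P.ch ι = 1}

/-- The weight `w^†(ι) = w⁰(ι) + ch(ι)`. -/
def wDag (ι : ℤ) : ℕ := P.w0 ι + P.ch ι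

/-- The weight on `ℒ`: `wt(a) = s` if `(s-1) v₀ ≤ a < s v₀`. -/
def wt (a : ℤ) : ℕ := ⌊(a : ℝ) / P.v₀⌋₊ + 1

/-- The set `ℤ⁺(p)` of positive integers prime to `p`. -/
def Zp (p : ℕ) : Set ℤ := {a | 0 < a ∧ IsCoprime a (p : ℤ)}

/-- The Lie `𝔽_p`-algebra `ℒ̄ = ℒ / ℒ(p)`, where `ℒ(p)` is spanned by the brackets of weight
`≥ p`. (It is finite: the generators of index `a ≥ (p-1) v₀` have weight `≥ p`, so the
topology of the profinite algebra `ℒ` plays no role here.) -/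
abbrev LBar : Type := TLie p (Zp p) N₀ P.wt

/-- The Lie `𝔽_p`-algebra `ℒ̄^† = ℒ^† / ℒ^†(p)`. -/
abbrev LDag : Type := TLie p P.Ap N₀ P.wDag

/-- `ℒ̄^†(s)`. -/
abbrev filtDag (s : ℕ) : Submodule (ZMod p) P.LDag := filt p P.Ap N₀ P.wDag s

/-- `ℒ̄^†[m]`. -/
abbrev gradDag (m : ℕ) : Submodule (ZMod p) P.LDag := grad p P.Ap N₀ P.wDag P.ch m

end Params

/-! ### The projection `𝒱 : ℒ̄^† → ℒ̄` -/

section Proj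

theorem lnb_foldl_zero {L : Type*} [LieRing L] (l : List L) :
    l.foldl (fun x y => ⁅x, y⁆) 0 = 0 := by
  induction l with
  | nil => rfl
  | cons a l ih => simpa using ih

theorem foldl_eq_zero_of_mem {L : Type*} [LieRing L] (l : List L) (x : L) (h : (0 : L) ∈ l) :
    l.foldl (fun x y => ⁅x, y⁆) x = 0 := by
  induction l generalizing x with
  | nil => simp at h
  | cons a l ih =>
    rcases List.mem_cons.1 h with h | h
    · subst h
      simpa using lnb_foldl_zero l
    · exact ih _ h

theorem lnb_eq_zero_of_mem {L : Type*} [LieRing L] (l : List L) (h : (0 : L) ∈ l) :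
    lnb l = 0 := by
  cases l with
  | nil => rfl
  | cons a l =>
    rcases List.mem_cons.1 h with h | h
    · subst h
      exact lnb_foldl_zero l
    · exact foldl_eq_zero_of_mem l a h

theorem map_lnb {R L L' : Type*} [CommRing R] [LieRing L] [LieAlgebra R L] [LieRing L']
    [LieAlgebra R L'] (f : L →ₗ⁅R⁆ L') (l : List L) : f (lnb l) = lnb (l.map f) := by
  cases l with
  | nil => simp [lnb]
  | cons a l =>
    simp only [lnb, List.map_cons]
    induction l generalizing a with
    | nil => rfl
    | cons b l ih => simp [ih]

/-- The quotient map onto the truncated algebra. -/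
def mkHom (p : ℕ) (S : Set ℤ) (N : ℕ) (w : ℤ → ℕ) :
    FreeLieAlgebra (ZMod p) (Gen S N) →ₗ⁅ZMod p⁆ TLie p S N w where
  toFun := LieSubmodule.Quotient.mk (N := heavyIdeal p S N w)
  map_add' _ _ := rfl
  map_smul' _ _ := rfl
  map_lie' := rfl

theorem lnb_genElt_eq_zero (p : ℕ) (S : Set ℤ) (N : ℕ) (w : ℤ → ℕ) (l : List (Gen S N))
    (h : p ≤ wtSum w l) : lnb (l.map (genElt p w)) = 0 := by
  have h1 : lnb (l.map (genElt p w)) = mkHom p S N w (lnb (l.map (FreeLieAlgebra.of (ZMod p)))) := by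
    rw [map_lnb, List.map_map]
    rfl
  rw [h1]
  refine (LieSubmodule.Quotient.mk_eq_zero' (N := heavyIdeal p S N w)).2 ?_
  exact LieSubmodule.subset_lieSpan ⟨l, h, rfl⟩

variable {p : ℕ} {S S' : Set ℤ} {N N' : ℕ} {w w' : ℤ → ℕ}

theorem lift_heavy (f : Gen S N → TLie p S' N' w')
    (hf : ∀ g, f g = 0 ∨ ∃ g', f g = genElt p w' g' ∧ w g.index ≤ w' g'.index) :
    heavyIdeal p S N w ≤ (FreeLieAlgebra.lift (ZMod p) f).ker := by
  refine LieSubmodule.lieSpan_le.2 ?_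
  rintro x ⟨l, hl, rfl⟩
  simp only [SetLike.mem_coe, LieHom.mem_ker, map_lnb, List.map_map]
  have h1 : l.map ((FreeLieAlgebra.lift (ZMod p) f) ∘ FreeLieAlgebra.of (ZMod p)) = l.map f := by
    simp
  rw [h1]
  by_cases h0 : (0 : TLie p S' N' w') ∈ l.map f
  · exact lnb_eq_zero_of_mem _ h0
  · have h2 : ∃ l' : List (Gen S' N'), l.map f = l'.map (genElt p w') ∧
        wtSum w l ≤ wtSum w' l' := by
      clear hl h1
      induction l with
      | nil => exact ⟨[], rfl, le_rfl⟩
      | cons g l ih =>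
        simp only [List.map_cons, List.mem_cons, not_or] at h0
        obtain ⟨l', h3, h4⟩ := ih h0.2
        rcases hf g with h | ⟨g', h5, h6⟩
        · exact absurd h.symm h0.1
        · refine ⟨g' :: l', by simp [h3, h5], ?_⟩
          simp only [wtSum, List.map_cons, List.sum_cons] at h4 ⊢
          omega
    obtain ⟨l', h3, h4⟩ := h2
    rw [h3]
    exact lnb_genElt_eq_zero p S' N' w' l' (hl.trans h4)

/-- The homomorphism of truncated algebras with prescribed values on the free generators. -/
def liftHom (f : Gen S N → TLie p S' N' w')
    (hf : ∀ g, f g = 0 ∨ ∃ g', f g = genElt p w' g' ∧ w g.index ≤ w' g'.index) :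
    TLie p S N w →ₗ⁅ZMod p⁆ TLie p S' N' w' where
  toLinearMap := Submodule.liftQ (heavyIdeal p S N w).toSubmodule
    (FreeLieAlgebra.lift (ZMod p) f : FreeLieAlgebra (ZMod p) (Gen S N) →ₗ[ZMod p] _)
    (fun x hx => LinearMap.mem_ker.2 (LieHom.mem_ker.1 (lift_heavy f hf hx)))
  map_lie' := by
    intro x y
    induction x using Submodule.Quotient.induction_on
    induction y using Submodule.Quotient.induction_on
    exact LieHom.map_lie (FreeLieAlgebra.lift (ZMod p) f) _ _

@[simp]
theorem liftHom_genElt (f : Gen S N → TLie p S' N' w')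
    (hf : ∀ g, f g = 0 ∨ ∃ g', f g = genElt p w' g' ∧ w g.index ≤ w' g'.index) (g : Gen S N) :
    liftHom f hf (genElt p w g) = f g :=
  FreeLieAlgebra.lift_of_apply f g

end Proj

namespace Params

variable {p N₀ : ℕ} [hp : Fact p.Prime] (P : Params p N₀)

theorem q_pos : 0 < P.q := pow_pos hp.out.pos _

theorem b_eq : (P.b : ℝ) = (P.r : ℝ) * ((p : ℝ) ^ P.M - 1) := by
  have h1 : 1 < p := hp.out.one_lt
  have hM : (1 : ℕ) < p ^ P.M₀ := Nat.one_lt_pow (by have := P.two_le_M₀; omega) h1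
  have hdvd : p ^ P.M₀ - 1 ∣ p ^ P.M - 1 := Nat.pow_sub_one_dvd_pow_sub_one _ P.M₀_dvd
  have hne : ((p : ℝ) ^ P.M₀ - 1) ≠ 0 := by
    have : (1 : ℝ) < (p : ℝ) ^ P.M₀ := by exact_mod_cast hM
    linarith
  have hc : ∀ n : ℕ, ((p ^ n - 1 : ℕ) : ℝ) = (p : ℝ) ^ n - 1 := by
    intro n
    rw [Nat.cast_sub (Nat.one_le_pow _ _ hp.out.pos)]
    simp
  unfold Params.b Params.r rStar
  rw [Nat.cast_mul, Nat.cast_div hdvd (by rw [hc]; exact hne), hc, hc]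
  push_cast
  field_simp

theorem q_mul_lt {s a : ℕ} (hs : 1 ≤ s) (hsp : s < p) (ha : (a : ℝ) < s * P.v₀) :
    P.q * a < s * P.b := by
  have hv := P.v₀_pos
  have hs0 : (0 : ℝ) < s := by exact_mod_cast hs
  have hsp' : (s : ℝ) ≤ (p : ℝ) - 1 := by
    have : s + 1 ≤ p := hsp
    have : ((s + 1 : ℕ) : ℝ) ≤ p := by exact_mod_cast this
    push_cast at this
    linarith
  have hA : (a : ℚ) ∈ ASet p ((p - 1 : ℝ) * P.v₀) 1 0 := by
    refine ⟨fun _ => a, fun _ => 0, monotone_const, by simp, by simp, ?_, by simp⟩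
    intro _
    exact ha.trans_le (mul_le_mul_of_nonneg_right hsp' hv.le)
  have hδ : delta0 p P.v₀ ≤ P.v₀ - ((a : ℚ) : ℝ) / s := by
    refine csInf_le ⟨0, fun x hx => hx.1.le⟩ ⟨?_, s, 1, 0, hs, hsp, le_rfl, ?_, a, hA, rfl⟩
    · have : (a : ℝ) / s < P.v₀ := by rwa [div_lt_iff₀ hs0, mul_comm]
      simpa using this
    · simp [ustar]
  have h3 := P.rStar_gt'
  have hq : (0 : ℝ) < (p : ℝ) ^ P.M := pow_pos (by exact_mod_cast hp.out.pos) _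
  have h4 : (a : ℝ) / s < (P.r : ℝ) * (1 - 1 / (p : ℝ) ^ P.M) := by
    have : ((a : ℚ) : ℝ) = a := by simp
    rw [this] at hδ
    unfold Params.r
    linarith
  have h5 : (P.r : ℝ) * (1 - 1 / (p : ℝ) ^ P.M) = P.b / (p : ℝ) ^ P.M := by
    rw [P.b_eq]
    field_simp
  rw [h5, div_lt_div_iff₀ hs0 hq] at h4
  have h6 : ((P.q * a : ℕ) : ℝ) < ((s * P.b : ℕ) : ℝ) := by
    unfold Params.q
    push_cast
    linarith
  exact_mod_cast h6

theorem eq_q_mul {ι : ℤ} (h : ι ∈ P.A0) (hc : P.ch ι = 0) : ∃ a : ℕ, ι = P.q * a := by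
  obtain ⟨-, m, u, c, α, β, hP⟩ := h
  have hne : {c | ∃ m u α β, P.IsPres ι m u c α β}.Nonempty := ⟨c, m, u, α, β, hP⟩
  have hm := Nat.sInf_mem hne
  change P.ch ι ∈ _ at hm
  rw [hc] at hm
  obtain ⟨m, u, α, β, hu1, hu, ⟨a, n, -, -, hn, -, rfl⟩, hβ, hι⟩ := hm
  have hβ0 : β = 0 := by
    rcases hβ with hβ | ⟨-, b', m', -, h0, -, hsum, -⟩
    · exact hβ.1
    · have hu' : 0 < ustar p := by simp [ustar]
      have := (h0 ⟨0, hu'⟩ rfl).2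
      exact absurd ((Finset.sum_eq_zero_iff.1 hsum) ⟨0, hu'⟩ (Finset.mem_univ _)) this
  subst hβ0
  refine ⟨∑ i, a i * p ^ (m - n i), ?_⟩
  have hp0 : (p : ℚ) ≠ 0 := by exact_mod_cast hp.out.ne_zero
  have : (ι : ℚ) = ((P.q * (∑ i, a i * p ^ (m - n i) : ℕ) : ℤ) : ℚ) := by
    rw [hι]
    push_cast
    rw [mul_zero, sub_zero, mul_left_comm, Finset.mul_sum]
    congr 1
    refine Finset.sum_congr rfl fun i _ => ?_
    rw [pow_sub₀ _ hp0 (hn i)]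
    field_simp
  exact_mod_cast this

theorem wDag_le_wt {ι : ℤ} (h : ι ∈ P.Ap) (hc : P.ch ι = 0) :
    P.wDag ι ≤ P.wt (ι / P.q) := by
  obtain ⟨a, ha⟩ := P.eq_q_mul h.1 hc
  have hq : (P.q : ℤ) ≠ 0 := by exact_mod_cast P.q_pos.ne'
  have hdiv : ι / P.q = a := by rw [ha, Int.mul_ediv_cancel_left _ hq]
  rw [hdiv]
  have hw := h.2.2.2.1
  unfold wDag
  rcases le_or_gt p (P.wt a) with hge | hlt
  · omega
  · rw [hc, add_zero]
    refine Nat.sInf_le ?_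
    have hlt' : (a : ℝ) < (P.wt a : ℕ) * P.v₀ := by
      have := Nat.lt_floor_add_one ((a : ℝ) / P.v₀)
      rw [div_lt_iff₀ P.v₀_pos] at this
      unfold wt
      push_cast
      exact this
    have := P.q_mul_lt (by simp [wt]) hlt hlt'
    change ι < (P.wt a : ℤ) * P.b
    rw [ha]
    exact_mod_cast this

open Classical in
/-- Values of `𝒱` on the free generators: `D^†_{qa, n} ↦ D_{a n}` for the indices `qa` with
`ch = 0`, `D₀^† ↦ D₀`, and all other generators go to `0`. -/
def vGen : Gen P.Ap N₀ → P.LBar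
  | none => genElt p P.wt none
  | some (ι, i) => if P.ch ι = 0 then xgen p (Zp p) P.wt ((ι : ℤ) / P.q) i else 0

theorem w0_zero_le : P.wDag 0 ≤ 1 := by
  have hb : 0 < P.b := by
    have := P.q_mul_lt (s := 1) (a := 0) le_rfl hp.out.one_lt (by simpa using P.v₀_pos)
    simpa using this
  have h1 : P.w0 0 ≤ 1 := Nat.sInf_le (by simpa using hb)
  have h2 : P.ch 0 ≤ 0 := by
    refine Nat.sInf_le ⟨0, 1, 0, 0, le_rfl, by simp [ustar], ?_, Or.inl ⟨rfl, rfl⟩, by simp⟩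
    refine ⟨fun _ => 0, fun _ => 0, monotone_const, by simp, by simp, fun _ => ?_, by simp⟩
    have : (1 : ℝ) < p := by exact_mod_cast hp.out.one_lt
    have := mul_pos (sub_pos.2 this) P.v₀_pos
    simpa [w] using this
  unfold wDag
  omega

theorem vGen_spec (g : Gen P.Ap N₀) :
    P.vGen g = 0 ∨ ∃ g' : Gen (Zp p) N₀, P.vGen g = genElt p P.wt g' ∧
      P.wDag g.index ≤ P.wt g'.index := by
  rcases g with _ | ⟨ι, i⟩
  · refine Or.inr ⟨none, rfl, ?_⟩
    exact P.w0_zero_le.trans (by simp [wt])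
  · by_cases hc : P.ch ι = 0
    · by_cases hz : (ι : ℤ) / P.q ∈ Zp p
      · refine Or.inr ⟨some (⟨_, hz⟩, i), ?_, P.wDag_le_wt ι.2 hc⟩
        simp [vGen, hc, xgen, hz]
      · left
        simp [vGen, xgen, hz]
    · left
      simp [vGen, hc]

/-- The epimorphism `𝒱 : ℒ̄^† → ℒ̄`. -/
def V : P.LDag →ₗ⁅ZMod p⁆ P.LBar := liftHom P.vGen P.vGen_spec

end Params

/-! ### The algebras of coefficients and the deformations -/

section Main

variable {p : ℕ} [hp : Fact p.Prime] {k : Type*} [Field k] [Finite k] [Algebra (ZMod p) k]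
variable (P : Params p (deg p k)) (α₀ : k)

/-- `D_{a n} ∈ ℒ̄_k`. -/
abbrev D (a n : ℤ) : k ⊗[ZMod p] P.LBar := Dgen p (Params.Zp p) P.wt α₀ a n

/-- `D^†_{ι n} ∈ ℒ̄^†_k`. -/
abbrev DDag (ι n : ℤ) : k ⊗[ZMod p] P.LDag := Dgen p P.Ap P.wDag α₀ ι n

/-- The ideal `t^{j b^*} 𝒩̄^†` of `𝒩̄^†`: the `k`-span of all `t^{-a} l` with
`l ∈ ℒ̄^†(s)_k`, `s ≥ 1` and `a + j b^* < s b^*` (so `𝒩̄^†` itself is the case `j = 0`). -/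
def NDag (j : ℕ) : Submodule k (LK p k P.LDag) :=
  Submodule.span k {z | ∃ (s : ℕ) (a : ℤ), ∃ l ∈ (P.filtDag s).baseChange k,
    1 ≤ s ∧ a + j * P.b < s * P.b ∧ z = tneg p a l}

/-- The kernel `t^{(p-1) b^*} 𝒩̄^†` of the projection `𝒩̄^† → 𝒩̃^†`. -/
abbrev NKer : Submodule k (LK p k P.LDag) := NDag P (p - 1)

/-- The `k`-span of all `t^{-ι} l` with `l ∈ ℒ̄^†(s)[m]_k`, `ι ∈ 𝔄⁰`,
`ι + ch(ι) b^* < s b^*`, `ch(ι) ≥ m + j` and `κ(ι) ≤ (p-3)m + s`.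
Its image in `𝒩̃^†` is `𝒩̃^{sp}⟨j⟩`; in particular for `j = 0` it is `𝒩̃^{sp}`. -/
def NSp (j : ℕ) : Submodule k (LK p k P.LDag) :=
  Submodule.span k {z | ∃ (s m : ℕ) (ι : ℤ), ∃ l ∈ (P.filtDag s ⊓ P.gradDag m).baseChange k,
    1 ≤ s ∧ ι ∈ P.A0 ∧ ι + P.ch ι * P.b < s * P.b ∧ m + j ≤ P.ch ι ∧
    (P.kap ι : ℤ) ≤ ((p : ℤ) - 3) * m + s ∧ z = tneg p ι l}

open Classical in
/-- The action `Ω_γ`: `t^{-ι} l ↦ t^{-ι} exp~(γ (p^m α) t^{b^*}) l` for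
`ι = p^m (q α - (q-1) β) ∈ 𝔄⁰`. It is defined here on all of `ℒ̄^†_𝒦` (as the identity on the
`t^{-i} l` with `i ∉ 𝔄⁰`); it preserves the kernel of `𝒩̄^† → 𝒩̃^†`, and induces the
action on `𝒩̃^{sp}`. -/
def Omega (γ : ZMod p) : LK p k P.LDag →ₗ[ZMod p] LK p k P.LDag :=
  twistK p (fun ι => if ι ∈ P.A0 then P.pa ι else 0) P.b γ

/-- The element `ē^{(q)} = ē(t^q)`. -/
def eQ (e : LK p k P.LBar) : LK p k P.LBar := substK p P.q P.q_pos e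

/-- The conditions on the choice of `ē^{sp} ∈ 𝒩̄^†`:
`ē^{sp} ≡ ∑_{ι ∈ 𝔄⁰(p)} t^{-ι} D^†_{ι 0} mod C₂`, its image in `𝒩̃^†` lies in `𝒩̃^{sp}`,
and it is compatible with `e`: `𝒱_𝒦(ē^{sp}) = ē^{(q)}`.
(Every `ι ∈ 𝔄⁰(p)` lies in `[0, (p-1) b^*]`, and `D^†_{ι 0} = 0` for `ι ∉ 𝔄⁰(p)`.) -/
structure IsSpecial (e : LK p k P.LBar) (E : LK p k P.LDag) : Prop where
  mem : E ∈ NDag P 0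
  lin : E - ∑ ι ∈ Finset.Icc (0 : ℤ) (P.b * ((p : ℤ) - 1)), tneg p ι (DDag P α₀ ι 0) ∈
    ⁅(⊤ : LieIdeal (Laur k) (LK p k P.LDag)),
      (⊤ : LieIdeal (Laur k) (LK p k P.LDag))⁆
  sp : E ∈ NSp P 0 ⊔ NKer P
  compat : LinearMap.lTensor (Laur k) (P.V : P.LDag →ₗ[ZMod p] P.LBar) E = eQ P e

/-- `A` is the conjugate `A^†_γ` of `Ω_γ`: an automorphism of the Lie algebra `ℒ̄^†` such that

* there is `c̃ ∈ 𝒩̃^{sp}⟨1⟩` with `σ c̃ ∈ 𝒩̃^{sp}⟨1⟩` and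
  `Ω_γ(ẽ^{sp}) = (σ c̃) ∘ (A ⊗ id)(ẽ^{sp}) ∘ (-c̃)` in `𝒩̃^†` (here `c` lifts `c̃`, and
  `X` is the right-hand side computed with the lifts, in `ℒ̄^†_𝒦`);
* `A(D^†_{ι 0}) - D^†_{ι 0} ∈ ⨁_{m < ch(ι)} ℒ̄^†[m]_k` for all `ι ∈ 𝔄⁰(p)`. -/
structure IsConj (E : LK p k P.LDag) (γ : ZMod p) (A : P.LDag ≃ₗ⁅ZMod p⁆ P.LDag) : Prop where
  conj : ∃ c ∈ NSp P 1, sigmaK p c ∈ NSp P 1 ⊔ NKer P ∧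
    ∃ Y X : LK p k P.LDag,
      IsCH (Laur k) p (sigmaK p c)
        (LinearMap.lTensor (Laur k) (A : P.LDag →ₗ[ZMod p] P.LDag) E) Y ∧
      IsCH (Laur k) p Y (-c) X ∧ Omega P γ E - X ∈ NKer P
  unip : ∀ ι : ℤ, (ι ∈ P.Ap ∨ ι = 0) →
    LinearMap.lTensor k (A : P.LDag →ₗ[ZMod p] P.LDag) (DDag P α₀ ι 0) - DDag P α₀ ι 0 ∈
      ⨆ m : Fin (P.ch ι), (P.gradDag m).baseChange k

/-- `ℒ̄[v₀] = 𝒱(ℒ̄^†[v₀])`, where `ℒ̄^†[v₀]` is the minimal ideal of `ℒ̄^†` which contains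
`A^†_γ(Ker 𝒱)` for all `γ ∈ ℤ/p`. -/
def ramIdeal {N₀ : ℕ} (P : Params p N₀) (A : ZMod p → (P.LDag ≃ₗ⁅ZMod p⁆ P.LDag)) :
    LieIdeal (ZMod p) P.LBar :=
  LieIdeal.map P.V (LieSubmodule.lieSpan (ZMod p) P.LDag
    {z | ∃ γ : ZMod p, ∃ l : P.LDag, P.V l = 0 ∧ z = A γ l})

/-! ### Structural constants and the explicit elements -/

/-- The set `ℤ⁰(p) = ℤ⁺(p) ∪ {0}`, in `ℕ`. -/
def Z0 (p : ℕ) : Set ℕ := {a | a = 0 ∨ a.Coprime p}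

/-- The conditions `η(a₁) = 1` and, for `0 ≤ s₁ ≤ s < p`,
`η(a₁,…,a_{s₁}) η(a_{s₁+1},…,a_s) = ∑_π η(a_{π(1)},…,a_{π(s)})`, where `π` runs over the
permutations such that `π⁻¹(1),…,π⁻¹(s₁)` and `π⁻¹(s₁+1),…,π⁻¹(s)` are increasing.
The value on the empty sequence is `1`. -/
structure IsStructural (p : ℕ) {k : Type*} [Field k] (η : List ℕ → k) : Prop where
  nil : η [] = 1
  one : ∀ a ∈ Z0 p, η [a] = 1
  shuffle : ∀ (s s₁ : ℕ), s₁ ≤ s → s < p → ∀ a : Fin s → ℕ, (∀ i, a i ∈ Z0 p) →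
    η ((List.ofFn a).take s₁) * η ((List.ofFn a).drop s₁) =
      ∑ π : Equiv.Perm (Fin s) with
        (∀ i j : Fin s, i < j → (j.val < s₁ ∨ s₁ ≤ i.val) → π.symm i < π.symm j),
        η (List.ofFn fun i => a (π i))

open Classical in
/-- `ē ∈ ℒ̄_𝒦` is given by the structural constants `η`:
`exp~(ē) ≡ 1 + ∑_{1 ≤ s < p} η(a₁,…,a_s) t^{-(a₁+⋯+a_s)} D_{a₁0} ⋯ D_{a_s0} mod J^p`.
(The indices `aᵢ ∈ ℤ⁰(p)` are taken `< (p-1) v₀`; for the others `D_{a 0} = 0` in `ℒ̄_k`.) -/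
def IsGivenBy (η : List ℕ → k) (e : LK p k P.LBar) : Prop :=
  texp (Laur k) p e -
    (1 + ∑ s ∈ Finset.Ico 1 p,
      ∑ a ∈ Fintype.piFinset fun _ : Fin s => {x ∈ Finset.range ⌈P.w⌉₊ | x ∈ Z0 p},
        mon (-(∑ i, (a i : ℤ))) (η (List.ofFn a)) •
          (List.ofFn fun i => UniversalEnvelopingAlgebra.ι (Laur k)
            (tneg p 0 (D P α₀ (a i) 0))).prod)
    ∈ augPow (Laur k) (LK p k P.LBar) p

open Classical in
/-- `η(ā, n̄)` for a sequence `(a₁,n₁),…,(a_s,n_s)`: if `n₁ ≥ ⋯ ≥ n_s`, it is the product, over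
the values `m` of `n̄`, of `σ^m η` of the block of those `aᵢ` with `nᵢ = m`; otherwise it
is `0`. -/
def etaBar (p : ℕ) [Fact p.Prime] {k : Type*} [Field k] [Finite k] [Algebra (ZMod p) k]
    (η : List ℕ → k) (l : List (ℕ × ℤ)) : k :=
  if l.Pairwise (fun x y => y.2 ≤ x.2) then
    ∏ m ∈ (l.map Prod.snd).toFinset,
      frobPow p k m (η ((l.filter fun x => x.2 = m).map Prod.fst))
  else 0

open Classical in
/-- The image in `ℒ̄_k` of
`ℱ⁰_{α,-N} = ∑ a₁ η(ā, n̄) […[D_{a₁n₁}, D_{a₂n₂}],…, D_{a_sn_s}]`, the sum over `1 ≤ s < p`,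
`aᵢ ∈ ℤ⁰(p)`, `n₁ = 0`, all `nᵢ ≥ -N`, `α = a₁ p^{n₁} + ⋯ + a_s p^{n_s}`.
(These conditions force `aᵢ ≤ α p^N` as soon as `nᵢ ≥ -N`, and `η(ā, n̄) = 0` if some
`nᵢ > 0 = n₁`; so the sum is over a finite set.) -/
def F0 (η : List ℕ → k) (α : ℚ) (N : ℕ) : k ⊗[ZMod p] P.LBar :=
  ∑ s ∈ Finset.Ico 1 p,
    ∑ x ∈ Fintype.piFinset fun _ : Fin s =>
        {a ∈ Finset.range (⌊α * (p : ℚ) ^ N⌋₊ + 1) | a ∈ Z0 p} ×ˢ Finset.Icc (-(N : ℤ)) 0 with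
        (∀ i, i.val = 0 → (x i).2 = 0) ∧ α = ∑ i, ((x i).1 : ℚ) * (p : ℚ) ^ (x i).2,
      (((((List.ofFn x).map Prod.fst).headD 0 : ℕ) : k) * etaBar p η (List.ofFn x)) •
        lnb (List.ofFn fun i => D P α₀ (x i).1 (x i).2)

end Main

end

end NilpAS

/-!
Why the theorem is true. An element `x` of a Lie algebra of class `< p` with a derivation `δ` has
the logarithmic derivative `logD δ x = e^{-x} δ(e^x)`, and `logD δ (x ∘ y) = e^{-y}·(logD δ x) +
logD δ y` (`logD_bch`). Where `δ^{p-1} = 1`, the equation `logD δ x = g` has a unique solution `x`,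
by contraction (`exists_logD_eq`, `logD_unique`). Applied to the grading by length this gives the
Campbell-Hausdorff composition `bch`, first in a free algebra on three generators, and its laws.

*Reduction to integers.* The gap between `A[u^*]` and `B[u^*]` makes the presentations of
`ι ∈ 𝔄⁰` unique, `ch` and `p^m α` additive, and `κ` subadditive, as long as the weights stay below
the bounds (`A0_add`). Hence the special elements modulo the kernel form a Lie algebra `SpQ`, on which
`t^{-ι} l ↦ p^m α t^{b^* - ι} l` is a derivation `Δ` with `Ω_γ = exp(γ Δ)`, and `ch(ι)` is
the eigenvalue of a derivation `θ`, raised by one by `Δ`.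

*Uniqueness.* If `σ z - z` is, modulo the kernel, a combination of the primitive exponents
`𝔄⁺(p)`, this combination and `z` vanish (`sigma_sub_rigid`): a nonzero coefficient at `i > 0` propagates to `p i`.
Dividing by the center and by induction on the class, homomorphisms that carry `ẽ^{sp}` to
conjugate elements and agree where `ch = 0` are equal (`rigid`).

*Existence.* A special lift is the image of `ē^{(q)}` under a section of `𝒱` plus the linear terms
with `ch ≥ 1` (`eLift_special`). By successive approximation in the weight, `Ω_γ ẽ^{sp}` is conjugate to
`ẽ^{sp}` plus terms with exponents in `𝔄⁺(p)` (`exists_congrConj`), and these are absorbed by a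
unipotent automorphism (`exists_unip`, `exists_isConj`).

*The ideal.* Let `π` be the projection of `ℒ̄` modulo an ideal `I`. By uniqueness, `A_γ^†(Ker 𝒱)`
maps into `I` for all `γ` if and only if `Ω_γ` carries `x̄ = π 𝒱 ẽ^{sp} = π ē^{(q)}` to a conjugate
`σ c ∘ x̄ ∘ (-c)`. As `θ x̄ = 0`, and `θ` is invertible on `c`, where `1 ≤ ch < p - 1`, this is
equivalent to its linearization, `logD Δ x̄ = e^{-x̄}·σ c - c` (`ConjData.exists_linear`, `ConjData.exists_conj`,
`linCond_iff_comp`). The only possible solution is `c = -∑ Φ^N T₀`, where `Φ = e^{-x̄}·σ` and `T₀` is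
the left side, up to terms which are negligible. So the equation says that the coefficients of
`T_N = Φ^N T₀` satisfy explicit bounds by weight modulo `I` (`coefBound_of_linCond`,
`linCond_of_coefBound`). These coefficients are Frobenius twists of `ℱ⁰_{α,-N}` (`FF_eq`). If the
finitely many `ℱ⁰` of the statement are in `I`, the recursion for `T_N` gives all the bounds, by
induction on the weight (`coefBound_of_cond`); the converse is `cond_of_coefBound`. Hence
`isLeast_ramIdeal`.
-/

open scoped TensorProduct

namespace NilpAS

noncomputable section

open Finset (range sum_add_distrib smul_sum sum_sub_distrib sum_range_succ' sum_congr mem_range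
  mem_product sum_mul mul_sum sum_range_succ sum_eq_zero mem_image sum_image Ico Icc sum_subset
  mem_Icc)
open Submodule (subset_span span_mono span_induction smul_mem span_eq_bot mul_induction_on' span_le
  mem_sup_left mem_sup_right map_mono mem_bot mem_sup)
open Nat (le_succ exists_eq_add_of_le cast_zero sInf_mem)
open List (length_cons reverseRecOn map_append map_singleton map_map length_append mem_cons_of_mem
  map_cons sum_ofFn map_ofFn ofFn mem_ofFn mem_map length_map mem_append mem_append_left sum_append
  map_congr_left nil_append map_nil mem_cons_self cons_append)
open TensorProduct (tmul_zero tmul_sub smul_tmul' zero_tmul sum_tmul tmul_smul tmul_add)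
open LinearMap (mem_ker mulRight mulLeft rTensor lTensor)
open Int (self_le_toNat cast_natCast)
open Function (iterate_succ_apply' iterate_succ_apply)
open UniversalEnvelopingAlgebra (lift_ι_apply)
open LieSubmodule (lieSpan_le)
open Module (finBasis)
open FiniteField (frobeniusAlgHom)
open Finset.HasAntidiagonal (antidiagonal mem_antidiagonal)
open Submodule.Quotient (mk_surjective)
open LieSubmodule.Quotient (mk_eq_zero')
open FreeLieAlgebra (lift_of_apply)
open Algebra (algebraMap_eq_smul_one)
open Fintype (piFinset)

local notation "ιU" => UniversalEnvelopingAlgebra.ι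
local notation "𝒰" => UniversalEnvelopingAlgebra

set_option linter.unusedSectionVars false

attribute [local instance 2000] LieRing.toBracket lieRingSelfModule lieAlgebraSelfModule

variable {p : ℕ} [hp : Fact p.Prime] {k : Type*} [Field k] [Finite k] [Algebra (ZMod p) k]

local notation "Fp" => ZMod p

variable {P : Params p (deg p k)} {α₀ : k} {η : List ℕ → k} {e : LK p k P.LBar}
  {L : Type*} [LieRing L] [LieAlgebra (ZMod p) L] {g : Type*} [LieRing g] [LieAlgebra (ZMod p) g]

/-! ### Nilpotent Lie algebras of class `< p` -/

section Basics

theorem lnb_append_singleton {L : Type*} [LieRing L] (l : List L) (hl : l ≠ []) (y : L) :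
    lnb (l ++ [y]) = ⁅lnb l, y⁆ := by
  cases l with
  | nil => simp at hl
  | cons a l => simp [lnb, List.foldl_append]

/-- The iterated right bracket `[…[[y, x], x], …, x]`. -/
def brIt {L : Type*} [LieRing L] (x : L) (m : ℕ) (y : L) : L := (fun z => ⁅z, x⁆)^[m] y

section brIt
variable {L : Type*} [LieRing L]

@[simp] theorem brIt_zero (x y : L) : brIt x 0 y = y := rfl
theorem brIt_succ (x : L) (m : ℕ) (y : L) : brIt x (m + 1) y = ⁅brIt x m y, x⁆ :=
  iterate_succ_apply' _ _ _

theorem brIt_add (x : L) (m : ℕ) (y z : L) : brIt x m (y + z) = brIt x m y + brIt x m z := by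
  induction m <;> simp_all [brIt_succ]

theorem brIt_zero_right (x : L) (m : ℕ) : brIt x m (0 : L) = 0 := by
  induction m <;> simp_all [brIt_succ]

theorem brIt_neg (x : L) (m : ℕ) (y : L) : brIt x m (-y) = -brIt x m y := by
  induction m <;> simp_all [brIt_succ]

theorem brIt_smul {F : Type*} [CommRing F] [LieAlgebra F L] (x : L) (m : ℕ) (c : F) (y : L) :
    brIt x m (c • y) = c • brIt x m y := by
  induction m <;> simp_all [brIt_succ]

theorem map_brIt {L' : Type*} [LieRing L'] {F : Type*} [CommRing F] [LieAlgebra F L]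
    [LieAlgebra F L'] (f : L →ₗ⁅F⁆ L') (x : L) (m : ℕ) (y : L) :
    f (brIt x m y) = brIt (f x) m (f y) := by
  induction m <;> simp_all [brIt_succ]

end brIt

/-- Nilpotency of class `< p`: all left-normed brackets of length `≥ p` vanish. -/
class NilLt (p : ℕ) (L : Type*) [LieRing L] : Prop where
  lnb_zero : ∀ l : List L, p ≤ l.length → lnb l = 0

theorem nilLt_of_chain {L : Type*} [LieRing L] {p : ℕ} (hp : 0 < p) (G : ℕ → AddSubgroup L)
    (h1 : ∀ x, x ∈ G 1) (h : ∀ n x y, x ∈ G n → ⁅x, y⁆ ∈ G (n + 1))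
    (hz : ∀ n, p ≤ n → ∀ x ∈ G n, x = 0) : NilLt p L := by
  constructor
  have key : ∀ l : List L, ∀ n x, x ∈ G n → l.foldl (fun x y => ⁅x, y⁆) x ∈ G (n + l.length) := by
    intro l
    induction l with
    | cons a l ih =>
      intro n x hx
      have := ih (n + 1) _ (h n x a hx)
      simp only [List.foldl_cons, length_cons]
      rwa [show n + (l.length + 1) = n + 1 + l.length by omega]
    | _ => simp_all
  intro l hl
  cases l with
  | nil => rfl
  | cons a l =>
    refine hz (1 + l.length) ?_ _ (key l 1 a (h1 a))
    simp only [length_cons] at hl; omega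

section lcS
variable (F : Type*) [CommRing F] (L : Type*) [LieRing L] [LieAlgebra F L]

/-- The lower central series: the span of the left-normed brackets of length `≥ n`. -/
def lcS (n : ℕ) : Submodule F L := Submodule.span F {x | ∃ l : List L, n ≤ l.length ∧ x = lnb l}

variable {F L}

theorem mem_lcS_one (x : L) : x ∈ lcS F L 1 := subset_span ⟨[x], by simp, rfl⟩

theorem lcS_anti {m n : ℕ} (h : m ≤ n) : lcS F L n ≤ lcS F L m :=
  span_mono fun _ ⟨l, hl, hx⟩ => ⟨l, h.trans hl, hx⟩

theorem lie_mem_lcS {n : ℕ} {x : L} (hx : x ∈ lcS F L n) (y : L) : ⁅x, y⁆ ∈ lcS F L (n + 1) := by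
  induction hx using span_induction with
  | mem x h =>
    obtain ⟨l, hl, rfl⟩ := h
    by_cases h0 : l = []
    · subst h0; simp [lnb]
    · rw [← lnb_append_singleton l h0]; exact subset_span ⟨l ++ [y], by simpa using hl, rfl⟩
  | _ => simp_all [add_mem, smul_mem]

theorem lie_mem_lcS' {n : ℕ} {x : L} (hx : x ∈ lcS F L n) (y : L) : ⁅y, x⁆ ∈ lcS F L (n + 1) := by
  rw [← lie_skew]; exact neg_mem (lie_mem_lcS hx y)

theorem lcS_eq_zero (p : ℕ) [h : NilLt p L] {n : ℕ} (hn : p ≤ n) {x : L} (hx : x ∈ lcS F L n) :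
    x = 0 := by
  induction hx using span_induction with
  | mem x hx => obtain ⟨l, hl, rfl⟩ := hx; exact h.lnb_zero l (hn.trans hl)
  | _ => simp_all

/-- Congruent arguments give congruent brackets, one step deeper. -/
theorem lie_sub_lie_mem {n : ℕ} {x x' y y' : L} (hx : x - x' ∈ lcS F L n)
    (hy : y - y' ∈ lcS F L n) : ⁅x, y⁆ - ⁅x', y'⁆ ∈ lcS F L (n + 1) := by
  have : ⁅x, y⁆ - ⁅x', y'⁆ = ⁅x - x', y⁆ + ⁅x', y - y'⁆ := by simp
  rw [this]; exact add_mem (lie_mem_lcS hx y) (lie_mem_lcS' hy x')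

theorem brIt_sub_mem {n : ℕ} {x x' y y' : L} (hx : x - x' ∈ lcS F L n)
    (hy : y - y' ∈ lcS F L n) (m : ℕ) : brIt x (m + 1) y - brIt x' (m + 1) y' ∈ lcS F L (n + 1) := by
  induction m with
  | zero => simpa [brIt_succ] using lie_sub_lie_mem hy hx
  | succ m ih => rw [brIt_succ, brIt_succ x']; exact lie_sub_lie_mem (lcS_anti (le_succ n) ih) hx

end lcS

theorem NilLt.of_injective {p : ℕ} {F L L' : Type*} [CommRing F] [LieRing L] [LieAlgebra F L]
    [LieRing L'] [LieAlgebra F L'] [NilLt p L'] (f : L →ₗ⁅F⁆ L') (hf : Function.Injective f) :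
    NilLt p L :=
  ⟨fun l hl => hf (by rw [map_lnb, map_zero]; exact NilLt.lnb_zero (p := p) _ (by simpa using hl))⟩

theorem NilLt.of_surjective {p : ℕ} {F L L' : Type*} [CommRing F] [LieRing L] [LieAlgebra F L]
    [LieRing L'] [LieAlgebra F L'] [NilLt p L] (f : L →ₗ⁅F⁆ L') (hf : Function.Surjective f) :
    NilLt p L' := by
  constructor
  intro l hl
  obtain ⟨l', rfl⟩ : ∃ l' : List L, l'.map f = l := by
    induction l with
    | cons a l ih =>
      clear hl ih
      choose g hg using hf
      exact ⟨(a :: l).map g, by simp [Function.comp_def, hg]⟩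
    | _ => simp_all
  rw [← map_lnb, NilLt.lnb_zero (p := p) l' (by simpa using hl), map_zero]

end Basics

/-! ### Exponentials of inner derivations and logarithmic derivatives -/

section Exp
variable (F : Type*) [Field F] (p : ℕ) {L : Type*} [LieRing L] [LieAlgebra F L]

/-- `exp(-ad x) y`, i.e. `y` conjugated by the inverse of `exp x`. -/
def rAd (x y : L) : L := ∑ m ∈ range p, ((m.factorial : F)⁻¹) • brIt x m y

/-- The left logarithmic derivative `exp(x)⁻¹ δ(exp x) = ∑_{m ≥ 1} (-ad x)^{m-1}(δ x) / m!`
for a derivation `δ`. -/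
def logD (δ : L → L) (x : L) : L :=
  ∑ m ∈ range (p - 1), (((m + 1).factorial : F)⁻¹) • brIt x m (δ x)

variable {F p}

theorem brIt_mem (G : Submodule F L) {x y : L} (hG : ∀ z ∈ G, ⁅z, x⁆ ∈ G) (hy : y ∈ G) (m : ℕ) :
    brIt x m y ∈ G := by
  induction m <;> simp_all [brIt_succ]

theorem rAd_add (x y z : L) : rAd F p x (y + z) = rAd F p x y + rAd F p x z := by
  simp [rAd, brIt_add, sum_add_distrib]

theorem rAd_neg (x y : L) : rAd F p x (-y) = -rAd F p x y := by simp [rAd, brIt_neg]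

theorem rAd_sub (x y z : L) : rAd F p x (y - z) = rAd F p x y - rAd F p x z := by
  rw [sub_eq_add_neg, rAd_add, rAd_neg, ← sub_eq_add_neg]

theorem rAd_zero_right (x : L) : rAd F p x 0 = 0 := by simp [rAd, brIt_zero_right]

theorem rAd_smul (x : L) (c : F) (y : L) : rAd F p x (c • y) = c • rAd F p x y := by
  simp [rAd, brIt_smul, smul_sum, smul_comm c]

theorem map_rAd {L' : Type*} [LieRing L'] [LieAlgebra F L'] (f : L →ₗ⁅F⁆ L') (x y : L) :
    f (rAd F p x y) = rAd F p (f x) (f y) := by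
  simp [rAd, map_brIt]

theorem map_logD {L' : Type*} [LieRing L'] [LieAlgebra F L'] (f : L →ₗ⁅F⁆ L') (δ : L → L)
    (δ' : L' → L') (x : L) (h : f (δ x) = δ' (f x)) :
    f (logD F p δ x) = logD F p δ' (f x) := by
  simp [logD, map_brIt, h]

theorem rAd_sub_mem {n : ℕ} {x x' : L} (hx : x - x' ∈ lcS F L n) (y : L) :
    rAd F p x y - rAd F p x' y ∈ lcS F L (n + 1) := by
  unfold rAd
  rw [← sum_sub_distrib]
  refine sum_mem fun m _ => ?_
  rw [← smul_sub]
  refine smul_mem _ _ ?_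
  cases m with
  | zero => simp
  | succ m => exact brIt_sub_mem hx (by simp) m

/-- The part of the logarithmic derivative that is nonlinear in `x`. -/
def logDtail (F : Type*) [Field F] (p : ℕ) {L : Type*} [LieRing L] [LieAlgebra F L]
    (δ : L → L) (x : L) : L :=
  ∑ m ∈ range (p - 2), (((m + 2).factorial : F)⁻¹) • brIt x (m + 1) (δ x)

theorem logD_eq (hp : 2 ≤ p) (δ : L → L) (x : L) : logD F p δ x = δ x + logDtail F p δ x := by
  obtain ⟨n, rfl⟩ := exists_eq_add_of_le hp
  unfold logD logDtail
  rw [show 2 + n - 1 = n + 1 by omega, sum_range_succ', show 2 + n - 2 = n by omega]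
  simp [add_comm, add_left_comm]

theorem logDtail_sub_mem {n : ℕ} (δ : L → L) {x x' : L} (hx : x - x' ∈ lcS F L n)
    (hδ : δ x - δ x' ∈ lcS F L n) : logDtail F p δ x - logDtail F p δ x' ∈ lcS F L (n + 1) := by
  unfold logDtail
  rw [← sum_sub_distrib]
  refine sum_mem fun m _ => ?_
  rw [← smul_sub]; exact smul_mem _ _ (brIt_sub_mem hx hδ m)

theorem logDtail_mem (G : Submodule F L) (hG : ∀ x ∈ G, ∀ y ∈ G, ⁅x, y⁆ ∈ G) {δ : L → L} {x : L}
    (hx : x ∈ G) (hd : δ x ∈ G) : logDtail F p δ x ∈ G := by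
  have h : ∀ m, brIt x m (δ x) ∈ G := by
    intro m
    induction m <;> simp_all [brIt_succ]
  exact sum_mem fun m _ => smul_mem _ _ (h _)

end Exp

/-! ### A module over the enveloping algebra which detects logarithmic derivatives -/

section Module
variable {F : Type*} [Field F] {p : ℕ} {L : Type*} [LieRing L] [LieAlgebra F L]
  (δ : LieDerivation F L L)

attribute [local instance 100] LieRing.ofAssociativeRing

/-- The operator `(a, y) ↦ (0, a δ(x) + [y, x])` on `F × L`. -/
def derEnd (x : L) : Module.End F (F × L) where
  toFun v := (0, v.1 • δ x + ⁅v.2, x⁆)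
  map_add' v w := by ext <;> simp [add_smul]; abel
  map_smul' c v := by ext <;> simp [mul_smul]

/-- The right action of the enveloping algebra on `F × L` for which `x ∈ L` acts as
`(a, y) ↦ (0, a δ(x) + [y, x])`. -/
def derRep : 𝒰 F L →ₐ[F] (Module.End F (F × L))ᵐᵒᵖ :=
  UniversalEnvelopingAlgebra.lift F
    { toFun := fun x => MulOpposite.op (derEnd δ x)
      map_add' := fun x y => MulOpposite.unop_injective (by ext v <;> simp [derEnd])
      map_smul' := fun c x => MulOpposite.unop_injective (by ext v <;> simp [derEnd])
      map_lie' := fun {x y} => by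
        rw [LieRing.of_associative_ring_bracket, ← MulOpposite.op_mul, ← MulOpposite.op_mul,
          ← MulOpposite.op_sub]
        congr 1
        ext v
        · simp [derEnd]
        · simp [derEnd]
          rw [← lie_skew y (δ x), ← lie_skew (δ y) x]; abel
        · simp [derEnd]
        · simp [derEnd]
          rw [leibniz_lie v y x, ← lie_skew x ⁅v, y⁆]; abel }

/-- The action of `derRep` written as a function of the vector. -/
def derAct : 𝒰 F L →ₗ[F] Module.End F (F × L) :=
  (MulOpposite.opLinearEquiv F).symm.toLinearMap ∘ₗ (derRep δ).toLinearMap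

theorem derAct_mul (u v : 𝒰 F L) (x : F × L) :
    derAct δ (u * v) x = derAct δ v (derAct δ u x) := by
  simp [derAct]

theorem derAct_ι (x : L) (v : F × L) :
    derAct δ (ιU F x) v = (0, v.1 • δ x + ⁅v.2, x⁆) := by
  simp [derAct, derRep, lift_ι_apply, -UniversalEnvelopingAlgebra.ι_apply, derEnd]

theorem derAct_one (v : F × L) : derAct δ 1 v = v := by simp [derAct]

theorem derAct_pow_snd (x : L) (m : ℕ) (y : L) :
    derAct δ (ιU F x ^ m) (0, y) = (0, brIt x m y) := by
  induction m with
  | zero => simp [derAct_one]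
  | succ m ih => rw [pow_succ, derAct_mul, ih, derAct_ι]; simp [brIt_succ]

theorem derAct_texp_snd (x y : L) :
    derAct δ (texp F p x) (0, y) = (0, rAd F p x y) := by
  unfold texp rAd
  simp only [map_sum, map_smul, LinearMap.sum_apply, LinearMap.smul_apply, derAct_pow_snd]
  ext <;> simp [Prod.fst_sum, Prod.snd_sum]

theorem derAct_texp_fst (hp : 1 ≤ p) (x : L) :
    derAct δ (texp F p x) (1, 0) = (1, logD F p δ x) := by
  unfold texp logD
  obtain ⟨n, rfl⟩ := exists_eq_add_of_le hp
  rw [add_comm 1 n, sum_range_succ']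
  simp only [map_add, map_sum, map_smul, LinearMap.sum_apply, LinearMap.smul_apply,
    LinearMap.add_apply, pow_succ', derAct_mul, derAct_ι, Nat.add_sub_cancel]
  simp only [one_smul, zero_lie, add_zero, derAct_pow_snd]
  ext <;> simp [Prod.fst_sum, Prod.snd_sum, derAct_one]

/-- The filtration `V₀ = F × L ⊇ V₁ = 0 × L ⊇ …` on the module. -/
def derFil (F L : Type*) [Field F] [LieRing L] [LieAlgebra F L] (n : ℕ) : Submodule F (F × L) :=
  if n = 0 then ⊤ else (⊥ : Submodule F F).prod (lcS F L n)

variable (F L) in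
/-- The augmentation of the enveloping algebra. -/
def aug : 𝒰 F L →ₐ[F] F := UniversalEnvelopingAlgebra.lift F (0 : L →ₗ⁅F⁆ F)

theorem augPow_eq (n : ℕ) : augPow F L n = (LinearMap.ker (aug F L).toLinearMap) ^ n := rfl

theorem aug_ι (x : L) : aug F L (ιU F x) = 0 := by rw [aug, lift_ι_apply]; rfl

theorem ι_mem_augPow (x : L) : ιU F x ∈ augPow F L 1 := by rw [augPow_eq, pow_one]; exact aug_ι x

/-- Induction for the enveloping algebra. -/
theorem envel_induction {P : 𝒰 F L → Prop} (hι : ∀ x, P (ιU F x)) (halg : ∀ c, P (algebraMap F _ c))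
    (hadd : ∀ a b, P a → P b → P (a + b)) (hmul : ∀ a b, P a → P b → P (a * b))
    (u : 𝒰 F L) : P u := by
  let S : Subalgebra F (𝒰 F L) :=
    { carrier := {u | P u}
      mul_mem' := fun {a b} ha hb => hmul a b ha hb
      add_mem' := fun {a b} ha hb => hadd a b ha hb
      algebraMap_mem' := halg }
  let f : L →ₗ⁅F⁆ S :=
    { toFun := fun x => ⟨ιU F x, hι x⟩
      map_add' := fun x y => Subtype.ext (map_add _ x y)
      map_smul' := fun c x => Subtype.ext (map_smul _ c x)
      map_lie' := Subtype.ext (LieHom.map_lie _ _ _) }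
  have h : (S.val.comp (UniversalEnvelopingAlgebra.lift F f)) = AlgHom.id F _ := by
    apply UniversalEnvelopingAlgebra.hom_ext
    ext x
    simp [-UniversalEnvelopingAlgebra.ι_apply, lift_ι_apply]; rfl
  have := DFunLike.congr_fun h u
  simp only [AlgHom.comp_apply, AlgHom.id_apply] at this
  rw [← this]; exact (UniversalEnvelopingAlgebra.lift F f u).2

theorem augPow_induction {C : ℕ → 𝒰 F L → Prop} (h0 : ∀ c, C 0 (algebraMap F _ c))
    (hadd : ∀ n u v, C n u → C n v → C n (u + v))
    (hmul : ∀ n u v, aug F L u = 0 → v ∈ augPow F L n → C n v → C (1 + n) (u * v)) {n : ℕ}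
    {u : 𝒰 F L} (hu : u ∈ augPow F L n) : C n u := by
  rw [augPow_eq] at hu
  exact Submodule.pow_induction_on_left' (M := LinearMap.ker (aug F L).toLinearMap)
    (C := fun n u _ => C n u) h0 (fun _ _ n _ _ => hadd n _ _)
    (fun u hu n v hv h => by rw [Nat.succ_eq_add_one, add_comm]; exact hmul n u v hu hv h) hu

theorem derAct_mem_fil {n : ℕ} {u : 𝒰 F L}
    (hu : u ∈ augPow F L n) : ∀ j, ∀ v ∈ derFil F L j, derAct δ u v ∈ derFil F L (j + n) := by
  have hι : ∀ x : L, ∀ j, ∀ v ∈ derFil F L j, derAct δ (ιU F x) v ∈ derFil F L (j + 1) := by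
    intro x j v hv
    rw [derAct_ι]
    unfold derFil at hv ⊢
    rw [if_neg (by omega)]
    refine ⟨rfl, ?_⟩
    split_ifs at hv with h
    · subst h; exact mem_lcS_one _
    · have h0 : v.1 = 0 := hv.1
      simp only [h0, zero_smul, zero_add]; exact lie_mem_lcS hv.2 x
  have hanti : ∀ i j, i ≤ j → derFil F L j ≤ derFil F L i := by
    intro i j hij
    unfold derFil
    split_ifs with h1 h2 h2
    · exact le_rfl
    · omega
    · exact le_top
    · exact Submodule.prod_mono le_rfl (lcS_anti hij)
  have h1 : ∀ u : 𝒰 F L, ∀ j, ∀ v ∈ derFil F L j,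
      derAct δ u v - aug F L u • v ∈ derFil F L (j + 1) := by
    intro u
    induction u using envel_induction with
    | hι x => intro j v hv; rw [aug_ι, zero_smul, sub_zero]; exact hι x j v hv
    | halg c =>
      intro j v hv
      rw [algebraMap_eq_smul_one, map_smul, LinearMap.smul_apply, derAct_one]; simp
    | hadd a b ha hb =>
      intro j v hv
      rw [map_add, map_add, LinearMap.add_apply, add_smul]
      convert add_mem (ha j v hv) (hb j v hv) using 1
      abel
    | hmul a b ha hb =>
      intro j v hv
      have e1 := ha j v hv
      have e2 := hb (j + 1) _ e1
      have e3 := hb j v hv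
      have e4 := add_mem (hanti _ _ (le_succ (j + 1)) e2) (smul_mem _ (aug F L a) e3)
      rw [derAct_mul, map_mul]
      convert add_mem e4 (smul_mem _ (aug F L b) e1) using 1
      simp only [map_sub, map_smul]; module
  refine augPow_induction (C := fun n u => ∀ j, ∀ v ∈ derFil F L j, derAct δ u v ∈ derFil F L (j + n))
    ?_ ?_ ?_ hu
  · intro r j v hv
    rw [algebraMap_eq_smul_one, map_smul, LinearMap.smul_apply, derAct_one]; exact smul_mem _ _ hv
  · intro i x y hx hy j v hv
    rw [map_add, LinearMap.add_apply]; exact add_mem (hx j v hv) (hy j v hv)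
  · intro i m x hm _ hx j v hv
    rw [derAct_mul, ← add_assoc]
    exact hx _ _ (by simpa [hm] using h1 m j v hv)

theorem derAct_augPow (hp : 1 ≤ p) [NilLt p L] {u : 𝒰 F L} (hu : u ∈ augPow F L p) (v : F × L) : derAct δ u v = 0 := by
  have := derAct_mem_fil δ hu 0 v (by simp [derFil])
  unfold derFil at this
  rw [if_neg (by omega)] at this; exact Prod.ext this.1 (lcS_eq_zero p (by omega) this.2)

theorem IsCH.logD (hp : 1 ≤ p) [NilLt p L] {x y z : L}
    (h : IsCH F p x y z) :
    NilpAS.logD F p δ z = rAd F p y (NilpAS.logD F p δ x) + NilpAS.logD F p δ y := by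
  have h1 := derAct_augPow δ hp h ((1, 0) : F × L)
  rw [map_sub, LinearMap.sub_apply, derAct_mul, derAct_texp_fst _ hp, derAct_texp_fst _ hp] at h1
  have : ((1, NilpAS.logD F p δ x) : F × L) = (1, 0) + (0, NilpAS.logD F p δ x) := by simp
  rw [this, map_add, derAct_texp_fst _ hp, derAct_texp_snd] at h1
  have := congrArg Prod.snd (sub_eq_zero.1 h1)
  simp only [Prod.snd_add] at this
  rw [← this, add_comm]

theorem IsCH.rAd (hp : 1 ≤ p) [NilLt p L] {x y z : L} (h : IsCH F p x y z) (a : L) :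
    NilpAS.rAd F p z a = NilpAS.rAd F p y (NilpAS.rAd F p x a) := by
  have h1 := derAct_augPow (0 : LieDerivation F L L) hp h ((0, a) : F × L)
  rw [map_sub, LinearMap.sub_apply, derAct_mul, derAct_texp_snd, derAct_texp_snd, derAct_texp_snd] at h1
  exact (congrArg Prod.snd (sub_eq_zero.1 h1)).symm

end Module

/-! ### Truncated free Lie algebras: universal property, gradings, derivations -/

section Perm
variable {R : Type*} [CommRing R] {L : Type*} [LieRing L] [LieAlgebra R L]

/-- `[x, [y₁, …, yᵣ]]` is a combination of the `[x, y_{π(1)}, …, y_{π(r)}]`. -/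
theorem lie_lnb_mem_span {G : Type*} (g : G → L) (l : List G) (hl : l ≠ []) (x : L) :
    ⁅x, lnb (l.map g)⁆ ∈ Submodule.span R
      {z | ∃ l' : List G, l'.Perm l ∧ z = (l'.map g).foldl (fun a b => ⁅a, b⁆) x} := by
  induction l using reverseRecOn generalizing x with
  | append_singleton l y ih =>
    by_cases h0 : l = []
    · subst h0; exact subset_span ⟨[y], List.Perm.refl _, by simp [lnb]⟩
    rw [map_append, map_singleton, lnb_append_singleton _ (by simpa using h0), leibniz_lie x,
      ← lie_skew (lnb (l.map g)) ⁅x, g y⁆, ← sub_eq_add_neg]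
    refine sub_mem ?_ (span_mono ?_ (ih h0 ⁅x, g y⁆))
    · have hz := ih h0 x
      generalize ⁅x, lnb (l.map g)⁆ = z at hz ⊢
      induction hz using span_induction with
      | mem z h =>
        obtain ⟨l', hl', rfl⟩ := h
        exact subset_span ⟨l' ++ [y], hl'.append_right [y], by simp [List.foldl_append]⟩
      | _ => simp_all [add_mem, smul_mem]
    · rintro _ ⟨l', hl', rfl⟩
      exact ⟨y :: l', (hl'.cons y).trans (List.perm_append_singleton y l).symm, by simp⟩
  | _ => simp_all

theorem lnb_lie_lnb_mem_span {G : Type*} (g : G → L) (l l₁ : List G) :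
    ⁅lnb (l.map g), lnb (l₁.map g)⁆ ∈ Submodule.span R
      {z | ∃ l' : List G, l'.Perm (l ++ l₁) ∧ z = lnb (l'.map g)} := by
  by_cases h1 : l₁ = []
  · subst h1; simp [lnb]
  cases l with
  | nil => simp [lnb]
  | cons a l =>
    refine span_mono ?_ (lie_lnb_mem_span (R := R) g l₁ h1 (lnb ((a :: l).map g)))
    rintro _ ⟨l', hl', rfl⟩
    refine ⟨a :: l ++ l', hl'.append_left _, ?_⟩
    simp [lnb, List.foldl_append]

end Perm

section TLie
variable {p : ℕ} {S : Set ℤ} {N : ℕ} {w : ℤ → ℕ}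

theorem TLie.gen_induction {P : TLie p S N w → Prop} (hg : ∀ g, P (genElt p w g)) (h0 : P 0)
    (hadd : ∀ x y, P x → P y → P (x + y)) (hsmul : ∀ (c : ZMod p) x, P x → P (c • x))
    (hlie : ∀ x y, P x → P y → P ⁅x, y⁆) (x : TLie p S N w) : P x := by
  let T : LieSubalgebra (ZMod p) (TLie p S N w) :=
    { carrier := {u | P u}
      add_mem' := fun {a b} ha hb => hadd a b ha hb
      zero_mem' := h0
      smul_mem' := fun c x hx => hsmul c x hx
      lie_mem' := fun {a b} ha hb => hlie a b ha hb }
  let f : FreeLieAlgebra (ZMod p) (Gen S N) →ₗ⁅ZMod p⁆ T :=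
    FreeLieAlgebra.lift (ZMod p) (fun g => ⟨genElt p w g, hg g⟩)
  have h : T.incl.comp f = mkHom p S N w := by
    apply FreeLieAlgebra.hom_ext
    intro g; simp [f, lift_of_apply]; rfl
  obtain ⟨y, rfl⟩ := LieSubmodule.Quotient.surjective_mk' (heavyIdeal p S N w) x
  have h2 : mkHom p S N w y = T.incl (f y) := by rw [← h]; rfl
  change P (mkHom p S N w y)
  rw [h2]; exact (f y).2

theorem TLie.hom_ext {L : Type*} [LieRing L] [LieAlgebra (ZMod p) L]
    {f f' : TLie p S N w →ₗ⁅ZMod p⁆ L} (h : ∀ g, f (genElt p w g) = f' (genElt p w g)) : f = f' := by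
  ext x
  induction x using TLie.gen_induction <;> simp_all

/-- The universal property of the truncated free Lie algebra. -/
def tLift {L : Type*} [LieRing L] [LieAlgebra (ZMod p) L] (f : Gen S N → L)
    (hf : ∀ l : List (Gen S N), p ≤ wtSum w l → lnb (l.map f) = 0) :
    TLie p S N w →ₗ⁅ZMod p⁆ L where
  toLinearMap := Submodule.liftQ (heavyIdeal p S N w).toSubmodule
    (FreeLieAlgebra.lift (ZMod p) f : FreeLieAlgebra (ZMod p) (Gen S N) →ₗ[ZMod p] _) (by
      have h : heavyIdeal p S N w ≤ (FreeLieAlgebra.lift (ZMod p) f).ker := by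
        refine lieSpan_le.2 ?_
        rintro x ⟨l, hl, rfl⟩
        simp only [SetLike.mem_coe, LieHom.mem_ker, map_lnb, map_map]
        have h1 : l.map ((FreeLieAlgebra.lift (ZMod p) f) ∘ FreeLieAlgebra.of (ZMod p)) =
            l.map f := by simp
        rw [h1, hf l hl]
      exact fun x hx => mem_ker.2 (LieHom.mem_ker.1 (h hx)))
  map_lie' := by
    intro x y
    induction x using Submodule.Quotient.induction_on
    induction y using Submodule.Quotient.induction_on
    exact LieHom.map_lie (FreeLieAlgebra.lift (ZMod p) f) _ _

@[simp]
theorem tLift_genElt {L : Type*} [LieRing L] [LieAlgebra (ZMod p) L] (f : Gen S N → L)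
    (hf : ∀ l : List (Gen S N), p ≤ wtSum w l → lnb (l.map f) = 0) (g : Gen S N) :
    tLift f hf (genElt p w g) = f g :=
  lift_of_apply f g

/-- Brackets of combinations of monomials, for a property of words that adds up. -/
theorem lie_mem_span_words {P Q T : List (Gen S N) → Prop}
    (hT : ∀ l l' l'', P l → Q l' → l''.Perm (l ++ l') → T l'') {x y : TLie p S N w}
    (hx : x ∈ Submodule.span (ZMod p) {z | ∃ l, P l ∧ z = lnb (l.map (genElt p w))})
    (hy : y ∈ Submodule.span (ZMod p) {z | ∃ l, Q l ∧ z = lnb (l.map (genElt p w))}) :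
    ⁅x, y⁆ ∈ Submodule.span (ZMod p) {z | ∃ l, T l ∧ z = lnb (l.map (genElt p w))} := by
  induction hx using span_induction with
  | mem x h =>
    obtain ⟨l, hl, rfl⟩ := h
    induction hy using span_induction with
    | mem y h =>
      obtain ⟨l₁, hl₁, rfl⟩ := h
      refine span_mono ?_ (lnb_lie_lnb_mem_span (R := ZMod p) (genElt p w) l l₁)
      rintro _ ⟨l', h', rfl⟩; exact ⟨l', hT _ _ _ hl hl₁ h', rfl⟩
    | _ => simp_all [add_mem, smul_mem]
  | _ => simp_all [add_mem, smul_mem]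

theorem TLie.mem_span_lnb (x : TLie p S N w) :
    x ∈ Submodule.span (ZMod p) {z | ∃ l : List (Gen S N), z = lnb (l.map (genElt p w))} := by
  induction x using TLie.gen_induction with
  | hg g => exact subset_span ⟨[g], rfl⟩
  | hlie x y hx hy =>
    simpa using lie_mem_span_words (P := fun _ => True) (Q := fun _ => True) (T := fun _ => True)
      (by simp) (by simpa using hx) (by simpa using hy)
  | _ => simp_all [add_mem, smul_mem]

theorem wtSum_perm (f : ℤ → ℕ) {l l' : List (Gen S N)} (h : l.Perm l') : wtSum f l = wtSum f l' :=
  (h.map _).sum_eq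

theorem wtSum_append (f : ℤ → ℕ) (l l' : List (Gen S N)) :
    wtSum f (l ++ l') = wtSum f l + wtSum f l' := by simp [wtSum]

theorem wtSum_cons (f : ℤ → ℕ) (g : Gen S N) (l : List (Gen S N)) :
    wtSum f (g :: l) = f g.index + wtSum f l := by simp [wtSum]

theorem lie_mem_filt {s s' : ℕ} {x y : TLie p S N w} (hx : x ∈ filt p S N w s)
    (hy : y ∈ filt p S N w s') : ⁅x, y⁆ ∈ filt p S N w (s + s') :=
  lie_mem_span_words (fun l l' l'' h h' h'' => by
    rw [wtSum_perm w h'', wtSum_append]; omega) hx hy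

theorem lie_mem_grad {d : ℤ → ℕ} {m m' : ℕ} {x y : TLie p S N w} (hx : x ∈ grad p S N w d m)
    (hy : y ∈ grad p S N w d m') : ⁅x, y⁆ ∈ grad p S N w d (m + m') :=
  lie_mem_span_words (fun l l' l'' h h' h'' => by
    rw [wtSum_perm d h'', wtSum_append]; omega) hx hy

theorem filt_anti {s s' : ℕ} (h : s ≤ s') : filt p S N w s' ≤ filt p S N w s :=
  span_mono fun _ ⟨l, hl, hx⟩ => ⟨l, h.trans hl, hx⟩

theorem filt_eq_bot {s : ℕ} (h : p ≤ s) : filt p S N w s = ⊥ := by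
  refine (span_eq_bot).2 ?_
  rintro _ ⟨l, hl, rfl⟩; exact lnb_genElt_eq_zero p S N w l (h.trans hl)

theorem length_le_wtSum (hw : ∀ g : Gen S N, 1 ≤ w g.index) (l : List (Gen S N)) :
    l.length ≤ wtSum w l := by
  induction l with
  | nil => simp [wtSum]
  | cons g l ih => rw [wtSum_cons, length_cons, add_comm]; exact add_le_add (hw g) ih

theorem mem_filt_one (hw : ∀ g : Gen S N, 1 ≤ w g.index) (x : TLie p S N w) :
    x ∈ filt p S N w 1 := by
  refine span_le.2 ?_ (TLie.mem_span_lnb x)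
  rintro _ ⟨_ | ⟨g, l⟩, rfl⟩
  · simp [lnb]
  · exact subset_span ⟨g :: l, le_trans (by simp) (length_le_wtSum hw _), rfl⟩

theorem TLie.nilLt (hp : 0 < p) (hw : ∀ g : Gen S N, 1 ≤ w g.index) : NilLt p (TLie p S N w) := by
  refine nilLt_of_chain hp (fun n => (filt p S N w n).toAddSubgroup)
    (fun x => mem_filt_one hw x) (fun n x y hx => lie_mem_filt hx (mem_filt_one hw y)) ?_
  intro n hn x hx
  have : x ∈ filt p S N w n := hx
  rwa [filt_eq_bot hn] at this

end TLie

theorem lie_tmul {R A L : Type*} [CommRing R] [CommRing A] [Algebra R A] [LieRing L]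
    [LieAlgebra R L] (s t : A) (x y : L) : ⁅s ⊗ₜ[R] x, t ⊗ₜ[R] y⁆ = (s * t) ⊗ₜ[R] ⁅x, y⁆ := rfl

section Derivation
variable {R : Type*} [CommRing R] {L : Type*} [LieRing L] [LieAlgebra R L]
variable {A : Type*} [CommRing A] [Algebra R A]

/-- The map `a ⊗ x ↦ f(a) x`. -/
def evalFst (f : A →ₗ[R] R) : A ⊗[R] L →ₗ[R] L := TensorProduct.lift ((LinearMap.lsmul R L).comp f)

theorem evalFst_tmul (f : A →ₗ[R] R) (a : A) (x : L) : evalFst f (a ⊗ₜ[R] x) = f a • x := rfl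

theorem evalFst_lie (f : A →ₐ[R] R) (X Y : A ⊗[R] L) :
    evalFst f.toLinearMap ⁅X, Y⁆ = ⁅evalFst f.toLinearMap X, evalFst f.toLinearMap Y⁆ := by
  induction X with
  | tmul a x =>
    induction Y with
    | zero => simp
    | add a b ha hb => simp only [lie_add, map_add, ha, hb]
    | tmul b y => simp [evalFst_tmul, mul_smul, smul_comm (f b)]
  | _ => simp_all [add_lie]

theorem evalFst_lie_of_der (f : A →ₐ[R] R) (d : A →ₗ[R] R)
    (hd : ∀ a b, d (a * b) = f a * d b + d a * f b) (X Y : A ⊗[R] L) :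
    evalFst d ⁅X, Y⁆ =
      ⁅evalFst f.toLinearMap X, evalFst d Y⁆ + ⁅evalFst d X, evalFst f.toLinearMap Y⁆ := by
  induction X with
  | zero => simp
  | add a b ha hb => simp only [add_lie, map_add, ha, hb]; abel
  | tmul a x =>
    induction Y with
    | zero => simp
    | add a b ha hb => simp only [lie_add, map_add, ha, hb]; abel
    | tmul b y =>
      simp only [lie_tmul, evalFst_tmul, hd, smul_lie, lie_smul, add_smul, mul_smul,
        AlgHom.toLinearMap_apply]
      rw [smul_comm (f b) (d a), smul_comm (f a) (d b)]

variable {p : ℕ} {S : Set ℤ} {N : ℕ} {w : ℤ → ℕ}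

/-- The homomorphism `g ↦ u(g) ⊗ g` into an extension of scalars. -/
def scaleHom {A : Type*} [CommRing A] [Algebra (ZMod p) A] (u : Gen S N → A) :
    TLie p S N w →ₗ⁅ZMod p⁆ A ⊗[ZMod p] TLie p S N w :=
  tLift (fun g => u g ⊗ₜ genElt p w g) (by
    intro l hl
    obtain ⟨c, hc⟩ : ∃ c : A,
        lnb (l.map fun g => (u g ⊗ₜ[ZMod p] genElt p w g)) = c ⊗ₜ lnb (l.map (genElt p w)) := by
      clear hl
      induction l using reverseRecOn with
      | append_singleton l y ih =>
        obtain ⟨c, hc⟩ := ih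
        by_cases h0 : l = []
        · subst h0; exact ⟨_, rfl⟩
        · simp only [map_append, map_singleton, lnb_append_singleton _ (mt List.map_eq_nil_iff.1 h0), hc]
          exact ⟨_, lie_tmul ..⟩
      | _ => simp_all [lnb]
    rw [hc, lnb_genElt_eq_zero p S N w l hl, tmul_zero])

theorem evalFst_scaleHom {A : Type*} [CommRing A] [Algebra (ZMod p) A] (f : A →ₐ[ZMod p] ZMod p)
    (u : Gen S N → A) (hu : ∀ g, f (u g) = 1) (x : TLie p S N w) :
    evalFst f.toLinearMap (scaleHom u x) = x := by
  induction x using TLie.gen_induction <;> simp_all [scaleHom, evalFst_tmul, evalFst_lie]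

/-- The derivation of the truncated free Lie algebra with `g ↦ d(g) g` on generators. It is the
`ε`-part of the homomorphism `g ↦ (1 + d(g) ε) ⊗ g` to the extension by dual numbers. -/
def TLie.der (d : Gen S N → ZMod p) : LieDerivation (ZMod p) (TLie p S N w) (TLie p S N w) where
  toLinearMap := evalFst (A := DualNumber (ZMod p)) (TrivSqZeroExt.sndHom (ZMod p) (ZMod p)) ∘ₗ
    (scaleHom (p := p) (A := DualNumber (ZMod p)) (w := w) (fun g => 1 + TrivSqZeroExt.inr (d g)) :
      TLie p S N w →ₗ[ZMod p] _)
  leibniz' x y := by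
    have hu : ∀ g : Gen S N, TrivSqZeroExt.fstHom (ZMod p) (ZMod p) (ZMod p)
        (1 + TrivSqZeroExt.inr (d g)) = 1 := by intro g; simp
    have h1 := fun x => evalFst_scaleHom (w := w) _ _ hu x
    have h2 := evalFst_lie_of_der (L := TLie p S N w)
      (TrivSqZeroExt.fstHom (ZMod p) (ZMod p) (ZMod p)) (TrivSqZeroExt.sndHom (ZMod p) (ZMod p))
      (fun a b => by simp [mul_comm]) (scaleHom (fun g => 1 + TrivSqZeroExt.inr (d g)) x)
      (scaleHom (fun g => 1 + TrivSqZeroExt.inr (d g)) y)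
    rw [h1, h1, ← LieHom.map_lie] at h2
    refine h2.trans ?_
    rw [sub_eq_add_neg, lie_skew]; rfl

theorem TLie.der_genElt (d : Gen S N → ZMod p) (g : Gen S N) :
    TLie.der (w := w) d (genElt p w g) = d g • genElt p w g := by
  change evalFst (A := DualNumber (ZMod p)) _ (scaleHom (A := DualNumber (ZMod p)) _ (genElt p w g)) = _
  simp [scaleHom, evalFst_tmul]

theorem TLie.der_lnb (d : Gen S N → ZMod p) (l : List (Gen S N)) :
    TLie.der (w := w) d (lnb (l.map (genElt p w))) = (l.map d).sum • lnb (l.map (genElt p w)) := by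
  induction l using reverseRecOn with
  | nil => simp [lnb]
  | append_singleton l y ih =>
    by_cases h0 : l = []
    · subst h0; simp [lnb, TLie.der_genElt]
    · rw [map_append, map_singleton, lnb_append_singleton _ (by simpa using h0),
        LieDerivation.apply_lie_eq_add, ih, TLie.der_genElt]
      simp [add_smul, add_comm]

/-- The derivation which multiplies brackets of length `n` by `n`. -/
def TLie.lenDer : LieDerivation (ZMod p) (TLie p S N w) (TLie p S N w) := TLie.der fun _ => 1

theorem TLie.lenDer_lnb (l : List (Gen S N)) : TLie.lenDer (w := w) (lnb (l.map (genElt p w))) =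
      (l.length : ZMod p) • lnb (l.map (genElt p w)) := by
  rw [TLie.lenDer, TLie.der_lnb]; simp

theorem TLie.lenDer_pow [hp : Fact p.Prime] (hw : ∀ g : Gen S N, 1 ≤ w g.index)
    (x : TLie p S N w) : (⇑(TLie.lenDer (w := w) (p := p) (S := S) (N := N)))^[p - 1] x = x := by
  have hlin : ∀ n : ℕ, ∀ x, (⇑(TLie.lenDer (w := w) (p := p) (S := S) (N := N)))^[n] x =
      ((TLie.lenDer (w := w) (p := p) (S := S) (N := N)).toLinearMap ^ n) x := by
    intro n x; rw [Module.End.pow_apply]; rfl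
  rw [hlin]
  have := TLie.mem_span_lnb x
  induction this using span_induction with
  | mem x h =>
    obtain ⟨l, rfl⟩ := h
    by_cases hl : p ≤ l.length
    · rw [lnb_genElt_eq_zero p S N w l (hl.trans (length_le_wtSum hw l)), map_zero]
    have hpow : ∀ n : ℕ, (⇑(TLie.lenDer (w := w) (p := p) (S := S) (N := N)))^[n]
        (lnb (l.map (genElt p w))) = ((l.length : ZMod p) ^ n) • lnb (l.map (genElt p w)) := by
      intro n
      induction n <;> simp_all [iterate_succ_apply', TLie.lenDer_lnb, smul_smul, pow_succ]
    rw [← hlin, hpow]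
    by_cases h0 : l = []
    · subst h0; simp [lnb]
    rw [ZMod.pow_card_sub_one_eq_one fun h => hl (Nat.le_of_dvd (List.length_pos_iff.2 h0)
      ((ZMod.natCast_eq_zero_iff _ _).1 h)), one_smul]
  | _ => simp_all

end Derivation

section

/-! ### The Campbell-Hausdorff composition -/

attribute [local instance 100] LieRing.ofAssociativeRing

section Aug
variable {F : Type*} [Field F] {L : Type*} [LieRing L] [LieAlgebra F L]

theorem mul_mem_augPow {m n : ℕ} {u v : 𝒰 F L} (hu : u ∈ augPow F L m) (hv : v ∈ augPow F L n) :
    u * v ∈ augPow F L (m + n) := by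
  rw [augPow_eq, pow_add]; exact Submodule.mul_mem_mul hu hv

theorem mem_augPow_one {u : 𝒰 F L} : u ∈ augPow F L 1 ↔ aug F L u = 0 := by
  rw [augPow_eq, pow_one]; rfl

theorem augPow_mul_right {n : ℕ} (hn : 1 ≤ n) {u : 𝒰 F L} (hu : u ∈ augPow F L n) (v : 𝒰 F L) :
    u * v ∈ augPow F L n := by
  obtain ⟨m, rfl⟩ := Nat.exists_eq_add_of_le' hn
  have := Submodule.mul_mem_mul hu (Submodule.mem_top (x := v))
  rw [augPow_eq, pow_succ, mul_assoc] at this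
  rw [augPow_eq, pow_succ]
  exact mul_le_mul_right (Submodule.mul_le.2 fun a ha b _ => by simp_all) _ this

theorem augPow_mul_left {n : ℕ} (hn : 1 ≤ n) {u : 𝒰 F L} (hu : u ∈ augPow F L n) (v : 𝒰 F L) :
    v * u ∈ augPow F L n := by
  obtain ⟨m, rfl⟩ := Nat.exists_eq_add_of_le' hn
  have := Submodule.mul_mem_mul (Submodule.mem_top (x := v)) hu
  rw [augPow_eq, pow_succ', ← mul_assoc] at this
  rw [augPow_eq, pow_succ']
  exact mul_le_mul_left (Submodule.mul_le.2 fun a _ b hb => by simp_all) _ this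

theorem augPow_anti {m n : ℕ} (hm : 1 ≤ m) (h : m ≤ n) : augPow F L n ≤ augPow F L m := by
  obtain ⟨d, rfl⟩ := exists_eq_add_of_le h
  rw [augPow_eq, pow_add]; exact Submodule.mul_le.2 fun a ha b _ => augPow_mul_right hm ha b

theorem ι_lie (x y : L) : ιU F ⁅x, y⁆ = ιU F x * ιU F y - ιU F y * ιU F x := by
  rw [LieHom.map_lie, LieRing.of_associative_ring_bracket]

theorem ι_pow_mem_augPow (x : L) {n : ℕ} (hn : 1 ≤ n) : ιU F x ^ n ∈ augPow F L n := by
  induction n, hn using Nat.le_induction with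
  | base => rw [pow_one]; exact ι_mem_augPow x
  | succ n hn ih => rw [pow_succ]; exact mul_mem_augPow ih (ι_mem_augPow x)

theorem ι_brIt_mem_augPow (x y : L) (m : ℕ) : ιU F (brIt x m y) ∈ augPow F L (m + 1) := by
  induction m with
  | zero => exact ι_mem_augPow y
  | succ m ih =>
    rw [brIt_succ, ι_lie]
    exact sub_mem (mul_mem_augPow ih (ι_mem_augPow x))
      (by rw [add_comm]; exact mul_mem_augPow (ι_mem_augPow x) ih)

theorem ι_pow_mul_mem_augPow (x y : L) (i j : ℕ) : ιU F x ^ i *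
    ιU F (brIt x j y) ∈ augPow F L (i + j + 1) := by
  cases i with
  | zero => simpa using ι_brIt_mem_augPow x y j
  | succ i =>
    rw [add_assoc (i + 1)]
    exact mul_mem_augPow (ι_pow_mem_augPow x (by omega)) (ι_brIt_mem_augPow x y j)

theorem aug_texp {p : ℕ} (hp : 1 ≤ p) (x : L) : aug F L (texp F p x) = 1 := by
  obtain ⟨n, rfl⟩ := Nat.exists_eq_add_of_le' hp
  unfold texp
  rw [map_sum, sum_range_succ']; simp only [map_smul, map_pow, aug_ι]; simp

end Aug

section Maps

/-- The relation `z = x ∘ y` is preserved by homomorphisms and extension of scalars. -/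
theorem IsCH.map {F F' : Type*} [Field F] [Field F'] [Algebra F F'] {L L' : Type*} [LieRing L]
    [LieAlgebra F L] [LieRing L'] [LieAlgebra F L'] [LieAlgebra F' L'] [IsScalarTower F F' L']
    {p : ℕ} (f : L →ₗ⁅F⁆ L') {x y z : L} (h : IsCH F p x y z) :
    IsCH F' p (f x) (f y) (f z) := by
  let _ : Algebra F (𝒰 F' L') := Algebra.compHom _ (algebraMap F F')
  have : IsScalarTower F F' (𝒰 F' L') := IsScalarTower.of_algebraMap_eq (fun _ => rfl)
  let g : L →ₗ⁅F⁆ 𝒰 F' L' :=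
    { toFun := fun x => ιU F' (f x)
      map_add' := fun x y => by rw [map_add, map_add]
      map_smul' := fun c x => by
        rw [map_smul, ← algebraMap_smul F' c (f x), map_smul, algebraMap_smul, RingHom.id_apply]
      map_lie' := fun {x y} => by rw [LieHom.map_lie, LieHom.map_lie] }
  let φ := UniversalEnvelopingAlgebra.lift F g
  have hφι : ∀ x, φ (ιU F x) = ιU F' (f x) := fun x => lift_ι_apply F g x
  have haug : ∀ u, aug F' L' (φ u) = algebraMap F F' (aug F L u) := by
    intro u
    induction u using envel_induction with
    | hι x => rw [hφι, aug_ι, aug_ι, map_zero]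
    | halg c => rw [AlgHom.commutes, AlgHom.commutes, IsScalarTower.algebraMap_apply F F',
        AlgHom.commutes]; rfl
    | hadd a b ha hb => simp only [map_add, ha, hb]
    | hmul a b ha hb => simp only [map_mul, ha, hb]
  have hpow : ∀ n u, u ∈ augPow F L n → φ u ∈ augPow F' L' n := by
    intro n u hu
    refine augPow_induction (C := fun n u => φ u ∈ augPow F' L' n) ?_ ?_ ?_ hu
    · intro r
      rw [AlgHom.commutes, IsScalarTower.algebraMap_apply F F', augPow_eq, pow_zero]
      exact Submodule.algebraMap_mem _
    · intro i x y hx hy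
      rw [map_add]; exact add_mem hx hy
    · intro i m x hm _ hx
      rw [map_mul]
      exact mul_mem_augPow (mem_augPow_one.2 (by rw [haug, hm, map_zero])) hx
  have ht : ∀ x, φ (texp F p x) = texp F' p (f x) := by
    intro x
    unfold texp
    rw [map_sum]
    refine sum_congr rfl fun i _ => ?_
    rw [map_smul, map_pow, hφι, ← algebraMap_smul F', map_inv₀, map_natCast]
  have := hpow p _ h
  rwa [map_sub, map_mul, ht, ht, ht] at this

end Maps

section Comm
variable {F : Type*} [Field F] {p : ℕ} {L : Type*} [LieRing L] [LieAlgebra F L]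

theorem sum_square_sub_antidiagonal {M : Type*} [AddCommGroup M] (W : AddSubgroup M) (n : ℕ)
    (g : ℕ → ℕ → M) (hg : ∀ i j, n ≤ i + j → g i j ∈ W) :
    ∑ i ∈ range n, ∑ j ∈ range n, g i j - ∑ m ∈ range n, ∑ x ∈ antidiagonal m, g x.1 x.2 ∈ W := by
  rw [← Finset.sum_product', ← Finset.sum_filter_add_sum_filter_not (range n ×ˢ range n)
      (fun x => x.1 + x.2 < n)]
  have h1 : ∑ x ∈ (range n ×ˢ range n) with x.1 + x.2 < n, g x.1 x.2 =
      ∑ m ∈ range n, ∑ x ∈ antidiagonal m, g x.1 x.2 := by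
    rw [← Finset.sum_fiberwise_of_maps_to (t := range n) (g := fun x : ℕ × ℕ => x.1 + x.2)
      (fun x hx => mem_range.2 (Finset.mem_filter.1 hx).2)]
    refine sum_congr rfl fun m hm => sum_congr ?_ fun _ _ => rfl
    ext ⟨i, j⟩
    simp only [Finset.mem_filter, mem_product, mem_range, mem_antidiagonal] at hm ⊢; omega
  rw [h1, add_sub_cancel_left]
  refine AddSubgroup.sum_mem _ fun x hx => hg _ _ ?_
  have := (Finset.mem_filter.1 hx).2
  omega

theorem ι_mul_pow (a y : L) (n : ℕ) : ιU F a * ιU F y ^ n =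
      ∑ x ∈ antidiagonal n, (n.choose x.1 : F) • (ιU F y ^ x.1 * ιU F (brIt y x.2 a)) := by
  set U := 𝒰 F L
  set Y := ιU F y
  have hM : ∀ m, ((mulRight F Y - mulLeft F Y) ^ m) (ιU F a) = ιU F (brIt y m a) := by
    intro m
    induction m with
    | zero => rfl
    | succ m ih => rw [pow_succ', Module.End.mul_apply, ih, brIt_succ, ι_lie]; rfl
  have hc : Commute (mulLeft F Y) (mulRight F Y - mulLeft F Y) :=
    (LinearMap.commute_mulLeft_right (R := F) Y Y).sub_right (Commute.refl _)
  have h := hc.add_pow' n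
  rw [add_sub_cancel] at h
  have h2 := LinearMap.congr_fun h (ιU F a)
  rw [LinearMap.pow_mulRight] at h2
  change ιU F a * Y ^ n = _ at h2
  rw [h2, LinearMap.sum_apply]
  refine sum_congr rfl fun x _ => ?_
  rw [LinearMap.smul_apply, Module.End.mul_apply, hM, LinearMap.pow_mulLeft, Nat.cast_smul_eq_nsmul]
  rfl

theorem sum_range_eq_pred (hp : 1 ≤ p) {M : Type*} [AddCommMonoid M] (f : ℕ → M) :
    ∑ i ∈ range p, f i = ∑ i ∈ range (p - 1), f (i + 1) + f 0 := by
  rw [← sum_range_succ', Nat.sub_add_cancel hp]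

theorem inv_factorial_mul_choose [CharP F p] (hp : p.Prime) {n : ℕ} (hn : n < p) {i j : ℕ}
    (h : i + j = n) : ((n.factorial : F)⁻¹) * (n.choose i : F) =
      ((i.factorial : F)⁻¹) * ((j.factorial : F)⁻¹) := by
  have hne : ∀ m, m < p → (m.factorial : F) ≠ 0 := by
    intro m hm
    rw [Ne, CharP.cast_eq_zero_iff F p, hp.dvd_factorial]; omega
  have h1 := hne n hn
  have h2 := hne i (by omega)
  have h3 := hne j (by omega)
  have h4 : (n.choose i : F) * i.factorial * j.factorial = n.factorial := by
    have := Nat.choose_mul_factorial_mul_factorial (show i ≤ n by omega)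
    rw [show n - i = j by omega] at this
    have := congrArg (Nat.cast (R := F)) this
    push_cast at this; exact this
  rw [← h4] at h1 ⊢
  have h5 : (n.choose i : F) ≠ 0 := fun h => h1 (by rw [h]; ring)
  field_simp

/-- `a exp(y) ≡ exp(y) (exp(-ad y) a)`. -/
theorem ι_mul_texp [CharP F p] (hp : p.Prime) (a y : L) : ιU F a * texp F p y -
      texp F p y * ιU F (rAd F p y a) ∈ augPow F L p := by
  have key := sum_square_sub_antidiagonal (augPow F L p).toAddSubgroup p
    (fun i j => (((i.factorial : F)⁻¹) * ((j.factorial : F)⁻¹)) • (ιU F y ^ i * ιU F (brIt y j a)))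
    (fun i j hij => smul_mem _ _ (augPow_anti hp.one_le (by omega) (ι_pow_mul_mem_augPow y a i j)))
  have e1 : texp F p y * ιU F (rAd F p y a) =
      ∑ i ∈ range p, ∑ j ∈ range p, (((i.factorial : F)⁻¹) * ((j.factorial : F)⁻¹)) •
      (ιU F y ^ i * ιU F (brIt y j a)) := by
    unfold texp rAd
    rw [map_sum, sum_mul]
    refine sum_congr rfl fun i _ => ?_
    rw [mul_sum]
    refine sum_congr rfl fun j _ => ?_
    rw [map_smul, smul_mul_smul_comm]
  have e2 : ιU F a * texp F p y = ∑ m ∈ range p, ∑ x ∈ antidiagonal m,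
        (((x.1.factorial : F)⁻¹) * ((x.2.factorial : F)⁻¹)) • (ιU F y ^ x.1 *
            ιU F (brIt y x.2 a)) := by
    unfold texp
    rw [mul_sum]
    refine sum_congr rfl fun n hn => ?_
    rw [mul_smul_comm, ι_mul_pow, smul_sum]
    refine sum_congr rfl fun x hx => ?_
    rw [smul_smul, inv_factorial_mul_choose hp (mem_range.1 hn) (mem_antidiagonal.1 hx)]
  rw [← neg_mem_iff, neg_sub, e1, e2]; exact key

variable (δ : LieDerivation F L L)

/-- The homomorphism `u ↦ u + D(u) ε` that defines the extension `D` of a derivation of a Lie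
algebra to its enveloping algebra. -/
def envDerAux : 𝒰 F L →ₐ[F] Matrix (Fin 2) (Fin 2) (𝒰 F L) :=
  UniversalEnvelopingAlgebra.lift F
    { toFun := fun x => !![ιU F x, ιU F (δ x); 0, ιU F x]
      map_add' := fun x y => by
        simp only [map_add]
        ext i j; fin_cases i <;> fin_cases j <;> simp
      map_smul' := fun c x => by
        simp only [map_smul, RingHom.id_apply]
        ext i j; fin_cases i <;> fin_cases j <;> simp
      map_lie' := fun {x y} => by
        rw [LieRing.of_associative_ring_bracket, LieDerivation.apply_lie_eq_add]
        simp only [map_add, ι_lie]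
        ext i j; fin_cases i <;> fin_cases j <;>
          simp
        abel }

theorem envDerAux_ι (x : L) : envDerAux δ (ιU F x) =
      !![ιU F x, ιU F (δ x); 0, ιU F x] :=
  lift_ι_apply _ _ _

/-- The extension of a derivation of a Lie algebra to its enveloping algebra. -/
def envDer : 𝒰 F L →ₗ[F] 𝒰 F L where
  toFun u := envDerAux δ u 0 1
  map_add' u v := by rw [map_add]; rfl
  map_smul' c u := by rw [map_smul]; rfl

theorem envDer_ι (x : L) : envDer δ (ιU F x) = ιU F (δ x) := by
  change envDerAux δ (ιU F x) 0 1 = _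
  rw [envDerAux_ι]; rfl

theorem envDerAux_diag (u : 𝒰 F L) :
    envDerAux δ u 0 0 = u ∧ envDerAux δ u 1 1 = u ∧ envDerAux δ u 1 0 = 0 := by
  induction u using envel_induction with
  | hι x => rw [envDerAux_ι]; simp
  | halg c => rw [AlgHom.commutes]; simp [Matrix.algebraMap_matrix_apply]
  | hadd a b ha hb => simp [map_add, ha, hb]
  | hmul a b ha hb => simp [map_mul, Matrix.mul_apply, Fin.sum_univ_two, ha, hb]

theorem envDer_mul (u v : 𝒰 F L) :
    envDer δ (u * v) = u * envDer δ v + envDer δ u * v := by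
  change envDerAux δ (u * v) 0 1 = u * envDerAux δ v 0 1 + envDerAux δ u 0 1 * v
  rw [map_mul, Matrix.mul_apply, Fin.sum_univ_two, (envDerAux_diag δ u).1, (envDerAux_diag δ v).2.1]

theorem envDer_algebraMap (c : F) : envDer δ (algebraMap F _ c) = 0 := by
  change envDerAux δ (algebraMap F _ c) 0 1 = 0
  rw [AlgHom.commutes]; simp [Matrix.algebraMap_matrix_apply]

theorem envDer_one : envDer δ 1 = 0 := by
  simpa using envDer_algebraMap δ 1

theorem envDer_mem_one (u : 𝒰 F L) : envDer δ u ∈ augPow F L 1 := by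
  induction u using envel_induction with
  | hι x => rw [envDer_ι]; exact ι_mem_augPow _
  | halg c => rw [envDer_algebraMap]; exact zero_mem _
  | hadd a b ha hb => rw [map_add]; exact add_mem ha hb
  | hmul a b ha hb =>
    rw [envDer_mul]; exact add_mem (augPow_mul_left le_rfl hb a) (augPow_mul_right le_rfl ha b)

theorem envDer_mem {n : ℕ} {u : 𝒰 F L}
    (hu : u ∈ augPow F L n) : envDer δ u ∈ augPow F L n := by
  refine augPow_induction (C := fun n u => envDer δ u ∈ augPow F L n) ?_ ?_ ?_ hu
  · intro r; rw [envDer_algebraMap]; exact zero_mem _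
  · intro i x y hx hy; rw [map_add]; exact add_mem hx hy
  · intro i m x hm hx' hx
    rw [envDer_mul]
    exact add_mem (mul_mem_augPow (mem_augPow_one.2 hm) hx)
      (mul_mem_augPow (envDer_mem_one δ m) hx')

theorem envDer_pow (y : L) (n : ℕ) : envDer δ (ιU F y ^ n) =
      ∑ j ∈ range n, (n.choose (j + 1) : F) • (ιU F y ^ (n - 1 - j) * ιU F (brIt y j (δ y))) := by
  induction n with
  | zero => simp [envDer_one]
  | succ n ih =>
    rw [pow_succ, envDer_mul, envDer_ι, ih, sum_mul]
    have hB : ∀ j, ιU F (brIt y j (δ y)) * ιU F y = ιU F y * ιU F (brIt y j (δ y)) +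
          ιU F (brIt y (j + 1) (δ y)) := by
      intro j; rw [brIt_succ, ι_lie]; abel
    have h1 : ∀ j ∈ range n, (n.choose (j + 1) : F) • (ιU F y ^ (n - 1 - j) *
          ιU F (brIt y j (δ y))) * ιU F y =
        (n.choose (j + 1) : F) • (ιU F y ^ (n - j) * ιU F (brIt y j (δ y))) +
        (n.choose (j + 1) : F) • (ιU F y ^ (n - (j + 1)) * ιU F (brIt y (j + 1) (δ y))) := by
      intro j hj
      have := mem_range.1 hj
      rw [smul_mul_assoc, mul_assoc, hB, mul_add, smul_add, ← mul_assoc, ← pow_succ,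
        show n - 1 - j + 1 = n - j by omega, show n - 1 - j = n - (j + 1) by omega]
    rw [sum_congr rfl h1, sum_add_distrib]
    have h2 : ∀ j, ((n + 1).choose (j + 1) : F) = n.choose (j + 1) + n.choose j := by
      intro j; rw [Nat.choose_succ_succ]; push_cast; ring
    simp only [h2, add_smul, Nat.add_sub_cancel]
    rw [sum_add_distrib, sum_range_succ, sum_range_succ' (n := n)]; simp; abel

/-- `D(exp z) ≡ exp(z) · logD z`. -/
theorem envDer_texp [CharP F p] (hp : p.Prime) (y : L) :
    envDer δ (texp F p y) - texp F p y * ιU F (logD F p δ y) ∈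
      augPow F L p := by
  have h1 := hp.one_le
  have key := sum_square_sub_antidiagonal (augPow F L p).toAddSubgroup (p - 1)
    (fun i j => (((i.factorial : F)⁻¹) * (((j + 1).factorial : F)⁻¹)) •
      (ιU F y ^ i * ιU F (brIt y j (δ y))))
    (fun i j hij => smul_mem _ _
      (augPow_anti hp.one_le (by omega) (ι_pow_mul_mem_augPow y (δ y) i j)))
  have hlast : ∑ j ∈ range (p - 1), (((((p - 1).factorial : F)⁻¹) *
      (((j + 1).factorial : F)⁻¹)) • (ιU F y ^ (p - 1) * ιU F (brIt y j (δ y)))) ∈ augPow F L p :=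
    sum_mem fun j _ => smul_mem _ _
      (augPow_anti hp.one_le (by omega) (ι_pow_mul_mem_augPow y (δ y) _ j))
  have key2 := add_mem (show _ ∈ augPow F L p from key) hlast
  rw [← neg_mem_iff]
  convert key2 using 1
  rw [neg_sub, sub_add_eq_add_sub]
  congr 1
  · unfold texp logD
    rw [map_sum, sum_mul]
    rw [← Nat.sub_add_cancel h1, sum_range_succ, Nat.sub_add_cancel h1]
    congr 1
    · refine sum_congr rfl fun i _ => ?_
      rw [mul_sum]
      refine sum_congr rfl fun j _ => ?_
      rw [map_smul, smul_mul_smul_comm]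
    · rw [mul_sum]
      refine sum_congr rfl fun j _ => ?_
      rw [map_smul, smul_mul_smul_comm]
  · unfold texp
    rw [map_sum, sum_range_eq_pred h1]
    simp only [pow_zero, map_smul, envDer_one, smul_zero, add_zero]
    refine sum_congr rfl fun n hn => ?_
    rw [envDer_pow, smul_sum, Finset.Nat.sum_antidiagonal_eq_sum_range_succ_mk,
      ← Finset.sum_range_reflect]
    refine sum_congr rfl fun j hj => ?_
    have hj' := mem_range.1 hj
    have hn' := mem_range.1 hn
    have e : (n + 1).choose (n + 1 - 1 - j + 1) = (n + 1).choose j := by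
      rw [← Nat.choose_symm (show j ≤ n + 1 by omega)]
      congr 1; omega
    rw [smul_smul, e, inv_factorial_mul_choose hp (show n + 1 < p by omega)
      (show j + (n - j + 1) = n + 1 by omega)]
    simp only
    congr 3
    omega

end Comm

end

section

attribute [local instance 100] LieRing.ofAssociativeRing

section Unique
variable {F : Type*} [Field F] {p : ℕ} {L : Type*} [LieRing L] [LieAlgebra F L]

theorem LieDerivation.mem_lcS (δ : LieDerivation F L L) {n : ℕ} {x : L} (hx : x ∈ lcS F L n) :
    δ x ∈ lcS F L n := by
  have key : ∀ l : List L, δ (lnb l) ∈ lcS F L l.length := by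
    intro l
    induction l using reverseRecOn with
    | nil => simp [lnb]
    | append_singleton l y ih =>
      by_cases h0 : l = []
      · subst h0; exact mem_lcS_one _
      · rw [lnb_append_singleton l h0, LieDerivation.apply_lie_eq_add, length_append,
          List.length_singleton]
        exact add_mem (lie_mem_lcS (subset_span ⟨l, le_rfl, rfl⟩) _) (lie_mem_lcS ih _)
  induction hx using span_induction with
  | mem x h => obtain ⟨l, hl, rfl⟩ := h; exact lcS_anti hl (key l)
  | _ => simp_all [add_mem, smul_mem]

theorem iterate_mem_of_mem {M : Type*} {W : M → Prop} {f : M → M} (hf : ∀ x, W x → W (f x))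
    {x : M} (hx : W x) (n : ℕ) : W (f^[n] x) := by
  induction n <;> simp_all [iterate_succ_apply']

/-- Two solutions of a contracting differential equation `logD z = Ψ z` agree, as soon as the
derivation is invertible on their difference. -/
theorem logD_unique (hp : 2 ≤ p) [NilLt p L] (δ : LieDerivation F L L) {z z' : L}
    (h : ∀ n, z - z' ∈ lcS F L n → logD F p δ z - logD F p δ z' ∈ lcS F L (n + 1))
    (hd : (⇑δ)^[p - 1] (z - z') = z - z') : z = z' := by
  have key : ∀ n, z - z' ∈ lcS F L (n + 1) := by
    intro n
    induction n with
    | zero => exact mem_lcS_one _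
    | succ n ih =>
      have h1 := h _ ih
      have h2 := logDtail_sub_mem (p := p) (F := F) (⇑δ) ih
        (by rw [← map_sub]; exact LieDerivation.mem_lcS δ ih)
      have h3 : δ (z - z') ∈ lcS F L (n + 1 + 1) := by
        have := sub_mem h1 h2
        rw [logD_eq hp, logD_eq hp] at this
        rw [map_sub]
        convert this using 1
        abel
      rw [← hd]
      obtain ⟨m, hm⟩ : ∃ m, p - 1 = m + 1 := ⟨p - 2, by omega⟩
      rw [hm, iterate_succ_apply]
      exact iterate_mem_of_mem (W := (· ∈ lcS F L (n + 1 + 1)))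
        (fun x hx => LieDerivation.mem_lcS δ hx) h3 m
  exact sub_eq_zero.1 (lcS_eq_zero p (le_succ p) (key p))

/-- The equation `logD δ z = g` has a solution in every subalgebra that contains `g`, is stable
under `δ`, and on which `δ ^ (p - 1) = 1`: iterate `z ↦ δ ^ (p - 2) (g - logDtail δ z)`. -/
theorem exists_logD_eq (hp : 2 ≤ p) [NilLt p L] (δ : LieDerivation F L L) (G : Submodule F L)
    (hG : ∀ x ∈ G, ∀ y ∈ G, ⁅x, y⁆ ∈ G) (hδ : ∀ x ∈ G, δ x ∈ G)
    (hd : ∀ x ∈ G, (⇑δ)^[p - 1] x = x) {g : L} (hg : g ∈ G) : ∃ z ∈ G, logD F p δ z = g := by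
  have hgz : ∀ z ∈ G, g - logDtail F p δ z ∈ G :=
    fun z hz => sub_mem hg (logDtail_mem G hG hz (hδ _ hz))
  let Ψ : L → L := fun z => (⇑δ)^[p - 2] (g - logDtail F p δ z)
  have h1 : Ψ^[p] 0 ∈ G := iterate_mem_of_mem (W := (· ∈ G))
    (fun z hz => iterate_mem_of_mem (W := (· ∈ G)) hδ (hgz z hz) _) G.zero_mem p
  have h2 : ∀ n, Ψ^[n + 1] 0 - Ψ^[n] 0 ∈ lcS F L (n + 1) := by
    intro n
    induction n with
    | zero => exact mem_lcS_one _
    | succ n ih =>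
      rw [iterate_succ_apply', iterate_succ_apply' _ n]
      change (⇑δ)^[p - 2] _ - (⇑δ)^[p - 2] _ ∈ _
      rw [← iterate_map_sub]
      refine iterate_mem_of_mem (W := (· ∈ lcS F L (n + 1 + 1)))
        (fun _ => LieDerivation.mem_lcS δ) ?_ _
      rw [← iterate_succ_apply' Ψ n, sub_sub_sub_cancel_left, ← neg_mem_iff, neg_sub]
      exact logDtail_sub_mem _ ih (by rw [← map_sub]; exact LieDerivation.mem_lcS δ ih)
  refine ⟨_, h1, ?_⟩
  have h3 := lcS_eq_zero p (le_succ p) (h2 p)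
  rw [iterate_succ_apply', sub_eq_zero] at h3
  have h4 := congrArg δ h3
  rw [← iterate_succ_apply' δ, show (p - 2).succ = p - 1 by omega, hd _ (hgz _ h1)] at h4
  rw [logD_eq hp, ← h4, sub_add_cancel]

theorem logD_eq_of_texp (hp : 1 ≤ p) [NilLt p L] (δ : LieDerivation F L L) {z z' : L}
    (h : texp F p z - texp F p z' ∈ augPow F L p) : logD F p δ z = logD F p δ z' := by
  have h1 := derAct_augPow δ hp h ((1, 0) : F × L)
  rw [map_sub, LinearMap.sub_apply, derAct_texp_fst _ hp, derAct_texp_fst _ hp] at h1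
  exact congrArg Prod.snd (sub_eq_zero.1 h1)

theorem texp_inj (hp : 2 ≤ p) [NilLt p L] (δ : LieDerivation F L L)
    (hδ : ∀ x, (⇑δ)^[p - 1] x = x) {z z' : L}
    (h : texp F p z - texp F p z' ∈ augPow F L p) : z = z' :=
  logD_unique hp δ (fun n _ => by
    rw [logD_eq_of_texp (by omega) δ h, sub_self]; exact zero_mem _) (hδ _)

end Unique

section Existence
variable {S : Set ℤ} {N : ℕ} {w : ℤ → ℕ}

local notation "UT" => UniversalEnvelopingAlgebra Fp (TLie p S N w)

/-- The product of a word of generators in the enveloping algebra. -/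
def wordU (p : ℕ) {S : Set ℤ} {N : ℕ} (w : ℤ → ℕ) (l : List (Gen S N)) :
    UniversalEnvelopingAlgebra (ZMod p) (TLie p S N w) :=
  (l.map fun g => ιU (ZMod p) (genElt p w g)).prod

theorem mem_span_wordU (u : UT) : u ∈ Submodule.span Fp (Set.range (wordU p w)) := by
  let T := Algebra.adjoin Fp (Set.range fun g : Gen S N => ιU Fp (genElt p w g))
  have h1 : ∀ u : UT, u ∈ T := by
    intro u
    induction u using envel_induction with
    | hι x =>
      induction x using TLie.gen_induction with
      | hg g => exact Algebra.subset_adjoin ⟨g, rfl⟩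
      | hsmul c x hx => rw [map_smul]; exact Subalgebra.smul_mem _ hx c
      | _ => simp_all [ι_lie, -UniversalEnvelopingAlgebra.ι_apply, -LieHom.map_lie, add_mem, sub_mem, mul_mem]
    | halg c => exact Subalgebra.algebraMap_mem _ c
    | hadd a b ha hb => exact add_mem ha hb
    | hmul a b ha hb => exact mul_mem ha hb
  have h2 : u ∈ Subalgebra.toSubmodule T := h1 u
  rw [Algebra.adjoin_eq_span] at h2
  refine span_mono ?_ h2
  intro x hx
  obtain ⟨l, hl, rfl⟩ := Submonoid.exists_list_of_mem_closure hx
  have hl' : ∃ l' : List (Gen S N), l'.map (fun g => ιU Fp (genElt p w g)) = l := by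
    clear hx
    induction l with
    | cons a l ih =>
      obtain ⟨g, hg⟩ := hl a (by simp)
      obtain ⟨l', h⟩ := ih (fun x hx => hl x (mem_cons_of_mem _ hx))
      exact ⟨g :: l', by rw [map_cons, h]; exact congrArg (· :: l) hg⟩
    | _ => simp_all
  obtain ⟨l', rfl⟩ := hl'; exact ⟨l', rfl⟩

theorem envDer_lenDer_wordU (l : List (Gen S N)) :
    envDer TLie.lenDer (wordU p w l) = (l.length : Fp) • wordU p w l := by
  induction l with
  | nil => simp [wordU, envDer_one]
  | cons g l ih =>
    have h : wordU p w (g :: l) = ιU Fp (genElt p w g) *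
      wordU p w l := by simp [wordU]
    have h1 : TLie.lenDer (genElt p w g) = genElt p w g := by
      rw [TLie.lenDer, TLie.der_genElt, one_smul]
    rw [h, envDer_mul, ih, envDer_ι, h1, mul_smul_comm, length_cons]
    push_cast
    rw [add_smul, one_smul]

theorem wordU_mem_augPow {l : List (Gen S N)} (hl : l ≠ []) :
    wordU p w l ∈ augPow Fp (TLie p S N w) l.length := by
  induction l with
  | cons g l ih =>
    have h : wordU p w (g :: l) = ιU Fp (genElt p w g) *
      wordU p w l := by simp [wordU]
    rw [h, length_cons, add_comm]
    by_cases h0 : l = []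
    · subst h0; simpa [wordU] using ι_mem_augPow (F := Fp) (genElt p w g)
    · exact mul_mem_augPow (ι_mem_augPow _) (ih h0)
  | _ => simp_all

theorem envDer_lenDer_pow_sub (u : UT) :
    (envDer TLie.lenDer ^ (p - 1)) u - u + algebraMap _ _ (aug Fp (TLie p S N w) u) ∈
      augPow Fp (TLie p S N w) p := by
  have h2 := hp.out.two_le
  induction mem_span_wordU u using span_induction with
  | mem x h =>
    obtain ⟨l, rfl⟩ := h
    have hpow : ∀ n : ℕ, ((envDer TLie.lenDer) ^ n) (wordU p w l) =
        ((l.length : Fp) ^ n) • wordU p w l := by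
      intro n
      induction n with
      | zero => simp
      | succ n ih => rw [pow_succ', Module.End.mul_apply, ih, map_smul, envDer_lenDer_wordU,
          smul_smul, pow_succ]
    rw [hpow]
    by_cases h0 : l = []
    · subst h0; simp [wordU, show p - 1 ≠ 0 by omega]
    · have hpos := List.length_pos_iff.2 h0
      have ha : aug Fp (TLie p S N w) (wordU p w l) = 0 :=
        mem_augPow_one.1 (augPow_anti le_rfl hpos (wordU_mem_augPow h0))
      rw [ha, map_zero, add_zero]
      by_cases hd : (l.length : Fp) = 0
      · rw [hd, zero_pow (by omega), zero_smul, zero_sub, neg_mem_iff]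
        refine augPow_anti (by omega) ?_ (wordU_mem_augPow h0)
        exact Nat.le_of_dvd hpos ((ZMod.natCast_eq_zero_iff _ _).1 hd)
      · rw [ZMod.pow_card_sub_one_eq_one hd, one_smul, sub_self]; exact zero_mem _
  | zero => simp
  | add a b _ _ ha hb =>
    convert add_mem ha hb using 1
    simp only [map_add]; abel
  | smul c a _ ha =>
    convert smul_mem _ c ha using 1
    rw [map_smul, map_smul, smul_add, smul_sub, algebraMap_eq_smul_one,
      algebraMap_eq_smul_one, smul_assoc]

/-- The Campbell-Hausdorff composition exists in a truncated free Lie algebra. The candidate `z`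
solves the equation which the left logarithmic derivative of `x ∘ y` has to satisfy. -/
theorem TLie.exists_isCH (hw : ∀ g : Gen S N, 1 ≤ w g.index) (x y : TLie p S N w) :
    ∃ z, IsCH Fp p x y z := by
  have h1 := hp.out.one_le
  have h2 := hp.out.two_le
  have := TLie.nilLt h1 hw
  let δ : LieDerivation Fp (TLie p S N w) (TLie p S N w) := TLie.lenDer
  set g := rAd Fp p y (logD Fp p δ x) + logD Fp p δ y with hg
  obtain ⟨z, -, hz2⟩ := exists_logD_eq (p := p) h2 δ ⊤ (fun _ _ _ _ => trivial)
    (fun _ _ => trivial) (fun x _ => TLie.lenDer_pow hw x) (g := g) trivial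
  refine ⟨z, ?_⟩
  set J := augPow Fp (TLie p S N w)
  set D := envDer δ
  have hu : D (texp Fp p x * texp Fp p y) - texp Fp p x * texp Fp p y *
      ιU Fp g ∈ J p := by
    have e1 := augPow_mul_left h1 (envDer_texp δ hp.out y) (texp Fp p x)
    have e2 := augPow_mul_right h1 (envDer_texp δ hp.out x) (texp Fp p y)
    have e3 := augPow_mul_left h1 (ι_mul_texp hp.out (logD Fp p δ x) y) (texp Fp p x)
    have := add_mem (add_mem e1 e2) e3
    convert this using 1
    rw [envDer_mul, hg, map_add]
    noncomm_ring
  have hv := envDer_texp δ hp.out z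
  rw [hz2] at hv
  have key : ∀ n, n + 1 ≤ p → texp Fp p x * texp Fp p y - texp Fp p z ∈
      J (n + 1) := by
    intro n
    induction n with
    | zero =>
      intro _
      refine mem_augPow_one.2 ?_
      rw [map_sub, map_mul, aug_texp h1, aug_texp h1, aug_texp h1]; simp
    | succ n ih =>
      intro hn
      set d := texp Fp p x * texp Fp p y - texp Fp p z
      have hd : d ∈ J (n + 1) := ih (by omega)
      have h3 : D d ∈ J (n + 1 + 1) := by
        have h4 := augPow_anti (by omega) hn (sub_mem hu hv)
        have h5 := add_mem h4 (mul_mem_augPow hd (ι_mem_augPow (F := Fp) g))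
        convert h5 using 1
        simp only [d, map_sub]
        noncomm_ring
      -- `D ^ (p - 1)` is the identity on `J (n + 1)` modulo `J p`
      have h6 : (D ^ (p - 1)) d ∈ J (n + 1 + 1) := by
        obtain ⟨m, hm⟩ : ∃ m, p - 1 = m + 1 := ⟨p - 2, by omega⟩
        rw [hm, pow_succ, Module.End.mul_apply, Module.End.pow_apply]
        exact iterate_mem_of_mem (W := (· ∈ J (n + 1 + 1))) (fun x hx => envDer_mem δ hx) h3 m
      have h7 := augPow_anti (by omega) hn (envDer_lenDer_pow_sub d)
      have h8 : aug Fp (TLie p S N w) d = 0 :=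
        mem_augPow_one.1 (augPow_anti le_rfl (by omega) hd)
      rw [h8, map_zero, add_zero] at h7
      have := sub_mem h6 h7
      rwa [sub_sub_cancel] at this
  have := key (p - 1) (by omega)
  rwa [show p - 1 + 1 = p by omega] at this

end Existence

section Bch

/-- The free Lie algebra of class `< p` on three generators. -/
abbrev T3 (p : ℕ) : Type := TLie p {1, 2} 1 (fun _ => 1)

theorem wtSum_one {S : Set ℤ} {N : ℕ} (l : List (Gen S N)) : wtSum (fun _ => 1) l = l.length := by
  simp [wtSum]

/-- The generators of `T3`. -/
def T3.X (p : ℕ) : Fin 3 → T3 p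
  | 0 => genElt p _ (some (⟨1, by simp⟩, 0))
  | 1 => genElt p _ (some (⟨2, by simp⟩, 0))
  | 2 => genElt p _ none

instance : NilLt p (T3 p) := TLie.nilLt hp.out.pos (fun _ => le_rfl)

/-- Values on the generators of `T3`. -/
def T3.val (x y z : L) : Gen ({1, 2} : Set ℤ) 1 → L
  | none => z
  | some (a, _) => if (a : ℤ) = 1 then x else y

/-- Evaluation of `T3` at three elements of a Lie algebra of class `< p`. -/
def T3.ev [NilLt p L] (x y z : L) : T3 p →ₗ⁅Fp⁆ L :=
  tLift (T3.val x y z) (fun l hl => NilLt.lnb_zero (p := p) _ (by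
    rw [wtSum_one] at hl; simpa using hl))

section
variable [NilLt p L] (x y z : L)
@[simp] theorem T3.ev_X0 : T3.ev x y z (T3.X p 0) = x := by simp [T3.ev, T3.X, T3.val]
@[simp] theorem T3.ev_X1 : T3.ev x y z (T3.X p 1) = y := by simp [T3.ev, T3.X, T3.val]
@[simp] theorem T3.ev_X2 : T3.ev x y z (T3.X p 2) = z := by simp [T3.ev, T3.X, T3.val]
end

theorem T3.gen_induction {P : T3 p → Prop} (hg : ∀ i, P (T3.X p i)) (h0 : P 0)
    (hadd : ∀ x y, P x → P y → P (x + y)) (hsmul : ∀ (c : Fp) x, P x → P (c • x))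
    (hlie : ∀ x y, P x → P y → P ⁅x, y⁆) (x : T3 p) : P x := by
  refine TLie.gen_induction ?_ h0 hadd hsmul hlie x
  rintro (_ | ⟨⟨a, ha⟩, i⟩)
  · exact hg 2
  · have : i = 0 := Subsingleton.elim _ _
    subst this
    rcases ha with rfl | rfl
    · exact hg 0
    · exact hg 1

theorem T3.map_ev {L' : Type*} [LieRing L'] [LieAlgebra Fp L'] [NilLt p L] [NilLt p L']
    (f : L →ₗ⁅Fp⁆ L') (x y z : L) (h : T3 p) :
    f (T3.ev x y z h) = T3.ev (f x) (f y) (f z) h := by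
  induction h using T3.gen_induction with
  | hg i => fin_cases i <;> simp
  | _ => simp_all

variable (p) in
/-- The Campbell-Hausdorff series, as an element of `T3`. -/
def T3.H : T3 p := (TLie.exists_isCH (fun _ => le_rfl) (T3.X p 0) (T3.X p 1)).choose

theorem T3.isCH_H : IsCH Fp p (T3.X p 0) (T3.X p 1) (T3.H p) :=
  (TLie.exists_isCH (fun _ => le_rfl) (T3.X p 0) (T3.X p 1)).choose_spec

variable (p) in
/-- The Campbell-Hausdorff composition in a Lie algebra of nilpotency class `< p`. -/
def bch [NilLt p L] (x y : L) : L := T3.ev x y 0 (T3.H p)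

section
variable [NilLt p L]

theorem map_bch {L' : Type*} [LieRing L'] [LieAlgebra Fp L'] [NilLt p L']
    (f : L →ₗ⁅Fp⁆ L') (x y : L) : f (bch p x y) = bch p (f x) (f y) := by
  rw [bch, T3.map_ev, map_zero]; rfl

theorem isCH_bch {F : Type*} [Field F] [Algebra Fp F] [LieAlgebra F L]
    [IsScalarTower Fp F L] (x y : L) : IsCH F p x y (bch p x y) := by
  have := T3.isCH_H.map (F' := F) (T3.ev (p := p) x y (0 : L))
  rwa [T3.ev_X0, T3.ev_X1] at this

theorem logD_bch (δ : LieDerivation Fp L L) (x y : L) : logD Fp p δ (bch p x y) =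
    rAd Fp p y (logD Fp p δ x) + logD Fp p δ y :=
  (isCH_bch x y).logD δ hp.out.one_le

theorem rAd_bch (x y a : L) : rAd Fp p (bch p x y) a =
    rAd Fp p y (rAd Fp p x a) :=
  (isCH_bch x y).rAd hp.out.one_le a

theorem bch_assoc (x y z : L) : bch p (bch p x y) z = bch p x (bch p y z) := by
  have h1 := hp.out.one_le
  have key : bch p (bch p (T3.X p 0) (T3.X p 1)) (T3.X p 2) =
      bch p (T3.X p 0) (bch p (T3.X p 1) (T3.X p 2)) := by
    refine texp_inj (F := Fp) hp.out.two_le TLie.lenDer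
      (fun x => TLie.lenDer_pow (fun _ => le_rfl) x) ?_
    have e1 : IsCH Fp p _ _ _ := isCH_bch (T3.X p 0) (T3.X p 1)
    have e2 : IsCH Fp p _ _ _ := isCH_bch (T3.X p 1) (T3.X p 2)
    have e3 : IsCH Fp p _ _ _ := isCH_bch (bch p (T3.X p 0) (T3.X p 1)) (T3.X p 2)
    have e4 : IsCH Fp p _ _ _ := isCH_bch (T3.X p 0) (bch p (T3.X p 1) (T3.X p 2))
    unfold IsCH at e1 e2 e3 e4
    have := add_mem (sub_mem e4 e3) (sub_mem (augPow_mul_left h1 e2 (texp Fp p (T3.X p 0)))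
        (augPow_mul_right h1 e1 (texp Fp p (T3.X p 2))))
    convert this using 1
    noncomm_ring
  have := congrArg (T3.ev x y z) key
  simpa only [map_bch, T3.ev_X0, T3.ev_X1, T3.ev_X2] using this

/-- Commuting elements compose to their sum: this is clear in the abelian algebra `𝔽_p²`, where the
identity is a derivation, and `𝔽_p²` maps to the algebra. -/
theorem bch_of_lie_eq_zero {x y : L} (h : ⁅x, y⁆ = 0) : bch p x y = x + y := by
  let A := Fp × Fp
  have h0 : ∀ a b : A, ⁅a, b⁆ = 0 := fun a b => by
    rw [LieRing.of_associative_ring_bracket, mul_comm, sub_self]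
  have hA : NilLt p A := ⟨fun l hl => match l, hp.out.two_le.trans hl with
    | a :: b :: l, _ => by change l.foldl _ ⁅a, b⁆ = 0; rw [h0]; exact lnb_foldl_zero l⟩
  let δ : LieDerivation Fp A A := { LinearMap.id with leibniz' := by simp [h0] }
  have h' : ⁅y, x⁆ = 0 := by rw [← lie_skew, h, neg_zero]
  let f : A →ₗ⁅Fp⁆ L :=
    { LinearMap.coprod (LinearMap.toSpanSingleton Fp L x) (LinearMap.toSpanSingleton Fp L y) with
      map_lie' := by simp [h0, h, h'] }
  have hb : ∀ (u v : A) m, brIt u (m + 1) v = 0 := by simp [brIt_succ, h0]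
  have hr : ∀ u v : A, rAd Fp p u v = v := fun u v => by
    rw [rAd, sum_range_eq_pred hp.out.one_le]; simp [hb]
  have hl : ∀ u : A, logD Fp p δ u = u := fun u => by
    rw [logD_eq hp.out.two_le, logDtail]; simp [hb]; rfl
  have h1 := logD_bch δ (1, 0) (0, 1)
  rw [hl, hl, hl, hr] at h1
  have hf : ∀ a, f a = a.1 • x + a.2 • y := fun _ => rfl
  have h2 := congrArg f h1
  rw [map_bch, map_add] at h2
  simpa [hf] using h2

theorem bch_zero (x : L) : bch p x 0 = x := by rw [bch_of_lie_eq_zero (lie_zero x), add_zero]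
theorem zero_bch (x : L) : bch p 0 x = x := by rw [bch_of_lie_eq_zero (zero_lie x), zero_add]
theorem bch_neg_self (x : L) : bch p x (-x) = 0 := by
  rw [bch_of_lie_eq_zero (by simp), add_neg_cancel]
theorem neg_bch_self (x : L) : bch p (-x) x = 0 := by
  rw [bch_of_lie_eq_zero (by simp), neg_add_cancel]

theorem bch_bch_neg (x y : L) : bch p (bch p x (-y)) y = x := by
  rw [bch_assoc, neg_bch_self, bch_zero]
theorem neg_bch_bch (x y : L) : bch p (-x) (bch p x y) = y := by
  rw [← bch_assoc, neg_bch_self, zero_bch]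
theorem bch_neg_bch' (x y : L) : bch p x (bch p (-x) y) = y := by
  rw [← bch_assoc, bch_neg_self, zero_bch]

theorem bch_left_cancel {x y z : L} (h : bch p x y = bch p x z) : y = z := by
  rw [← neg_bch_bch (p := p) x y, h, neg_bch_bch]

theorem neg_bch (x y : L) : -bch p x y = bch p (-y) (-x) := by
  refine bch_left_cancel (p := p) (x := bch p x y) ?_
  rw [bch_neg_self, bch_assoc, bch_neg_bch', bch_neg_self]

/-- Membership and congruences for the composition, relative to a subalgebra `S` and an ideal
`W` of it. -/
theorem T3.ev_congr {S W : Submodule Fp L} (hS : ∀ x ∈ S, ∀ y ∈ S, ⁅x, y⁆ ∈ S)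
    (hW : ∀ x ∈ S, ∀ y ∈ W, ⁅x, y⁆ ∈ W) {x x' y y' z z' : L} (hx : x ∈ S) (hx' : x' ∈ S)
    (hy : y ∈ S) (hy' : y' ∈ S) (hz : z ∈ S) (hz' : z' ∈ S) (hxx : x - x' ∈ W) (hyy : y - y' ∈ W)
    (hzz : z - z' ∈ W) (h : T3 p) : T3.ev x y z h ∈ S ∧ T3.ev x' y' z' h ∈ S ∧
      T3.ev x y z h - T3.ev x' y' z' h ∈ W := by
  induction h using T3.gen_induction with
  | hg i => fin_cases i <;> simp [*]
  | h0 => simp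
  | hadd a b ha hb =>
    simp only [map_add]
    exact ⟨add_mem ha.1 hb.1, add_mem ha.2.1 hb.2.1, by
      convert add_mem ha.2.2 hb.2.2 using 1; abel⟩
  | hsmul c a ha =>
    simp only [map_smul, ← smul_sub]
    exact ⟨S.smul_mem _ ha.1, S.smul_mem _ ha.2.1, W.smul_mem _ ha.2.2⟩
  | hlie a b ha hb =>
    simp only [LieHom.map_lie]
    refine ⟨hS _ ha.1 _ hb.1, hS _ ha.2.1 _ hb.2.1, ?_⟩
    have e1 := hW _ ha.1 _ hb.2.2
    have e2 := neg_mem (hW _ hb.2.1 _ ha.2.2)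
    rw [lie_skew] at e2
    convert add_mem e1 e2 using 1
    simp only [lie_sub, sub_lie]; abel

theorem bch_mem {S : Submodule Fp L} (hS : ∀ x ∈ S, ∀ y ∈ S, ⁅x, y⁆ ∈ S) {x y : L}
    (hx : x ∈ S) (hy : y ∈ S) : bch p x y ∈ S :=
  (T3.ev_congr (W := ⊥) hS (by simp) hx hx hy hy (zero_mem _) (zero_mem _) (by simp) (by simp)
    (by simp) _).1

theorem bch_congr {S W : Submodule Fp L} (hS : ∀ x ∈ S, ∀ y ∈ S, ⁅x, y⁆ ∈ S)
    (hW : ∀ x ∈ S, ∀ y ∈ W, ⁅x, y⁆ ∈ W) {x x' y y' : L} (hx : x ∈ S) (hx' : x' ∈ S)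
    (hy : y ∈ S) (hy' : y' ∈ S) (hxx : x - x' ∈ W) (hyy : y - y' ∈ W) :
    bch p x y - bch p x' y' ∈ W :=
  (T3.ev_congr hS hW hx hx' hy hy' (zero_mem _) (zero_mem _) hxx hyy (by simp) _).2.2

end

end Bch

end

/-! ### Conjugation by a unipotent automorphism and its differential form -/

section DExp
variable {M : Type*} [AddCommGroup M] [Module (ZMod p) M]

/-- The truncated exponential `∑_{j < p} (γ Δ)^j / j!` of an operator. -/
def dExp (Δ : Module.End Fp M) (γ : Fp) : Module.End Fp M :=
  ∑ j ∈ range p, (γ ^ j * (j.factorial : Fp)⁻¹) • Δ ^ j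

theorem dExp_apply (Δ : Module.End Fp M) (γ : Fp) (x : M) : dExp Δ γ x =
    ∑ j ∈ range p, (γ ^ j * (j.factorial : Fp)⁻¹) • (Δ ^ j) x := by
  simp [dExp, LinearMap.sum_apply]

theorem dExp_eq_add (Δ : Module.End Fp M) (γ : Fp) (x : M) : dExp Δ γ x = x +
    ∑ j ∈ range (p - 1), (γ ^ (j + 1) * ((j + 1).factorial : Fp)⁻¹) •
      (Δ ^ (j + 1)) x := by
  rw [dExp_apply, sum_range_eq_pred hp.out.one_le, add_comm]; simp

theorem dExp_dExp {Δ : Module.End Fp M} (hΔ : Δ ^ p = 0) (γ γ' : Fp) (x : M) :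
    dExp Δ γ (dExp Δ γ' x) = dExp Δ (γ + γ') x := by
  have key := sum_square_sub_antidiagonal (⊥ : AddSubgroup M) p
    (fun i j => ((γ ^ i * (i.factorial : Fp)⁻¹) *
      (γ' ^ j * (j.factorial : Fp)⁻¹)) • (Δ ^ (i + j)) x) (by
      intro i j hij
      obtain ⟨m, hm⟩ := exists_eq_add_of_le hij
      rw [hm, pow_add, hΔ, zero_mul, LinearMap.zero_apply, smul_zero]; exact zero_mem _)
  rw [AddSubgroup.mem_bot, sub_eq_zero] at key
  have e1 : dExp Δ γ (dExp Δ γ' x) = ∑ i ∈ range p, ∑ j ∈ range p,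
      ((γ ^ i * (i.factorial : Fp)⁻¹) *
      (γ' ^ j * (j.factorial : Fp)⁻¹)) • (Δ ^ (i + j)) x := by
    rw [dExp_apply]
    refine sum_congr rfl fun i _ => ?_
    rw [dExp_apply, map_sum, smul_sum]
    refine sum_congr rfl fun j _ => ?_
    rw [map_smul, smul_smul, pow_add, Module.End.mul_apply]
  rw [e1, key, dExp_apply]
  refine sum_congr rfl fun m hm => ?_
  have e2 : ∀ y ∈ antidiagonal m, ((γ ^ y.1 * (y.1.factorial : Fp)⁻¹) *
      (γ' ^ y.2 * (y.2.factorial : Fp)⁻¹)) • (Δ ^ (y.1 + y.2)) x =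
      (m.choose y.1 • (γ ^ y.1 * γ' ^ y.2) * (m.factorial : Fp)⁻¹) • (Δ ^ m) x := by
    intro y hy
    have hy' := mem_antidiagonal.1 hy
    rw [hy']
    congr 1
    have := inv_factorial_mul_choose (F := Fp) hp.out (mem_range.1 hm) hy'
    rw [nsmul_eq_mul]
    linear_combination -(γ ^ y.1 * γ' ^ y.2) * this
  rw [sum_congr rfl e2, ← Finset.sum_smul, ← sum_mul, ← (Commute.all γ γ').add_pow']

theorem dExp_zero (Δ : Module.End Fp M) (x : M) : dExp Δ 0 x = x := by rw [dExp_eq_add]; simp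

end DExp

section Abstract

/-- The exponential of a derivation that raises a filtration of length `< p` is a homomorphism. -/
theorem dExp_lie (Δ : LieDerivation Fp L L)
    (hΔ : ∀ i j, p ≤ i + j → ∀ x y : L, ⁅(Δ.toLinearMap ^ i) x, (Δ.toLinearMap ^ j) y⁆ = 0)
    (γ : Fp) (x y : L) :
    dExp Δ.toLinearMap γ ⁅x, y⁆ = ⁅dExp Δ.toLinearMap γ x, dExp Δ.toLinearMap γ y⁆ := by
  have key := sum_square_sub_antidiagonal (⊥ : AddSubgroup L) p
    (fun i j => ((γ ^ i * (i.factorial : Fp)⁻¹) *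
      (γ ^ j * (j.factorial : Fp)⁻¹)) •
        ⁅(Δ.toLinearMap ^ i) x, (Δ.toLinearMap ^ j) y⁆) (by
      intro i j hij
      rw [hΔ i j hij, smul_zero]; exact zero_mem _)
  rw [AddSubgroup.mem_bot, sub_eq_zero] at key
  have e1 : ⁅dExp Δ.toLinearMap γ x, dExp Δ.toLinearMap γ y⁆ = ∑ i ∈ range p,
      ∑ j ∈ range p, ((γ ^ i * (i.factorial : Fp)⁻¹) *
      (γ ^ j * (j.factorial : Fp)⁻¹)) •
        ⁅(Δ.toLinearMap ^ i) x, (Δ.toLinearMap ^ j) y⁆ := by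
    rw [dExp_apply, dExp_apply, sum_lie]
    refine sum_congr rfl fun i _ => ?_
    rw [lie_sum]
    refine sum_congr rfl fun j _ => ?_
    rw [smul_lie, lie_smul, smul_smul]
  rw [e1, key, dExp_apply]
  refine sum_congr rfl fun m hm => ?_
  rw [Module.End.pow_apply]
  change _ • (⇑Δ)^[m] ⁅x, y⁆ = _
  rw [LieDerivation.iterate_apply_lie, smul_sum]
  refine sum_congr rfl fun z hz => ?_
  have hz' := mem_antidiagonal.1 hz
  rw [Module.End.pow_apply, Module.End.pow_apply, ← Nat.cast_smul_eq_nsmul Fp, smul_smul]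
  congr 1
  have := inv_factorial_mul_choose (F := Fp) hp.out (mem_range.1 hm) hz'
  rw [← hz', pow_add, hz']
  linear_combination (γ ^ z.1 * γ ^ z.2) * this

theorem logD_add (δ δ' : L → L) (x : L) : logD Fp p (δ + δ') x =
    logD Fp p δ x + logD Fp p δ' x := by
  simp [logD, brIt_add, sum_add_distrib]

theorem logD_smul (c : Fp) (δ : L → L) (x : L) : logD Fp p (c • δ) x =
    c • logD Fp p δ x := by
  simp [logD, brIt_smul, smul_sum, smul_comm c]

theorem logD_of_apply_eq_zero {δ : L → L} {x : L} (h : δ x = 0) : logD Fp p δ x = 0 := by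
  simp [logD, h, brIt_zero_right]

theorem rAd_mem (G : Submodule Fp L) {x y : L} (hG : ∀ z ∈ G, ⁅z, x⁆ ∈ G) (hy : y ∈ G) :
    rAd Fp p x y ∈ G :=
  sum_mem fun _ _ => smul_mem _ _ (brIt_mem G hG hy _)

theorem logD_mem (G : Submodule Fp L) {δ : L → L} {x : L} (hG : ∀ z ∈ G, ⁅z, x⁆ ∈ G)
    (hy : δ x ∈ G) : logD Fp p δ x ∈ G :=
  sum_mem fun _ _ => smul_mem _ _ (brIt_mem G hG hy _)

/-- A derivation acting on both factors of `L × L`. -/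
def prodDer (δ : LieDerivation Fp L L) : LieDerivation Fp (L × L) (L × L) where
  toLinearMap := LinearMap.prodMap δ.toLinearMap δ.toLinearMap
  leibniz' x y := Prod.ext (δ.leibniz' x.1 y.1) (δ.leibniz' x.2 y.2)

theorem prod_foldl (x : L × L) (l : List (L × L)) : l.foldl (fun a b => ⁅a, b⁆) x =
    ((l.map Prod.fst).foldl (fun a b => ⁅a, b⁆) x.1,
      (l.map Prod.snd).foldl (fun a b => ⁅a, b⁆) x.2) := by
  induction l generalizing x <;> simp_all [List.foldl_cons, map_cons]

instance [NilLt p L] : NilLt p (L × L) := by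
  constructor
  intro l hl
  cases l with
  | nil => rfl
  | cons a l =>
    have h1 := NilLt.lnb_zero (p := p) ((a :: l).map Prod.fst) (by simpa using hl)
    have h2 := NilLt.lnb_zero (p := p) ((a :: l).map Prod.snd) (by simpa using hl)
    exact (prod_foldl a l).trans (Prod.ext h1 h2)

/-- The data for comparing a unipotent automorphism `exp(γ Δ)` of `L` with inner automorphisms:
a filtration `F`, a derivation `θ` (the degree) of which `Δ` raises the eigenvalues by one, and
the graph `Γ` of a partially defined operator. For special elements, `Γ` consists of the pairs
`(c, σ c)`, and `Γ_Δ'` holds because `p^m α` is divisible by `p` at the exponents of `σ c`. -/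
structure ConjData (p : ℕ) [Fact p.Prime] (L : Type*) [LieRing L] [LieAlgebra (ZMod p) L] where
  θ : LieDerivation (ZMod p) L L
  Δ : LieDerivation (ZMod p) L L
  F : ℕ → Submodule (ZMod p) L
  Γ : Submodule (ZMod p) (L × L)
  F_zero : ∀ x, x ∈ F 0
  F_anti : ∀ {i j}, i ≤ j → F j ≤ F i
  F_lie : ∀ {i j x y}, x ∈ F i → y ∈ F j → ⁅x, y⁆ ∈ F (i + j)
  F_top : ∀ x ∈ F (p - 1), x = 0
  Δ_mem : ∀ {j x}, x ∈ F j → Δ x ∈ F (j + 1)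
  θΔ : ∀ x, θ (Δ x) = Δ (θ x) + Δ x
  θ_pow : ∀ x ∈ F 1, (⇑θ)^[p - 1] x = x
  Γ_lie : ∀ z ∈ Γ, ∀ z' ∈ Γ, ⁅z, z'⁆ ∈ Γ
  Γ_θ : ∀ z ∈ Γ, (θ z.1, θ z.2) ∈ Γ
  Γ_F : ∀ z ∈ Γ, z.1 ∈ F 1 ∧ z.2 ∈ F 1
  Γ_Δ : ∀ z ∈ Γ, (Δ z.1, 0) ∈ Γ
  Γ_Δ' : ∀ z ∈ Γ, Δ z.2 = 0

namespace ConjData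
variable (C : ConjData p L)

theorem pow_mem {i j : ℕ} {x : L} (hx : x ∈ C.F i) : (C.Δ.toLinearMap ^ j) x ∈ C.F (i + j) := by
  induction j with
  | zero => exact hx
  | succ j ih => rw [pow_succ', Module.End.mul_apply]; exact C.Δ_mem ih

theorem pow_zero : C.Δ.toLinearMap ^ p = 0 := by
  ext x
  refine C.F_top _ (C.F_anti ?_ (C.pow_mem (i := 0) (j := p) (C.F_zero x)))
  omega

/-- The automorphism `exp(γ Δ)`. -/
def Om (γ : Fp) : L →ₗ⁅Fp⁆ L where
  toLinearMap := dExp C.Δ.toLinearMap γ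
  map_lie' {x y} := dExp_lie C.Δ (fun i j hij x y =>
    C.F_top _ (C.F_anti (by omega) (C.F_lie (C.pow_mem (i := 0) (j := i) (C.F_zero x))
      (C.pow_mem (i := 0) (j := j) (C.F_zero y))))) γ x y

theorem Om_neg_Om (γ : Fp) (x : L) : C.Om (-γ) (C.Om γ x) = x := by
  change dExp _ _ (dExp _ _ x) = x
  rw [dExp_dExp C.pow_zero, neg_add_cancel, dExp_zero]

theorem Om_sub_mem (γ : Fp) (x : L) : C.Om γ x - x ∈ C.F 1 := by
  change dExp _ _ x - x ∈ _
  rw [dExp_eq_add, add_sub_cancel_left]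
  refine sum_mem fun j _ => smul_mem _ _ ?_
  exact C.F_anti (by omega) (C.pow_mem (i := 0) (C.F_zero x))

theorem θ_pow_apply (j : ℕ) (x : L) : C.θ ((C.Δ.toLinearMap ^ j) x) =
    (C.Δ.toLinearMap ^ j) (C.θ x) + (j : Fp) • (C.Δ.toLinearMap ^ j) x := by
  induction j with
  | zero => simp
  | succ j ih =>
    rw [pow_succ', Module.End.mul_apply, Module.End.mul_apply]
    have := C.θΔ ((C.Δ.toLinearMap ^ j) x)
    rw [ih, map_add, map_smul] at this
    refine this.trans ?_
    rw [Nat.cast_succ, add_smul, one_smul, ← add_assoc]; rfl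

theorem θ_Om (γ : Fp) (x : L) : C.θ (C.Om γ x) = C.Om γ ((C.θ + γ • C.Δ) x) := by
  have h1 : C.θ (C.Om γ x) = C.Om γ (C.θ x) + ∑ j ∈ range p,
      (γ ^ j * (j.factorial : Fp)⁻¹) • (j : Fp) • (C.Δ.toLinearMap ^ j) x := by
    change C.θ (dExp _ _ x) = dExp _ _ (C.θ x) + _
    rw [dExp_apply, dExp_apply, map_sum, ← sum_add_distrib]
    refine sum_congr rfl fun j _ => ?_
    rw [map_smul, C.θ_pow_apply, smul_add]
  have h2 : C.Om γ (γ • C.Δ x) = ∑ j ∈ range p,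
      (γ ^ j * (j.factorial : Fp)⁻¹) • (j : Fp) • (C.Δ.toLinearMap ^ j) x := by
    have hsum' : ∀ f : ℕ → L, ∑ i ∈ range p, f i = ∑ i ∈ range (p - 1), f i + f (p - 1) := by
      intro f; rw [← sum_range_succ, Nat.sub_add_cancel hp.out.one_le]
    change dExp _ _ (γ • C.Δ x) = _
    rw [dExp_apply, hsum', sum_range_eq_pred hp.out.one_le]
    have h0 : (C.Δ.toLinearMap ^ (p - 1)) (γ • C.Δ x) = 0 :=
      C.F_top _ (C.F_anti (by omega) (C.pow_mem (i := 0) (C.F_zero _)))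
    rw [h0]
    simp only [smul_zero, add_zero, cast_zero, zero_smul]
    refine sum_congr rfl fun j hj => ?_
    have hne : ((j + 1 : ℕ) : Fp) ≠ 0 := by
      rw [Ne, ZMod.natCast_eq_zero_iff]
      intro hd
      have := Nat.le_of_dvd (Nat.succ_pos _) hd
      have := mem_range.1 hj
      omega
    rw [map_smul, smul_smul, smul_smul, pow_succ γ, pow_succ C.Δ.toLinearMap, Module.End.mul_apply]
    change _ = _ • (C.Δ.toLinearMap ^ j) (C.Δ x)
    congr 1
    rw [Nat.factorial_succ, Nat.cast_mul, mul_inv]; field_simp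
  rw [h1, LieDerivation.add_apply, map_add, ← h2]; rfl

theorem Γ_Om {z : L × L} (hz : z ∈ C.Γ) (γ : Fp) :
    (C.Om γ z.1, z.2) ∈ C.Γ ∧ C.Om γ z.2 = z.2 := by
  constructor
  · have h : (C.Om γ z.1, z.2) = z + ∑ j ∈ range (p - 1),
        (γ ^ (j + 1) * ((j + 1).factorial : Fp)⁻¹) •
          ((C.Δ.toLinearMap ^ (j + 1)) z.1, (0 : L)) := by
      ext
      · change dExp _ _ _ = _
        rw [dExp_eq_add]; simp [Prod.fst_sum]
      · simp [Prod.snd_sum]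
    rw [h]
    refine add_mem hz (sum_mem fun j hj => smul_mem _ _ ?_)
    clear hj
    induction j with
    | zero => simpa using C.Γ_Δ z hz
    | succ j ih => rw [pow_succ', Module.End.mul_apply]; exact C.Γ_Δ _ ih
  · change dExp _ _ _ = _
    rw [dExp_eq_add, sum_eq_zero, add_zero]
    intro j _
    rw [pow_succ C.Δ.toLinearMap, Module.End.mul_apply]
    have : C.Δ.toLinearMap z.2 = 0 := C.Γ_Δ' z hz
    rw [this, map_zero, smul_zero]

variable [NilLt p L]

theorem logD_neg (δ : LieDerivation Fp L L) (c : L) :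
    logD Fp p δ (-c) = -rAd Fp p (-c) (logD Fp p δ c) := by
  have h := logD_bch δ c (-c)
  rw [bch_neg_self, logD_of_apply_eq_zero (map_zero _)] at h
  exact (neg_eq_of_add_eq_zero_right h.symm).symm

theorem rAd_zero_left (a : L) : rAd Fp p 0 a = a := by
  rw [rAd, sum_range_eq_pred hp.out.one_le]; simp [brIt_succ]

theorem rAd_rAd_neg (c a : L) : rAd Fp p c (rAd Fp p (-c) a) = a := by
  rw [← rAd_bch, neg_bch_self, rAd_zero_left]

theorem logD_Om (γ : Fp) {e : L} (he : C.θ e = 0) : logD Fp p C.θ (C.Om γ e) =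
    γ • C.Om γ (logD Fp p C.Δ e) := by
  rw [← map_logD (C.Om γ) (⇑(C.θ + γ • C.Δ)) (⇑C.θ) e (C.θ_Om γ e).symm]
  rw [LieDerivation.coe_add, logD_add, logD_of_apply_eq_zero he, zero_add,
    LieDerivation.coe_smul, logD_smul, map_smul]

theorem logD_conj (δ : LieDerivation Fp L L) {e : L} (he : δ e = 0) (c c' : L) :
    logD Fp p δ (bch p (bch p c' e) (-c)) = rAd Fp p (bch p (bch p c' e) (-c))
        (rAd Fp p (-c') (logD Fp p δ c')) -
      rAd Fp p (-c) (logD Fp p δ c) := by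
  rw [logD_bch, logD_bch, logD_of_apply_eq_zero he, add_zero, logD_neg, rAd_bch, rAd_bch,
    rAd_rAd_neg, sub_eq_add_neg]

theorem Γ_rAd {z : L × L} (hz : z ∈ C.Γ) : (rAd Fp p (-z.1) (logD Fp p C.θ z.1),
      rAd Fp p (-z.2) (logD Fp p C.θ z.2)) ∈ C.Γ := by
  have h1 : logD Fp p (prodDer C.θ) z ∈ C.Γ :=
    logD_mem C.Γ (fun y hy => C.Γ_lie y hy z hz) (C.Γ_θ z hz)
  have h2 : rAd Fp p (-z) (logD Fp p (prodDer C.θ) z) ∈ C.Γ :=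
    rAd_mem C.Γ (fun y hy => C.Γ_lie y hy (-z) (neg_mem hz)) h1
  have e1 := map_rAd (p := p) (F := Fp) (LieHom.fst Fp L L) (-z)
    (logD Fp p (prodDer C.θ) z)
  have e2 := map_rAd (p := p) (F := Fp) (LieHom.snd Fp L L) (-z)
    (logD Fp p (prodDer C.θ) z)
  rw [map_logD (LieHom.fst Fp L L) (⇑(prodDer C.θ)) (⇑C.θ) z rfl] at e1
  rw [map_logD (LieHom.snd Fp L L) (⇑(prodDer C.θ)) (⇑C.θ) z rfl] at e2
  have : rAd Fp p (-z) (logD Fp p (prodDer C.θ) z) =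
      (rAd Fp p (-z.1) (logD Fp p C.θ z.1),
        rAd Fp p (-z.2) (logD Fp p C.θ z.2)) := Prod.ext e1 e2
  rwa [this] at h2

/-- A conjugation of `e` to `exp(Δ) e` gives a solution of the linear equation
`logD Δ e = Ad(e)⁻¹ c₁' - c₁`: apply `logD θ`, where `logD θ (exp(Δ) e) = exp(Δ) (logD Δ e)`. -/
theorem exists_linear {e : L} (he : C.θ e = 0)
    (h : ∃ z ∈ C.Γ, C.Om 1 e = bch p (bch p z.2 e) (-z.1)) :
    ∃ z ∈ C.Γ, logD Fp p C.Δ e = rAd Fp p e z.2 - z.1 := by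
  obtain ⟨⟨c, c'⟩, hz, h⟩ := h
  simp only at h
  have h1 := C.logD_Om 1 he
  have h2 := logD_conj C.θ he c c'
  rw [← h, h1, one_smul] at h2
  have hΓ := C.Γ_rAd hz
  simp only at hΓ
  set g := rAd Fp p (-c) (logD Fp p C.θ c)
  set g' := rAd Fp p (-c') (logD Fp p C.θ c')
  have h3 := C.Γ_Om hΓ (-1)
  simp only at h3
  refine ⟨(C.Om (-1) g, g'), h3.1, ?_⟩
  have h4 := congrArg (C.Om (-1)) h2
  rw [C.Om_neg_Om, map_sub, map_rAd, C.Om_neg_Om, h3.2] at h4; exact h4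

/-- A solution of the linear equation can be integrated to a conjugation, by an element with a
suitable `logD θ`. Then both sides have the same `logD θ` and are equal by `logD_unique`. -/
theorem exists_conj {e : L} (he : C.θ e = 0) (γ : Fp)
    (h : ∃ z ∈ C.Γ, logD Fp p C.Δ e = rAd Fp p e z.2 - z.1) :
    ∃ z ∈ C.Γ, C.Om γ e = bch p (bch p z.2 e) (-z.1) := by
  have hp2 := hp.out.two_le
  obtain ⟨⟨c₁, c₁'⟩, hz, h⟩ := h
  simp only at h
  have hΩ := C.Γ_Om (C.Γ.smul_mem γ hz) γ
  simp only [Prod.smul_mk] at hΩ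
  obtain ⟨d, hd, hlog⟩ := exists_logD_eq (p := p) hp2 (prodDer C.θ) C.Γ C.Γ_lie C.Γ_θ (by
    intro x hx
    have h6 : ∀ m, (⇑(prodDer C.θ))^[m] x = ((⇑C.θ)^[m] x.1, (⇑C.θ)^[m] x.2) := by
      intro m
      induction m with
      | zero => rfl
      | succ m ih => rw [iterate_succ_apply', ih, iterate_succ_apply', iterate_succ_apply']; rfl
    rw [h6, C.θ_pow _ (C.Γ_F x hx).1, C.θ_pow _ (C.Γ_F x hx).2]) (neg_mem hΩ.1)
  have hl1 : logD Fp p C.θ d.1 = -C.Om γ (γ • c₁) := by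
    refine (map_logD (LieHom.fst Fp L L) (⇑(prodDer C.θ)) (⇑C.θ) d rfl).symm.trans ?_
    rw [hlog]; rfl
  have hl2 : logD Fp p C.θ d.2 = -(γ • c₁') := by
    refine (map_logD (LieHom.snd Fp L L) (⇑(prodDer C.θ)) (⇑C.θ) d rfl).symm.trans ?_
    rw [hlog]; rfl
  refine ⟨-d, neg_mem hd, ?_⟩
  have hF1lie : ∀ x ∈ (⊤ : Submodule Fp L), ∀ y ∈ C.F 1, ⁅x, y⁆ ∈ C.F 1 :=
    fun x _ y hy => C.F_anti (by omega) (C.F_lie (C.F_zero x) hy)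
  have hdF := C.Γ_F d hd
  have e1 : rAd Fp p d.1 (logD Fp p C.θ (-d.1)) = C.Om γ (γ • c₁) := by
    rw [logD_neg, rAd_neg, rAd_rAd_neg, hl1, neg_neg]
  have e2 : rAd Fp p d.2 (logD Fp p C.θ (-d.2)) = γ • c₁' := by
    rw [logD_neg, rAd_neg, rAd_rAd_neg, hl2, neg_neg]
  have hz1 := C.logD_Om γ he
  have hz2 := logD_conj C.θ he (-d.1) (-d.2)
  rw [neg_neg, neg_neg, e1, e2] at hz2
  rw [h, map_sub, smul_sub, ← map_smul, ← map_smul, ← rAd_smul, map_rAd, hΩ.2] at hz1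
  change C.Om γ e = bch p (bch p (-d.2) e) (- -d.1)
  rw [neg_neg]
  refine logD_unique hp2 C.θ (fun n hn => ?_) (C.θ_pow _ ?_)
  · rw [hz1, hz2, sub_sub_sub_cancel_right]; exact rAd_sub_mem hn _
  · have g1 : bch p (bch p (-d.2) e) d.1 - bch p (bch p 0 e) 0 ∈ C.F 1 := by
      refine bch_congr (S := ⊤) (fun _ _ _ _ => trivial) hF1lie trivial trivial trivial trivial
        (bch_congr (S := ⊤) (fun _ _ _ _ => trivial) hF1lie trivial trivial trivial trivial ?_ ?_) ?_
      · rw [sub_zero]; exact neg_mem hdF.2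
      · rw [sub_self]; exact zero_mem _
      · rw [sub_zero]; exact hdF.1
    rw [bch_zero, zero_bch] at g1
    have := sub_mem (C.Om_sub_mem γ e) g1
    rwa [sub_sub_sub_cancel_right] at this

end ConjData

end Abstract

/-! ### Extension of scalars -/

section Tensor
variable {A : Type*} [CommRing A] [Algebra (ZMod p) A]

instance [NilLt p L] : NilLt p (A ⊗[Fp] L) := by
  let G : ℕ → Submodule Fp (A ⊗[Fp] L) := fun n =>
    Submodule.span Fp {z | ∃ a : A, ∃ l ∈ lcS Fp L n, z = a ⊗ₜ l}
  refine nilLt_of_chain hp.out.pos (fun n => (G n).toAddSubgroup) ?_ ?_ ?_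
  · intro x
    change x ∈ G 1
    induction x with
    | zero => exact zero_mem _
    | add a b ha hb => exact add_mem ha hb
    | tmul a l => exact subset_span ⟨a, l, mem_lcS_one l, rfl⟩
  · intro n x y hx
    change x ∈ G n at hx
    change ⁅x, y⁆ ∈ G (n + 1)
    induction hx using span_induction with
    | mem x h =>
      obtain ⟨a, l, hl, rfl⟩ := h
      induction y with
      | zero => rw [lie_zero]; exact zero_mem _
      | add a b ha hb => rw [lie_add]; exact add_mem ha hb
      | tmul b m => rw [lie_tmul]; exact subset_span ⟨_, _, lie_mem_lcS hl m, rfl⟩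
    | _ => simp_all [add_mem, smul_mem]
  · intro n hn x hx
    change x ∈ G n at hx
    induction hx using span_induction with
    | mem x h =>
      obtain ⟨a, l, hl, rfl⟩ := h
      rw [lcS_eq_zero p hn hl, tmul_zero]
    | _ => simp_all

/-- Extension of scalars of a derivation. -/
def baseDer (A : Type*) [CommRing A] [Algebra Fp A] (δ : LieDerivation Fp L L) :
    LieDerivation A (A ⊗[Fp] L) (A ⊗[Fp] L) where
  toLinearMap := LinearMap.baseChange A δ.toLinearMap
  leibniz' X Y := by
    induction X with
    | zero => simp
    | add a b ha hb => simp only [add_lie, lie_add, map_add, ha, hb]; abel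
    | tmul a x =>
      induction Y with
      | zero => simp
      | add a b ha hb => simp only [add_lie, lie_add, map_add, ha, hb]; abel
      | tmul b y =>
        simp only [lie_tmul, LinearMap.baseChange_tmul]
        have := δ.leibniz' x y
        rw [this, tmul_sub, mul_comm b a]

theorem baseDer_iterate (δ : LieDerivation Fp L L) {n : ℕ} (hδ : ∀ x, (⇑δ)^[n] x = x)
    (X : A ⊗[Fp] L) : (⇑(baseDer A δ))^[n] X = X := by
  have h : ∀ n X, (⇑(baseDer A δ))^[n] X = ((baseDer A δ).toLinearMap ^ n) X := by
    intro n X; rw [Module.End.pow_apply]; rfl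
  rw [h]
  induction X with
  | zero => simp
  | add a b ha hb => rw [map_add, ha, hb]
  | tmul a x =>
    rw [← h]
    have : ∀ n, (⇑(baseDer A δ))^[n] (a ⊗ₜ x) = a ⊗ₜ[Fp] (⇑δ)^[n] x := by
      intro n
      induction n with
      | zero => rfl
      | succ n ih => rw [iterate_succ_apply', ih, iterate_succ_apply']; rfl
    rw [this, hδ]

/-- In an extension of scalars of a truncated free Lie algebra the relation `z = x ∘ y` determines
`z`. -/
theorem isCH_iff {F : Type*} [Field F] [Algebra Fp F] {S : Set ℤ} {N : ℕ} {w : ℤ → ℕ}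
    (hw : ∀ g : Gen S N, 1 ≤ w g.index) [NilLt p (TLie p S N w)]
    (x y z : F ⊗[Fp] TLie p S N w) : IsCH F p x y z ↔ z = bch p x y := by
  constructor
  · intro h
    refine texp_inj (F := F) hp.out.two_le (baseDer F TLie.lenDer)
      (fun X => baseDer_iterate _ (fun x => TLie.lenDer_pow hw x) X) ?_
    have h2 : IsCH F p x y (bch p x y) := isCH_bch x y
    have := sub_mem h2 h
    convert this using 1
    abel
  · rintro rfl; exact isCH_bch x y

end Tensor

section Laurent

theorem mon_mul (i j : ℤ) (c d : k) : mon i c * mon j d = mon (i + j) (c * d) :=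
  HahnSeries.single_mul_single

theorem mon_pow (i : ℤ) (c : k) (n : ℕ) : mon i c ^ n = mon (n * i) (c ^ n) := by
  have := HahnSeries.single_pow (Γ := ℤ) (R := k) i n c
  rw [nsmul_eq_mul] at this; exact this

theorem substLin_mon (q : ℕ) (hq : 0 < q) (i : ℤ) (c : k) :
    substLin p q hq (mon i c) = mon (q * i) c :=
  HahnSeries.embDomain_single (f := mulEmb q hq)

theorem diagK_mon (f : ℤ → ℕ) (i : ℤ) (c : k) : diagK p f (mon i c) = mon i ((f (-i) : k) * c) := by
  refine HahnSeries.ext (Γ := ℤ) (R := k) (funext fun j => ?_)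
  change (f (-j) : k) * (HahnSeries.single i c).coeff j = (HahnSeries.single i _).coeff j
  by_cases h : j = i
  · subst h; simp
  · simp [HahnSeries.coeff_single_of_ne h]

variable (p k) in
/-- The coefficient of `t^{-i}`. -/
def coefLin (i : ℤ) : Laur k →ₗ[ZMod p] k where
  toFun g := HahnSeries.coeff (Γ := ℤ) (R := k) g (-i)
  map_add' _ _ := rfl
  map_smul' c g := by rw [coeff_smul, RingHom.id_apply, Algebra.smul_def]

theorem coefLin_mon (i j : ℤ) (c : k) : coefLin p k i (mon (-j) c) = if i = j then c else 0 := by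
  change (HahnSeries.single (-j) c).coeff (-i) = _
  split_ifs with h
  · subst h; simp
  · exact HahnSeries.coeff_single_of_ne (by omega)

variable (p) in
/-- The monomial `c t^{-i} ⊗ l`. -/
def mt (i : ℤ) (c : k) (l : L) : LK p k L := mon (-i) c ⊗ₜ l

theorem tneg_tmul (i : ℤ) (c : k) (l : L) : tneg p i (c ⊗ₜ l) = mt p i c l := rfl

theorem mt_lie (i j : ℤ) (c d : k) (l m : L) :
    ⁅mt p i c l, mt p j d m⁆ = mt p (i + j) (c * d) ⁅l, m⁆ := by
  rw [mt, mt, lie_tmul, mon_mul, mt, neg_add]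

variable (p k) in
/-- The coefficient of `t^{-i}`, an element of `L_k`. -/
def co (i : ℤ) : LK p k L →ₗ[ZMod p] k ⊗[ZMod p] L := rTensor L (coefLin p k i)

theorem co_mt (i j : ℤ) (c : k) (l : L) : co p k i (mt p j c l) = if i = j then c ⊗ₜ l else 0 := by
  change coefLin p k i (mon (-j) c) ⊗ₜ[Fp] l = _
  rw [coefLin_mon]
  split_ifs <;> simp

theorem co_tneg (i j : ℤ) (x : k ⊗[Fp] L) : co p k i (tneg p j x) = if i = j then x else 0 := by
  induction x with
  | zero => simp
  | add a b ha hb => rw [map_add, map_add, ha, hb]; split_ifs <;> simp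
  | tmul c l => exact co_mt i j c l

/-- The `p`-th power map of `k`, on `L_k`. -/
def frobT : k ⊗[Fp] L →ₗ[Fp] k ⊗[Fp] L :=
  rTensor L (frobeniusAlgHom Fp k).toLinearMap

theorem frobT_tmul (c : k) (l : L) : frobT (c ⊗ₜ[Fp] l) = (c ^ p) ⊗ₜ l := by
  change (frobeniusAlgHom Fp k c) ⊗ₜ l = _; simp [ZMod.card]

theorem sigmaK_mt (i : ℤ) (c : k) (l : L) : sigmaK p (mt p i c l) = mt p (p * i) (c ^ p) l := by
  change (frobeniusAlgHom Fp (Laur k) (mon (-i) c)) ⊗ₜ l = _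
  rw [FiniteField.frobeniusAlgHom_apply, ZMod.card, mon_pow, mt, mul_neg]

theorem substK_mt (q : ℕ) (hq : 0 < q) (i : ℤ) (c : k) (l : L) :
    substK p q hq (mt p i c l) = mt p (q * i) c l := by
  change substLin p q hq (mon (-i) c) ⊗ₜ l = _
  rw [substLin_mon, mt, mul_neg]

theorem sigmaK_lie (x y : LK p k L) : sigmaK p ⁅x, y⁆ = ⁅sigmaK p x, sigmaK p y⁆ :=
  (LieAlgebra.ExtendScalars.map (frobeniusAlgHom Fp (Laur k))
    (LieHom.id : L →ₗ⁅Fp⁆ L)).map_lie x y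

variable (p k L) in
/-- `σ` as a homomorphism of Lie algebras. -/
def sigmaL : LK p k L →ₗ⁅ZMod p⁆ LK p k L where
  toLinearMap := sigmaK p
  map_lie' {x y} := sigmaK_lie x y

section Maps
variable {L' : Type*} [LieRing L'] [LieAlgebra (ZMod p) L']

variable (k) in
/-- The extension of a homomorphism to `L_𝒦`. -/
def lT (f : L →ₗ⁅Fp⁆ L') : LK p k L →ₗ⁅Fp⁆ LK p k L' :=
  LieAlgebra.ExtendScalars.map (AlgHom.id Fp (Laur k)) f

theorem lT_mt (f : L →ₗ⁅Fp⁆ L') (i : ℤ) (c : k) (l : L) :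
    lT k f (mt p i c l) = mt p i c (f l) := rfl

theorem lT_eq (f : L →ₗ⁅Fp⁆ L') (x : LK p k L) :
    lT k f x = lTensor (Laur k) (f : L →ₗ[Fp] L') x := by
  induction x using TensorProduct.induction_on with
  | tmul a l => rfl
  | _ => simp_all

variable (k) in
/-- The extension of a homomorphism to `L_k`. -/
def kTm (f : L →ₗ⁅Fp⁆ L') : k ⊗[Fp] L →ₗ⁅Fp⁆ k ⊗[Fp] L' :=
  LieAlgebra.ExtendScalars.map (AlgHom.id Fp k) f

theorem kTm_tmul (f : L →ₗ⁅Fp⁆ L') (c : k) (l : L) : kTm k f (c ⊗ₜ l) = c ⊗ₜ[Fp] f l := rfl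

theorem kTm_eq (f : L →ₗ⁅Fp⁆ L') (x : k ⊗[Fp] L) :
    kTm k f x = lTensor k (f : L →ₗ[Fp] L') x := by
  induction x using TensorProduct.induction_on with
  | tmul a l => rfl
  | _ => simp_all

theorem lT_tneg (f : L →ₗ⁅Fp⁆ L') (i : ℤ) (x : k ⊗[Fp] L) :
    lT k f (tneg p i x) = tneg p i (kTm k f x) := by
  induction x using TensorProduct.induction_on with
  | tmul c l => rfl
  | _ => simp_all

theorem co_lT (f : L →ₗ⁅Fp⁆ L') (i : ℤ) (x : LK p k L) :
    co p k i (lT k f x) = kTm k f (co p k i x) := by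
  induction x using TensorProduct.induction_on with
  | tmul c l => rfl
  | _ => simp_all

theorem lT_sigmaK (f : L →ₗ⁅Fp⁆ L') (x : LK p k L) :
    lT k f (sigmaK p x) = sigmaK p (lT k f x) := by
  induction x using TensorProduct.induction_on with
  | tmul c l => rfl
  | _ => simp_all

theorem lT_comp {L'' : Type*} [LieRing L''] [LieAlgebra Fp L''] (g : L' →ₗ⁅Fp⁆ L'')
    (f : L →ₗ⁅Fp⁆ L') (x : LK p k L) : lT k (g.comp f) x = lT k g (lT k f x) := by
  induction x using TensorProduct.induction_on with
  | tmul c l => rfl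
  | _ => simp_all

end Maps

/-! ### Laurent polynomials with prescribed coefficients -/

variable (k) in
/-- The span of the monomials `c t^{-i} ⊗ l` with `G i l`. -/
def Dg (G : ℤ → L → Prop) : Submodule Fp (LK p k L) :=
  Submodule.span Fp {z | ∃ i c l, G i l ∧ z = mt p i c l}

variable (k) in
/-- The span of the `c ⊗ l` with `G l`. -/
def kG (G : L → Prop) : Submodule Fp (k ⊗[Fp] L) :=
  Submodule.span Fp {z | ∃ (c : k) (l : L), G l ∧ z = c ⊗ₜ l}

variable {G G' G'' : ℤ → L → Prop}

theorem mt_mem_Dg {i : ℤ} {c : k} {l : L} (h : G i l) : mt p i c l ∈ Dg k G :=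
  subset_span ⟨i, c, l, h, rfl⟩

/-- Induction on monomials. -/
theorem Dg_induction {P : (x : LK p k L) → x ∈ Dg k G → Prop}
    (hm : ∀ i c l (h : G i l), P (mt p i c l) (mt_mem_Dg h)) (h0 : P 0 (zero_mem _))
    (hadd : ∀ x y hx hy, P x hx → P y hy → P (x + y) (add_mem hx hy))
    (hsmul : ∀ (c : Fp) x hx, P x hx → P (c • x) (smul_mem _ c hx))
    {x : LK p k L} (hx : x ∈ Dg k G) : P x hx := by
  refine span_induction (p := fun x hx => P x hx) ?_ h0 hadd hsmul hx
  rintro _ ⟨i, c, l, h, rfl⟩; exact hm i c l h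

theorem Dg_le {W : Submodule Fp (LK p k L)} (h : ∀ i c l, G i l → mt p i c l ∈ W) :
    Dg k G ≤ W := by
  refine span_le.2 ?_
  rintro _ ⟨i, c, l, hl, rfl⟩; exact h i c l hl

theorem Dg_mono (h : ∀ i l, G i l → G' i l) : Dg (p := p) k G ≤ Dg k G' :=
  Dg_le fun i _ l hl => mt_mem_Dg (h i l hl)

theorem map_mem_Dg {L' : Type*} [LieRing L'] [LieAlgebra Fp L'] {G' : ℤ → L' → Prop}
    (φ : LK p k L →ₗ[Fp] LK p k L') (h : ∀ i c l, G i l → φ (mt p i c l) ∈ Dg k G')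
    {x : LK p k L} (hx : x ∈ Dg k G) : φ x ∈ Dg k G' :=
  Dg_le (W := (Dg k G').comap φ) h hx

theorem lie_mem_Dg (h : ∀ i j l m, G i l → G' j m → G'' (i + j) ⁅l, m⁆) {x y : LK p k L}
    (hx : x ∈ Dg k G) (hy : y ∈ Dg k G') : ⁅x, y⁆ ∈ Dg k G'' := by
  induction hx using Dg_induction with
  | hm i c l hl =>
    induction hy using Dg_induction with
    | hm j d m hm => rw [mt_lie]; exact mt_mem_Dg (h i j l m hl hm)
    | _ => simp_all [add_mem, smul_mem]
  | _ => simp_all [add_mem, smul_mem]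

theorem Dg_or : Dg (p := p) k (fun i l => G i l ∨ G' i l) = Dg k G ⊔ Dg k G' := by
  refine le_antisymm (Dg_le fun i c l h => ?_) (sup_le (Dg_mono fun _ _ => Or.inl)
    (Dg_mono fun _ _ => Or.inr))
  rcases h with h | h
  · exact mem_sup_left (mt_mem_Dg h)
  · exact mem_sup_right (mt_mem_Dg h)

theorem co_mem_kG {x : LK p k L} (hx : x ∈ Dg k G) (i : ℤ) : co p k i x ∈ kG k (G i) := by
  induction hx using Dg_induction with
  | hm j c l hl =>
    rw [co_mt]
    split_ifs with h
    · subst h; exact subset_span ⟨c, l, hl, rfl⟩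
    · exact zero_mem _
  | _ => simp_all [add_mem, smul_mem]

theorem tneg_mem_Dg {i : ℤ} {x : k ⊗[Fp] L} (hx : x ∈ kG k (G i)) : tneg p i x ∈ Dg k G := by
  induction hx using span_induction with
  | mem x h => obtain ⟨c, l, h, rfl⟩ := h; exact mt_mem_Dg h
  | _ => simp_all [add_mem, smul_mem]

theorem kG_mono {G G' : L → Prop} (h : ∀ l, G l → G' l) : kG (p := p) k G ≤ kG k G' :=
  span_mono fun _ ⟨c, l, hl, hx⟩ => ⟨c, l, h l hl, hx⟩

theorem kG_eq_zero {G : L → Prop} (h : ∀ l, G l → l = 0) {x : k ⊗[Fp] L} (hx : x ∈ kG k G) :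
    x = 0 := by
  induction hx using span_induction with
  | mem x hx => obtain ⟨c, l, hl, rfl⟩ := hx; rw [h l hl, tmul_zero]
  | _ => simp_all

/-- A Laurent polynomial is the sum of its monomials. -/
theorem exists_eq_sum_co {x : LK p k L} (hx : x ∈ Dg k G) :
    ∃ s : Finset ℤ, (∀ i ∉ s, co p k i x = 0) ∧ x = ∑ i ∈ s, tneg p i (co p k i x) := by
  classical
  suffices ∃ s : Finset ℤ, ∀ t : Finset ℤ, s ⊆ t →
      (∀ i ∉ t, co p k i x = 0) ∧ x = ∑ i ∈ t, tneg p i (co p k i x) by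
    obtain ⟨s, hs⟩ := this; exact ⟨s, hs s subset_rfl⟩
  induction hx using Dg_induction with
  | h0 => exact ⟨∅, fun t _ => by simp⟩
  | hadd a b _ _ ha hb =>
    obtain ⟨s, hs⟩ := ha
    obtain ⟨s', hs'⟩ := hb
    refine ⟨s ∪ s', fun t ht => ?_⟩
    have h1 := hs t (Finset.union_subset_left ht)
    have h2 := hs' t (Finset.union_subset_right ht)
    refine ⟨fun i hi => by rw [map_add, h1.1 i hi, h2.1 i hi, add_zero], ?_⟩
    simp only [map_add, sum_add_distrib]
    rw [← h1.2, ← h2.2]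
  | hsmul c a _ ha =>
    obtain ⟨s, hs⟩ := ha
    refine ⟨s, fun t ht => ⟨fun i hi => by rw [map_smul, (hs t ht).1 i hi, smul_zero], ?_⟩⟩
    simp only [map_smul]
    rw [← smul_sum, ← (hs t ht).2]
  | hm j c l hl =>
    refine ⟨{j}, fun t ht => ⟨fun i hi => ?_, ?_⟩⟩
    · rw [co_mt, if_neg]
      rintro rfl; exact hi (ht (Finset.mem_singleton_self _))
    · rw [Finset.sum_eq_single j]
      · rw [co_mt, if_pos rfl, tneg_tmul]
      · intro i _ hi
        rw [co_mt, if_neg hi, map_zero]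
      · intro h; exact absurd (ht (Finset.mem_singleton_self _)) h

/-- Membership can be tested on the coefficients. -/
theorem mem_Dg_iff_co {x : LK p k L} (hx : x ∈ Dg k G) :
    x ∈ Dg k G' ↔ ∀ i, co p k i x ∈ kG k (G' i) := by
  refine ⟨fun h i => co_mem_kG h i, fun h => ?_⟩
  obtain ⟨s, -, hs⟩ := exists_eq_sum_co hx
  rw [hs]; exact sum_mem fun i _ => tneg_mem_Dg (h i)

theorem eq_of_co_eq {x y : LK p k L} (hx : x ∈ Dg k G) (hy : y ∈ Dg k G')
    (h : ∀ i, co p k i x = co p k i y) : x = y := by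
  have h1 : x - y ∈ Dg k (fun i l => G i l ∨ G' i l) := sub_mem
    (Dg_mono (fun _ _ => Or.inl) hx) (Dg_mono (fun _ _ => Or.inr) hy)
  obtain ⟨s, -, hs⟩ := exists_eq_sum_co h1
  rw [← sub_eq_zero, hs]
  refine sum_eq_zero fun i _ => ?_
  rw [map_sub, h, sub_self, map_zero]

theorem co_sigmaK {x : LK p k L} (hx : x ∈ Dg k G) (i : ℤ) :
    co p k (p * i) (sigmaK p x) = frobT (co p k i x) := by
  have hp0 : (p : ℤ) ≠ 0 := by exact_mod_cast hp.out.ne_zero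
  induction hx using Dg_induction with
  | hm j c l hl =>
    rw [sigmaK_mt, co_mt, co_mt]
    simp only [mul_eq_mul_left_iff, hp0, or_false]
    split_ifs
    · rw [frobT_tmul]
    · simp
  | _ => simp_all

theorem co_sigmaK_of_not_dvd {x : LK p k L} (hx : x ∈ Dg k G) {i : ℤ} (hi : ¬ (p : ℤ) ∣ i) :
    co p k i (sigmaK p x) = 0 := by
  induction hx using Dg_induction with
  | hm j c l hl =>
    rw [sigmaK_mt, co_mt, if_neg]
    rintro rfl; exact hi ⟨_, rfl⟩
  | _ => simp_all

theorem mem_baseChange_iff_kG (M : Submodule Fp L) (x : k ⊗[Fp] L) :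
    x ∈ M.baseChange k ↔ x ∈ kG k (· ∈ M) := by
  constructor
  · intro h
    rw [Submodule.baseChange_eq_span] at h
    induction h using span_induction with
    | mem x h => obtain ⟨l, hl, rfl⟩ := h; exact subset_span ⟨1, l, hl, rfl⟩
    | smul c a hs ha =>
      clear hs
      induction ha using span_induction with
      | mem x h =>
        obtain ⟨d, l, hl, rfl⟩ := h; exact subset_span ⟨c * d, l, hl, by rw [smul_tmul']; rfl⟩
      | zero => rw [smul_zero]; exact zero_mem _
      | add a b _ _ ha hb => rw [smul_add]; exact add_mem ha hb
      | smul d a _ ha => rw [smul_comm]; exact smul_mem _ _ ha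
    | _ => simp_all [add_mem]
  · intro h
    induction h using span_induction with
    | mem x h => obtain ⟨c, l, hl, rfl⟩ := h; exact Submodule.tmul_mem_baseChange_of_mem c hl
    | zero => exact zero_mem _
    | add a b _ _ ha hb => exact add_mem ha hb
    | smul c a _ ha => rw [← algebraMap_smul k]; exact smul_mem _ _ ha

/-- `k`-spans of the elements `t^{-i} l`, where `l` runs over extensions of scalars. -/
theorem mem_span_tneg_iff {I : Type*} (Q : I → Prop) (a : I → ℤ) (M : I → Submodule Fp L)
    (z : LK p k L) :
    z ∈ Submodule.span k {z | ∃ i, Q i ∧ ∃ l ∈ (M i).baseChange k, z = tneg p (a i) l} ↔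
      z ∈ Dg k (fun j l => ∃ i, Q i ∧ a i = j ∧ l ∈ M i) := by
  constructor
  · intro h
    induction h using span_induction with
    | mem x h =>
      obtain ⟨i, hi, l, hl, rfl⟩ := h
      refine tneg_mem_Dg (kG_mono (fun l hl => ?_) ((mem_baseChange_iff_kG _ _).1 hl))
      exact ⟨i, hi, rfl, hl⟩
    | smul c x hs hx =>
      clear hs
      induction hx using Dg_induction with
      | h0 => rw [smul_zero]; exact zero_mem _
      | hadd a b _ _ ha hb => rw [smul_add]; exact add_mem ha hb
      | hsmul d a _ ha => rw [smul_comm]; exact smul_mem _ _ ha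
      | hm j d l hl =>
        have : c • mt p j d l = mt p j (c * d) l := by
          rw [mt, smul_tmul', Algebra.smul_def]
          congr 1
          change mon 0 c * mon (-j) d = _
          rw [mon_mul, zero_add]
        rw [this]; exact mt_mem_Dg hl
    | _ => simp_all [add_mem]
  · intro h
    induction h using Dg_induction with
    | h0 => exact zero_mem _
    | hadd a b _ _ ha hb => exact add_mem ha hb
    | hsmul c a _ ha => rw [← algebraMap_smul k]; exact smul_mem _ _ ha
    | hm j d l hl =>
      obtain ⟨i, hi, rfl, hl⟩ := hl
      exact subset_span ⟨i, hi, d ⊗ₜ l, Submodule.tmul_mem_baseChange_of_mem d hl, rfl⟩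

end Laurent

/-! ### Presentations of the integers in `𝔄⁰` -/

section Rep

/-- `A` is a sum of `u` terms `a p^e`, with integers `0 ≤ a < w` and `e ≤ m`, where `e = m`
occurs. -/
def RepA (p : ℕ) (w : ℝ) (m u A : ℕ) : Prop :=
  ∃ l : List (ℕ × ℕ), l.length = u ∧ (∀ x ∈ l, (x.1 : ℝ) < w ∧ x.2 ≤ m) ∧ (∃ x ∈ l, x.2 = m) ∧
    (l.map fun x => x.1 * p ^ x.2).sum = A

/-- `B` is a sum of `c < p` powers `p^e` with `e ≤ m`, where `e = m` occurs. -/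
def RepB (p m c B : ℕ) : Prop :=
  ∃ l : List ℕ, l.length = c ∧ c < p ∧ (∀ e ∈ l, e ≤ m) ∧ m ∈ l ∧ (l.map (p ^ ·)).sum = B

theorem exists_sorted (l : List (ℕ × ℕ)) :
    ∃ l' : List (ℕ × ℕ), l'.Perm l ∧ l'.Pairwise (fun x y => y.2 ≤ x.2) := by
  have : Std.Total (fun x y : ℕ × ℕ => y.2 ≤ x.2) := ⟨fun a b => le_total _ _⟩
  have : IsTrans (ℕ × ℕ) (fun x y => y.2 ≤ x.2) := ⟨fun a b c h h' => h'.trans h⟩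
  exact ⟨l.insertionSort (fun x y => y.2 ≤ x.2), List.perm_insertionSort _ _,
    List.pairwise_insertionSort _ _⟩

theorem sum_get_div {p : ℕ} (hp : 0 < p) (l : List (ℕ × ℕ)) {m : ℕ} (hm : ∀ x ∈ l, x.2 ≤ m) :
    (p : ℚ) ^ m * ∑ i : Fin l.length, ((l.get i).1 : ℚ) / (p : ℚ) ^ (m - (l.get i).2) =
      (((l.map fun x => x.1 * p ^ x.2).sum : ℕ) : ℚ) := by
  have hp0 : (p : ℚ) ≠ 0 := by exact_mod_cast hp.ne'
  have h1 : (l.map fun x => x.1 * p ^ x.2).sum =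
      ∑ i : Fin l.length, (l.get i).1 * p ^ (l.get i).2 := by
    rw [← sum_ofFn]
    congr 1
    conv_lhs => rw [← List.ofFn_get l, map_ofFn]
    rfl
  rw [h1, mul_sum]
  push_cast
  refine sum_congr rfl fun i _ => ?_
  have := hm _ (List.get_mem l i)
  rw [pow_sub₀ _ hp0 this]; field_simp

theorem monotone_sub_get {l : List (ℕ × ℕ)} (h : l.Pairwise (fun x y => y.2 ≤ x.2)) (m : ℕ) :
    Monotone fun i : Fin l.length => m - (l.get i).2 := by
  intro i j hij
  rcases hij.eq_or_lt with rfl | hlt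
  · exact le_rfl
  · have := List.pairwise_iff_get.1 h i j hlt
    change m - _ ≤ m - _; omega

theorem sub_get_zero {l : List (ℕ × ℕ)} (h : l.Pairwise (fun x y => y.2 ≤ x.2)) {m : ℕ}
    (hm : ∃ x ∈ l, x.2 = m) (i : Fin l.length) (hi : i.val = 0) : m - (l.get i).2 = 0 := by
  obtain ⟨x, hx, rfl⟩ := hm
  obtain ⟨j, rfl⟩ := List.get_of_mem hx
  rcases (Fin.le_def.2 (by omega) : i ≤ j).eq_or_lt with rfl | hlt
  · omega
  · have := List.pairwise_iff_get.1 h i j hlt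
    omega

theorem mem_ASet_iff {p : ℕ} (hp : 0 < p) {w : ℝ} {m u : ℕ} (hu : 1 ≤ u) {α : ℚ} :
    α ∈ ASet p w u m ↔ ∃ A, RepA p w m u A ∧ (A : ℚ) = (p : ℚ) ^ m * α := by
  have hp0 : (p : ℚ) ≠ 0 := by exact_mod_cast hp.ne'
  constructor
  · rintro ⟨a, n, -, h0, hn, hw, rfl⟩
    refine ⟨_, ⟨ofFn fun i => (a i, m - n i), by simp, ?_, ?_, rfl⟩, ?_⟩
    · intro x hx
      obtain ⟨i, rfl⟩ := mem_ofFn.1 hx; exact ⟨hw i, by simp⟩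
    · refine ⟨(a ⟨0, hu⟩, m - n ⟨0, hu⟩), mem_ofFn.2 ⟨_, rfl⟩, ?_⟩
      simp [h0 ⟨0, hu⟩ rfl]
    · rw [map_ofFn, sum_ofFn, mul_sum]
      push_cast
      refine sum_congr rfl fun i _ => ?_
      simp only [Function.comp]
      push_cast
      rw [pow_sub₀ _ hp0 (hn i)]; field_simp
  · rintro ⟨A, ⟨l, hl, hx, hm, hA⟩, hα⟩
    obtain ⟨l', hperm, hs⟩ := exists_sorted l
    have hl' : l'.length = u := hperm.length_eq.trans hl
    subst hl'
    refine ⟨fun i => (l'.get i).1, fun i => m - (l'.get i).2, monotone_sub_get hs m,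
      fun i hi => ?_, fun i => Nat.sub_le _ _, fun i => ?_, ?_⟩
    · refine sub_get_zero hs ?_ i hi
      obtain ⟨x, h1, h2⟩ := hm; exact ⟨x, hperm.mem_iff.2 h1, h2⟩
    · exact (hx _ (hperm.mem_iff.1 (List.get_mem l' i))).1
    · have h1 := sum_get_div hp l' (m := m) (fun x h => (hx x (hperm.mem_iff.1 h)).2)
      rw [(hperm.map _).sum_eq, hA, hα] at h1; exact (mul_left_cancel₀ (pow_ne_zero m hp0) h1).symm

theorem sum_map_flatten_replicate {p : ℕ} (n : ℕ) (b e : Fin n → ℕ) :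
    ((((ofFn fun i => List.replicate (b i) (e i))).flatten).map (p ^ ·)).sum =
      ∑ i, b i * p ^ e i := by
  rw [List.map_flatten, List.sum_flatten, map_map, map_ofFn, sum_ofFn]; simp

theorem mem_BSet_iff {p : ℕ} (hp : 2 ≤ p) {r : ℚ} {m c : ℕ} {β : ℚ} :
    β ∈ BSet p r (ustar p) m c ↔ ∃ B, RepB p m c B ∧ (B : ℚ) * r = (p : ℚ) ^ m * β := by
  have hp0 : (p : ℚ) ≠ 0 := by
    have : p ≠ 0 := by omega
    exact_mod_cast this
  have hu : 0 < ustar p := by simp [ustar]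
  constructor
  · rintro ⟨hc, b, n, -, h0, hn, hsum, rfl⟩
    refine ⟨_, ⟨(ofFn fun i => List.replicate (b i) (m - n i)).flatten, ?_, hc, ?_, ?_,
      rfl⟩, ?_⟩
    · rw [List.length_flatten, map_ofFn, sum_ofFn, ← hsum]; simp
    · intro x hx
      obtain ⟨l, hl, hxl⟩ := List.mem_flatten.1 hx
      obtain ⟨i, rfl⟩ := mem_ofFn.1 hl
      rw [List.eq_of_mem_replicate hxl]; exact Nat.sub_le _ _
    · refine List.mem_flatten.2 ⟨_, mem_ofFn.2 ⟨⟨0, hu⟩, rfl⟩, ?_⟩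
      have := h0 ⟨0, hu⟩ rfl
      rw [List.mem_replicate]; exact ⟨this.2, by omega⟩
    · rw [sum_map_flatten_replicate, mul_left_comm, mul_sum, mul_comm]
      push_cast
      congr 1
      refine sum_congr rfl fun i _ => ?_
      rw [pow_sub₀ _ hp0 (hn i)]; field_simp
  · rintro ⟨B, ⟨l, hl, hc, hx, hm, hB⟩, hβ⟩
    have hcu : c ≤ ustar p := by
      unfold ustar
      obtain ⟨n, rfl⟩ := exists_eq_add_of_le hp
      have : c ≤ n + 1 := by omega
      rw [show 2 + n - 1 = n + 1 by omega, show 2 + n - 2 = n by omega]; nlinarith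
    obtain ⟨l', hperm, hs⟩ := exists_sorted (l.map fun e => (1, e))
    have h1 : ∀ x ∈ l', x.1 = 1 ∧ x.2 ∈ l := by
      intro x h
      obtain ⟨e, he, rfl⟩ := mem_map.1 (hperm.mem_iff.1 h); exact ⟨rfl, he⟩
    set l₂ := l' ++ List.replicate (ustar p - c) (0, 0) with hl₂
    have hlen : l'.length = c := by rw [hperm.length_eq, length_map, hl]
    have hlen₂ : l₂.length = ustar p := by
      rw [hl₂, length_append, hlen, List.length_replicate]; omega
    have hs₂ : l₂.Pairwise (fun x y => y.2 ≤ x.2) := by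
      rw [hl₂, List.pairwise_append]
      refine ⟨hs, ?_, ?_⟩
      · exact List.pairwise_replicate.2 (Or.inr le_rfl)
      · intro a _ b hb
        rw [List.eq_of_mem_replicate hb]; exact Nat.zero_le _
    have hm₂ : ∀ x ∈ l₂, x.2 ≤ m := by
      intro x h
      rcases mem_append.1 h with h | h
      · exact hx _ (h1 x h).2
      · rw [List.eq_of_mem_replicate h]; exact Nat.zero_le _
    have hmm : ∃ x ∈ l₂, x.2 = m :=
      ⟨(1, m), mem_append_left _ (hperm.mem_iff.2 (mem_map.2 ⟨m, hm, rfl⟩)), rfl⟩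
    have hlpos : 0 < l'.length := by rw [hlen, ← hl]; exact List.length_pos_of_mem hm
    refine ⟨hc, ?_⟩
    rw [← hlen₂]
    refine ⟨fun i => (l₂.get i).1, fun i => m - (l₂.get i).2, monotone_sub_get hs₂ m,
      fun i hi => ⟨sub_get_zero hs₂ hmm i hi, ?_⟩, fun i => Nat.sub_le _ _, ?_, ?_⟩
    · have h2 : l₂.get i ∈ l' := by
        have : l₂.get i = l'[0] := by
          rw [List.get_eq_getElem]
          simp only [hi, hl₂]
          rw [List.getElem_append_left hlpos]
        rw [this]; exact List.getElem_mem _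
      change (l₂.get i).1 ≠ 0
      rw [(h1 _ h2).1]; exact one_ne_zero
    · have h2 : ∑ i : Fin l₂.length, (l₂.get i).1 = (l₂.map Prod.fst).sum := by
        rw [← sum_ofFn]
        congr 1
        conv_rhs => rw [← List.ofFn_get l₂, map_ofFn]
        rfl
      rw [h2, hl₂, map_append, sum_append, (hperm.map _).sum_eq, map_map]
      simp only [List.map_replicate, List.sum_replicate, smul_zero, add_zero]
      rw [← hl]; simp [Function.comp_def]
    · have h1 := sum_get_div (p := p) (by omega) l₂ (m := m) hm₂
      have h2 : (l₂.map fun x => x.1 * p ^ x.2).sum = B := by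
        rw [hl₂, map_append, sum_append, (hperm.map _).sum_eq, map_map, ← hB]
        simp [Function.comp_def]
      rw [h2] at h1
      refine mul_left_cancel₀ (pow_ne_zero m hp0) ?_
      rw [← hβ, mul_left_comm, h1, mul_comm]

theorem RepA.add {p : ℕ} {w : ℝ} {m u A m' u' A' : ℕ} (h : RepA p w m u A)
    (h' : RepA p w m' u' A') : RepA p w (max m m') (u + u') (A + A') := by
  obtain ⟨l, hl, hx, ⟨y, hy, hm⟩, hA⟩ := h
  obtain ⟨l', hl', hx', ⟨y', hy', hm'⟩, hA'⟩ := h'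
  refine ⟨l ++ l', by simp [hl, hl'], ?_, ?_, by simp [hA, hA']⟩
  · intro x h
    rcases mem_append.1 h with h | h
    · exact ⟨(hx x h).1, (hx x h).2.trans (le_max_left _ _)⟩
    · exact ⟨(hx' x h).1, (hx' x h).2.trans (le_max_right _ _)⟩
  · rcases max_choice m m' with h | h
    · exact ⟨y, mem_append_left _ hy, by rw [h, hm]⟩
    · exact ⟨y', List.mem_append_right _ hy', by rw [h, hm']⟩

theorem RepB.add {p m c B m' c' B' : ℕ} (h : RepB p m c B) (h' : RepB p m' c' B')
    (hc : c + c' < p) : RepB p (max m m') (c + c') (B + B') := by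
  obtain ⟨l, hl, -, hx, hm, hB⟩ := h
  obtain ⟨l', hl', -, hx', hm', hB'⟩ := h'
  refine ⟨l ++ l', by simp [hl, hl'], hc, ?_, ?_, by simp [hB, hB']⟩
  · intro x h
    rcases mem_append.1 h with h | h
    · exact (hx x h).trans (le_max_left _ _)
    · exact (hx' x h).trans (le_max_right _ _)
  · rcases max_choice m m' with h | h
    · exact by rw [h]; exact mem_append_left _ hm
    · exact by rw [h]; exact List.mem_append_right _ hm'

theorem RepA.mul {p : ℕ} {w : ℝ} {m u A : ℕ} (h : RepA p w m u A) : RepA p w (m + 1) u (p * A) := by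
  obtain ⟨l, hl, hx, ⟨y, hy, hm⟩, hA⟩ := h
  refine ⟨l.map fun x => (x.1, x.2 + 1), by simp [hl], ?_, ?_, ?_⟩
  · intro x h
    obtain ⟨x, hxl, rfl⟩ := mem_map.1 h; exact ⟨(hx x hxl).1, Nat.succ_le_succ (hx x hxl).2⟩
  · exact ⟨_, mem_map.2 ⟨y, hy, rfl⟩, by simp [hm]⟩
  · rw [map_map, ← hA, ← List.sum_map_mul_left]
    congr 1
    refine map_congr_left fun x _ => ?_
    simp only [Function.comp, pow_succ]; ring

theorem RepB.mul {p m c B : ℕ} (h : RepB p m c B) : RepB p (m + 1) c (p * B) := by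
  obtain ⟨l, hl, hc, hx, hm, hB⟩ := h
  refine ⟨l.map (· + 1), by simp [hl], hc, ?_, ?_, ?_⟩
  · intro x h
    obtain ⟨x, hxl, rfl⟩ := mem_map.1 h; exact Nat.succ_le_succ (hx x hxl)
  · exact mem_map.2 ⟨m, hm, rfl⟩
  · rw [map_map, ← hB, ← List.sum_map_mul_left]
    congr 1
    refine map_congr_left fun x _ => ?_
    simp only [Function.comp, pow_succ]; ring

theorem exists_list_le (l : List ℕ) (n : ℕ) (hn : n ≤ l.sum) :
    ∃ l' : List ℕ, l'.length = l.length ∧ l'.sum = n ∧ ∀ a ∈ l', ∃ a' ∈ l, a ≤ a' := by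
  induction l generalizing n with
  | nil => exact ⟨[], rfl, by simpa using hn.antisymm (Nat.zero_le _) |>.symm, by simp⟩
  | cons a l ih =>
    simp only [List.sum_cons] at hn
    obtain ⟨l', h1, h2, h3⟩ := ih (n - a) (by omega)
    refine ⟨min a n :: l', by simp [h1], by simp [h2]; omega, ?_⟩
    intro x hx
    rcases List.mem_cons.1 hx with rfl | hx
    · exact ⟨a, by simp, min_le_left _ _⟩
    · obtain ⟨a', h4, h5⟩ := h3 x hx; exact ⟨a', mem_cons_of_mem _ h4, h5⟩

/-- Division by `p`: the digits at `p^0`, whose sum is divisible by `p`, are replaced by equally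
many smaller ones. -/
theorem RepA.div {p : ℕ} (hp : 2 ≤ p) {w : ℝ} {m u A : ℕ} (h : RepA p w (m + 1) u (p * A)) :
    RepA p w m u A := by
  obtain ⟨l, hl, hx, ⟨y, hy, hm⟩, hA⟩ := h
  set l0 := l.filter (fun x => x.2 = 0) with hl0
  set l1 := l.filter (fun x => ¬ x.2 = 0) with hl1
  have hperm : l.Perm (l0 ++ l1) := by
    have := List.filter_append_perm (fun x : ℕ × ℕ => decide (x.2 = 0)) l
    refine this.symm.trans ?_
    simp only [hl0, hl1, decide_not]; exact List.Perm.refl _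
  have h0 : (l0.map fun x => x.1 * p ^ x.2) = l0.map Prod.fst := by
    refine map_congr_left fun x h => ?_
    have : x.2 = 0 := by simpa using (List.mem_filter.1 h).2
    simp [this]
  have h1 : (l1.map fun x => x.1 * p ^ x.2) = l1.map fun x => p * (x.1 * p ^ (x.2 - 1)) := by
    refine map_congr_left fun x h => ?_
    have : ¬ x.2 = 0 := by simpa using (List.mem_filter.1 h).2
    obtain ⟨n, hn⟩ := Nat.exists_eq_succ_of_ne_zero this
    rw [hn, Nat.succ_sub_one, pow_succ]; ring
  have hsum : (l0.map Prod.fst).sum + p * (l1.map fun x => x.1 * p ^ (x.2 - 1)).sum = p * A := by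
    rw [← hA, (hperm.map _).sum_eq, map_append, sum_append, h0, h1, List.sum_map_mul_left]
  obtain ⟨T, hT⟩ : p ∣ (l0.map Prod.fst).sum :=
    (Nat.dvd_add_left (Dvd.intro _ rfl)).1 (hsum ▸ Dvd.intro _ rfl)
  obtain ⟨l', e1, e2, e3⟩ := exists_list_le (l0.map Prod.fst) T (by rw [hT]; nlinarith)
  refine ⟨l'.map (fun a => (a, 0)) ++ l1.map (fun x => (x.1, x.2 - 1)), ?_, ?_, ?_, ?_⟩
  · rw [length_append, length_map, length_map, e1, length_map,
      ← length_append, ← hperm.length_eq, hl]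
  · intro x h
    rcases mem_append.1 h with h | h
    · obtain ⟨a, ha, rfl⟩ := mem_map.1 h
      obtain ⟨a', ha', hle⟩ := e3 a ha
      obtain ⟨z, hz, rfl⟩ := mem_map.1 ha'
      refine ⟨lt_of_le_of_lt ?_ (hx z (List.mem_of_mem_filter hz)).1, Nat.zero_le _⟩
      exact_mod_cast hle
    · obtain ⟨z, hz, rfl⟩ := mem_map.1 h
      have := hx z (List.mem_of_mem_filter hz)
      refine ⟨this.1, ?_⟩
      have := this.2
      simp only; omega
  · refine ⟨(y.1, y.2 - 1), List.mem_append_right _ (mem_map.2 ⟨y, ?_, rfl⟩), by simp [hm]⟩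
    rw [hl1, List.mem_filter]; exact ⟨hy, by simp [hm]⟩
  · rw [map_append, sum_append, map_map, map_map]
    simp only [Function.comp_def, pow_zero, mul_one, List.map_id']
    rw [e2]
    rw [hT, ← mul_add] at hsum; exact Nat.eq_of_mul_eq_mul_left (by omega) hsum

theorem RepB.le {p m c B : ℕ} (h : RepB p m c B) : p ^ m ≤ B ∧ B ≤ c * p ^ m := by
  obtain ⟨l, hl, hc, hx, hm, hB⟩ := h
  have hp : 0 < p := by omega
  constructor
  · rw [← hB]; exact List.single_le_sum (fun _ _ => Nat.zero_le _) _ (mem_map.2 ⟨m, hm, rfl⟩)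
  · rw [← hB, ← hl]
    have := List.sum_le_card_nsmul (l.map (p ^ ·)) (p ^ m) (by
      intro x h
      obtain ⟨e, he, rfl⟩ := mem_map.1 h; exact Nat.pow_le_pow_right hp (hx e he))
    simpa using this

theorem RepB.div {p m c B : ℕ} (hp : 2 ≤ p) (h : RepB p m c (p * B)) :
    ∃ m', m = m' + 1 ∧ RepB p m' c B := by
  obtain ⟨l, hl, hc, hx, hm, hB⟩ := h
  set l0 := l.filter (fun x => x = 0) with hl0
  set l1 := l.filter (fun x => ¬ x = 0) with hl1
  have hperm : l.Perm (l0 ++ l1) := by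
    have := List.filter_append_perm (fun x : ℕ => decide (x = 0)) l
    refine this.symm.trans ?_
    simp only [hl0, hl1, decide_not]; exact List.Perm.refl _
  have h0 : (l0.map (p ^ ·)).sum = l0.length := by
    have : l0.map (p ^ ·) = l0.map (fun _ => 1) := by
      refine map_congr_left fun x h => ?_
      have : x = 0 := by simpa using (List.mem_filter.1 h).2
      simp [this]
    rw [this]; simp
  have h1 : (l1.map (p ^ ·)) = l1.map fun x => p * (p ^ (x - 1)) := by
    refine map_congr_left fun x h => ?_
    have : ¬ x = 0 := by simpa using (List.mem_filter.1 h).2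
    obtain ⟨n, hn⟩ := Nat.exists_eq_succ_of_ne_zero this
    simp only [hn, Nat.succ_sub_one, pow_succ]; ring
  have hsum : l0.length + p * (l1.map fun x => p ^ (x - 1)).sum = p * B := by
    rw [← hB, (hperm.map _).sum_eq, map_append, sum_append, h0, h1, List.sum_map_mul_left]
  have hlen : l0.length ≤ c := by rw [← hl]; exact List.length_filter_le _ _
  have hd : p ∣ l0.length := (Nat.dvd_add_left (Dvd.intro _ rfl)).1 (hsum ▸ Dvd.intro _ rfl)
  have hz : l0.length = 0 := Nat.eq_zero_of_dvd_of_lt hd (by omega)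
  have hl00 : l0 = [] := List.eq_nil_of_length_eq_zero hz
  rw [hl00, nil_append] at hperm
  rw [hz, zero_add] at hsum
  have hne : ∀ x ∈ l, x ≠ 0 := by
    intro x h
    have := hperm.mem_iff.1 h
    simpa using (List.mem_filter.1 this).2
  obtain ⟨m', rfl⟩ := Nat.exists_eq_succ_of_ne_zero (hne m hm)
  refine ⟨m', rfl, l1.map (· - 1), ?_, hc, ?_, ?_, ?_⟩
  · rw [length_map, ← hperm.length_eq, hl]
  · intro x h
    obtain ⟨y, hy, rfl⟩ := mem_map.1 h
    have := hx y (hperm.mem_iff.2 hy)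
    omega
  · exact mem_map.2 ⟨_, hperm.mem_iff.1 hm, rfl⟩
  · rw [map_map]; exact Nat.eq_of_mul_eq_mul_left (by omega) hsum

theorem RepB.modEq {p m c B : ℕ} (h : RepB p m c B) : c ≡ B [MOD (p - 1)] := by
  obtain ⟨l, rfl, hc, -, -, rfl⟩ := h
  have hp : p ≡ 1 [MOD (p - 1)] := by
    have : p = 1 + (p - 1) := by omega
    conv_lhs => rw [this]
    simp [Nat.ModEq]
  clear hc
  induction l with
  | nil => rfl
  | cons a l ih =>
    rw [map_cons, List.sum_cons, length_cons, add_comm]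
    refine Nat.ModEq.add ?_ ih
    simpa using (hp.pow a).symm

theorem RepB.pos {p m c B : ℕ} (h : RepB p m c B) : 1 ≤ c := by
  obtain ⟨l, rfl, -, -, hm, -⟩ := h; exact List.length_pos_of_mem hm

theorem RepB.unique {p m c m' c' B : ℕ} (hp : 2 ≤ p) (h : RepB p m c B) (h' : RepB p m' c' B) :
    c = c' ∧ m = m' := by
  constructor
  · have h1 := h.modEq.trans h'.modEq.symm
    have h2 := h.pos
    have h3 := h'.pos
    have h4 : c < p := by obtain ⟨_, _, h, _⟩ := h; exact h
    have h5 : c' < p := by obtain ⟨_, _, h, _⟩ := h'; exact h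
    have h6 : c - 1 ≡ c' - 1 [MOD (p - 1)] := by
      refine Nat.ModEq.add_right_cancel' 1 ?_
      rwa [Nat.sub_add_cancel h2, Nat.sub_add_cancel h3]
    have h7 := Nat.ModEq.eq_of_lt_of_lt h6 (by omega) (by omega)
    omega
  · have h4 : c < p := by obtain ⟨_, _, h, _⟩ := h; exact h
    have h5 : c' < p := by obtain ⟨_, _, h, _⟩ := h'; exact h
    have key : ∀ {m c m' c'}, c' < p → RepB p m c B → RepB p m' c' B → m ≤ m' := by
      intro m c m' c' hc h h'
      have h1 : p ^ m < p ^ (m' + 1) := by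
        rw [pow_succ']
        calc p ^ m ≤ B := h.le.1
          _ ≤ c' * p ^ m' := h'.le.2
          _ < p * p ^ m' := Nat.mul_lt_mul_of_pos_right hc (pow_pos (by omega) _)
      have := (Nat.pow_lt_pow_iff_right (by omega)).1 h1
      omega
    exact le_antisymm (key h5 h h') (key h4 h' h)

end Rep

namespace Params
variable {p N₀ : ℕ} [hp : Fact p.Prime] (P : Params p N₀)

/-- A presentation `ι = q A - b B` of an integer, where `A = p^m α` and `B = p^m β / r^*`. -/
def Pr (ι : ℤ) (m u c A B : ℕ) : Prop :=
  1 ≤ u ∧ u ≤ ustar p ∧ RepA p P.w m u A ∧ ((B = 0 ∧ c = 0) ∨ RepB p m c B) ∧ ι = P.q * A - P.b * B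

theorem p_ne_zero : (p : ℚ) ≠ 0 := by exact_mod_cast hp.out.ne_zero

theorem b_pos : 0 < P.b := by
  have := P.q_mul_lt (s := 1) (a := 0) le_rfl hp.out.one_lt (by simpa using P.v₀_pos)
  simpa using this

theorem b_pos_int : (0 : ℤ) < P.b := by exact_mod_cast P.b_pos

theorem w_pos : 0 < P.w := by
  have : (1 : ℝ) < p := by exact_mod_cast hp.out.one_lt
  exact mul_pos (sub_pos.2 this) P.v₀_pos

theorem b_eq' : (P.b : ℚ) = P.r * ((P.q : ℚ) - 1) := by
  have h : (P.b : ℝ) = ((P.r * ((P.q : ℚ) - 1) : ℚ) : ℝ) := by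
    rw [P.b_eq]
    unfold q
    push_cast; rfl
  exact_mod_cast h

theorem one_lt_q : 1 < P.q := Nat.one_lt_pow P.M_pos.ne' hp.out.one_lt

theorem r_pos : 0 < P.r := by
  have h1 : (0 : ℚ) < P.b := by exact_mod_cast P.b_pos
  have h2 : (1 : ℚ) < P.q := by exact_mod_cast P.one_lt_q
  rw [P.b_eq'] at h1; exact pos_of_mul_pos_left h1 (by linarith)

theorem coprime_b : Nat.Coprime P.b p := by
  have h1 : Nat.Coprime P.b₀ p := P.coprime_b₀.coprime_mul_right_right
  have hdvd : p ^ P.M₀ - 1 ∣ p ^ P.M - 1 := Nat.pow_sub_one_dvd_pow_sub_one _ P.M₀_dvd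
  have h2 : Nat.Coprime (p ^ P.M - 1) p := by
    have h3 : Nat.Coprime (p ^ P.M - 1) (p ^ P.M) := by
      rw [Nat.coprime_self_sub_left (Nat.one_le_pow _ _ hp.out.pos)]; exact Nat.coprime_one_left _
    exact Nat.Coprime.coprime_dvd_right (dvd_pow_self p P.M_pos.ne') h3
  exact Nat.Coprime.mul_left h1 (Nat.Coprime.coprime_dvd_left (Nat.div_dvd_of_dvd hdvd) h2)

theorem isPres_iff {ι : ℤ} {m u c : ℕ} {α β : ℚ} : P.IsPres ι m u c α β ↔
    ∃ A B, P.Pr ι m u c A B ∧ (A : ℚ) = (p : ℚ) ^ m * α ∧ (B : ℚ) * P.r = (p : ℚ) ^ m * β := by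
  have hr := P.r_pos.ne'
  have hι : ∀ A B : ℕ, (A : ℚ) = (p : ℚ) ^ m * α → (B : ℚ) * P.r = (p : ℚ) ^ m * β →
      ((ι : ℚ) = (p : ℚ) ^ m * (P.q * α - (P.q - 1) * β) ↔ ι = P.q * A - P.b * B) := by
    intro A B hA hB
    have : (p : ℚ) ^ m * (P.q * α - (P.q - 1) * β) = ((P.q * A - P.b * B : ℤ) : ℚ) := by
      push_cast
      rw [P.b_eq', hA, mul_sub, mul_left_comm _ ((P.q : ℚ) - 1), ← hB]; ring
    rw [this]; exact_mod_cast Iff.rfl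
  constructor
  · rintro ⟨h1, h2, hα, hβ, h⟩
    obtain ⟨A, hA, hA'⟩ := (mem_ASet_iff hp.out.pos h1).1 hα
    rcases hβ with ⟨rfl, rfl⟩ | hβ
    · exact ⟨A, 0, ⟨h1, h2, hA, Or.inl ⟨rfl, rfl⟩, (hι A 0 hA' (by simp)).1 h⟩, hA', by simp⟩
    · obtain ⟨B, hB, hB'⟩ := (mem_BSet_iff hp.out.two_le).1 hβ
      exact ⟨A, B, ⟨h1, h2, hA, Or.inr hB, (hι A B hA' hB').1 h⟩, hA', hB'⟩
  · rintro ⟨A, B, ⟨h1, h2, hA, hB, h⟩, hA', hB'⟩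
    refine ⟨h1, h2, (mem_ASet_iff hp.out.pos h1).2 ⟨A, hA, hA'⟩, ?_, (hι A B hA' hB').2 h⟩
    rcases hB with ⟨rfl, rfl⟩ | hB
    · left
      refine ⟨?_, rfl⟩
      rw [cast_zero, zero_mul] at hB'
      exact (mul_eq_zero.1 hB'.symm).resolve_left (pow_ne_zero _ p_ne_zero)
    · exact Or.inr ((mem_BSet_iff hp.out.two_le).2 ⟨B, hB, hB'⟩)

theorem Pr.exists_isPres {P : Params p N₀} {ι : ℤ} {m u c A B : ℕ} (h : P.Pr ι m u c A B) :
    ∃ α β, P.IsPres ι m u c α β ∧ (A : ℚ) = (p : ℚ) ^ m * α ∧ (B : ℚ) * P.r = (p : ℚ) ^ m * β := by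
  have hpm : (p : ℚ) ^ m ≠ 0 := pow_ne_zero _ p_ne_zero
  have h1 : (A : ℚ) = (p : ℚ) ^ m * (A / (p : ℚ) ^ m) := by field_simp
  have h2 : (B : ℚ) * P.r = (p : ℚ) ^ m * (B * P.r / (p : ℚ) ^ m) := by field_simp
  exact ⟨_, _, P.isPres_iff.2 ⟨A, B, h, h1, h2⟩, h1, h2⟩

theorem RepA_extend {m u A u' : ℕ} (h : RepA p P.w m u A) (hu : u ≤ u') : RepA p P.w m u' A := by
  obtain ⟨l, hl, hx, ⟨y, hy, hm⟩, hA⟩ := h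
  refine ⟨l ++ List.replicate (u' - u) (0, 0), ?_, ?_, ⟨y, mem_append_left _ hy, hm⟩, ?_⟩
  · grind
  · intro x h
    rcases mem_append.1 h with h | h
    · exact hx x h
    · rw [List.eq_of_mem_replicate h]; exact ⟨by simpa using P.w_pos, Nat.zero_le _⟩
  · rw [map_append, sum_append, hA]; simp

/-- The gap between `A[u^*]` and `B[u^*]` bounds the exponents in a presentation. -/
theorem Pr.bound {P : Params p N₀} {ι : ℤ} (hι : |ι| ≤ P.b * ((p : ℤ) - 1)) {m u c A B : ℕ}
    (h : P.Pr ι m u c A B) (hB0 : B ≠ 0) : p ^ (m + 1) ≤ P.q ∧ B < P.q := by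
  obtain ⟨h1, h2, hA, hB, he⟩ := h
  have hB : RepB p m c B := hB.resolve_left fun h => hB0 h.1
  have hc : c < p := by obtain ⟨_, _, h, _⟩ := hB; exact h
  have hpm : (0 : ℚ) < (p : ℚ) ^ m := pow_pos (by exact_mod_cast hp.out.pos) _
  have hr := P.r_pos
  have hd := P.dist_le m m c ((A : ℚ) / (p : ℚ) ^ m)
    ((mem_ASet_iff hp.out.pos (by simp [ustar])).2 ⟨A, P.RepA_extend hA h2, by field_simp⟩)
    ((B : ℚ) * P.r / (p : ℚ) ^ m)
    ((mem_BSet_iff hp.out.two_le).2 ⟨B, hB, by change _ * P.r = _; field_simp⟩)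
  change 2 * P.r * ((p : ℚ) - 1) ≤ _ at hd
  have hq : ((p : ℚ) ^ P.M) = P.q := by unfold q; push_cast; rfl
  rw [hq, ← sub_div, abs_div, abs_of_pos hpm, mul_div_assoc', le_div_iff₀ hpm] at hd
  have hBle : (B : ℚ) ≤ ((p : ℚ) - 1) * (p : ℚ) ^ m := by
    have h3 : B ≤ (p - 1) * p ^ m := hB.le.2.trans (Nat.mul_le_mul_right _ (by omega))
    have h4 : (B : ℚ) ≤ (((p - 1) * p ^ m : ℕ) : ℚ) := by exact_mod_cast h3
    rw [Nat.cast_mul, Nat.cast_sub hp.out.one_le] at h4; simpa using h4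
  have hq0 : (0 : ℚ) < P.q := by exact_mod_cast P.q_pos
  have e1 : (P.q : ℚ) * |(A : ℚ) - B * P.r| = |(ι : ℚ) - B * P.r| := by
    rw [show (P.q : ℚ) * |(A : ℚ) - B * P.r| = |P.q * ((A : ℚ) - B * P.r)| by
      rw [abs_mul, abs_of_pos hq0], he]
    push_cast
    rw [P.b_eq']
    congr 1
    ring
  have hι' : |(ι : ℚ)| ≤ P.b * ((p : ℚ) - 1) := by exact_mod_cast hι
  have e2 : |(ι : ℚ) - B * P.r| ≤ |(ι : ℚ)| + B * P.r := by
    refine (abs_sub _ _).trans ?_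
    rw [abs_of_nonneg (by positivity : (0 : ℚ) ≤ B * P.r)]
  have hp1 : (1 : ℚ) < p := by exact_mod_cast hp.out.one_lt
  have e3 : P.r * ((p : ℚ) - 1) * (p : ℚ) ^ m ≤ P.r * ((p : ℚ) - 1) * (P.q - 1) := by
    have h5 : (B : ℚ) * P.r ≤ ((p : ℚ) - 1) * (p : ℚ) ^ m * P.r :=
      mul_le_mul_of_nonneg_right hBle hr.le
    rw [P.b_eq'] at hι'
    rw [e1] at hd; nlinarith
  have e4 : (p : ℚ) ^ m ≤ P.q - 1 := le_of_mul_le_mul_left e3 (mul_pos hr (by linarith))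
  have e5 : p ^ m < p ^ P.M := by
    have : (p : ℚ) ^ m < (p : ℚ) ^ P.M := by rw [hq]; linarith
    exact_mod_cast this
  have e6 : p ^ (m + 1) ≤ P.q :=
    Nat.pow_le_pow_right hp.out.pos ((Nat.pow_lt_pow_iff_right hp.out.one_lt).1 e5)
  refine ⟨e6, lt_of_le_of_lt hB.le.2 (lt_of_lt_of_le ?_ e6)⟩
  rw [pow_succ']; exact Nat.mul_lt_mul_of_pos_right hc (pow_pos hp.out.pos _)

theorem Pr.unique {P : Params p N₀} {ι : ℤ} (hι : |ι| ≤ P.b * ((p : ℤ) - 1))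
    {m u c A B m' u' c' A' B' : ℕ} (h : P.Pr ι m u c A B) (h' : P.Pr ι m' u' c' A' B') :
    A = A' ∧ B = B' ∧ c = c' := by
  have hq : (0 : ℤ) < P.q := by exact_mod_cast P.q_pos
  have hlt : B < P.q := by
    by_cases hB : B = 0
    · grind
    · exact (h.bound hι hB).2
  have hlt' : B' < P.q := by
    by_cases hB : B' = 0
    · grind
    · exact (h'.bound hι hB).2
  have he := h.2.2.2.2
  have he' := h'.2.2.2.2
  have hBB : B = B' := by
    have h1 : (P.q : ℤ) ∣ P.b * ((B : ℤ) - B') := ⟨(A : ℤ) - A', by linarith⟩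
    have hcop : IsCoprime (P.q : ℤ) (P.b : ℤ) :=
      Nat.isCoprime_iff_coprime.2 ((Nat.Coprime.pow_right _ P.coprime_b).symm)
    have h2 : (P.q : ℤ) ∣ (B : ℤ) - B' := hcop.dvd_of_dvd_mul_left h1
    have h3 : |(B : ℤ) - B'| < P.q := by rw [abs_lt]; constructor <;> omega
    have h4 := Int.eq_zero_of_abs_lt_dvd h2 h3
    omega
  subst hBB
  have hAA : A = A' := by
    have : (P.q : ℤ) * A = P.q * A' := by linarith
    exact_mod_cast mul_left_cancel₀ hq.ne' this
  refine ⟨hAA, rfl, ?_⟩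
  rcases h.2.2.2.1 with ⟨h1, h2⟩ | h1 <;> rcases h'.2.2.2.1 with ⟨h3, h4⟩ | h3
  · omega
  · have := h3.le.1
    have := pow_pos hp.out.pos (n := m')
    omega
  · have := h1.le.1
    have := pow_pos hp.out.pos (n := m)
    omega
  · exact (h1.unique hp.out.two_le h3).1

theorem Pr.lt_w {P : Params p N₀} {ι : ℤ} (hι : |ι| ≤ P.b * ((p : ℤ) - 1)) {A : ℕ}
    (h : ι = P.q * A) : (A : ℝ) < P.w := by
  have hp1 : (1 : ℝ) < p := by exact_mod_cast hp.out.one_lt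
  have h1 : (P.q * A : ℝ) ≤ P.b * ((p : ℝ) - 1) := by
    have := (le_abs_self ι).trans hι
    rw [h] at this; exact_mod_cast this
  have hq : (0 : ℝ) < P.q := by exact_mod_cast P.q_pos
  have h2 : (P.b : ℝ) < P.q * P.v₀ := by
    have h3 := P.rStar_lt'
    rw [P.b_eq]
    change (P.r : ℝ) * _ < _ at h3
    have h4 : (P.q : ℝ) = (p : ℝ) ^ P.M := by unfold q; push_cast; rfl
    rw [← h4] at h3 ⊢
    have h5 := mul_lt_mul_of_pos_left h3 hq
    have h6 : (P.q : ℝ) * (P.r * (1 - 1 / P.q)) = P.r * (P.q - 1) := by field_simp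
    rw [h6] at h5; exact h5
  unfold w
  have : (P.q : ℝ) * A < P.q * ((p - 1) * P.v₀) := by nlinarith
  exact lt_of_mul_lt_mul_left this hq.le

theorem RepA_single {A : ℕ} (h : (A : ℝ) < P.w) : RepA p P.w 0 1 A :=
  ⟨[(A, 0)], rfl, by simpa using h, ⟨(A, 0), by simp⟩, by simp⟩

theorem Pr_single {A : ℕ} (h : (A : ℝ) < P.w) : P.Pr (P.q * A) 0 1 0 A 0 :=
  ⟨le_rfl, by simp [ustar], P.RepA_single h, Or.inl ⟨rfl, rfl⟩, by simp⟩

theorem mem_A0_iff {ι : ℤ} : ι ∈ P.A0 ↔ |ι| ≤ P.b * ((p : ℤ) - 1) ∧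
    ∃ m u c A B, P.Pr ι m u c A B := by
  refine and_congr Iff.rfl ⟨?_, ?_⟩
  · rintro ⟨m, u, c, α, β, h⟩
    obtain ⟨A, B, h, -⟩ := P.isPres_iff.1 h; exact ⟨m, u, c, A, B, h⟩
  · rintro ⟨m, u, c, A, B, h⟩
    obtain ⟨α, β, h, -⟩ := h.exists_isPres; exact ⟨m, u, c, α, β, h⟩

theorem Pr.mem_A0 {P : Params p N₀} {ι : ℤ} (hι : |ι| ≤ P.b * ((p : ℤ) - 1)) {m u c A B : ℕ}
    (h : P.Pr ι m u c A B) : ι ∈ P.A0 := P.mem_A0_iff.2 ⟨hι, m, u, c, A, B, h⟩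

theorem Pr.spec {P : Params p N₀} {ι : ℤ} (hι : |ι| ≤ P.b * ((p : ℤ) - 1)) {m u c A B : ℕ}
    (h : P.Pr ι m u c A B) : P.pa ι = A ∧ P.pb ι = B ∧ P.ch ι = c ∧ P.kap ι ≤ u := by
  obtain ⟨α, β, h1, hα, hβ⟩ := h.exists_isPres
  refine ⟨?_, ?_, ?_, Nat.sInf_le ⟨m, c, α, β, h1⟩⟩
  · obtain ⟨m', u', c', α', β', h2, h3⟩ := sInf_mem
      (s := {n : ℕ | ∃ m u c α β, P.IsPres ι m u c α β ∧ (n : ℚ) = (p : ℚ) ^ m * α})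
      ⟨A, m, u, c, α, β, h1, hα⟩
    obtain ⟨A', B', h4, h5, h6⟩ := P.isPres_iff.1 h2
    have := (h.unique hι h4).1
    change P.pa ι = A
    rw [this]
    have h7 : ((P.pa ι : ℕ) : ℚ) = (A' : ℚ) := h3.trans h5.symm
    exact_mod_cast h7
  · obtain ⟨m', u', c', α', β', h2, h3⟩ := sInf_mem
      (s := {n : ℕ | ∃ m u c α β, P.IsPres ι m u c α β ∧ (n : ℚ) * P.r = (p : ℚ) ^ m * β})
      ⟨B, m, u, c, α, β, h1, hβ⟩
    obtain ⟨A', B', h4, h5, h6⟩ := P.isPres_iff.1 h2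
    have := (h.unique hι h4).2.1
    change P.pb ι = B
    rw [this]
    have h7 : ((P.pb ι : ℕ) : ℚ) = (B' : ℚ) := mul_right_cancel₀ P.r_pos.ne' (h3.trans h6.symm)
    exact_mod_cast h7
  · obtain ⟨m', u', α', β', h2⟩ := sInf_mem
      (s := {c | ∃ m u α β, P.IsPres ι m u c α β}) ⟨c, m, u, α, β, h1⟩
    obtain ⟨A', B', h4, h5, h6⟩ := P.isPres_iff.1 h2; exact (h.unique hι h4).2.2.symm

theorem A0_abs {ι : ℤ} (h : ι ∈ P.A0) : |ι| ≤ P.b * ((p : ℤ) - 1) := h.1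

/-- A presentation with the least number of digits. -/
theorem A0_get {ι : ℤ} (h : ι ∈ P.A0) : ∃ m, P.Pr ι m (P.kap ι) (P.ch ι) (P.pa ι) (P.pb ι) := by
  obtain ⟨h0, m, u, c, α, β, h1⟩ := h
  obtain ⟨m', c', α', β', h2⟩ := sInf_mem
    (s := {u | ∃ m c α β, P.IsPres ι m u c α β}) ⟨u, m, c, α, β, h1⟩
  obtain ⟨A, B, h4, -⟩ := P.isPres_iff.1 h2
  obtain ⟨e1, e2, e3, -⟩ := h4.spec h0; exact ⟨m', by rw [e1, e2, e3]; exact h4⟩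

theorem A0_eq {ι : ℤ} (h : ι ∈ P.A0) : ι = P.q * P.pa ι - P.b * P.pb ι := by
  obtain ⟨m, h⟩ := P.A0_get h; exact h.2.2.2.2

theorem kap_pos {ι : ℤ} (h : ι ∈ P.A0) : 1 ≤ P.kap ι := by obtain ⟨m, h⟩ := P.A0_get h; exact h.1

theorem ch_lt {ι : ℤ} (h : ι ∈ P.A0) : P.ch ι < p := by
  obtain ⟨m, h⟩ := P.A0_get h
  rcases h.2.2.2.1 with ⟨-, h⟩ | ⟨_, _, h, _⟩
  · rw [h]; exact hp.out.pos
  · exact h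

theorem ch_eq_zero_iff {ι : ℤ} (h : ι ∈ P.A0) : P.ch ι = 0 ↔ P.pb ι = 0 := by
  obtain ⟨m, h⟩ := P.A0_get h
  rcases h.2.2.2.1 with ⟨h1, h2⟩ | h1
  · simp [h1, h2]
  · have := h1.pos
    have := h1.le.1
    have := pow_pos hp.out.pos (n := m)
    constructor <;> intro <;> omega

/-- The presentation with `m = 0` if `B = 0`. -/
theorem A0_get_of_pb {ι : ℤ} (h : ι ∈ P.A0) (hB : P.pb ι = 0) :
    (P.pa ι : ℝ) < P.w ∧ ι = P.q * P.pa ι ∧ P.kap ι = 1 := by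
  have h1 : ι = P.q * P.pa ι := by have := P.A0_eq h; rw [hB] at this; simpa using this
  have h2 := Pr.lt_w h.1 h1
  refine ⟨h2, h1, le_antisymm ?_ (P.kap_pos h)⟩
  have h3 := P.Pr_single h2
  rw [← h1] at h3; exact (h3.spec h.1).2.2.2

/-- A presentation with the least number of digits, where `m = 0` if `B = 0`. -/
theorem A0_get' {ι : ℤ} (h : ι ∈ P.A0) : ∃ m, RepA p P.w m (P.kap ι) (P.pa ι) ∧
    ((P.pb ι = 0 ∧ P.ch ι = 0 ∧ m = 0) ∨ RepB p m (P.ch ι) (P.pb ι)) := by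
  by_cases hB : P.pb ι = 0
  · obtain ⟨h1, h2, h3⟩ := P.A0_get_of_pb h hB
    exact ⟨0, by rw [h3]; exact P.RepA_single h1, Or.inl ⟨hB, (P.ch_eq_zero_iff h).2 hB, rfl⟩⟩
  · obtain ⟨m, h1, h2, h3, h4, h5⟩ := P.A0_get h
    grind

theorem kap_le {ι : ℤ} (h : ι ∈ P.A0) : P.kap ι ≤ ustar p := by
  obtain ⟨m, h⟩ := P.A0_get h; exact h.2.1

theorem single_spec {A : ℕ} (h : (A : ℝ) < P.w) (hA : P.q * A ≤ P.b * (p - 1)) :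
    (P.q * A : ℤ) ∈ P.A0 ∧ P.pa (P.q * A) = A ∧ P.pb (P.q * A) = 0 ∧ P.ch (P.q * A) = 0 ∧
      P.kap (P.q * A) = 1 := by
  have h1 : |(P.q * A : ℤ)| ≤ P.b * ((p : ℤ) - 1) := by
    rw [abs_of_nonneg (by positivity)]
    have : ((P.q * A : ℕ) : ℤ) ≤ ((P.b * (p - 1) : ℕ) : ℤ) := by exact_mod_cast hA
    rw [Nat.cast_mul, Nat.cast_mul, Nat.cast_sub hp.out.one_le] at this; exact_mod_cast this
  have h2 := P.Pr_single h
  have h3 := h2.spec h1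
  have h4 := h2.mem_A0 h1
  exact ⟨h4, h3.1, h3.2.1, h3.2.2.1, le_antisymm h3.2.2.2 (P.kap_pos h4)⟩

theorem zero_spec : (0 : ℤ) ∈ P.A0 ∧ P.pa 0 = 0 ∧ P.pb 0 = 0 ∧ P.ch 0 = 0 ∧ P.kap 0 = 1 := by
  have := P.single_spec (A := 0) (by simpa using P.w_pos) (by simp)
  simpa using this

theorem abs_le_of_abs_mul_le {ι : ℤ} (h : |(p : ℤ) * ι| ≤ P.b * ((p : ℤ) - 1)) :
    |ι| ≤ P.b * ((p : ℤ) - 1) := by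
  refine le_trans ?_ h
  rw [abs_mul, Nat.abs_cast]
  have : (1 : ℤ) ≤ p := by exact_mod_cast hp.out.one_le
  nlinarith [abs_nonneg ι]

/-- If `p` divides `p^m α` and `p^m β / r^*`, the presentation can be divided by `p`. -/
theorem A0_div {ι : ℤ} (h : ι ∈ P.A0) (ha : p ∣ P.pa ι) (hb : p ∣ P.pb ι) :
    ∃ i, ι = p * i ∧ i ∈ P.A0 ∧ P.kap i ≤ P.kap ι := by
  obtain ⟨A, hA⟩ := ha
  obtain ⟨B, hB⟩ := hb
  have he := P.A0_eq h
  refine ⟨P.q * A - P.b * B, ?_, ?_⟩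
  · rw [he, hA, hB]; push_cast; ring
  have hi : |(P.q * A - P.b * B : ℤ)| ≤ P.b * ((p : ℤ) - 1) := by
    refine P.abs_le_of_abs_mul_le ?_
    have : (p : ℤ) * (P.q * A - P.b * B) = ι := by rw [he, hA, hB]; push_cast; ring
    rw [this]; exact h.1
  obtain ⟨m, h1, h2⟩ := P.A0_get' h
  rcases h2 with ⟨h2, h3, rfl⟩ | h2
  · have hB0 : B = 0 := by
      rw [h2] at hB
      have := hp.out.pos
      rcases Nat.mul_eq_zero.1 hB.symm with h | h <;> omega
    subst hB0
    have h4 := (P.A0_get_of_pb h h2)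
    have h5 : P.Pr (P.q * A - P.b * (0 : ℕ)) 0 1 0 A 0 := by
      have : (A : ℝ) < P.w := by
        refine lt_of_le_of_lt ?_ h4.1
        rw [hA]; exact_mod_cast Nat.le_mul_of_pos_left A hp.out.pos
      simpa using P.Pr_single this
    exact ⟨h5.mem_A0 hi, by rw [h4.2.2]; exact (h5.spec hi).2.2.2⟩
  · rw [hB] at h2
    obtain ⟨m', rfl, h6⟩ := h2.div hp.out.two_le
    rw [hA] at h1
    have h7 : P.Pr (P.q * A - P.b * B) m' (P.kap ι) (P.ch ι) A B :=
      ⟨P.kap_pos h, P.kap_le h, h1.div hp.out.two_le, Or.inr h6, rfl⟩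
    exact ⟨h7.mem_A0 hi, (h7.spec hi).2.2.2⟩

/-- `𝔄⁰` is stable under multiplication by `p` within the bound on the absolute values. -/
theorem A0_mul {ι : ℤ} (h : ι ∈ P.A0) (hι : |(p : ℤ) * ι| ≤ P.b * ((p : ℤ) - 1)) :
    (p : ℤ) * ι ∈ P.A0 ∧ P.pa (p * ι) = p * P.pa ι ∧ P.pb (p * ι) = p * P.pb ι ∧
      P.ch (p * ι) = P.ch ι ∧ P.kap (p * ι) = P.kap ι := by
  have he := P.A0_eq h
  obtain ⟨m, h1, h2⟩ := P.A0_get' h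
  have h3 : P.Pr (p * ι) (m + 1) (P.kap ι) (P.ch ι) (p * P.pa ι) (p * P.pb ι) := by
    refine ⟨P.kap_pos h, P.kap_le h, h1.mul, ?_, ?_⟩
    · rcases h2 with ⟨h2, h3, rfl⟩ | h2
      · grind
      · exact Or.inr h2.mul
    · grind
  have h4 := h3.spec hι
  have h5 := h3.mem_A0 hι
  refine ⟨h5, h4.1, h4.2.1, h4.2.2.1, le_antisymm h4.2.2.2 ?_⟩
  obtain ⟨i, h6, h7, h8⟩ := P.A0_div h5 (by rw [h4.1]; exact Dvd.intro _ rfl)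
    (by rw [h4.2.1]; exact Dvd.intro _ rfl)
  have hp0 : (p : ℤ) ≠ 0 := by exact_mod_cast hp.out.ne_zero
  rw [← mul_left_cancel₀ hp0 h6] at h8; exact h8

/-- Presentations can be added, as long as the bounds on `|ι|`, `ch` and `κ` are respected. -/
theorem A0_add {ι ι' : ℤ} (h : ι ∈ P.A0) (h' : ι' ∈ P.A0)
    (hι : |ι + ι'| ≤ P.b * ((p : ℤ) - 1)) (hc : P.ch ι + P.ch ι' < p)
    (hk : P.kap ι + P.kap ι' ≤ ustar p) :
    ι + ι' ∈ P.A0 ∧ P.pa (ι + ι') = P.pa ι + P.pa ι' ∧ P.pb (ι + ι') = P.pb ι + P.pb ι' ∧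
      P.ch (ι + ι') = P.ch ι + P.ch ι' ∧ P.kap (ι + ι') ≤ P.kap ι + P.kap ι' := by
  have he := P.A0_eq h
  have he' := P.A0_eq h'
  obtain ⟨m, h1, h2⟩ := P.A0_get' h
  obtain ⟨m', h1', h2'⟩ := P.A0_get' h'
  have h3 : P.Pr (ι + ι') (max m m') (P.kap ι + P.kap ι') (P.ch ι + P.ch ι')
      (P.pa ι + P.pa ι') (P.pb ι + P.pb ι') := by
    refine ⟨Nat.le_add_right_of_le (P.kap_pos h), hk, h1.add h1', ?_, ?_⟩
    · rcases h2 with ⟨h2, h3, rfl⟩ | h2 <;> rcases h2' with ⟨h2', h3', rfl⟩ | h2'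
      · left; omega
      · grind
      · grind
      · right; exact h2.add h2' hc
    · grind
  exact ⟨h3.mem_A0 hι, (h3.spec hι).1, (h3.spec hι).2.1, (h3.spec hι).2.2.1, (h3.spec hι).2.2.2⟩

theorem RepB_one : RepB p 0 1 1 := ⟨[0], rfl, hp.out.one_lt, by simp, by simp, by simp⟩

theorem A0_sub_b {ι : ℤ} (h : ι ∈ P.A0) (hι : |ι - P.b| ≤ P.b * ((p : ℤ) - 1))
    (hc : P.ch ι + 1 < p) :
    ι - P.b ∈ P.A0 ∧ P.pa (ι - P.b) = P.pa ι ∧ P.pb (ι - P.b) = P.pb ι + 1 ∧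
      P.ch (ι - P.b) = P.ch ι + 1 ∧ P.kap (ι - P.b) ≤ P.kap ι := by
  have he := P.A0_eq h
  obtain ⟨m, h1, h2⟩ := P.A0_get' h
  have h3 : P.Pr (ι - P.b) m (P.kap ι) (P.ch ι + 1) (P.pa ι) (P.pb ι + 1) := by
    refine ⟨P.kap_pos h, P.kap_le h, h1, Or.inr ?_, ?_⟩
    · rcases h2 with ⟨h2, h3, rfl⟩ | h2
      · rw [h2, h3]; exact RepB_one
      · have := h2.add RepB_one hc
        grind
    · grind
  exact ⟨h3.mem_A0 hι, (h3.spec hι).1, (h3.spec hι).2.1, (h3.spec hι).2.2.1, (h3.spec hι).2.2.2⟩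

theorem mul_notMem_of_primitive {i : ℤ} (h : i ∈ P.A0) (h' : (p : ℤ) * i ∈ P.A0) :
    Nat.gcd (Nat.gcd (P.pa (p * i)) (P.pb (p * i))) p ≠ 1 := by
  have hm := P.A0_mul h h'.1
  rw [hm.2.1, hm.2.2.1]
  intro h1
  have : p ∣ Nat.gcd (Nat.gcd (p * P.pa i) (p * P.pb i)) p :=
    Nat.dvd_gcd (Nat.dvd_gcd (Dvd.intro _ rfl) (Dvd.intro _ rfl)) dvd_rfl
  rw [h1] at this; exact hp.out.one_lt.ne' (Nat.dvd_one.1 this)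

theorem w0_le_iff {ι : ℤ} {s : ℕ} : P.w0 ι ≤ s ↔ ι < s * P.b := by
  have hb := P.b_pos_int
  have hne : {s : ℕ | ι < s * P.b}.Nonempty := by
    refine ⟨ι.toNat + 1, ?_⟩
    have := self_le_toNat ι
    change ι < ((ι.toNat + 1 : ℕ) : ℤ) * P.b
    push_cast; nlinarith
  constructor
  · intro h
    have h1 : ι < (P.w0 ι : ℤ) * P.b := sInf_mem hne
    have h2 : (P.w0 ι : ℤ) ≤ s := by exact_mod_cast h
    nlinarith
  · intro h; exact Nat.sInf_le h

theorem w0_pos {ι : ℤ} (h : 0 ≤ ι) : 1 ≤ P.w0 ι := by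
  by_contra h0
  have := (P.w0_le_iff (ι := ι) (s := 0)).1 (by omega)
  simp at this; omega

theorem lt_of_q_mul_lt {s a : ℕ} (h : P.q * a < s * P.b) : (a : ℝ) < s * P.v₀ := by
  have hq : (0 : ℝ) < P.q := by exact_mod_cast P.q_pos
  have h2 : (P.b : ℝ) < P.q * P.v₀ := by
    have h3 := P.rStar_lt'
    rw [P.b_eq]
    change (P.r : ℝ) * _ < _ at h3
    have h4 : (P.q : ℝ) = (p : ℝ) ^ P.M := by unfold q; push_cast; rfl
    rw [← h4] at h3 ⊢
    have h5 := mul_lt_mul_of_pos_left h3 hq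
    have h6 : (P.q : ℝ) * (P.r * (1 - 1 / P.q)) = P.r * (P.q - 1) := by field_simp
    rw [h6] at h5; exact h5
  have h1 : (P.q * a : ℝ) < s * P.b := by exact_mod_cast h
  have : (P.q : ℝ) * a < P.q * (s * P.v₀) := by
    have : (0 : ℝ) ≤ s := Nat.cast_nonneg s
    nlinarith
  exact lt_of_mul_lt_mul_left this hq.le

end Params

/-! ### Derivations of subquotients -/

section SubQuot
variable {p : ℕ} {M : Type*} [LieRing M] [LieAlgebra (ZMod p) M]

/-- The operator induced on a subquotient. -/
def subQuotMap (S : LieSubalgebra (ZMod p) M) (W : LieIdeal (ZMod p) S) (φ : M →ₗ[ZMod p] M)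
    (hS : ∀ x ∈ S, φ x ∈ S)
    (hW : ∀ x (hx : x ∈ S), (⟨x, hx⟩ : S) ∈ W → (⟨φ x, hS x hx⟩ : S) ∈ W) :
    (S ⧸ W) →ₗ[ZMod p] (S ⧸ W) :=
  Submodule.mapQ W.toSubmodule W.toSubmodule
    ({ toFun := fun x => ⟨φ x.1, hS x.1 x.2⟩
       map_add' := fun x y => Subtype.ext (φ.map_add x.1 y.1)
       map_smul' := fun c x => Subtype.ext (φ.map_smul c x.1) } : S →ₗ[ZMod p] S)
    (fun x hx => hW x.1 x.2 hx)

/-- An operator which is a derivation of a Lie subalgebra modulo an ideal of it. -/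
def subQuotDer (S : LieSubalgebra (ZMod p) M) (W : LieIdeal (ZMod p) S) (φ : M →ₗ[ZMod p] M)
    (hS : ∀ x ∈ S, φ x ∈ S)
    (hW : ∀ x (hx : x ∈ S), (⟨x, hx⟩ : S) ∈ W → (⟨φ x, hS x hx⟩ : S) ∈ W)
    (hl : ∀ x (hx : x ∈ S) y (hy : y ∈ S), (⟨φ ⁅x, y⁆, hS _ (S.lie_mem hx hy)⟩ : S) -
        (⁅(⟨x, hx⟩ : S), ⟨φ y, hS y hy⟩⁆ - ⁅(⟨y, hy⟩ : S), ⟨φ x, hS x hx⟩⁆) ∈ W) :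
    LieDerivation (ZMod p) (S ⧸ W) (S ⧸ W) where
  toLinearMap := subQuotMap S W φ hS hW
  leibniz' := by rintro ⟨⟨x, hx⟩⟩ ⟨⟨y, hy⟩⟩; exact (Submodule.Quotient.eq _).2 (hl x hx y hy)

end SubQuot

/-! ### The modules of special elements -/

theorem le_ustar {p : ℕ} (hp : 2 ≤ p) {m s : ℕ} (hm : m + 2 ≤ p) (hs : s + 1 ≤ p) :
    ((p : ℤ) - 3) * m + s ≤ ustar p := by
  have h10 : (ustar p : ℤ) = ((p : ℤ) - 1) * (p - 2) + 1 := by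
    unfold ustar
    push_cast [Nat.cast_sub (show 1 ≤ p by omega), Nat.cast_sub hp]; ring
  rw [h10]
  rcases hp.eq_or_lt with h | h
  · subst h
    push_cast; omega
  · obtain ⟨n, rfl⟩ := exists_eq_add_of_le (show 3 ≤ p from h)
    push_cast
    have h1 : ((n * m : ℕ) : ℤ) ≤ (n * (n + 1) : ℕ) := by
      exact_mod_cast Nat.mul_le_mul_left n (show m ≤ n + 1 by omega)
    push_cast at h1
    have h2 : (s : ℤ) ≤ n + 2 := by omega
    have h3 : (0 : ℤ) ≤ n := by positivity
    nlinarith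

section Families
variable (P)
variable (f : P.LDag →ₗ⁅ZMod p⁆ g)

omit [Finite k] in
theorem Params.one_le_wDag (x : Gen P.Ap (deg p k)) : 1 ≤ P.wDag x.index := by
  have : 0 ≤ x.index := by
    rcases x with _ | ⟨x, i⟩
    · exact le_rfl
    · exact x.2.2.1.le
  have := P.w0_pos this
  unfold Params.wDag; omega

omit [Finite k] in
theorem Params.one_le_wt (x : Gen (Params.Zp p) (deg p k)) : 1 ≤ P.wt x.index := Nat.succ_le_succ (Nat.zero_le _)

instance : NilLt p P.LDag := TLie.nilLt hp.out.pos P.one_le_wDag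
instance : NilLt p P.LBar := TLie.nilLt hp.out.pos P.one_le_wt

/-- The image in `g` of the ideal of weight `s`. -/
def fil (s : ℕ) : Submodule Fp g := (P.filtDag s).map (f : P.LDag →ₗ[Fp] g)

/-- The image in `g` of the part of degree `m` of the ideal of weight `s`. -/
def filG (s m : ℕ) : Submodule Fp g :=
  (P.filtDag s ⊓ P.gradDag m).map (f : P.LDag →ₗ[Fp] g)

variable {P f}

theorem filG_le_fil {s m : ℕ} : filG P f s m ≤ fil P f s := map_mono inf_le_left

theorem fil_anti {s s' : ℕ} (h : s ≤ s') : fil P f s' ≤ fil P f s := map_mono (filt_anti h)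

theorem fil_eq_zero {s : ℕ} (h : p ≤ s) {l : g} (hl : l ∈ fil P f s) : l = 0 := by
  obtain ⟨x, hx, rfl⟩ := hl
  have hx' : x ∈ filt p P.Ap (deg p k) P.wDag s := hx
  rw [filt_eq_bot h] at hx'
  rw [(mem_bot _).1 hx']; exact map_zero _

theorem lie_mem_fil {s s' : ℕ} {l l' : g} (hl : l ∈ fil P f s) (hl' : l' ∈ fil P f s') :
    ⁅l, l'⁆ ∈ fil P f (s + s') := by
  obtain ⟨x, hx, rfl⟩ := hl
  obtain ⟨y, hy, rfl⟩ := hl'; exact ⟨⁅x, y⁆, lie_mem_filt hx hy, f.map_lie x y⟩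

theorem lie_mem_filG {s s' m m' : ℕ} {l l' : g} (hl : l ∈ filG P f s m)
    (hl' : l' ∈ filG P f s' m') : ⁅l, l'⁆ ∈ filG P f (s + s') (m + m') := by
  obtain ⟨x, hx, rfl⟩ := hl
  obtain ⟨y, hy, rfl⟩ := hl'
  exact ⟨⁅x, y⁆, ⟨lie_mem_filt hx.1 hy.1, lie_mem_grad hx.2 hy.2⟩, f.map_lie x y⟩

variable (P f)

/-- The condition `t^{-i} l ∈ t^{j b} 𝒩̄^†`. -/
def Nd (j : ℕ) (i : ℤ) (l : g) : Prop := ∃ s : ℕ, 1 ≤ s ∧ i + j * P.b < s * P.b ∧ l ∈ fil P f s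

/-- The condition that `t^{-i} l` is one of the generators of `𝒩̃^{sp}⟨j⟩`. -/
def Spd (j : ℕ) (i : ℤ) (l : g) : Prop := ∃ s m : ℕ, 1 ≤ s ∧ i ∈ P.A0 ∧
  i + P.ch i * P.b < s * P.b ∧ m + j ≤ P.ch i ∧ (P.kap i : ℤ) ≤ ((p : ℤ) - 3) * m + s ∧
  l ∈ filG P f s m

/-- The monomials of `𝒩̃^{sp}⟨j⟩` and those of the kernel of the projection to `𝒩̃^†`. -/
def Sd (j : ℕ) (i : ℤ) (l : g) : Prop := Spd P f j i l ∨ Nd P f (p - 1) i l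

variable {P f}

theorem Nd.zero (j : ℕ) (i : ℤ) : Nd P f j i 0 := by
  have hb := P.b_pos_int
  refine ⟨(i + j * P.b).toNat + 1, by omega, ?_, zero_mem _⟩
  have := self_le_toNat (i + j * P.b)
  push_cast; nlinarith

theorem Nd.anti {j j' : ℕ} {i i' : ℤ} {l : g} (h : Nd P f j i l) (h' : i' + j' * P.b ≤ i + j * P.b) :
    Nd P f j' i' l := by
  obtain ⟨s, h1, h2, h3⟩ := h; exact ⟨s, h1, lt_of_le_of_lt h' h2, h3⟩

theorem Nd.lie {j j' : ℕ} {i i' : ℤ} {l l' : g} (h : Nd P f j i l) (h' : Nd P f j' i' l') :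
    Nd P f (j + j') (i + i') ⁅l, l'⁆ := by
  obtain ⟨s, h1, h2, h3⟩ := h
  obtain ⟨s', h1', h2', h3'⟩ := h'
  refine ⟨s + s', by omega, ?_, lie_mem_fil h3 h3'⟩
  push_cast; linarith

theorem Nd.neg {i : ℤ} {l : g} (h : Nd P f (p - 1) i l) : i < 0 ∨ l = 0 := by
  obtain ⟨s, h1, h2, h3⟩ := h
  by_cases hs : p ≤ s
  · exact Or.inr (fil_eq_zero hs h3)
  · left
    have hb := P.b_pos_int
    have : (s : ℤ) ≤ (p - 1 : ℕ) := by omega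
    nlinarith

theorem Nd.mul {i : ℤ} {l : g} (h : Nd P f (p - 1) i l) : Nd P f (p - 1) (p * i) l := by
  rcases h.neg with hi | rfl
  · refine h.anti ?_
    have : (1 : ℤ) ≤ p := by exact_mod_cast hp.out.one_le
    nlinarith
  · exact Nd.zero _ _

theorem Spd.nd {j : ℕ} {i : ℤ} {l : g} (h : Spd P f j i l) : Nd P f (P.ch i) i l := by
  obtain ⟨s, m, h1, h2, h3, h4, h5, h6⟩ := h; exact ⟨s, h1, h3, filG_le_fil h6⟩

theorem Spd.nd_zero {j : ℕ} {i : ℤ} {l : g} (h : Spd P f j i l) : Nd P f 0 i l := by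
  refine h.nd.anti ?_
  have : (0 : ℤ) ≤ P.ch i * P.b := by positivity
  push_cast; linarith

theorem Spd.nd_of_le {j : ℕ} {i : ℤ} {l : g} (h : Spd P f j i l) (hc : p - 1 ≤ P.ch i) :
    Nd P f (p - 1) i l := by
  refine h.nd.anti ?_
  have := P.b_pos_int
  have : ((p - 1 : ℕ) : ℤ) ≤ P.ch i := by exact_mod_cast hc
  nlinarith

theorem Sd.nd_zero {j : ℕ} {i : ℤ} {l : g} (h : Sd P f j i l) : Nd P f 0 i l := by
  rcases h with h | h
  · exact h.nd_zero
  · refine h.anti ?_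
    have : (0 : ℤ) ≤ (p - 1 : ℕ) * P.b := by positivity
    push_cast at this ⊢; linarith

theorem Spd.anti {j j' : ℕ} {i : ℤ} {l : g} (h : Spd P f j i l) (hj : j' ≤ j) : Spd P f j' i l := by
  obtain ⟨s, m, h1, h2, h3, h4, h5, h6⟩ := h; exact ⟨s, m, h1, h2, h3, by omega, h5, h6⟩

theorem Sd.anti {j j' : ℕ} {i : ℤ} {l : g} (h : Sd P f j i l) (hj : j' ≤ j) : Sd P f j' i l :=
  h.imp (fun h => h.anti hj) id

theorem Nd.of_lt {i : ℤ} {l : g} {j : ℕ} (h : Nd P f j i l) {i' : ℤ}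
    (hi : i' ≤ -(P.b * ((p : ℤ) - 1))) : Nd P f (p - 1) i' l := by
  obtain ⟨s, h1, h2, h3⟩ := h
  refine ⟨s, h1, ?_, h3⟩
  have hb := P.b_pos_int
  have h4 : ((p - 1 : ℕ) : ℤ) = p - 1 := by rw [Nat.cast_sub hp.out.one_le]; rfl
  have : (1 : ℤ) ≤ s := by exact_mod_cast h1
  rw [h4]; nlinarith

theorem Spd.lie {j j' : ℕ} {i i' : ℤ} {l l' : g} (h : Spd P f j i l) (h' : Spd P f j' i' l') :
    Nd P f (p - 1) (i + i') ⁅l, l'⁆ ∨ (Spd P f (j + j') (i + i') ⁅l, l'⁆ ∧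
      P.pa (i + i') = P.pa i + P.pa i' ∧ P.ch (i + i') = P.ch i + P.ch i') := by
  have hN := h.nd_zero.lie h'.nd_zero
  have hN' := h.nd.lie h'.nd
  obtain ⟨s, m, h1, h2, h3, h4, h5, h6⟩ := h
  obtain ⟨s', m', h1', h2', h3', h4', h5', h6'⟩ := h'
  have hb := P.b_pos_int
  have hp2 := hp.out.two_le
  have hpc : ((p - 1 : ℕ) : ℤ) = p - 1 := by rw [Nat.cast_sub hp.out.one_le]; rfl
  by_cases hs : p ≤ s + s'
  · left
    rw [fil_eq_zero hs (lie_mem_fil (filG_le_fil h6) (filG_le_fil h6'))]; exact Nd.zero _ _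
  by_cases hc : p - 1 ≤ P.ch i + P.ch i'
  · left
    refine hN'.anti ?_
    have : ((p - 1 : ℕ) : ℤ) ≤ (P.ch i + P.ch i' : ℕ) := by exact_mod_cast hc
    nlinarith
  by_cases hlow : i + i' ≤ -(P.b * ((p : ℤ) - 1))
  · exact Or.inl (hN.of_lt hlow)
  right
  have hup : i + i' ≤ P.b * ((p : ℤ) - 1) := by
    have h7 : ((s + s' : ℕ) : ℤ) ≤ (p : ℤ) - 1 := by omega
    have h8 : (0 : ℤ) ≤ P.ch i * P.b := by positivity
    have h9 : (0 : ℤ) ≤ P.ch i' * P.b := by positivity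
    push_cast at h7; nlinarith
  have hk : P.kap i + P.kap i' ≤ ustar p := by
    have h7 : (P.kap i + P.kap i' : ℤ) ≤ ((p : ℤ) - 3) * (m + m') + (s + s') := by linarith
    have h8 := le_ustar hp2 (show m + m' + 2 ≤ p by omega) (show s + s' + 1 ≤ p by omega)
    push_cast at h8
    have : ((P.kap i + P.kap i' : ℕ) : ℤ) ≤ ustar p := by push_cast; linarith
    exact_mod_cast this
  obtain ⟨e1, e2, e3, e4, e5⟩ := P.A0_add h2 h2' (abs_le.2 ⟨by linarith, hup⟩) (by omega) hk
  refine ⟨⟨s + s', m + m', by omega, e1, ?_, by omega, ?_, lie_mem_filG h6 h6'⟩, e2, e4⟩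
  · rw [e4]; push_cast; linarith
  · have : (P.kap (i + i') : ℤ) ≤ P.kap i + P.kap i' := by exact_mod_cast e5
    push_cast; linarith

theorem Sd.lie {j j' : ℕ} {i i' : ℤ} {l l' : g} (h : Sd P f j i l) (h' : Sd P f j' i' l') :
    Sd P f (j + j') (i + i') ⁅l, l'⁆ := by
  rcases h with h | h
  · rcases h' with h' | h'
    · rcases h.lie h' with h1 | h1
      · exact Or.inr h1
      · exact Or.inl h1.1
    · right
      have := h.nd_zero.lie h'
      rwa [zero_add] at this
  · exact Or.inr (h.lie h'.nd_zero)

theorem Spd.sub_b {j : ℕ} {i : ℤ} {l : g} (h : Spd P f j i l) :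
    Nd P f (p - 1) (i - P.b) l ∨ (Spd P f (j + 1) (i - P.b) l ∧ i - P.b ∈ P.A0 ∧
      P.pa (i - P.b) = P.pa i ∧ P.ch (i - P.b) = P.ch i + 1) := by
  have hb := P.b_pos_int
  by_cases hc : p - 1 ≤ P.ch i
  · exact Or.inl ((h.nd_of_le hc).anti (by linarith))
  by_cases hlow : i - P.b ≤ -(P.b * ((p : ℤ) - 1))
  · exact Or.inl (h.nd_zero.of_lt hlow)
  right
  obtain ⟨s, m, h1, h2, h3, h4, h5, h6⟩ := h
  have hi := abs_le.1 (P.A0_abs h2)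
  obtain ⟨e1, e2, e3, e4, e5⟩ := P.A0_sub_b h2 (abs_le.2 ⟨by linarith, by linarith⟩) (by omega)
  refine ⟨⟨s, m, h1, e1, ?_, by omega, ?_, h6⟩, e1, e2, e4⟩
  · rw [e4]; push_cast; linarith
  · have : (P.kap (i - P.b) : ℤ) ≤ P.kap i := by exact_mod_cast e5
    linarith

theorem Sd.sub_b {j : ℕ} {i : ℤ} {l : g} (h : Sd P f j i l) : Sd P f (j + 1) (i - P.b) l := by
  rcases h with h | h
  · rcases h.sub_b with h1 | h1
    · exact Or.inr h1
    · exact Or.inl h1.1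
  · exact Or.inr (h.anti (by have := P.b_pos_int
                             linarith))

theorem Sd.top {i : ℤ} {l : g} (h : Sd P f (p - 1) i l) : Nd P f (p - 1) i l := by
  rcases h with h | h
  · refine h.nd_of_le ?_
    obtain ⟨s, m, h1, h2, h3, h4, h5, h6⟩ := h; omega
  · exact h

variable (P f)

open Classical in
/-- The function `p^m α` on `𝔄⁰`, extended by zero. -/
def paE (i : ℤ) : ℕ := if i ∈ P.A0 then P.pa i else 0

variable (p k g) in
/-- Multiplication by `t^n` on `L_𝒦`. -/
def shiftK (n : ℤ) : LK p k g →ₗ[ZMod p] LK p k g := rTensor g (mulLeft (ZMod p) (mon n (1 : k)))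

variable (g) in
/-- The operator `t^{-i} l ↦ ch(i) t^{-i} l`. -/
def thK : LK p k g →ₗ[Fp] LK p k g := rTensor g (diagK p P.ch)

variable (g) in
/-- The operator `t^{-ι} l ↦ (p^m α) t^{b-ι} l`. -/
def deK : LK p k g →ₗ[Fp] LK p k g := (shiftK p k g P.b) ∘ₗ rTensor g (diagK p (paE P))

/-- The Lie algebra of special elements. -/
def Spc : LieSubalgebra Fp (LK p k g) where
  toSubmodule := Dg k (Sd P f 0)
  lie_mem' hx hy := lie_mem_Dg (fun _ _ _ _ h h' => h.lie h') hx hy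

/-- The kernel of the projection to `𝒩̃^†`, as an ideal of the algebra of special elements. -/
def SpcKer : LieIdeal Fp (Spc P f) where
  toSubmodule := (Dg k (Nd P f (p - 1))).comap (Spc P f).toSubmodule.subtype
  lie_mem {x m} hm := by
    refine lie_mem_Dg (G := Sd P f 0) (fun i j l m h h' => ?_) x.2 hm
    have := h.nd_zero.lie h'
    rwa [zero_add] at this

/-- The algebra `𝒩̃^{sp}`. -/
abbrev SpQ : Type _ := Spc P f ⧸ SpcKer P f

variable {P f}

theorem thK_mt (i : ℤ) (c : k) (l : g) : thK P g (mt p i c l) = mt p i ((P.ch i : k) * c) l := by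
  change diagK p P.ch (mon (-i) c) ⊗ₜ l = _
  rw [diagK_mon, neg_neg]; rfl

theorem shiftK_mt (n i : ℤ) (c : k) (l : g) : shiftK p k g n (mt p i c l) = mt p (i - n) c l := by
  change (mon n 1 * mon (-i) c) ⊗ₜ l = _
  rw [mon_mul, one_mul, show n + -i = -(i - n) by ring]; rfl

theorem deK_mt (i : ℤ) (c : k) (l : g) :
    deK P g (mt p i c l) = mt p (i - P.b) ((paE P i : k) * c) l := by
  change shiftK p k g P.b (diagK p (paE P) (mon (-i) c) ⊗ₜ l) = _
  rw [diagK_mon, neg_neg]; exact shiftK_mt _ _ _ _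

theorem paE_of_mem {i : ℤ} (h : i ∈ P.A0) : paE P i = P.pa i := if_pos h

theorem Dg_Nd_le_Sd {j : ℕ} : Dg (p := p) k (Nd P f (p - 1)) ≤ Dg (p := p) k (Sd P f j) := Dg_mono fun _ _ => Or.inr

theorem thK_mem {G : ℤ → g → Prop} {x : LK p k g} (hx : x ∈ Dg k G) : thK P g x ∈ Dg k G :=
  map_mem_Dg _ (fun i c l h => by rw [thK_mt]; exact mt_mem_Dg h) hx

theorem deK_mem {j : ℕ} {x : LK p k g} (hx : x ∈ Dg k (Sd P f j)) :
    deK P g x ∈ Dg k (Sd P f (j + 1)) :=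
  map_mem_Dg _ (fun i c l h => by rw [deK_mt]; exact mt_mem_Dg h.sub_b) hx

theorem deK_mem' {x : LK p k g} (hx : x ∈ Dg k (Nd P f (p - 1))) :
    deK P g x ∈ Dg k (Nd P f (p - 1)) :=
  map_mem_Dg _ (fun i c l h => by
    rw [deK_mt]
    refine mt_mem_Dg (h.anti ?_)
    have := P.b_pos_int
    linarith) hx

theorem sigmaK_mem {x : LK p k g} (hx : x ∈ Dg k (Nd P f (p - 1))) :
    sigmaK p x ∈ Dg k (Nd P f (p - 1)) :=
  map_mem_Dg _ (fun i c l h => by rw [sigmaK_mt]; exact mt_mem_Dg h.mul) hx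

theorem lie_mem_Nd {j : ℕ} {x y : LK p k g} (hx : x ∈ Dg k (Sd P f j))
    (hy : y ∈ Dg k (Nd P f (p - 1))) : ⁅x, y⁆ ∈ Dg k (Nd P f (p - 1)) :=
  lie_mem_Dg (fun i i' l l' h h' => by
    have := h.nd_zero.lie h'
    rwa [zero_add] at this) hx hy

theorem lie_mem_Sd {j j' : ℕ} {x y : LK p k g} (hx : x ∈ Dg k (Sd P f j))
    (hy : y ∈ Dg k (Sd P f j')) : ⁅x, y⁆ ∈ Dg k (Sd P f (j + j')) :=
  lie_mem_Dg (fun i i' l l' h h' => h.lie h') hx hy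

theorem Sd_mono {j j' : ℕ} (h : j' ≤ j) : Dg (p := p) k (Sd P f j) ≤ Dg (p := p) k (Sd P f j') :=
  Dg_mono fun _ _ h' => h'.anti h

theorem Sd_zero {j : ℕ} {x : LK p k g} (hx : x ∈ Dg k (Sd P f j)) : x ∈ Dg k (Sd P f 0) :=
  Sd_mono (Nat.zero_le j) hx

theorem mt_add_left (i : ℤ) (c d : k) (l : g) : mt p i (c + d) l = mt p i c l + mt p i d l := by
  rw [← tneg_tmul, TensorProduct.add_tmul, map_add]; rfl

theorem mt_sub_left (i : ℤ) (c d : k) (l : g) : mt p i (c - d) l = mt p i c l - mt p i d l := by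
  rw [← tneg_tmul, TensorProduct.sub_tmul, map_sub]; rfl

theorem mt_neg (i : ℤ) (c : k) (l : g) : mt p i c (-l) = -mt p i c l := TensorProduct.tmul_neg _ _

/-- An additive function on the exponents gives a derivation modulo the kernel. -/
theorem leibniz_mem (φ : LK p k g →ₗ[ZMod p] LK p k g) (n : ℤ) (hn : 0 ≤ n) (v : ℤ → ℕ)
    (hφ : ∀ i c l, φ (mt p i c l) = mt p (i - n) ((v i : k) * c) l)
    (hv : ∀ i i' (l l' : g), Spd P f 0 i l → Spd P f 0 i' l' →
      Nd P f (p - 1) (i + i') ⁅l, l'⁆ ∨ v (i + i') = v i + v i')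
    {x y : LK p k g} (hx : x ∈ Dg k (Sd P f 0)) (hy : y ∈ Dg k (Sd P f 0)) :
    φ ⁅x, y⁆ - (⁅x, φ y⁆ - ⁅y, φ x⁆) ∈ Dg k (Nd P f (p - 1)) := by
  induction hx using Dg_induction with
  | h0 => simp
  | hadd a b _ _ ha hb =>
    have := add_mem ha hb
    convert this using 1
    simp only [add_lie, map_add, lie_add]; abel
  | hsmul c a _ ha =>
    have := smul_mem _ c ha
    convert this using 1
    simp only [smul_lie, map_smul, lie_smul, smul_sub]
  | hm i c l hl =>
    induction hy using Dg_induction with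
    | h0 => simp
    | hadd a b _ _ ha hb =>
      have := add_mem ha hb
      convert this using 1
      simp only [add_lie, map_add, lie_add]; abel
    | hsmul c a _ ha =>
      have := smul_mem _ c ha
      convert this using 1
      simp only [smul_lie, map_smul, lie_smul, smul_sub]
    | hm i' c' l' hl' =>
      have key : φ ⁅mt p i c l, mt p i' c' l'⁆ -
          (⁅mt p i c l, φ (mt p i' c' l')⁆ - ⁅mt p i' c' l', φ (mt p i c l)⁆) =
          mt p (i + i' - n) (((v (i + i') : k) - (v i + v i')) * (c * c')) ⁅l, l'⁆ := by
        rw [mt_lie, hφ, hφ, hφ, mt_lie, mt_lie, ← lie_skew l' l, mt_neg, sub_neg_eq_add,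
          show i' + (i - n) = i + i' - n by ring, show i + (i' - n) = i + i' - n by ring,
          ← mt_add_left, ← mt_sub_left]
        congr 1
        ring
      rw [key]
      have hle : i + i' - n + (p - 1 : ℕ) * P.b ≤ i + i' + (p - 1 : ℕ) * P.b := by linarith
      rcases hl with hl | hl
      · rcases hl' with hl' | hl'
        · rcases hv i i' l l' hl hl' with h | h
          · exact mt_mem_Dg (h.anti hle)
          · rw [h]
            push_cast
            rw [sub_self, zero_mul]
            have : mt p (i + i' - n) (0 : k) ⁅l, l'⁆ = 0 := by rw [← tneg_tmul, zero_tmul, map_zero]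
            rw [this]; exact zero_mem _
        · have := hl.nd_zero.lie hl'
          rw [zero_add] at this; exact mt_mem_Dg (this.anti hle)
      · exact mt_mem_Dg ((hl.lie hl'.nd_zero).anti hle)

end Families

section Families
variable {f : P.LDag →ₗ⁅ZMod p⁆ g}

theorem Dg_true {G : ℤ → g → Prop} {x : LK p k g} (hx : x ∈ Dg k G) :
    x ∈ Dg k (fun (_ : ℤ) (_ : g) => True) := Dg_mono (fun _ _ _ => trivial) hx

theorem co_thK {G : ℤ → g → Prop} {x : LK p k g} (hx : x ∈ Dg k G) (i : ℤ) :
    co p k i (thK P g x) = P.ch i • co p k i x := by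
  induction hx using Dg_induction with
  | h0 => simp
  | hadd a b _ _ ha hb => simp only [map_add, ha, hb, smul_add]
  | hsmul c a _ ha => simp only [map_smul, ha]; rw [smul_comm]
  | hm j c l hl =>
    rw [thK_mt, co_mt, co_mt]
    split_ifs with h
    · subst h
      rw [← nsmul_eq_mul, smul_tmul']
    · simp

theorem co_deK {G : ℤ → g → Prop} {x : LK p k g} (hx : x ∈ Dg k G) (i : ℤ) :
    co p k i (deK P g x) = paE P (i + P.b) • co p k (i + P.b) x := by
  induction hx using Dg_induction with
  | h0 => simp
  | hadd a b _ _ ha hb => simp only [map_add, ha, hb, smul_add]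
  | hsmul c a _ ha => simp only [map_smul, ha]; rw [smul_comm]
  | hm j c l hl =>
    rw [deK_mt, co_mt, co_mt]
    by_cases h : i + P.b = j
    · subst h
      rw [if_pos (by ring), if_pos rfl, ← nsmul_eq_mul, smul_tmul']
    · rw [if_neg (fun h' => h (by rw [h']; ring)), if_neg h, smul_zero]

theorem frobT_mem_kG {G : g → Prop} {x : k ⊗[Fp] g} (hx : x ∈ kG k G) : frobT x ∈ kG k G := by
  induction hx using span_induction with
  | mem x h =>
    obtain ⟨c, l, hl, rfl⟩ := h
    rw [frobT_tmul]; exact subset_span ⟨_, l, hl, rfl⟩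
  | _ => simp_all [add_mem, smul_mem]

theorem sigmaK_true {G : ℤ → g → Prop} {x : LK p k g} (hx : x ∈ Dg k G) :
    sigmaK p x ∈ Dg k (fun (_ : ℤ) (_ : g) => True) :=
  map_mem_Dg _ (fun i c l _ => by rw [sigmaK_mt]; exact mt_mem_Dg trivial) hx

theorem deK_true {G : ℤ → g → Prop} {x : LK p k g} (hx : x ∈ Dg k G) :
    deK P g x ∈ Dg k (fun (_ : ℤ) (_ : g) => True) :=
  map_mem_Dg _ (fun i c l _ => by rw [deK_mt]; exact mt_mem_Dg trivial) hx

theorem Sd.nd_of_notMem {j : ℕ} {i : ℤ} {l : g} (h : Sd P f j i l) (hi : i ∉ P.A0) :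
    Nd P f (p - 1) i l := by
  rcases h with h | h
  · obtain ⟨s, m, h1, h2, -⟩ := h; exact absurd h2 hi
  · exact h

theorem sigmaK_thK_sub {x : LK p k g} (hx : x ∈ Dg k (Sd P f 0))
    (hx' : sigmaK p x ∈ Dg k (Sd P f 0)) :
    sigmaK p (thK P g x) - thK P g (sigmaK p x) ∈ Dg k (Nd P f (p - 1)) := by
  refine (mem_Dg_iff_co (sub_mem (sigmaK_true (thK_mem hx)) (thK_mem (sigmaK_true hx)))).2 ?_
  intro j
  rw [map_sub, co_thK hx']
  by_cases hj : (p : ℤ) ∣ j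
  · obtain ⟨i, rfl⟩ := hj
    rw [co_sigmaK (thK_mem hx), co_sigmaK hx, co_thK hx, map_nsmul]
    by_cases hi : i ∈ P.A0
    · by_cases hi' : (p : ℤ) * i ∈ P.A0
      · rw [(P.A0_mul hi hi'.1).2.2.2.1, sub_self]; exact zero_mem _
      · have h1 := co_mem_kG hx' (p * i)
        rw [co_sigmaK hx] at h1
        have h2 := kG_mono (fun l (hl : Sd P f 0 (p * i) l) => hl.nd_of_notMem hi') h1
        exact sub_mem (nsmul_mem h2 _) (nsmul_mem h2 _)
    · have h2 := kG_mono (fun l (hl : Sd P f 0 i l) => (hl.nd_of_notMem hi).mul)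
        (frobT_mem_kG (co_mem_kG hx i))
      exact sub_mem (nsmul_mem h2 _) (nsmul_mem h2 _)
  · rw [co_sigmaK_of_not_dvd (thK_mem hx) hj, co_sigmaK_of_not_dvd hx hj]; simp

theorem p_nsmul_eq_zero (x : k ⊗[Fp] g) : p • x = 0 := by
  rw [← Nat.cast_smul_eq_nsmul Fp, CharP.cast_eq_zero, zero_smul]

theorem deK_sigmaK {x : LK p k g} (hx : x ∈ Dg k (Sd P f 0)) :
    deK P g (sigmaK p x) ∈ Dg k (Nd P f (p - 1)) := by
  refine (mem_Dg_iff_co (deK_true (sigmaK_true hx))).2 ?_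
  intro j
  rw [co_deK (sigmaK_true hx)]
  by_cases hj : (p : ℤ) ∣ j + P.b
  · obtain ⟨i, hi⟩ := hj
    rw [hi, co_sigmaK hx]
    by_cases h1 : (p : ℤ) * i ∈ P.A0
    · by_cases h2 : i ∈ P.A0
      · rw [paE_of_mem h1, (P.A0_mul h2 h1.1).2.1, mul_comm, mul_nsmul, p_nsmul_eq_zero]
        exact zero_mem _
      · refine nsmul_mem (kG_mono (fun l (hl : Sd P f 0 i l) => ?_)
          (frobT_mem_kG (co_mem_kG hx i))) _
        refine (hl.nd_of_notMem h2).mul.anti ?_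
        have := P.b_pos_int
        linarith
    · rw [paE, if_neg h1, zero_smul]; exact zero_mem _
  · rw [co_sigmaK_of_not_dvd hx hj, smul_zero]; exact zero_mem _

theorem sigmaK_deK {x : LK p k g} (hx : x ∈ Dg k (Sd P f 0)) (hx' : sigmaK p x ∈ Dg k (Sd P f 0)) :
    sigmaK p (deK P g x) ∈ Dg k (Nd P f (p - 1)) := by
  refine (mem_Dg_iff_co (sigmaK_true (deK_true hx))).2 ?_
  intro j
  by_cases hj : (p : ℤ) ∣ j
  · obtain ⟨i, rfl⟩ := hj
    rw [co_sigmaK (deK_true hx), co_deK hx, map_nsmul, ← co_sigmaK hx]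
    refine nsmul_mem (kG_mono (fun l (hl : Sd P f 0 _ l) => ?_) (co_mem_kG hx' _)) _
    refine hl.nd_zero.anti ?_
    rw [Nat.cast_sub hp.out.one_le]
    push_cast
    have := P.b_pos_int
    nlinarith
  · rw [co_sigmaK_of_not_dvd (deK_true hx) hj]; exact zero_mem _

/-! ### The Lie algebra of special elements modulo the kernel -/

/-- The class of a special element. -/
def spq (x : LK p k g) (hx : x ∈ Dg k (Sd P f 0)) : SpQ P f :=
  LieSubmodule.Quotient.mk (N := SpcKer P f) (⟨x, hx⟩ : Spc P f)

theorem spq_eq_iff {x y : LK p k g} {hx : x ∈ Dg k (Sd P f 0)} {hy : y ∈ Dg k (Sd P f 0)} :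
    spq x hx = spq y hy ↔ x - y ∈ Dg k (Nd P f (p - 1)) :=
  Submodule.Quotient.eq (SpcKer P f).toSubmodule

theorem spq_eq_zero {x : LK p k g} {hx : x ∈ Dg k (Sd P f 0)} :
    spq x hx = 0 ↔ x ∈ Dg k (Nd P f (p - 1)) :=
  mk_eq_zero' (N := SpcKer P f)

theorem spq_ind {Q : SpQ P f → Prop} (h : ∀ x hx, Q (spq x hx)) (u : SpQ P f) : Q u := by
  obtain ⟨⟨x, hx⟩⟩ := u; exact h x hx

theorem spq_neg {x : LK p k g} (hx : x ∈ Dg k (Sd P f 0)) : -spq x hx = spq (-x) (neg_mem hx) := rfl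

theorem spq_sub {x y : LK p k g} (hx : x ∈ Dg k (Sd P f 0)) (hy : y ∈ Dg k (Sd P f 0)) :
    spq x hx - spq y hy = spq (x - y) (sub_mem hx hy) := rfl

theorem spq_smul {x : LK p k g} (hx : x ∈ Dg k (Sd P f 0)) (c : Fp) :
    c • spq x hx = spq (c • x) (smul_mem _ c hx) := rfl

theorem thK_derK {x y : LK p k g} (hx : x ∈ Dg k (Sd P f 0)) (hy : y ∈ Dg k (Sd P f 0)) :
    thK P g ⁅x, y⁆ - (⁅x, thK P g y⁆ - ⁅y, thK P g x⁆) ∈ Dg k (Nd P f (p - 1)) := by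
  refine leibniz_mem (thK P g) 0 le_rfl P.ch (fun i c l => ?_) (fun i i' l l' h h' => ?_) hx hy
  · rw [thK_mt, sub_zero]
  · exact (h.lie h').imp_right fun h => h.2.2

theorem deK_derK {x y : LK p k g} (hx : x ∈ Dg k (Sd P f 0)) (hy : y ∈ Dg k (Sd P f 0)) :
    deK P g ⁅x, y⁆ - (⁅x, deK P g y⁆ - ⁅y, deK P g x⁆) ∈ Dg k (Nd P f (p - 1)) := by
  refine leibniz_mem (deK P g) P.b (by positivity) (paE P) deK_mt (fun i i' l l' h h' => ?_) hx hy
  refine (h.lie h').imp_right fun h1 => ?_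
  obtain ⟨⟨-, -, -, h2, -⟩, h3, -⟩ := h1
  obtain ⟨-, -, -, h4, -⟩ := h
  obtain ⟨-, -, -, h5, -⟩ := h'
  rw [paE_of_mem h2, paE_of_mem h4, paE_of_mem h5, h3]

variable (P f) in
/-- The degree derivation. -/
def thQ : LieDerivation Fp (SpQ P f) (SpQ P f) :=
  subQuotDer (Spc P f) (SpcKer P f) (thK P g) (fun _ hx => thK_mem hx)
    (fun x _ hx => thK_mem (G := Nd P f (p - 1)) (x := x) hx) (fun _ hx _ hy => thK_derK hx hy)

variable (P f) in
/-- The derivation `t^{-ι} l ↦ (p^m α) t^{b-ι} l`. -/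
def deQ : LieDerivation Fp (SpQ P f) (SpQ P f) :=
  subQuotDer (Spc P f) (SpcKer P f) (deK P g) (fun _ hx => Sd_zero (deK_mem hx))
    (fun x _ hx => deK_mem' (x := x) hx) (fun _ hx _ hy => deK_derK hx hy)

theorem thQ_spq {x : LK p k g} (hx : x ∈ Dg k (Sd P f 0)) :
    thQ P f (spq x hx) = spq (thK P g x) (thK_mem hx) := rfl

theorem mt_zero_left (i : ℤ) (l : g) : mt p i (0 : k) l = 0 := by
  rw [← tneg_tmul, zero_tmul, map_zero]

theorem thK_deK_sub {x : LK p k g} (hx : x ∈ Dg k (Sd P f 0)) :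
    thK P g (deK P g x) - (deK P g (thK P g x) + deK P g x) ∈ Dg k (Nd P f (p - 1)) := by
  induction hx using Dg_induction with
  | h0 => simp
  | hadd a b _ _ ha hb =>
    have := add_mem ha hb
    convert this using 1
    simp only [map_add]; abel
  | hsmul c a _ ha =>
    have := smul_mem _ c ha
    convert this using 1
    simp only [map_smul, smul_sub, smul_add]
  | hm i c l hl =>
    rw [deK_mt, thK_mt, thK_mt, deK_mt, ← mt_add_left, ← mt_sub_left]
    rcases hl with hl | hl
    · rcases hl.sub_b with h | h
      · exact mt_mem_Dg h
      · rw [h.2.2.2]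
        have : ((P.ch i + 1 : ℕ) : k) * ((paE P i : k) * c) -
            ((paE P i : k) * ((P.ch i : k) * c) + (paE P i : k) * c) = 0 := by
          push_cast; ring
        rw [this]
        rw [mt_zero_left]; exact zero_mem _
    · exact mt_mem_Dg (hl.anti (by have := P.b_pos_int
                                   linarith))

theorem thK_pow_sub {x : LK p k g} (hx : x ∈ Dg k (Sd P f 1)) :
    ((thK P g) ^ (p - 1)) x - x ∈ Dg k (Nd P f (p - 1)) := by
  induction hx using Dg_induction with
  | h0 => simp
  | hadd a b _ _ ha hb =>
    have := add_mem ha hb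
    convert this using 1
    simp only [map_add]; abel
  | hsmul c a _ ha =>
    have := smul_mem _ c ha
    convert this using 1
    simp only [map_smul, smul_sub]
  | hm i c l hl =>
    have hpow : ∀ n, ((thK P g) ^ n) (mt p i c l) = mt p i ((P.ch i : k) ^ n * c) l := by
      intro n
      induction n with
      | zero => simp
      | succ n ih => rw [pow_succ', Module.End.mul_apply, ih, thK_mt, pow_succ', mul_assoc]
    rw [hpow, ← mt_sub_left]
    rcases hl with hl | hl
    · obtain ⟨s, m, h1, h2, h3, h4, -⟩ := hl
      have h5 := P.ch_lt h2
      have h6 : (P.ch i : k) ^ (p - 1) = 1 := by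
        have h7 : (P.ch i : Fp) ≠ 0 := by
          rw [Ne, ZMod.natCast_eq_zero_iff]
          intro hd
          have := Nat.le_of_dvd (by omega) hd
          omega
        have := congrArg (algebraMap Fp k) (ZMod.pow_card_sub_one_eq_one h7)
        simpa using this
      rw [h6, one_mul, sub_self]
      have : mt p i (0 : k) l = 0 := by rw [← tneg_tmul, zero_tmul, map_zero]
      rw [this]; exact zero_mem _
    · exact mt_mem_Dg hl

variable (P f) in
/-- The data for comparing `Ω_γ` with inner automorphisms of the algebra of special elements;
here `Γ` is the graph of `σ` on the `c` with `c, σ c ∈ 𝒩̃^{sp}⟨1⟩`. -/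
def conjData : ConjData p (SpQ P f) where
  θ := thQ P f
  Δ := deQ P f
  F j :=
    { carrier := {u | ∃ x, ∃ hx : x ∈ Dg k (Sd P f j), u = spq x (Sd_zero hx)}
      add_mem' := by rintro _ _ ⟨x, hx, rfl⟩ ⟨y, hy, rfl⟩; exact ⟨x + y, add_mem hx hy, rfl⟩
      zero_mem' := ⟨0, zero_mem _, rfl⟩
      smul_mem' := by
        rintro c _ ⟨x, hx, rfl⟩; exact ⟨c • x, smul_mem _ c hx, rfl⟩ }
  Γ :=
    { carrier := {u | ∃ x, ∃ (hx : x ∈ Dg k (Sd P f 1)) (hx' : sigmaK p x ∈ Dg k (Sd P f 1)),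
        u = (spq x (Sd_zero hx), spq (sigmaK p x) (Sd_zero hx'))}
      add_mem' := by
        rintro _ _ ⟨x, hx, hx', rfl⟩ ⟨y, hy, hy', rfl⟩
        refine ⟨x + y, add_mem hx hy, by rw [map_add]; exact add_mem hx' hy', ?_⟩
        simp only [map_add]; rfl
      zero_mem' := by
        refine ⟨0, zero_mem _, by simp, ?_⟩
        simp only [map_zero]; rfl
      smul_mem' := by
        rintro c _ ⟨x, hx, hx', rfl⟩
        refine ⟨c • x, smul_mem _ c hx, by rw [map_smul]; exact smul_mem _ c hx', ?_⟩
        simp only [map_smul]; rfl }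
  F_zero := spq_ind fun x hx => ⟨x, hx, rfl⟩
  F_anti := by rintro i j hij _ ⟨x, hx, rfl⟩; exact ⟨x, Sd_mono hij hx, rfl⟩
  F_lie := by rintro i j _ _ ⟨x, hx, rfl⟩ ⟨y, hy, rfl⟩; exact ⟨⁅x, y⁆, lie_mem_Sd hx hy, rfl⟩
  F_top := by rintro _ ⟨x, hx, rfl⟩; exact spq_eq_zero.2 (Dg_mono (fun _ _ h => h.top) hx)
  Δ_mem := by rintro j _ ⟨x, hx, rfl⟩; exact ⟨_, deK_mem hx, rfl⟩
  θΔ := spq_ind fun x hx => spq_eq_iff.2 (thK_deK_sub hx)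
  θ_pow := by
    rintro _ ⟨x, hx, rfl⟩
    have h : ∀ n, ∃ hn : ((thK P g) ^ n) x ∈ Dg k (Sd P f 0),
        (⇑(thQ P f))^[n] (spq x (Sd_zero hx)) = spq (((thK P g) ^ n) x) hn := by
      intro n
      induction n with
      | zero => exact ⟨Sd_zero hx, rfl⟩
      | succ n ih =>
        obtain ⟨hn, h⟩ := ih
        rw [iterate_succ_apply', h, pow_succ', Module.End.mul_apply]; exact ⟨thK_mem hn, rfl⟩
    obtain ⟨hn, h⟩ := h (p - 1)
    rw [h]; exact spq_eq_iff.2 (thK_pow_sub hx)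
  Γ_lie := by
    rintro _ ⟨x, hx, hx', rfl⟩ _ ⟨y, hy, hy', rfl⟩
    refine ⟨⁅x, y⁆, Sd_mono (by omega) (lie_mem_Sd hx hy),
      by rw [sigmaK_lie]; exact Sd_mono (by omega) (lie_mem_Sd hx' hy'), ?_⟩
    simp only [sigmaK_lie]; rfl
  Γ_θ := by
    rintro _ ⟨x, hx, hx', rfl⟩
    have h := sigmaK_thK_sub (Sd_zero hx) (Sd_zero hx')
    refine ⟨thK P g x, thK_mem hx, ?_, ?_⟩
    · have := add_mem (Dg_Nd_le_Sd h) (thK_mem (P := P) hx')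
      rwa [sub_add_cancel] at this
    · refine Prod.ext rfl (spq_eq_iff.2 ?_)
      rw [← neg_sub]; exact neg_mem h
  Γ_F := by rintro _ ⟨x, hx, hx', rfl⟩; exact ⟨⟨x, hx, rfl⟩, ⟨_, hx', rfl⟩⟩
  Γ_Δ := by
    rintro _ ⟨x, hx, hx', rfl⟩
    have h := sigmaK_deK (Sd_zero hx) (Sd_zero hx')
    refine ⟨deK P g x, Sd_mono (by omega) (deK_mem hx), Dg_Nd_le_Sd h, ?_⟩
    exact Prod.ext rfl (spq_eq_zero.2 h).symm
  Γ_Δ' := by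
    rintro _ ⟨x, hx, hx', rfl⟩; exact spq_eq_zero.2 (deK_sigmaK (Sd_zero hx))

/-! ### The twist -/

variable (P g) in
/-- The action of `Ω_γ`. -/
def twK (γ : Fp) : LK p k g →ₗ[Fp] LK p k g := twistK p (paE P) P.b γ

theorem twK_mt (γ : Fp) (i : ℤ) (c : k) (l : g) : twK P g γ (mt p i c l) =
    ∑ j ∈ range p, (γ ^ j * ((j.factorial : ℕ) : Fp)⁻¹) •
      mt p (i - j * P.b) ((paE P i : k) ^ j * c) l := by
  have hpow : ∀ n, ((diagK p (paE P)) ^ n) (mon (-i) c) = mon (-i) ((paE P i : k) ^ n * c) := by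
    intro n
    induction n with
    | zero => simp
    | succ n ih =>
      rw [pow_succ', Module.End.mul_apply, ih, diagK_mon, neg_neg, pow_succ', mul_assoc]
  change (rTensor g _) (mon (-i) c ⊗ₜ l) = _
  rw [LinearMap.rTensor_tmul, LinearMap.sum_apply, sum_tmul]
  refine sum_congr rfl fun j _ => ?_
  rw [LinearMap.smul_apply, ← smul_tmul', LinearMap.comp_apply, hpow]
  congr 2
  change mon (((j * P.b : ℕ) : ℕ) : ℤ) (1 : k) * mon (-i) ((paE P i : k) ^ j * c) =
    mon (-(i - j * P.b)) ((paE P i : k) ^ j * c)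
  rw [mon_mul, one_mul]
  congr 1
  push_cast; ring

theorem deK_pow_mt {i : ℤ} {l : g} (h : Spd P f 0 i l) (c : k) (j : ℕ) :
    ((deK P g) ^ j) (mt p i c l) - mt p (i - j * P.b) ((paE P i : k) ^ j * c) l ∈
        Dg k (Nd P f (p - 1)) ∧
      (Nd P f (p - 1) (i - j * P.b) l ∨
        (Spd P f j (i - j * P.b) l ∧ paE P (i - j * P.b) = paE P i)) := by
  induction j with
  | zero =>
    have : i - ((0 : ℕ) : ℤ) * P.b = i := by simp
    rw [this]; simp [h]
  | succ j ih =>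
    have e : i - ((j + 1 : ℕ) : ℤ) * P.b = i - j * P.b - P.b := by push_cast; ring
    have h1 := deK_mem' ih.1
    rw [map_sub, deK_mt, ← Module.End.mul_apply, ← pow_succ'] at h1
    rw [e]
    rcases ih.2 with h2 | ⟨h2, h3⟩
    · have h4 : Nd P f (p - 1) (i - j * P.b - P.b) l := h2.anti (by
        have := P.b_pos_int
        linarith)
      refine ⟨?_, Or.inl h4⟩
      have := add_mem h1 (sub_mem (mt_mem_Dg (p := p) (k := k)
        (c := (paE P (i - j * P.b) : k) * ((paE P i : k) ^ j * c)) h4)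
        (mt_mem_Dg (p := p) (k := k) (c := (paE P i : k) ^ (j + 1) * c) h4))
      rwa [sub_add_sub_cancel] at this
    · constructor
      · rw [h3, ← mul_assoc, ← pow_succ'] at h1; exact h1
      · rcases h2.sub_b with h4 | ⟨h4, h5, h6, -⟩
        · exact Or.inl h4
        · refine Or.inr ⟨h4, ?_⟩
          rw [paE_of_mem h5, h6, ← h3, paE]
          obtain ⟨-, -, -, h7, -⟩ := h2
          rw [if_pos h7]

theorem twK_sub_mem (γ : Fp) {x : LK p k g} (hx : x ∈ Dg k (Sd P f 0)) :
    (∑ j ∈ range p, (γ ^ j * ((j.factorial : ℕ) : Fp)⁻¹) • ((deK P g) ^ j) x) -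
      twK P g γ x ∈ Dg k (Nd P f (p - 1)) := by
  induction hx using Dg_induction with
  | h0 => simp
  | hadd a b _ _ ha hb =>
    have := add_mem ha hb
    convert this using 1
    simp only [map_add, smul_add, sum_add_distrib]; abel
  | hsmul c a _ ha =>
    have := smul_mem _ c ha
    convert this using 1
    simp only [map_smul, smul_sub, smul_sum]
    congr 1
    exact sum_congr rfl fun j _ => smul_comm _ _ _
  | hm i c l hl =>
    rw [twK_mt, ← sum_sub_distrib]
    refine sum_mem fun j hj => ?_
    clear hj
    rw [← smul_sub]
    refine smul_mem _ _ ?_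
    rcases hl with hl | hl
    · exact (deK_pow_mt hl c j).1
    · have h1 : ((deK P g) ^ j) (mt p i c l) ∈ Dg k (Nd P f (p - 1)) := by
        induction j with
        | zero => exact mt_mem_Dg hl
        | succ j ih => rw [pow_succ', Module.End.mul_apply]; exact deK_mem' ih
      refine sub_mem h1 (mt_mem_Dg (hl.anti ?_))
      have : (0 : ℤ) ≤ j * P.b := by positivity
      linarith

theorem twK_mem (γ : Fp) {x : LK p k g} (hx : x ∈ Dg k (Sd P f 0)) :
    twK P g γ x ∈ Dg k (Sd P f 0) := by
  have h1 : (∑ j ∈ range p, (γ ^ j * ((j.factorial : ℕ) : Fp)⁻¹) •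
      ((deK P g) ^ j) x) ∈ Dg k (Sd P f 0) := by
    refine sum_mem fun j hj => smul_mem _ _ ?_
    clear hj
    induction j with
    | zero => exact hx
    | succ j ih => rw [pow_succ', Module.End.mul_apply]; exact Sd_zero (deK_mem ih)
  have := sub_mem h1 (Dg_Nd_le_Sd (twK_sub_mem γ hx))
  rwa [sub_sub_cancel] at this

theorem Om_spq (γ : Fp) {x : LK p k g} (hx : x ∈ Dg k (Sd P f 0)) :
    (conjData P f).Om γ (spq x hx) = spq (twK P g γ x) (twK_mem γ hx) := by
  have h : ∀ j : ℕ, ∃ hj : ((deK P g) ^ j) x ∈ Dg k (Sd P f 0),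
      ((conjData P f).Δ.toLinearMap ^ j) (spq x hx) = spq (((deK P g) ^ j) x) hj := by
    intro j
    induction j with
    | zero => exact ⟨hx, rfl⟩
    | succ j ih =>
      obtain ⟨hj, h⟩ := ih
      rw [pow_succ' (deK P g), Module.End.mul_apply, pow_succ' (conjData P f).Δ.toLinearMap,
        Module.End.mul_apply, h]
      exact ⟨Sd_zero (deK_mem hj), rfl⟩
  choose h1 h2 using h
  change dExp _ γ _ = _
  rw [dExp_apply]
  simp only [h2, spq_smul]
  have h3 : ∀ (s : Finset ℕ) (y : ℕ → LK p k g) (hy : ∀ j, y j ∈ Dg k (Sd P f 0)),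
      ∑ j ∈ s, spq (y j) (hy j) = spq (∑ j ∈ s, y j) (sum_mem fun j _ => hy j) := by
    intro s y hy
    induction s using Finset.cons_induction with
    | empty => rfl
    | cons a s ha ih =>
      simp only [Finset.sum_cons]
      rw [ih]; rfl
  rw [h3 _ (fun j => (γ ^ j * ((j.factorial : ℕ) : Fp)⁻¹) • ((deK P g) ^ j) x)
    (fun j => smul_mem _ _ (h1 j))]
  exact spq_eq_iff.2 (twK_sub_mem γ hx)

end Families

/-! ### Sums over words -/

section Words

/-- The iterated bracket `[…[[x, l₁], l₂], …]`. -/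
def brs {L : Type*} [LieRing L] (x : L) (l : List L) : L := l.foldl (fun y z => ⁅y, z⁆) x

variable {L : Type*} [LieRing L]

theorem brs_nil (x : L) : brs x [] = x := rfl
theorem brs_cons (x y : L) (l : List L) : brs x (y :: l) = brs ⁅x, y⁆ l := rfl
theorem lnb_cons (x : L) (l : List L) : lnb (x :: l) = brs x l := rfl
theorem brs_append (x : L) (l l' : List L) : brs x (l ++ l') = brs (brs x l) l' := List.foldl_append
theorem brs_concat (x : L) (l : List L) (y : L) : brs x (l ++ [y]) = ⁅brs x l, y⁆ := by
  rw [brs_append]; rfl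

theorem brs_add (x y : L) (l : List L) : brs (x + y) l = brs x l + brs y l := by
  induction l using reverseRecOn with
  | nil => rfl
  | append_singleton l z ih => rw [brs_concat, ih, add_lie, brs_concat, brs_concat]

theorem brs_zero (l : List L) : brs (0 : L) l = 0 := by
  have := brs_add (0 : L) 0 l
  rw [add_zero] at this; exact left_eq_add.1 this

theorem brs_sum {I : Type*} (s : Finset I) (x : I → L) (l : List L) :
    brs (∑ i ∈ s, x i) l = ∑ i ∈ s, brs (x i) l := by
  induction s using Finset.cons_induction with
  | empty => exact brs_zero l
  | cons a s ha ih => rw [Finset.sum_cons, Finset.sum_cons, brs_add, ih]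

theorem brs_smul {R : Type*} [CommRing R] [LieAlgebra R L] (c : R) (x : L) (l : List L) :
    brs (c • x) l = c • brs x l := by
  induction l using reverseRecOn with
  | nil => rfl
  | append_singleton l z ih => rw [brs_concat, ih, smul_lie, brs_concat]

variable {α : Type*} [DecidableEq α]

/-- The words of length `< n` in the alphabet `X`. -/
def words (X : Finset α) (n : ℕ) : Finset (List α) :=
  (range n).biUnion fun s => (piFinset fun _ : Fin s => X).image ofFn

theorem mem_words {X : Finset α} {n : ℕ} {l : List α} :
    l ∈ words X n ↔ l.length < n ∧ ∀ x ∈ l, x ∈ X := by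
  simp only [words, Finset.mem_biUnion, mem_range, mem_image, Fintype.mem_piFinset]
  constructor
  · rintro ⟨s, hs, x, hx, rfl⟩
    refine ⟨by simpa using hs, fun y hy => ?_⟩
    obtain ⟨i, rfl⟩ := (List.mem_ofFn' _ _).1 hy; exact hx i
  · rintro ⟨h1, h2⟩; exact ⟨l.length, h1, l.get, fun i => h2 _ (List.get_mem l i), List.ofFn_get l⟩

theorem sum_words {M : Type*} [AddCommMonoid M] (X : Finset α) (n : ℕ) (F : List α → M) :
    ∑ s ∈ range n, ∑ x ∈ piFinset fun _ : Fin s => X, F (ofFn x) = ∑ l ∈ words X n, F l := by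
  rw [words, Finset.sum_biUnion]
  · refine sum_congr rfl fun s _ => ?_
    rw [sum_image fun x _ y _ h => List.ofFn_injective h]
  · intro s _ s' _ h
    refine Finset.disjoint_left.2 fun l hl hl' => h ?_
    obtain ⟨x, -, rfl⟩ := mem_image.1 hl
    obtain ⟨y, -, hy⟩ := mem_image.1 hl'
    have := congrArg List.length hy
    simpa using this.symm

theorem nil_mem_words {X : Finset α} {n : ℕ} (hn : 1 ≤ n) : [] ∈ words X n :=
  mem_words.2 ⟨hn, by simp⟩

theorem sum_words_Ico {M : Type*} [AddCommMonoid M] (X : Finset α) {n : ℕ} (hn : 1 ≤ n)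
    (F : List α → M) :
    ∑ s ∈ Ico 1 n, ∑ x ∈ piFinset fun _ : Fin s => X, F (ofFn x) =
      ∑ l ∈ words X n with l ≠ [], F l := by
  have h := sum_words X n (fun l => if l ≠ [] then F l else 0)
  rw [Finset.sum_filter, ← h, Finset.range_eq_Ico, Finset.sum_eq_sum_Ico_succ_bot hn]
  have h0 : ∑ x ∈ piFinset fun _ : Fin 0 => X, (if ofFn x ≠ [] then F (ofFn x) else 0) = 0 :=
    sum_eq_zero fun x _ => by simp
  rw [h0, zero_add]
  refine sum_congr rfl fun s hs => sum_congr rfl fun x _ => ?_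
  rw [if_pos]
  intro h
  have := congrArg List.length h
  rw [List.length_ofFn] at this; simp [this] at hs

end Words

section DerAct
variable {F : Type*} [Field F] {p : ℕ} {L : Type*} [LieRing L] [LieAlgebra F L]

theorem derAct_prod_snd (δ : LieDerivation F L L) (y : L) (l : List L) :
    derAct δ (l.map (ιU F)).prod (0, y) = (0, brs y l) := by
  induction l generalizing y with
  | nil => simp [derAct_one, brs_nil]
  | cons x l ih =>
    rw [map_cons, List.prod_cons, derAct_mul, derAct_ι]
    simp only [zero_smul, zero_add]
    rw [ih, brs_cons]

theorem derAct_prod_fst (δ : LieDerivation F L L) (x : L) (l : List L) :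
    derAct δ ((x :: l).map (ιU F)).prod (1, 0) = (0, brs (δ x) l) := by
  rw [map_cons, List.prod_cons, derAct_mul, derAct_ι]
  simp only [one_smul, zero_lie, add_zero]; exact derAct_prod_snd δ _ l

variable [Algebra (ZMod p) F] [hp : Fact p.Prime] [LieAlgebra (ZMod p) L] [IsScalarTower (ZMod p) F L]

theorem inv_smul_eq (n : ℕ) (x : L) : ((n : F)⁻¹) • x = ((n : ZMod p)⁻¹) • x := by
  rw [← algebraMap_smul F ((n : ZMod p)⁻¹) x, map_inv₀, map_natCast]

theorem rAd_eq (x y : L) : rAd F p x y = rAd (ZMod p) p x y :=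
  sum_congr rfl fun m _ => inv_smul_eq _ _

theorem logD_eq_zmod (δ : L → L) (x : L) : logD F p δ x = logD (ZMod p) p δ x :=
  sum_congr rfl fun m _ => inv_smul_eq _ _

end DerAct

section Given

section Co

theorem coefLin_mul_mon (i : ℤ) (u : Laur k) (n : ℤ) (c : k) :
    coefLin p k i (u * mon n c) = coefLin p k (i + n) u * c := by
  have h := HahnSeries.coeff_mul_single_add (Γ := ℤ) (R := k) (r := c) (x := u) (a := -(i + n))
    (b := n)
  rw [show -(i + n) + n = -i by ring] at h; exact h

theorem co_lie_tneg (i : ℤ) (y : LK p k L) (x : k ⊗[Fp] L) :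
    co p k i ⁅y, tneg p 0 x⁆ = ⁅co p k i y, x⁆ := by
  induction y using TensorProduct.induction_on with
  | tmul u l =>
    induction x using TensorProduct.induction_on with
    | tmul c m =>
      rw [tneg_tmul, mt, lie_tmul]
      change coefLin p k i (u * mon (-0) c) ⊗ₜ[Fp] ⁅l, m⁆ = ⁅coefLin p k i u ⊗ₜ[Fp] l, c ⊗ₜ[Fp] m⁆
      rw [coefLin_mul_mon, lie_tmul, neg_zero, add_zero]
    | _ => simp_all
  | _ => simp_all

theorem co_brs (i : ℤ) (y : LK p k L) (l : List (k ⊗[Fp] L)) :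
    co p k i (brs y (l.map (tneg p 0))) = brs (co p k i y) l := by
  induction l generalizing y with
  | nil => rfl
  | cons x l ih => rw [map_cons, brs_cons, ih, co_lie_tneg, brs_cons]

theorem co_mon_smul (i n : ℤ) (c : k) (y : LK p k L) :
    co p k i (mon n c • y) = c • co p k (i + n) y := by
  induction y using TensorProduct.induction_on with
  | tmul u l =>
    rw [smul_tmul']
    change coefLin p k i (mon n c * u) ⊗ₜ[Fp] l = c • (coefLin p k (i + n) u ⊗ₜ[Fp] l)
    rw [mul_comm, coefLin_mul_mon, smul_tmul', mul_comm]; rfl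
  | _ => simp_all

theorem mon_smul_mem_Dg {G G' : ℤ → L → Prop} (n : ℤ) (c : k)
    (h : ∀ i l, G i l → G' (i - n) l) {y : LK p k L} (hy : y ∈ Dg k G) :
    mon n c • y ∈ Dg k G' := by
  induction hy using Dg_induction with
  | h0 => rw [smul_zero]; exact zero_mem _
  | hadd a b _ _ ha hb => rw [smul_add]; exact add_mem ha hb
  | hsmul d a _ ha => rw [smul_comm]; exact smul_mem _ _ ha
  | hm i d l hl =>
    have : mon n c • mt p i d l = mt p (i - n) (c * d) l := by
      rw [mt, smul_tmul']
      change (mon n c * mon (-i) d) ⊗ₜ l = _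
      rw [mon_mul, mt]
      congr 2
      ring
    rw [this]; exact mt_mem_Dg (h i l hl)

end Co

variable (P) in
open Classical in
/-- The indices which occur in the words of `ℒ̄`. -/
def alph : Finset ℕ := {x ∈ range ⌈P.w⌉₊ | x ∈ Z0 p}

variable (P α₀) in
/-- `D_{a 0}` in `ℒ̄_𝒦`. -/
def DK (a : ℕ) : LK p k P.LBar := tneg p 0 (D P α₀ a 0)

theorem sum_natCast_ofFn {s : ℕ} (a : Fin s → ℕ) : (∑ i, (a i : ℤ)) = ((ofFn a).sum : ℕ) := by
  rw [sum_ofFn]; push_cast; rfl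

theorem IsGivenBy.words (he : IsGivenBy P α₀ η e) :
    texp (Laur k) p e - (1 + ∑ l ∈ words (alph P) p with l ≠ [],
      mon (-(l.sum : ℤ)) (η l) • ((l.map (DK P α₀)).map (ιU (Laur k))).prod)
      ∈ augPow (Laur k) (LK p k P.LBar) p := by
  unfold IsGivenBy at he
  rw [← sum_words_Ico (alph P) hp.out.one_le]
  have h : ∑ s ∈ Ico 1 p, ∑ a ∈ piFinset fun _ : Fin s => alph P,
      mon (-((ofFn a).sum : ℤ)) (η (ofFn a)) • (((ofFn a).map (DK P α₀)).map (ιU (Laur k))).prod =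
      ∑ s ∈ Ico 1 p, ∑ a ∈ piFinset fun _ : Fin s => alph P, mon (-(∑ i, (a i : ℤ))) (η (ofFn a)) •
          (ofFn fun i => ιU (Laur k) (tneg p 0 (D P α₀ (a i) 0))).prod :=
    sum_congr rfl fun s _ => sum_congr rfl fun a _ => by
      rw [sum_natCast_ofFn, map_map, map_ofFn]; rfl
  rw [h]; exact he

theorem rAd_given (hη : η [] = 1) (he : IsGivenBy P α₀ η e) (y : LK p k P.LBar) :
    rAd Fp p e y = ∑ l ∈ words (alph P) p,
      mon (-(l.sum : ℤ)) (η l) • brs y (l.map (DK P α₀)) := by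
  have h1 := derAct_augPow (0 : LieDerivation (Laur k) (LK p k P.LBar) (LK p k P.LBar))
    hp.out.one_le he.words ((0, y) : Laur k × LK p k P.LBar)
  simp only [map_sub, map_add, map_sum, LinearMap.sub_apply, LinearMap.add_apply,
    LinearMap.sum_apply, derAct_texp_snd, derAct_one, map_smul, LinearMap.smul_apply,
    derAct_prod_snd] at h1
  have h2 := congrArg Prod.snd (sub_eq_zero.1 h1)
  rw [Prod.snd_add, Prod.snd_sum] at h2
  simp only [Prod.smul_snd] at h2
  rw [← rAd_eq (F := Laur k), h2,
    ← Finset.sum_filter_add_sum_filter_not (NilpAS.words (alph P) p) (fun l => l ≠ []), add_comm]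
  congr 1
  rw [Finset.sum_eq_single []]
  · simp only [List.sum_nil, hη, map_nil, brs_nil]; exact (one_smul (Laur k) y).symm
  · intro l hl h; simp at hl; exact absurd hl.2 h
  · intro h; exact absurd (Finset.mem_filter.2 ⟨nil_mem_words hp.out.one_le, by simp⟩) h

/-- `[…[δ l₁, l₂], …]` for a word of generators. -/
def headBr {L : Type*} [LieRing L] (u : ℕ → L) (v : ℕ → L) : List ℕ → L
  | [] => 0
  | a :: l => brs (v a) (l.map u)

theorem logD_given (he : IsGivenBy P α₀ η e)
    (δ : LieDerivation (Laur k) (LK p k P.LBar) (LK p k P.LBar)) :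
    logD Fp p δ e = ∑ l ∈ words (alph P) p with l ≠ [],
      mon (-(l.sum : ℤ)) (η l) • headBr (DK P α₀) (fun a => δ (DK P α₀ a)) l := by
  have h1 := derAct_augPow δ hp.out.one_le he.words ((1, 0) : Laur k × LK p k P.LBar)
  simp only [map_sub, map_add, map_sum, LinearMap.sub_apply, LinearMap.add_apply,
    LinearMap.sum_apply, derAct_texp_fst _ hp.out.one_le, derAct_one, map_smul,
    LinearMap.smul_apply] at h1
  have h2 := congrArg Prod.snd (sub_eq_zero.1 h1)
  rw [Prod.snd_add, Prod.snd_sum] at h2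
  simp only [Prod.smul_snd, zero_add] at h2
  rw [← logD_eq_zmod (F := Laur k), h2]
  refine sum_congr rfl fun l hl => ?_
  obtain ⟨-, hl⟩ := Finset.mem_filter.1 hl
  cases l with
  | nil => exact absurd rfl hl
  | cons a l => rw [map_cons, derAct_prod_fst]; rfl

/-! ### The structure of the element given by the structural constants -/

variable (P) in
/-- The part of `ℒ̄` of total index `i`. -/
def Ix (i : ℤ) (l : P.LBar) : Prop :=
  ∃ A : ℕ, i = A ∧ l ∈ grad p (Params.Zp p) (deg p k) P.wt Int.toNat A

theorem Ix.lie {i i' : ℤ} {l l' : P.LBar} (h : Ix P i l) (h' : Ix P i' l') :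
    Ix P (i + i') ⁅l, l'⁆ := by
  obtain ⟨A, rfl, h⟩ := h
  obtain ⟨A', rfl, h'⟩ := h'; exact ⟨A + A', by push_cast; rfl, lie_mem_grad h h'⟩

theorem genElt_mem_grad {S : Set ℤ} {N : ℕ} {w d : ℤ → ℕ} (x : Gen S N) :
    genElt p w x ∈ grad p S N w d (d x.index) :=
  subset_span ⟨[x], by simp [wtSum], rfl⟩

theorem genElt_mem_filt {S : Set ℤ} {N : ℕ} {w : ℤ → ℕ} (x : Gen S N) :
    genElt p w x ∈ filt p S N w (w x.index) :=
  subset_span ⟨[x], by simp [wtSum], rfl⟩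

/-- `D_{a n}` is a combination of free generators of index `a`. -/
theorem Dgen_mem {S : Set ℤ} {w : ℤ → ℕ} (a n : ℤ) : Dgen p S w α₀ a n ∈
    kG k (fun l => l = 0 ∨ ∃ x : Gen S (deg p k), x.index = a ∧ l = genElt p w x) := by
  unfold Dgen
  split_ifs with h
  · subst h; exact subset_span ⟨_, _, Or.inr ⟨none, rfl, rfl⟩, rfl⟩
  · refine sum_mem fun i _ => subset_span ⟨_, _, ?_, rfl⟩
    unfold xgen
    split_ifs with h'
    · exact Or.inr ⟨some (⟨a, h'⟩, i), rfl, rfl⟩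
    · exact Or.inl rfl

theorem D_mem_grad (a : ℕ) (n : ℤ) : D P α₀ a n ∈
    kG k (· ∈ grad p (Params.Zp p) (deg p k) P.wt Int.toNat a) := by
  refine kG_mono (fun l hl => ?_) (Dgen_mem (S := Params.Zp p) (w := P.wt) (α₀ := α₀) (a : ℤ) n)
  rcases hl with rfl | ⟨x, hx, rfl⟩
  · exact zero_mem _
  · have := genElt_mem_grad (p := p) (w := P.wt) (d := Int.toNat) x
    rwa [hx] at this

theorem DK_mem (a : ℕ) : DK P α₀ a ∈
    Dg k (fun i l => i = 0 ∧ l ∈ grad p (Params.Zp p) (deg p k) P.wt Int.toNat a) :=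
  tneg_mem_Dg (kG_mono (fun _ h => ⟨rfl, h⟩) (D_mem_grad a 0))

theorem brs_DK_mem {x : LK p k P.LBar} {A : ℕ}
    (hx : x ∈ Dg k (fun i l => i = 0 ∧ l ∈ grad p (Params.Zp p) (deg p k) P.wt Int.toNat A))
    (l : List ℕ) : brs x (l.map (DK P α₀)) ∈ Dg k (fun i m => i = 0 ∧
      m ∈ grad p (Params.Zp p) (deg p k) P.wt Int.toNat (A + l.sum)) := by
  induction l generalizing x A with
  | nil => simpa [brs_nil] using hx
  | cons a l ih =>
    rw [map_cons, brs_cons, List.sum_cons, ← add_assoc]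
    exact ih (lie_mem_Dg (fun i j l m h h' => ⟨by omega, lie_mem_grad h.2 h'.2⟩) hx (DK_mem a))

theorem lie_mem_Ix {x y : LK p k P.LBar} (hx : x ∈ Dg k (Ix P)) (hy : y ∈ Dg k (Ix P)) :
    ⁅x, y⁆ ∈ Dg k (Ix P) := lie_mem_Dg (fun _ _ _ _ h h' => h.lie h') hx hy

/-- Extension of scalars of a derivation, over the prime field. -/
def derZ {L : Type*} [LieRing L] [LieAlgebra Fp L] (δ : LieDerivation Fp L L) :
    LieDerivation Fp (LK p k L) (LK p k L) where
  toLinearMap := (baseDer (Laur k) δ).toLinearMap.restrictScalars Fp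
  leibniz' x y := (baseDer (Laur k) δ).leibniz' x y

theorem derZ_mt {L : Type*} [LieRing L] [LieAlgebra Fp L] (δ : LieDerivation Fp L L)
    (i : ℤ) (c : k) (l : L) : derZ δ (mt p i c l) = mt p i c (δ l) := rfl

theorem lenDer_mem_grad {S : Set ℤ} {N : ℕ} {w d : ℤ → ℕ} {m : ℕ} {x : TLie p S N w}
    (hx : x ∈ grad p S N w d m) : TLie.lenDer x ∈ grad p S N w d m := by
  induction hx using span_induction with
  | mem x h =>
    obtain ⟨l, hl, rfl⟩ := h
    rw [TLie.lenDer_lnb]; exact smul_mem _ _ (subset_span ⟨l, hl, rfl⟩)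
  | _ => simp_all [add_mem, smul_mem]

/-- The element `ē` is homogeneous: its monomials are the `t^{-A} l` with `l` of total
index `A`. -/
theorem given_mem (he : IsGivenBy P α₀ η e) : e ∈ Dg k (Ix P) := by
  have hp2 := hp.out.two_le
  set δ : LieDerivation Fp (LK p k P.LBar) (LK p k P.LBar) :=
    derZ (TLie.lenDer (w := P.wt) (p := p) (S := Params.Zp p) (N := deg p k)) with hδ
  have hpow : ∀ x, (⇑δ)^[p - 1] x = x := fun x =>
    baseDer_iterate (A := Laur k) _ (fun x => TLie.lenDer_pow P.one_le_wt x) x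
  have hδG : ∀ x ∈ Dg k (Ix P), δ x ∈ Dg k (Ix P) := fun x hx =>
    map_mem_Dg δ.toLinearMap (fun i c l h => by
      obtain ⟨A, rfl, h⟩ := h
      change derZ _ (mt p _ c l) ∈ _
      rw [derZ_mt]; exact mt_mem_Dg ⟨A, rfl, lenDer_mem_grad h⟩) hx
  have hg : logD Fp p δ e ∈ Dg k (Ix P) := by
    have h1 := logD_given he (baseDer (Laur k) (TLie.lenDer (w := P.wt)))
    have h2 : logD Fp p δ e = logD Fp p (baseDer (Laur k) (TLie.lenDer (w := P.wt))) e := rfl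
    rw [h2, h1]
    refine sum_mem fun l hl => ?_
    obtain ⟨-, hl⟩ := Finset.mem_filter.1 hl
    cases l with
    | nil => exact absurd rfl hl
    | cons a l =>
      have h3 : δ (DK P α₀ a) ∈ Dg k (fun i l => i = 0 ∧
          l ∈ grad p (Params.Zp p) (deg p k) P.wt Int.toNat a) :=
        map_mem_Dg δ.toLinearMap (fun i c l h => by
          change derZ _ (mt p i c l) ∈ _
          rw [derZ_mt]; exact mt_mem_Dg ⟨h.1, lenDer_mem_grad h.2⟩) (DK_mem a)
      refine mon_smul_mem_Dg _ _ (fun i m h => ?_) (brs_DK_mem h3 l)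
      refine ⟨a + l.sum, ?_, h.2⟩
      rw [h.1, List.sum_cons]; push_cast; ring
  obtain ⟨z, hz, hlog⟩ := exists_logD_eq (p := p) hp2 δ (Dg k (Ix P))
    (fun x hx y hy => lie_mem_Ix hx hy) hδG (fun x _ => hpow x) hg
  have : z = e := logD_unique hp2 δ (fun n _ => by rw [hlog, sub_self]; exact zero_mem _) (hpow _)
  rw [← this]; exact hz

end Given

section Given

/-! ### The Frobenius on generators -/

section Frob

theorem frobPow_zero (c : k) : frobPow p k 0 c = c := by simp [frobPow]

theorem frobPow_succ (n : ℤ) (c : k) : frobPow p k (n + 1) c = frobPow p k n c ^ p := by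
  unfold frobPow
  rw [add_comm, zpow_add, zpow_one, AlgEquiv.mul_apply]; simp [ZMod.card]

theorem frobT_smul (c : k) (x : k ⊗[Fp] L) : frobT (c • x) = c ^ p • frobT x := by
  induction x using TensorProduct.induction_on with
  | tmul d l =>
    rw [smul_tmul', frobT_tmul, frobT_tmul, smul_tmul', smul_eq_mul, smul_eq_mul, mul_pow]
  | _ => simp_all

theorem frobT_lie (x y : k ⊗[Fp] L) : frobT ⁅x, y⁆ = ⁅frobT x, frobT y⁆ :=
  (LieAlgebra.ExtendScalars.map (frobeniusAlgHom Fp k)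
    (LieHom.id : L →ₗ⁅Fp⁆ L)).map_lie x y

theorem frobT_brs (x : k ⊗[Fp] L) (l : List (k ⊗[Fp] L)) :
    frobT (brs x l) = brs (frobT x) (l.map frobT) := by
  induction l generalizing x with
  | nil => rfl
  | cons y l ih => rw [brs_cons, ih, frobT_lie]; rfl

/-- The Frobenius of a finite field has finite order. -/
theorem exists_frobT_iterate : ∃ n : ℕ, ∀ x : k ⊗[Fp] L, frobT^[n + 1] x = x := by
  have : Fintype k := Fintype.ofFinite k
  obtain ⟨n, hn⟩ : ∃ n : ℕ, ∀ c : k, c ^ p ^ (n + 1) = c := by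
    have hcp : CharP k p := charP_of_injective_algebraMap (algebraMap Fp k).injective p
    obtain ⟨m, -, hc⟩ := FiniteField.card k p
    refine ⟨m - 1, fun c => ?_⟩
    have h1 : (m : ℕ) - 1 + 1 = m := Nat.sub_add_cancel m.pos
    rw [h1]
    have := FiniteField.pow_card c
    rwa [hc] at this
  refine ⟨n, fun x => ?_⟩
  have hpow : ∀ (m : ℕ) (c : k) (l : L), frobT^[m] (c ⊗ₜ[Fp] l) = (c ^ p ^ m) ⊗ₜ l := by
    intro m c l
    induction m with
    | zero => simp
    | succ m ih => rw [iterate_succ_apply', ih, frobT_tmul, ← pow_mul, pow_succ]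
  induction x using TensorProduct.induction_on with
  | zero =>
    have : ∀ m, frobT^[m] (0 : k ⊗[Fp] L) = 0 := fun m => by
      induction m with
      | zero => rfl
      | succ m ih => rw [iterate_succ_apply', ih, map_zero]
    exact this _
  | add a b ha hb =>
    have : ∀ m, frobT^[m] (a + b) = frobT^[m] a + frobT^[m] b := fun m => by
      induction m with
      | zero => rfl
      | succ m ih => simp only [iterate_succ_apply', ih, map_add]
    rw [this, ha, hb]
  | tmul c l => rw [hpow, hn]

theorem frobT_mem_kG_iff {G : L → Prop} {x : k ⊗[Fp] L} : frobT x ∈ kG k G ↔ x ∈ kG k G := by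
  refine ⟨fun h => ?_, frobT_mem_kG⟩
  obtain ⟨n, hn⟩ := exists_frobT_iterate (p := p) (k := k) (L := L)
  rw [← hn x, iterate_succ_apply]
  exact iterate_mem_of_mem (W := (· ∈ kG k G)) (fun _ h => frobT_mem_kG h) h n

theorem frobT_iterate_mem_kG_iff {G : L → Prop} {x : k ⊗[Fp] L} (n : ℕ) :
    frobT^[n] x ∈ kG k G ↔ x ∈ kG k G := by
  induction n with
  | zero => rfl
  | succ n ih => rw [iterate_succ_apply', frobT_mem_kG_iff, ih]

end Frob

theorem frobT_Dgen {S : Set ℤ} {w : ℤ → ℕ} {α₀ : k} (a n : ℤ) :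
    frobT (Dgen p S w α₀ a n) = Dgen p S w α₀ a (n + 1) := by
  unfold Dgen
  split_ifs with h
  · rw [frobT_tmul, frobPow_succ]
  · rw [map_sum]
    refine sum_congr rfl fun i _ => ?_
    rw [frobT_tmul, frobPow_succ]

variable (P α₀ η e)

/-! ### The elements `ℱ` as coefficients of a recursive sequence -/

/-- The derivation `D_{a n} ↦ a D_{a n}`. -/
def idxDer : LieDerivation Fp P.LBar P.LBar := TLie.der fun x => (x.index : Fp)

variable {P} in
/-- The series `T₀ = e^{-ē} δ e^{ē}` (where `δ D_{a n} = a D_{a n}`),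
`T_{N+1} = Ad(-ē) σ T_N`. -/
def Tser : ℕ → LK p k P.LBar
  | 0 => logD Fp p (derZ (idxDer P)) e
  | N + 1 => rAd Fp p e (sigmaK p (Tser N))

variable {P} in
/-- The coefficient of `t^{-A}` in `T_N`. -/
def FF (N : ℕ) (A : ℤ) : k ⊗[Fp] P.LBar := co p k A (Tser e N)

theorem derZ_DK (a : ℕ) : derZ (idxDer P) (DK P α₀ a) = a • DK P α₀ a := by
  have h := Dgen_mem (p := p) (S := Params.Zp p) (w := P.wt) (α₀ := α₀) (a : ℤ) 0
  unfold DK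
  change Dgen p (Params.Zp p) P.wt α₀ a 0 ∈ _ at h
  change derZ (idxDer P) (tneg p 0 (Dgen p (Params.Zp p) P.wt α₀ a 0)) =
    a • tneg p 0 (Dgen p (Params.Zp p) P.wt α₀ a 0)
  generalize Dgen p (Params.Zp p) P.wt α₀ (a : ℤ) 0 = y at h ⊢
  induction h using span_induction with
  | mem x h =>
    obtain ⟨c, l, hl, rfl⟩ := h
    rw [tneg_tmul, derZ_mt]
    rcases hl with rfl | ⟨x, hx, rfl⟩
    · rw [map_zero, ← tneg_tmul, tmul_zero, map_zero, smul_zero]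
    · rw [idxDer, TLie.der_genElt, hx]
      push_cast
      rw [Nat.cast_smul_eq_nsmul, ← tneg_tmul, tmul_smul, map_nsmul, tneg_tmul]
  | zero => simp
  | add x y _ _ hx hy => rw [map_add, map_add, hx, hy, smul_add]
  | smul c x _ hx => rw [map_smul, map_smul, hx, smul_comm]

variable {P α₀ η e}

theorem co_tneg_zero {L : Type*} [LieRing L] [LieAlgebra Fp L] (i : ℤ) (x : k ⊗[Fp] L) :
    co p k i (tneg p 0 x) = if i = 0 then x else 0 := co_tneg i 0 x

theorem map_DK (l : List ℕ) :
    l.map (DK P α₀) = (l.map fun a : ℕ => D P α₀ (a : ℤ) 0).map (tneg p 0) := by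
  rw [map_map]; rfl

theorem FF_zero (he : IsGivenBy P α₀ η e) (A : ℤ) : FF e 0 A =
    ∑ l ∈ words (alph P) p with l ≠ [], if A = (l.sum : ℕ) then
      (((l.headD 0 : ℕ) : k) * η l) • lnb (l.map fun a : ℕ => D P α₀ (a : ℤ) 0) else 0 := by
  have h1 := logD_given he (baseDer (Laur k) (idxDer P))
  have h2 : Tser e 0 = logD Fp p (baseDer (Laur k) (idxDer P)) e := rfl
  rw [FF, h2, h1, map_sum]
  refine sum_congr rfl fun l hl => ?_
  obtain ⟨-, hl⟩ := Finset.mem_filter.1 hl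
  cases l with
  | nil => exact absurd rfl hl
  | cons a l =>
    have h3 : (baseDer (Laur k) (idxDer P)) (DK P α₀ a) = a • DK P α₀ a := derZ_DK P α₀ a
    rw [headBr, h3, co_mon_smul, map_DK, co_brs, map_nsmul, DK, co_tneg_zero]
    by_cases h : A = (((a :: l).sum : ℕ) : ℤ)
    · rw [if_pos h, if_pos (by rw [h]; push_cast; ring), List.headD_cons, map_cons, lnb_cons,
        ← Nat.cast_smul_eq_nsmul k, brs_smul, smul_smul, mul_comm]
    · rw [if_neg h, if_neg (fun h' => h (by push_cast at h' ⊢; linarith)), smul_zero, brs_zero,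
        smul_zero]

theorem FF_succ (hη : η [] = 1) (he : IsGivenBy P α₀ η e) (N : ℕ) (A : ℤ) : FF e (N + 1) A =
    ∑ l ∈ words (alph P) p, η l •
      brs (co p k (A - (l.sum : ℕ)) (sigmaK p (Tser e N))) (l.map fun a : ℕ => D P α₀ (a : ℤ) 0) := by
  rw [FF, Tser, rAd_given hη he, map_sum]
  refine sum_congr rfl fun l _ => ?_
  rw [co_mon_smul, map_DK, co_brs, Nat.cast_list_sum]; rfl

theorem Tser_mem (he : IsGivenBy P α₀ η e) (N : ℕ) :
    Tser e N ∈ Dg (p := p) k (fun (_ : ℤ) (_ : P.LBar) => True) := by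
  have he' := Dg_true (given_mem he)
  have hl : ∀ z ∈ Dg (p := p) k (fun (_ : ℤ) (_ : P.LBar) => True),
      ⁅z, e⁆ ∈ Dg (p := p) k (fun (_ : ℤ) (_ : P.LBar) => True) :=
    fun z hz => lie_mem_Dg (fun _ _ _ _ _ _ => trivial) hz he'
  induction N with
  | zero =>
    refine logD_mem (p := p) _ hl ?_
    exact map_mem_Dg (p := p) (derZ (idxDer P)).toLinearMap
      (fun i c l _ => mt_mem_Dg (p := p) (l := idxDer P l) trivial) he'
  | succ N ih => exact rAd_mem _ hl (sigmaK_true ih)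

/-! ### The closed form of the coefficients -/

/-- The value `∑ aᵢ p^{nᵢ}` of a word. -/
def wv (p : ℕ) (l : List (ℕ × ℤ)) : ℚ := (l.map fun x => (x.1 : ℚ) * (p : ℚ) ^ x.2).sum

variable (P α₀ η) in
/-- The term of `ℱ⁰` which belongs to a word. -/
def Ft (l : List (ℕ × ℤ)) : k ⊗[Fp] P.LBar :=
  ((((l.map Prod.fst).headD 0 : ℕ) : k) * etaBar p η l) • lnb (l.map fun x => D P α₀ x.1 x.2)

/-- The first letter of the word has the exponent `0`. -/
def St (l : List (ℕ × ℤ)) : Prop := ∃ a t, l = (a, (0 : ℤ)) :: t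

theorem D_eq_zero {a : ℕ} (ha : ⌈P.w⌉₊ ≤ a) (n : ℤ) : D P α₀ a n = 0 := by
  refine kG_eq_zero (fun l hl => ?_) (Dgen_mem (S := Params.Zp p) (w := P.wt) (α₀ := α₀) (a : ℤ) n)
  rcases hl with rfl | ⟨x, hx, rfl⟩
  · rfl
  · have := lnb_genElt_eq_zero p (Params.Zp p) (deg p k) P.wt [x] (by
      simp only [wtSum, map_cons, map_nil, List.sum_singleton, hx]
      unfold Params.wt
      have h1 : (p - 1 : ℕ) ≤ ⌊(((a : ℤ) : ℝ)) / P.v₀⌋₊ := by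
        refine Nat.le_floor ?_
        rw [le_div_iff₀ P.v₀_pos, Nat.cast_sub hp.out.one_le]
        have h2 : (p - 1 : ℝ) * P.v₀ ≤ a := Nat.ceil_le.1 ha
        simpa using h2
      have := hp.out.one_le
      omega)
    simpa [lnb] using this

theorem Ft_eq_zero {l : List (ℕ × ℤ)} {x : ℕ × ℤ} (hx : x ∈ l) (h : ⌈P.w⌉₊ ≤ x.1) :
    Ft P α₀ η l = 0 := by
  rw [Ft, lnb_eq_zero_of_mem, smul_zero]; exact mem_map.2 ⟨x, hx, D_eq_zero h _⟩

theorem le_wv {l : List (ℕ × ℤ)} {N : ℕ} {x : ℕ × ℤ} (hx : x ∈ l) (hn : -(N : ℤ) ≤ x.2) :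
    (x.1 : ℚ) ≤ wv p l * (p : ℚ) ^ N := by
  have hp1 : (1 : ℚ) ≤ p := by exact_mod_cast hp.out.one_le
  have hp0 : (0 : ℚ) < p := by linarith
  have h1 : (x.1 : ℚ) * (p : ℚ) ^ x.2 ≤ wv p l := by
    refine List.single_le_sum (fun y hy => ?_) _ (mem_map.2 ⟨x, hx, rfl⟩)
    obtain ⟨z, -, rfl⟩ := mem_map.1 hy; positivity
  have h2 : (1 : ℚ) ≤ (p : ℚ) ^ x.2 * (p : ℚ) ^ N := by
    rw [← zpow_natCast, ← zpow_add₀ hp0.ne']; exact one_le_zpow₀ hp1 (by linarith)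
  calc (x.1 : ℚ) = x.1 * 1 := (mul_one _).symm
    _ ≤ x.1 * ((p : ℚ) ^ x.2 * (p : ℚ) ^ N) := mul_le_mul_of_nonneg_left h2 (by positivity)
    _ = (x.1 * (p : ℚ) ^ x.2) * (p : ℚ) ^ N := by ring
    _ ≤ _ := mul_le_mul_of_nonneg_right h1 (by positivity)

theorem words_mono {α : Type*} [DecidableEq α] {X Y : Finset α} (h : X ⊆ Y) (n : ℕ) :
    words X n ⊆ words Y n := fun _ hl =>
  mem_words.2 ⟨(mem_words.1 hl).1, fun x hx => h ((mem_words.1 hl).2 x hx)⟩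

variable (P α₀ η) in
open Classical in
/-- The sum of the terms of `ℱ⁰_{α,-N}` over the words with letters in a given alphabet. -/
def Fs (X : Finset ℕ) (N : ℕ) (α : ℚ) : k ⊗[Fp] P.LBar :=
  ∑ l ∈ words (X ×ˢ Icc (-(N : ℤ)) 0) p, if St l ∧ α = wv p l then Ft P α₀ η l else 0

open Classical in
theorem F0_eq (α : ℚ) (N : ℕ) : F0 P α₀ η α N = Fs P α₀ η (alph P) N α := by
  -- letters `≥ (p - 1) v₀` vanish in `ℒ̄`, and letters `> α p^N` do not occur in a value `α`
  set X : Finset ℕ := {a ∈ range (⌊α * (p : ℚ) ^ N⌋₊ + 1) | a ∈ Z0 p} with hX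
  have h1 : F0 P α₀ η α N = Fs P α₀ η X N α := by
    have h2 := sum_words_Ico (X ×ˢ Icc (-(N : ℤ)) 0) hp.out.one_le
      (fun l => if St l ∧ α = wv p l then Ft P α₀ η l else 0)
    unfold Fs
    rw [← Finset.sum_filter_add_sum_filter_not _ (fun l => l ≠ []), ← h2]
    have h3 : ∑ l ∈ words (X ×ˢ Icc (-(N : ℤ)) 0) p with ¬ l ≠ [],
        (if St l ∧ α = wv p l then Ft P α₀ η l else 0) = 0 := by
      refine sum_eq_zero fun l hl => if_neg ?_
      rw [not_not.1 (Finset.mem_filter.1 hl).2]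
      rintro ⟨⟨a, t, h⟩, -⟩
      cases h
    rw [h3, add_zero, F0]
    refine sum_congr rfl fun s hs => ?_
    rw [Finset.sum_filter]
    refine sum_congr (by rw [hX]) fun x _ => ?_
    obtain ⟨n, rfl⟩ : ∃ n, s = n + 1 := ⟨s - 1, by have := (Finset.mem_Ico.1 hs).1; omega⟩
    have h4 : (∀ i : Fin (n + 1), i.val = 0 → (x i).2 = 0) ↔ St (ofFn x) := by
      rw [List.ofFn_succ]
      constructor
      · intro h; exact ⟨(x 0).1, _, by rw [← h 0 rfl]⟩
      · rintro ⟨a, t, h⟩ i hi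
        have : i = 0 := Fin.ext hi
        rw [this, (List.cons.inj h).1]
    have h5 : ∑ i, ((x i).1 : ℚ) * (p : ℚ) ^ (x i).2 = wv p (ofFn x) := by
      rw [wv, map_ofFn, sum_ofFn]; rfl
    refine if_congr (and_congr h4 (by rw [h5])) ?_ rfl
    rw [Ft, map_ofFn (f := x) (g := fun x => D P α₀ x.1 x.2)]; rfl
  rw [h1]
  have key : ∀ Y : Finset ℕ, Y ⊆ X ∪ alph P → (∀ a ∈ X ∪ alph P, a ∉ Y →
      (⌈P.w⌉₊ ≤ a ∨ α * (p : ℚ) ^ N < a)) →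
      Fs P α₀ η Y N α = Fs P α₀ η (X ∪ alph P) N α := by
    intro Y hY h
    refine sum_subset (words_mono (Finset.product_subset_product_left hY) _) ?_
    intro l hl hl'
    split_ifs with h6
    · have h7 := mem_words.1 hl
      rw [mem_words] at hl'
      push Not at hl'
      obtain ⟨x, hx, hx'⟩ := hl' h7.1
      obtain ⟨h8, h9⟩ := mem_product.1 (h7.2 x hx)
      have h10 : x.1 ∉ Y := fun h' => hx' (mem_product.2 ⟨h', h9⟩)
      rcases h _ h8 h10 with h11 | h11
      · exact Ft_eq_zero hx h11
      · exfalso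
        have := le_wv (p := p) (N := N) hx (mem_Icc.1 h9).1
        rw [← h6.2] at this; linarith
    · rfl
  have hZ : ∀ a ∈ X ∪ alph P, a ∈ Z0 p := fun a ha =>
    (Finset.mem_union.1 ha).elim (fun h => (Finset.mem_filter.1 h).2) fun h => (Finset.mem_filter.1 h).2
  rw [key X Finset.subset_union_left, key (alph P) Finset.subset_union_right]
  · intro a ha ha'
    left
    by_contra h
    exact ha' (Finset.mem_filter.2 ⟨mem_range.2 (not_le.1 h), hZ a ha⟩)
  · intro a ha ha'
    right
    have h6 : ⌊α * (p : ℚ) ^ N⌋₊ < a := by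
      by_contra h
      exact ha' (Finset.mem_filter.2 ⟨mem_range.2 (by omega), hZ a ha⟩)
    exact (Nat.lt_of_floor_lt h6)

/-! ### The recursion for the closed form -/

theorem exists_split {m : ℤ} (l : List (ℕ × ℤ)) (hs : l.Pairwise (fun x y => y.2 ≤ x.2))
    (hm : ∀ x ∈ l, m ≤ x.2) : ∃ (l' : List (ℕ × ℤ)) (w : List ℕ), l = l' ++ w.map (fun a : ℕ => (a, m)) ∧
      ∀ x ∈ l', m < x.2 := by
  induction l with
  | nil => exact ⟨[], [], rfl, by simp⟩
  | cons x l ih =>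
    obtain ⟨h1, h2⟩ := List.pairwise_cons.1 hs
    obtain ⟨l', w, rfl, h3⟩ := ih h2 (fun y hy => hm y (mem_cons_of_mem _ hy))
    rcases (hm x mem_cons_self).eq_or_lt with h | h
    · obtain rfl : l' = [] := List.eq_nil_iff_forall_not_mem.2 fun y hy => by
        have := h1 y (by simp [hy])
        have := h3 y hy
        omega
      refine ⟨[], x.1 :: w, ?_, by simp⟩
      rw [map_cons, nil_append, nil_append, h]
    · exact ⟨x :: l', w, rfl, List.forall_mem_cons.2 ⟨h, h3⟩⟩

theorem etaBar_append (hη : η [] = 1) {m : ℤ} {l : List (ℕ × ℤ)} (hl : ∀ x ∈ l, m < x.2)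
    (w : List ℕ) : etaBar p η (l ++ w.map fun a : ℕ => (a, m)) =
      etaBar p η l * frobPow p k m (η w) := by
  classical
  unfold etaBar
  have h1 : (l ++ w.map fun a : ℕ => (a, m)).Pairwise (fun x y => y.2 ≤ x.2) ↔
      l.Pairwise (fun x y => y.2 ≤ x.2) := by
    rw [List.pairwise_append]
    refine ⟨fun h => h.1, fun h => ⟨h, ?_, ?_⟩⟩
    · rw [List.pairwise_map]; exact List.pairwise_of_forall fun _ _ => le_rfl
    · intro x hx y hy
      obtain ⟨a, -, rfl⟩ := mem_map.1 hy; exact (hl x hx).le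
  by_cases hs : l.Pairwise (fun x y => y.2 ≤ x.2)
  · rw [if_pos (h1.2 hs), if_pos hs]
    have hblock : ∀ j ∈ (l.map Prod.snd).toFinset,
        frobPow p k j (η (((l ++ w.map fun a : ℕ => (a, m)).filter fun x => x.2 = j).map Prod.fst)) =
        frobPow p k j (η ((l.filter fun x => x.2 = j).map Prod.fst)) := by
      intro j hj
      obtain ⟨x, hx, rfl⟩ := mem_map.1 (List.mem_toFinset.1 hj)
      have hne := (hl x hx).ne
      rw [List.filter_append, (List.filter_eq_nil_iff (l := w.map fun a : ℕ => (a, m))).2, List.append_nil]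
      intro y hy
      obtain ⟨a, -, rfl⟩ := mem_map.1 hy; simpa using hne
    rcases w with _ | ⟨a, w⟩
    · simp [hη]
    · have hset : ((l ++ (a :: w).map fun a : ℕ => (a, m)).map Prod.snd).toFinset =
          insert m (l.map Prod.snd).toFinset := by
        ext j
        simp only [map_append, map_map, List.toFinset_append, Finset.mem_union,
          List.mem_toFinset, mem_map, Finset.mem_insert, Function.comp]
        constructor
        · rintro (h | ⟨b, -, rfl⟩)
          exacts [Or.inr h, Or.inl rfl]
        · rintro (rfl | h)
          exacts [Or.inr ⟨a, by simp, rfl⟩, Or.inl h]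
      have hnot : m ∉ (l.map Prod.snd).toFinset := by
        intro h
        obtain ⟨x, hx, h⟩ := mem_map.1 (List.mem_toFinset.1 h); exact (hl x hx).ne h.symm
      rw [hset, Finset.prod_insert hnot, Finset.prod_congr rfl hblock, mul_comm]
      congr 3
      rw [List.filter_append, (List.filter_eq_nil_iff (l := l)).2, nil_append,
        List.filter_eq_self.2, map_map]
      · exact (List.map_id (a :: w)).trans rfl
      · intro y hy
        obtain ⟨b, -, rfl⟩ := mem_map.1 hy; simp
      · intro x hx; simpa using (hl x hx).ne'
  · rw [if_neg (fun h => hs (h1.1 h)), if_neg hs, zero_mul]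

theorem wv_append (l : List (ℕ × ℤ)) (w : List ℕ) (m : ℤ) :
    wv p (l ++ w.map fun a : ℕ => (a, m)) = wv p l + (w.sum : ℕ) * (p : ℚ) ^ m := by
  unfold wv
  rw [map_append, sum_append, map_map]
  congr 1
  induction w with
  | nil => simp
  | cons a w ih =>
    rw [map_cons, List.sum_cons, ih, List.sum_cons]
    push_cast; simp only [Function.comp]; ring

theorem Ft_append (hη : η [] = 1) {m : ℤ} {l : List (ℕ × ℤ)} (h0 : l ≠ [])
    (hl : ∀ x ∈ l, m < x.2) (w : List ℕ) : Ft P α₀ η (l ++ w.map fun a : ℕ => (a, m)) =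
      frobPow p k m (η w) • brs (Ft P α₀ η l) (w.map fun a : ℕ => D P α₀ (a : ℤ) m) := by
  unfold Ft
  rw [etaBar_append hη hl, brs_smul, smul_smul]
  obtain ⟨x, l, rfl⟩ := List.exists_cons_of_ne_nil h0
  congr 1
  · simp only [cons_append, map_cons, List.headD_cons]; ring
  · rw [map_append, map_cons, cons_append, lnb_cons, brs_append, lnb_cons, map_map]; rfl

open Classical in
/-- Every word is split into the letters with the exponent `-(N + 1)`, which come last, and the
others. -/
theorem Fs_succ (hη : η [] = 1) (X : Finset ℕ) (N : ℕ) (α : ℚ) :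
    Fs P α₀ η X (N + 1) α = ∑ w ∈ words X p, frobPow p k (-(N + 1 : ℤ)) (η w) •
      brs (Fs P α₀ η X N (α - (w.sum : ℕ) * (p : ℚ) ^ (-(N + 1 : ℤ))))
        (w.map fun a : ℕ => D P α₀ (a : ℤ) (-(N + 1 : ℤ))) := by
  set m : ℤ := -(N + 1 : ℤ) with hm
  have hN : ∀ l ∈ words (X ×ˢ Icc (-(N : ℤ)) 0) p, ∀ x ∈ l, m < x.2 := by
    intro l hl x hx
    have := (mem_Icc.1 (mem_product.1 ((mem_words.1 hl).2 x hx)).2).1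
    omega
  have hcond : ∀ l ∈ words (X ×ˢ Icc (-(N : ℤ)) 0) p, ∀ w : List ℕ,
      (St (l ++ w.map fun a : ℕ => (a, m)) ∧ α = wv p (l ++ w.map fun a : ℕ => (a, m))) ↔
        (St l ∧ α - (w.sum : ℕ) * (p : ℚ) ^ m = wv p l) := by
    intro l hl w
    rw [wv_append, sub_eq_iff_eq_add]
    refine and_congr_left fun _ => ?_
    cases l with
    | nil => cases w <;> simp [St]; omega
    | cons x l => simp [St]
  have hterm : ∀ w, frobPow p k m (η w) •
      brs (Fs P α₀ η X N (α - (w.sum : ℕ) * (p : ℚ) ^ m)) (w.map fun a : ℕ => D P α₀ (a : ℤ) m) =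
      ∑ l ∈ words (X ×ˢ Icc (-(N : ℤ)) 0) p,
        if St (l ++ w.map fun a : ℕ => (a, m)) ∧ α = wv p (l ++ w.map fun a : ℕ => (a, m)) then
          Ft P α₀ η (l ++ w.map fun a : ℕ => (a, m)) else 0 := by
    intro w
    rw [Fs, brs_sum, smul_sum]
    refine sum_congr rfl fun l hl => ?_
    rw [if_congr (hcond l hl w) rfl rfl]
    split_ifs with h
    · rw [Ft_append hη _ (hN l hl)]
      obtain ⟨a, t, rfl⟩ := h.1; simp
    · rw [brs_zero, smul_zero]
  simp only [hterm]
  rw [Finset.sum_comm, ← Finset.sum_product', eq_comm, Fs]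
  refine Finset.sum_bij_ne_zero (fun x _ _ => x.1 ++ x.2.map fun a : ℕ => (a, m)) ?_ ?_ ?_ ?_
  · intro x hx h
    obtain ⟨h1, h2⟩ := mem_product.1 hx
    rw [mem_words]
    constructor
    · by_contra hlen
      apply h
      split_ifs with hc
      · rw [Ft, NilLt.lnb_zero (p := p), smul_zero]; simpa using hlen
      · rfl
    · intro y hy
      rcases mem_append.1 hy with hy | hy
      · have := mem_product.1 ((mem_words.1 h1).2 y hy)
        refine mem_product.2 ⟨this.1, mem_Icc.2 ?_⟩
        have := mem_Icc.1 this.2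
        push_cast; omega
      · obtain ⟨a, ha, rfl⟩ := mem_map.1 hy
        refine mem_product.2 ⟨(mem_words.1 h2).2 a ha, mem_Icc.2 ?_⟩
        push_cast; omega
  · intro x hx _ y hy _ h
    obtain ⟨h1, h2⟩ := mem_product.1 hx
    obtain ⟨h3, h4⟩ := mem_product.1 hy
    have hf : ∀ (l : List (ℕ × ℤ)) (w : List ℕ), (∀ x ∈ l, m < x.2) →
        (l ++ w.map fun a : ℕ => (a, m)).filter (fun x => x.2 ≠ m) = l := by
      intro l w hl
      rw [List.filter_append, List.filter_eq_self.2, (List.filter_eq_nil_iff (l := w.map _)).2,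
        List.append_nil]
      · intro y hy
        obtain ⟨a, -, rfl⟩ := mem_map.1 hy; simp
      · intro x hx; simpa using (hl x hx).ne'
    have e1 : x.1 = y.1 := by rw [← hf x.1 x.2 (hN _ h1), h, hf y.1 y.2 (hN _ h3)]
    refine Prod.ext e1 ?_
    rw [e1] at h
    exact List.map_injective_iff.2 (fun a b h => congrArg Prod.fst h) (List.append_cancel_left h)
  · intro l hl h
    have hs : l.Pairwise (fun x y => y.2 ≤ x.2) := by
      by_contra hs
      apply h
      split_ifs
      · rw [Ft, etaBar, if_neg hs, mul_zero, zero_smul]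
      · rfl
    have hl' := mem_words.1 hl
    obtain ⟨l', w, rfl, h1⟩ := exists_split (m := m) l hs (fun x hx => by
      have := (mem_Icc.1 (mem_product.1 (hl'.2 x hx)).2).1
      push_cast at this; omega)
    refine ⟨(l', w), mem_product.2 ⟨mem_words.2 ⟨?_, fun x hx => ?_⟩,
      mem_words.2 ⟨?_, fun a ha => ?_⟩⟩, h, rfl⟩
    · have := hl'.1
      rw [length_append] at this
      change l'.length < p; omega
    · have h2 := mem_product.1 (hl'.2 x (mem_append_left _ hx))
      have h3 := mem_Icc.1 h2.2
      have h4 := h1 x hx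
      exact mem_product.2 ⟨h2.1, mem_Icc.2 ⟨by omega, h3.2⟩⟩
    · have := hl'.1
      rw [length_append, length_map] at this
      change w.length < p; omega
    · exact (mem_product.1 (hl'.2 (a, m) (List.mem_append_right _ (mem_map.2 ⟨a, ha, rfl⟩)))).1
  · intro x hx h; rfl

theorem Fs_eq_zero {X : Finset ℕ} {N : ℕ} {α : ℚ} (h : ∀ B : ℤ, α * (p : ℚ) ^ N ≠ B) :
    Fs P α₀ η X N α = 0 := by
  classical
  refine sum_eq_zero fun l hl => ?_
  rw [if_neg]
  rintro ⟨-, rfl⟩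
  have hp0 : (p : ℚ) ≠ 0 := by exact_mod_cast hp.out.ne_zero
  have hl' : ∀ x ∈ l, -(N : ℤ) ≤ x.2 := fun x hx =>
    (mem_Icc.1 (mem_product.1 ((mem_words.1 hl).2 x hx)).2).1
  clear hl
  have : ∃ B : ℤ, wv p l * (p : ℚ) ^ N = B := by
    clear h
    induction l with
    | nil => exact ⟨0, by simp [wv]⟩
    | cons x l ih =>
      obtain ⟨B, hB⟩ := ih fun y hy => hl' y (mem_cons_of_mem _ hy)
      obtain ⟨n, hn⟩ := Int.eq_ofNat_of_zero_le (a := x.2 + N) (by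
        have := hl' x mem_cons_self
        omega)
      refine ⟨x.1 * (p : ℤ) ^ n + B, ?_⟩
      push_cast
      rw [← hB, ← zpow_natCast (p : ℚ) n, ← hn, zpow_add₀ hp0, zpow_natCast]
      unfold wv
      rw [map_cons, List.sum_cons]; ring
  obtain ⟨B, hB⟩ := this; exact h B hB

theorem frobT_iterate_D (n : ℕ) (a m : ℤ) : frobT^[n] (D P α₀ a m) = D P α₀ a (m + n) := by
  induction n with
  | zero => simp
  | succ n ih =>
    rw [iterate_succ_apply', ih, frobT_Dgen]
    congr 1
    push_cast; ring

theorem frobT_iterate_smul_brs {L : Type*} [LieRing L] [LieAlgebra Fp L] (n : ℕ) (m : ℤ)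
    (c : k) (x : k ⊗[Fp] L) (l : List (k ⊗[Fp] L)) :
    frobT^[n] (frobPow p k m c • brs x l) =
      frobPow p k (m + n) c • brs (frobT^[n] x) (l.map (frobT^[n])) := by
  induction n with
  | zero => simp
  | succ n ih =>
    rw [iterate_succ_apply', ih, frobT_smul, frobT_brs, map_map, ← frobPow_succ,
      iterate_succ_apply', ← Function.iterate_succ', Nat.cast_succ, add_assoc]

theorem frobT_iterate_sum {L : Type*} [LieRing L] [LieAlgebra Fp L] (n : ℕ) {I : Type*}
    (s : Finset I) (f : I → k ⊗[Fp] L) :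
    frobT^[n] (∑ i ∈ s, f i) = ∑ i ∈ s, frobT^[n] (f i) := by
  induction n with
  | zero => rfl
  | succ n ih => simp only [iterate_succ_apply', ih, map_sum]

/-- The coefficients of `T_N` are the elements `ℱ⁰`, up to a power of `σ`. -/
theorem FF_eq (hη : η [] = 1) (he : IsGivenBy P α₀ η e) (N : ℕ) (A : ℤ) :
    FF e N A = frobT^[N] (F0 P α₀ η (A / (p : ℚ) ^ N) N) := by
  classical
  have hp0 : (p : ℚ) ≠ 0 := by exact_mod_cast hp.out.ne_zero
  simp only [F0_eq]
  induction N generalizing A with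
  | zero =>
    have hterm : ∀ w : List ℕ, w ≠ [] → (if St (w.map fun a : ℕ => (a, (0 : ℤ))) ∧
            (A : ℚ) / (p : ℚ) ^ 0 = wv p (w.map fun a : ℕ => (a, (0 : ℤ)))
          then Ft P α₀ η (w.map fun a : ℕ => (a, (0 : ℤ))) else 0) =
        if A = (w.sum : ℕ) then
          (((w.headD 0 : ℕ) : k) * η w) • lnb (w.map fun a : ℕ => D P α₀ (a : ℤ) 0) else 0 := by
      intro w hw
      have e1 := wv_append (p := p) [] w 0
      have e2 := etaBar_append (p := p) hη (m := 0) (l := []) (by simp) w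
      rw [nil_append] at e1 e2
      refine if_congr ?_ ?_ rfl
      · rw [e1, pow_zero, div_one, zpow_zero, mul_one]
        constructor
        · rintro ⟨-, h⟩
          have : wv p [] = 0 := rfl
          rw [this, zero_add] at h
          refine Int.cast_injective (α := ℚ) ?_
          rw [h, cast_natCast]
        · intro h
          refine ⟨?_, by rw [h, cast_natCast]; simp [wv]⟩
          cases w with
          | nil => exact absurd rfl hw
          | cons a w => exact ⟨a, _, rfl⟩
      · have e3 : etaBar p η [] = 1 := by simp [etaBar]
        rw [Ft, e2, e3, one_mul, frobPow_zero, map_map, map_map]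
        congr 3
        exact congrArg (fun l : List ℕ => l.headD 0) (List.map_id w)
    rw [FF_zero he, Function.iterate_zero_apply, Fs]
    refine Finset.sum_bij_ne_zero (fun l _ _ => l.map fun a : ℕ => (a, (0 : ℤ))) ?_ ?_ ?_ ?_
    · intro l hl _
      have := mem_words.1 (Finset.mem_filter.1 hl).1
      refine mem_words.2 ⟨by simpa using this.1, fun x hx => ?_⟩
      obtain ⟨a, ha, rfl⟩ := mem_map.1 hx; exact mem_product.2 ⟨this.2 a ha, by simp⟩
    · intro l _ _ l' _ _ h; exact List.map_injective_iff.2 (fun a b h => congrArg Prod.fst h) h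
    · intro l hl h
      have hl' := mem_words.1 hl
      have hz : ∀ x ∈ l, x.2 = 0 := fun x hx => by
        have := mem_Icc.1 (mem_product.1 (hl'.2 x hx)).2
        simp only [cast_zero, neg_zero] at this; omega
      have e1 : (l.map Prod.fst).map (fun a : ℕ => (a, (0 : ℤ))) = l := by
        rw [map_map]
        conv_rhs => rw [← List.map_id l]
        refine map_congr_left fun x hx => ?_
        exact Prod.ext rfl (hz x hx).symm
      have hne : l.map Prod.fst ≠ [] := by
        intro h0
        rw [List.map_eq_nil_iff] at h0
        apply h
        rw [if_neg]
        rintro ⟨⟨a, t, h1⟩, -⟩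
        rw [h0] at h1
        cases h1
      refine ⟨l.map Prod.fst, Finset.mem_filter.2 ⟨mem_words.2 ⟨by simpa using hl'.1, ?_⟩, hne⟩,
        ?_, e1⟩
      · intro a ha
        obtain ⟨x, hx, rfl⟩ := mem_map.1 ha; exact (mem_product.1 (hl'.2 x hx)).1
      · rw [← hterm _ hne, e1]; exact h
    · intro l hl _; exact (hterm l (Finset.mem_filter.1 hl).2).symm
  | succ N ih =>
    have h1 : (-(N + 1 : ℤ)) + ((N + 1 : ℕ) : ℤ) = 0 := by push_cast; ring
    rw [FF_succ hη he, Fs_succ hη, frobT_iterate_sum]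
    refine sum_congr rfl fun w _ => ?_
    rw [frobT_iterate_smul_brs, map_map, h1, frobPow_zero]
    congr 1
    have h2 : (w.map ((frobT^[N + 1]) ∘ fun a : ℕ => D P α₀ (a : ℤ) (-(N + 1 : ℤ)))) =
        w.map fun a : ℕ => D P α₀ (a : ℤ) 0 := by
      refine map_congr_left fun a _ => ?_
      rw [Function.comp_apply, frobT_iterate_D, h1]
    rw [h2]
    congr 1
    have h3 : (A : ℚ) / (p : ℚ) ^ (N + 1) - (w.sum : ℕ) * (p : ℚ) ^ (-(N + 1 : ℤ)) =
        ((A - (w.sum : ℕ) : ℤ) : ℚ) / (p : ℚ) ^ (N + 1) := by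
      rw [zpow_neg, show ((N : ℤ) + 1) = ((N + 1 : ℕ) : ℤ) by push_cast; rfl, zpow_natCast]
      rw [Int.cast_sub, sub_div, cast_natCast, div_eq_mul_inv ((w.sum : ℕ) : ℚ)]
    rw [h3]
    by_cases hd : (p : ℤ) ∣ A - (w.sum : ℕ)
    · obtain ⟨A', hA'⟩ := hd
      rw [hA', co_sigmaK (Tser_mem he N), iterate_succ_apply']
      change frobT (FF e N A') = _
      rw [ih]
      have h4 : ((p * A' : ℤ) : ℚ) / (p : ℚ) ^ (N + 1) = A' / (p : ℚ) ^ N := by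
        rw [pow_succ]
        push_cast; field_simp
      rw [h4]
    · rw [co_sigmaK_of_not_dvd (Tser_mem he N) hd, Fs_eq_zero]
      · have : ∀ n, frobT^[n] (0 : k ⊗[Fp] P.LBar) = 0 := fun n => by
          induction n with
          | zero => rfl
          | succ n ih => rw [iterate_succ_apply', ih, map_zero]
        exact (this _).symm
      · intro B hB
        apply hd
        refine ⟨B, ?_⟩
        have : ((A - (w.sum : ℕ) : ℤ) : ℚ) = ((p * B : ℤ) : ℚ) := by
          rw [Int.cast_mul, ← hB, pow_succ]
          push_cast; field_simp
        exact_mod_cast this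

end Given

section Coeff

/-! ### The defining condition in terms of the recursive sequence -/

theorem smul_mem_kG {L : Type*} [LieRing L] [LieAlgebra Fp L] {G : L → Prop} (c : k)
    {x : k ⊗[Fp] L} (hx : x ∈ kG k G) : c • x ∈ kG k G := by
  induction hx using span_induction with
  | mem x h => obtain ⟨d, l, hl, rfl⟩ := h; exact subset_span ⟨c * d, l, hl, rfl⟩
  | zero => rw [smul_zero]; exact zero_mem _
  | add x y _ _ hx hy => rw [smul_add]; exact add_mem hx hy
  | smul a x _ hx => rw [smul_comm]; exact smul_mem _ _ hx

theorem lie_mem_kG {L : Type*} [LieRing L] [LieAlgebra Fp L] {G G' G'' : L → Prop}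
    (h : ∀ l m, G l → G' m → G'' ⁅l, m⁆) {x y : k ⊗[Fp] L} (hx : x ∈ kG k G)
    (hy : y ∈ kG k G') : ⁅x, y⁆ ∈ kG k G'' := by
  induction hx using span_induction with
  | mem x hx =>
    obtain ⟨c, l, hl, rfl⟩ := hx
    induction hy using span_induction with
    | mem y hy => obtain ⟨d, m, hm, rfl⟩ := hy; exact subset_span ⟨c * d, _, h _ _ hl hm, rfl⟩
    | _ => simp_all [add_mem, smul_mem]
  | _ => simp_all [add_mem, smul_mem]

variable (P)

/-- The filtration of `ℒ̄` by weight. -/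
abbrev filB (s : ℕ) : Submodule Fp P.LBar := filt p (Params.Zp p) (deg p k) P.wt s

/-- The weight of a word of indices. -/
def wtW (l : List ℕ) : ℕ := (l.map fun a : ℕ => P.wt (a : ℤ)).sum

variable {P}

theorem filB_one (l : P.LBar) : l ∈ filB P 1 := mem_filt_one P.one_le_wt l

theorem D_mem_filB (a : ℕ) : D P α₀ (a : ℤ) 0 ∈ kG k (· ∈ filB P (P.wt a)) := by
  refine kG_mono ?_ (Dgen_mem (p := p) (S := Params.Zp p) (w := P.wt) (α₀ := α₀) (a : ℤ) 0)
  rintro l (rfl | ⟨x, hx, rfl⟩)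
  · exact zero_mem _
  · rw [← hx]; exact genElt_mem_filt x

open Classical in
theorem lt_of_mem_alph {a : ℕ} (ha : a ∈ alph P) : (a : ℝ) < P.w :=
  Nat.lt_ceil.1 (mem_range.1 (Finset.mem_filter.1 ha).1)

theorem q_mul_lt_wt {a : ℕ} (ha : a ∈ alph P) : P.q * a < P.wt a * P.b := by
  have h1 := P.v₀_pos
  have h2 : (a : ℝ) / P.v₀ < (p - 1 : ℕ) := by
    rw [div_lt_iff₀ h1, Nat.cast_sub hp.out.one_le]; simpa [Params.w] using lt_of_mem_alph ha
  have h3 := (Nat.floor_lt (by positivity)).2 h2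
  refine P.q_mul_lt (by simp [Params.wt]) ?_ ?_
  · simp only [Params.wt, cast_natCast]; omega
  · have := Nat.lt_floor_add_one ((a : ℝ) / P.v₀)
    rw [div_lt_iff₀ h1] at this
    simp only [Params.wt, cast_natCast]
    push_cast; exact this

theorem q_mul_sum_le {l : List ℕ} (hl : ∀ a ∈ l, a ∈ alph P) :
    P.q * l.sum + l.length ≤ wtW P l * P.b := by
  induction l with
  | nil => simp
  | cons a l ih =>
    have h1 := ih fun x hx => hl x (mem_cons_of_mem _ hx)
    have h2 := q_mul_lt_wt (hl a mem_cons_self)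
    simp only [wtW, map_cons, List.sum_cons, length_cons] at h1 ⊢; nlinarith

theorem brs_mem_filB {M : ℕ → Submodule Fp P.LBar}
    (hM : ∀ s s' l l', l ∈ M s → l' ∈ filB P s' → ⁅l, l'⁆ ∈ M (s + s')) {s : ℕ}
    {x : k ⊗[Fp] P.LBar} (hx : x ∈ kG k (· ∈ M s)) (l : List ℕ) :
    brs x (l.map fun a : ℕ => D P α₀ (a : ℤ) 0) ∈ kG k (· ∈ M (s + wtW P l)) := by
  induction l generalizing x s with
  | nil => simpa [wtW, brs_nil] using hx
  | cons a l ih =>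
    rw [map_cons, brs_cons, wtW, map_cons, List.sum_cons, ← add_assoc]
    exact ih (lie_mem_kG (fun l m => hM _ _ l m) hx (D_mem_filB a))

variable (P) in
/-- The elements of weight `≥ u`, where `A` has a presentation by `u` digits
with maximal exponent `N`. -/
def RepL (N : ℕ) (A : ℤ) (l : P.LBar) : Prop :=
  ∃ A' u : ℕ, A = A' ∧ RepA p P.w N u A' ∧ l ∈ filB P u

theorem brs_RepL {N : ℕ} {A : ℤ} {x : k ⊗[Fp] P.LBar} (hx : x ∈ kG k (RepL P N A))
    {l : List ℕ} (hl : ∀ a ∈ l, a ∈ alph P) :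
    brs x (l.map fun a : ℕ => D P α₀ (a : ℤ) 0) ∈ kG k (RepL P N (A + (l.sum : ℕ))) := by
  induction l generalizing x A with
  | nil => simpa [brs_nil] using hx
  | cons a l ih =>
    rw [map_cons, brs_cons, List.sum_cons, Nat.cast_add, ← add_assoc]
    refine ih (lie_mem_kG (fun l m => ?_) hx (D_mem_filB a)) fun x hx => hl x (mem_cons_of_mem _ hx)
    rintro ⟨A', u, rfl, hA, hl'⟩ hm
    refine ⟨A' + a, u + 1, by push_cast; rfl, ?_, ?_⟩
    · simpa using hA.add (P.RepA_single (lt_of_mem_alph (hl a mem_cons_self)))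
    · exact filt_anti (by simp [Params.wt]) (lie_mem_filt hl' hm)

theorem FF_mem_RepL (hη : η [] = 1) (he : IsGivenBy P α₀ η e) (N : ℕ) (A : ℤ) :
    FF e N A ∈ kG k (RepL P N A) := by
  induction N generalizing A with
  | zero =>
    rw [FF_zero he]
    refine sum_mem fun l hl => ?_
    obtain ⟨hl, h0⟩ := Finset.mem_filter.1 hl
    split_ifs with h
    · refine smul_mem_kG _ ?_
      obtain ⟨a, l, rfl⟩ := List.exists_cons_of_ne_nil h0
      have hl' := (mem_words.1 hl).2
      rw [map_cons, lnb_cons, h, List.sum_cons, Nat.cast_add]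
      refine brs_RepL (kG_mono (fun l hl => ?_) (D_mem_filB a))
        fun x hx => hl' x (mem_cons_of_mem _ hx)
      exact ⟨a, 1, rfl, P.RepA_single (lt_of_mem_alph (hl' a mem_cons_self)), filB_one l⟩
    · exact zero_mem _
  | succ N ih =>
    rw [FF_succ hη he]
    refine sum_mem fun l hl => smul_mem_kG _ ?_
    have h : A = (A - (l.sum : ℕ)) + (l.sum : ℕ) := by ring
    rw [show RepL P (N + 1) A = RepL P (N + 1) ((A - (l.sum : ℕ)) + (l.sum : ℕ)) by rw [← h]]
    refine brs_RepL ?_ (mem_words.1 hl).2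
    by_cases hd : (p : ℤ) ∣ A - (l.sum : ℕ)
    · obtain ⟨A', hA'⟩ := hd
      rw [hA', co_sigmaK (Tser_mem he N)]
      refine frobT_mem_kG (kG_mono ?_ (ih A'))
      rintro l ⟨A', u, rfl, hA, hl⟩; exact ⟨p * A', u, by push_cast; rfl, hA.mul, hl⟩
    · rw [co_sigmaK_of_not_dvd (Tser_mem he N) hd]; exact zero_mem _

/-- If a coefficient does not vanish, its index has a presentation by fewer than `p` digits. -/
theorem exists_RepA_of_FF (hη : η [] = 1) (he : IsGivenBy P α₀ η e) {N : ℕ} {A : ℤ}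
    (h : FF e N A ≠ 0) : ∃ A' u : ℕ, A = A' ∧ RepA p P.w N u A' ∧ u < p := by
  by_contra hc
  push Not at hc
  refine h (kG_eq_zero (fun l => ?_) (FF_mem_RepL hη he N A))
  rintro ⟨A', u, hA, hR, hl⟩
  rw [filB, filt_eq_bot (hc A' u hA hR)] at hl; exact hl

variable (P) in
/-- The sum of an ideal and a step of the filtration. -/
def filI (I : LieIdeal Fp P.LBar) (s : ℕ) : Submodule Fp P.LBar :=
  I.toSubmodule ⊔ filB P s

theorem filI_anti {I : LieIdeal Fp P.LBar} {s s' : ℕ} (h : s ≤ s') :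
    filI P I s' ≤ filI P I s := sup_le_sup_left (filt_anti h) _

theorem filI_top {I : LieIdeal Fp P.LBar} {s : ℕ} (h : p ≤ s) :
    filI P I s = I.toSubmodule := by
  rw [filI, filB, filt_eq_bot h, sup_bot_eq]

theorem lie_mem_filI {I : LieIdeal Fp P.LBar} (s s' : ℕ) (l l' : P.LBar)
    (h : l ∈ filI P I s) (h' : l' ∈ filB P s') : ⁅l, l'⁆ ∈ filI P I (s + s') := by
  obtain ⟨x, hx, y, hy, rfl⟩ := mem_sup.1 h
  rw [add_lie]
  refine add_mem (mem_sup_left ?_) (mem_sup_right (lie_mem_filt hy h'))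
  exact lie_mem_left Fp P.LBar I x l' hx

/-- The bounds on the coefficients of the `T_N` modulo an ideal, at the step `s`. -/
def CoefBound (e : LK p k P.LBar) (I : LieIdeal Fp P.LBar) (s : ℕ) : Prop :=
  ∀ (N : ℕ) (A : ℤ), (s : ℤ) * P.b ≤ p * (P.q * A - P.b * (p : ℤ) ^ N) →
    FF e N A ∈ kG k (· ∈ filI P I (s + 2))

/-- The part of the recursion with a nonempty word. -/
theorem FF_succ_mem (hη : η [] = 1) (he : IsGivenBy P α₀ η e) {I : LieIdeal Fp P.LBar}
    {s : ℕ} (hs : ∀ t < s, CoefBound e I t) {N : ℕ} {A : ℤ}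
    (h : (s : ℤ) * P.b ≤ P.q * A - P.b * (p : ℤ) ^ (N + 1)) :
    FF e (N + 1) A - co p k A (sigmaK p (Tser e N)) ∈ kG k (· ∈ filI P I (s + 2)) := by
  classical
  rw [FF_succ hη he, ← Finset.sum_erase_add _ _ (nil_mem_words (X := alph P) hp.out.one_le), hη,
    one_smul, map_nil, brs_nil, List.sum_nil, cast_zero, sub_zero, add_sub_cancel_right]
  refine sum_mem fun l hl => smul_mem_kG _ ?_
  obtain ⟨h0, hl⟩ := Finset.mem_erase.1 hl
  have h1 := q_mul_sum_le (mem_words.1 hl).2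
  have h2 : 1 ≤ l.length := by
    cases l with
    | nil => exact absurd rfl h0
    | cons a l => simp
  by_cases hd : (p : ℤ) ∣ A - (l.sum : ℕ)
  · obtain ⟨A', hA'⟩ := hd
    rw [hA', co_sigmaK (Tser_mem he N)]
    change brs (frobT (FF e N A')) _ ∈ _
    have hb := P.b_pos
    have h4 : P.q * A = P.q * (p * A') + P.q * (l.sum : ℕ) := by rw [← hA']; ring
    have h5 : (P.q : ℤ) * (l.sum : ℕ) + 1 ≤ wtW P l * P.b := by exact_mod_cast by omega
    by_cases h3 : wtW P l ≤ s
    · obtain ⟨t, rfl⟩ := exists_eq_add_of_le h3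
      have h6 : t < wtW P l + t := by
        have : wtW P l ≠ 0 := by
          intro h7
          rw [h7] at h1; omega
        omega
      have h7 := hs t h6 N A' (by
        rw [pow_succ] at h
        push_cast at h; nlinarith)
      have h8 := brs_mem_filB (α₀ := α₀) lie_mem_filI (frobT_mem_kG h7) l
      refine kG_mono (fun l hl => ?_) h8
      exact filI_anti (by omega) hl
    · have h8 := brs_mem_filB (α₀ := α₀) (M := filB P) (s := 1)
        (fun s s' l l' h h' => lie_mem_filt h h')
        (frobT_mem_kG (kG_mono (fun l _ => filB_one l) (FF_mem_RepL hη he N A'))) l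
      refine kG_mono (fun l hl => ?_) h8
      exact mem_sup_right (filt_anti (by omega) hl)
  · rw [co_sigmaK_of_not_dvd (Tser_mem he N) hd, brs_zero]; exact zero_mem _

/-- Along a ray `(N + j, p^j A)` the coefficients agree up to `σ`. -/
theorem FF_ray (hη : η [] = 1) (he : IsGivenBy P α₀ η e) {I : LieIdeal Fp P.LBar}
    {s : ℕ} (hs : ∀ t < s, CoefBound e I t) {N : ℕ} {A : ℤ}
    (h : (s : ℤ) * P.b ≤ p * (P.q * A - P.b * (p : ℤ) ^ N)) (j : ℕ) :
    FF e (N + j) (p ^ j * A) ∈ kG k (· ∈ filI P I (s + 2)) ↔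
      FF e N A ∈ kG k (· ∈ filI P I (s + 2)) := by
  induction j with
  | zero => simp
  | succ j ih =>
    have h0 : (0 : ℤ) ≤ P.q * A - P.b * (p : ℤ) ^ N := by
      have h1 : (0 : ℤ) ≤ (s : ℤ) * P.b := by positivity
      exact nonneg_of_mul_nonneg_right (h1.trans h) (by exact_mod_cast hp.out.pos)
    have h1 := FF_succ_mem hη he hs (N := N + j) (A := p * (p ^ j * A)) (by
      have h2 : P.q * (p * (p ^ j * A)) - P.b * (p : ℤ) ^ (N + j + 1) =
        p ^ j * (p * (P.q * A - P.b * (p : ℤ) ^ N)) := by ring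
      rw [h2]
      refine h.trans (le_mul_of_one_le_left (by positivity) ?_)
      exact_mod_cast Nat.one_le_pow _ _ hp.out.pos)
    rw [co_sigmaK (Tser_mem he _)] at h1
    rw [← ih, ← frobT_mem_kG_iff (x := FF e (N + j) (p ^ j * A)), pow_succ', mul_assoc, ← add_assoc]
    exact ⟨fun h2 => by simpa [FF] using sub_mem h2 h1, fun h2 => by simpa [FF] using add_mem h1 h2⟩

theorem exists_primitive_RepA {N u A : ℕ} (h : RepA p P.w N u A) : ∃ m j A' : ℕ, N = m + j ∧
    A = p ^ j * A' ∧ (m = 0 ∨ ¬ p ∣ A') ∧ RepA p P.w m u A' := by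
  induction N generalizing A with
  | zero => exact ⟨0, 0, A, rfl, by simp, Or.inl rfl, h⟩
  | succ N ih =>
    by_cases hd : p ∣ A
    · obtain ⟨A', rfl⟩ := hd
      obtain ⟨m, j, A'', rfl, rfl, h1, h2⟩ := ih (h.div hp.out.two_le)
      exact ⟨m, j + 1, A'', rfl, by ring, h1, h2⟩
    · exact ⟨N + 1, 0, A, rfl, by simp, Or.inr hd, h⟩

theorem RepA.one_le {w : ℝ} {N u A : ℕ} (h : RepA p w N u A) : 1 ≤ u := by
  obtain ⟨l, rfl, -, ⟨x, hx, -⟩, -⟩ := h; exact List.length_pos_of_mem hx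

theorem lt_ustar {u : ℕ} (hu : u < p) : u ≤ ustar p := by
  have := le_ustar hp.out.two_le (m := 0) (s := u) (by have := hp.out.two_le; omega) hu
  push_cast at this; omega

/-- The condition of the theorem on an ideal. -/
def F0Cond (η : List ℕ → k) (α₀ : k) (mι : ℤ → ℕ) (I : LieIdeal Fp P.LBar) : Prop :=
  ∀ ι ∈ P.A1p, ∀ (m : ℕ) (α : ℚ), α ∈ ASet p P.w (ustar p) m →
    (ι : ℚ) = P.q * (p : ℚ) ^ m * α - (p : ℚ) ^ m * P.b →
      F0 P α₀ η α (m + mι ι) ∈ I.toSubmodule.baseChange k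

theorem F0_mem_iff (hη : η [] = 1) (he : IsGivenBy P α₀ η e) (I : LieIdeal Fp P.LBar)
    {m n A : ℕ} {α : ℚ} (hα : (A : ℚ) = (p : ℚ) ^ m * α) :
    F0 P α₀ η α (m + n) ∈ I.toSubmodule.baseChange k ↔
      FF e (m + n) (p ^ n * A) ∈ kG k (· ∈ I.toSubmodule) := by
  have hp0 : (p : ℚ) ≠ 0 := by exact_mod_cast hp.out.ne_zero
  have h : ((p ^ n * A : ℤ) : ℚ) / (p : ℚ) ^ (m + n) = α := by
    push_cast
    rw [hα, pow_add]; field_simp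
  rw [FF_eq hη he, h, mem_baseChange_iff_kG, frobT_iterate_mem_kG_iff]

/-- Induction on `s`. The coefficients of a ray `p^n ι` agree up to `σ` (`FF_ray`), so consider a
primitive `ι`. If `ι < (p - 2) b`, then `ι ∈ 𝔄⁰₁(p)` and the assumption is about a member of its
ray. For other `ι` the words which contribute to the coefficient have weight `≥ p`, or the
term of the empty word is zero because `A` is prime to `p`. -/
theorem coefBound_of_cond (hη : η [] = 1) (he : IsGivenBy P α₀ η e) {mι : ℤ → ℕ}
    (hmι : ∀ ι ∈ P.A1p, ∀ n : ℕ, ι * (p : ℤ) ^ n ≤ ((p : ℤ) - 1) * P.b → n ≤ mι ι)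
    {I : LieIdeal (ZMod p) P.LBar} (hI : F0Cond η α₀ mι I) (s : ℕ) : CoefBound e I s := by
  have hb := P.b_pos
  have hp2 := hp.out.two_le
  have hpz : (0 : ℤ) < p := by exact_mod_cast hp.out.pos
  induction s using Nat.strong_induction_on with
  | _ s hs =>
  rcases lt_or_ge (p - 2) s with hsp | hsp
  · intro N A h
    have h1 := hs _ hsp N A (h.trans' (by gcongr))
    rw [filI_top (by omega)] at h1 ⊢; exact h1
  intro N A h
  by_cases hF : FF e N A = 0
  · rw [hF]; exact zero_mem _
  obtain ⟨A', u, rfl, hR, hu⟩ := exists_RepA_of_FF hη he hF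
  obtain ⟨m, j, A, rfl, rfl, hprim, hR'⟩ := exists_primitive_RepA hR
  clear hR hF
  set ι : ℤ := P.q * A - P.b * (p : ℤ) ^ m with hι
  have hray : ∀ n : ℕ, (P.q : ℤ) * (p ^ n * A) - P.b * (p : ℤ) ^ (m + n) = p ^ n * ι := by
    intro n
    rw [hι]; ring
  push_cast at h ⊢
  rw [hray] at h
  have hιn : 0 ≤ ι := by
    have h1 : (0 : ℤ) ≤ (s : ℤ) * P.b := by positivity
    exact nonneg_of_mul_nonneg_right (nonneg_of_mul_nonneg_right (h1.trans h) hpz) (by positivity)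
  have hPr : P.Pr ι m u 1 A (p ^ m) := by
    refine ⟨hR'.one_le, lt_ustar hu, hR', Or.inr ⟨[m], rfl, hp.out.one_lt, by simp, by simp,
      by simp⟩, ?_⟩
    rw [hι]; push_cast; rfl
  rcases lt_or_ge ι ((p - 2 : ℕ) * P.b) with hlt | hge
  · have hcast : ((p - 2 : ℕ) : ℤ) = (p : ℤ) - 2 := by omega
    have habs : |ι| ≤ P.b * ((p : ℤ) - 1) := by
      rw [abs_of_nonneg hιn]
      rw [hcast] at hlt; nlinarith
    obtain ⟨h1, h2, h3, h4⟩ := hPr.spec habs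
    have hι0 : ι ≠ 0 := by
      intro h0
      rw [h0, P.zero_spec.2.2.1] at h2; exact absurd h2.symm (pow_ne_zero _ hp.out.ne_zero)
    have hw : P.w0 ι ≤ p - 2 := P.w0_le_iff.2 hlt
    have hA1 : ι ∈ P.A1p := by
      refine ⟨⟨hPr.mem_A0 habs, lt_of_le_of_ne hιn hι0.symm, ?_, ?_, ?_⟩, h3⟩
      · rw [h1, h2]
        rcases hprim with rfl | hprim
        · simp
        · rw [Nat.gcd_assoc]
          exact Nat.Coprime.coprime_dvd_right (Nat.gcd_dvd_right _ _)
            ((Nat.Prime.coprime_iff_not_dvd hp.out).2 hprim).symm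
      · rw [h3]; omega
      · have := P.w0_pos hιn
        rw [h3]; omega
    have hA : (A : ℚ) = (p : ℚ) ^ m * (A / (p : ℚ) ^ m) := by
      have : (p : ℚ) ≠ 0 := by exact_mod_cast hp.out.ne_zero
      field_simp
    have h5 := (F0_mem_iff hη he I hA).1 (hI ι hA1 m (A / (p : ℚ) ^ m)
      ((mem_ASet_iff hp.out.pos (by simp [ustar])).2 ⟨A, P.RepA_extend hR' (lt_ustar hu), hA⟩) (by
        rw [mul_assoc, ← hA, hι]
        push_cast; ring))
    have hmn := hmι ι hA1 (mι ι + 1)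
    generalize mι ι = n at h5 hmn
    have h6 : (s : ℤ) * P.b ≤ p * (P.q * (p ^ n * A) - P.b * (p : ℤ) ^ (m + n)) := by
      have h7 : ¬ (ι * (p : ℤ) ^ (n + 1) ≤ ((p : ℤ) - 1) * P.b) := fun h8 => by
        have := hmn h8
        omega
      rw [hray]
      have h8 : (s : ℤ) ≤ (p : ℤ) - 2 := by omega
      rw [pow_succ] at h7; nlinarith
    have h9 : FF e (m + n) (p ^ n * A) ∈ kG k (· ∈ filI P I (s + 2)) :=
      kG_mono (fun l hl => mem_sup_left hl) h5
    rw [← hray] at h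
    rcases le_total j n with hjn | hjn
    · obtain ⟨i, rfl⟩ := exists_eq_add_of_le hjn
      refine (FF_ray hη he hs h i).1 ?_
      rwa [← mul_assoc, ← pow_add, add_assoc, add_comm i j]
    · obtain ⟨i, rfl⟩ := exists_eq_add_of_le hjn
      have := (FF_ray hη he hs h6 i).2 h9
      rwa [← mul_assoc, ← pow_add, add_assoc, add_comm i n] at this
  · have hsι : (s : ℤ) * P.b ≤ ι := hge.trans' (by gcongr)
    refine (FF_ray hη he hs (hsι.trans (le_mul_of_one_le_left hιn (by omega))) j).2 ?_
    rcases m with _ | m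
    · rw [FF_zero he]
      refine sum_mem fun l hl => ?_
      obtain ⟨hl, h0⟩ := Finset.mem_filter.1 hl
      split_ifs with h1
      · refine smul_mem_kG _ ?_
        have h2 := q_mul_sum_le (mem_words.1 hl).2
        obtain ⟨a, l, rfl⟩ := List.exists_cons_of_ne_nil h0
        have h3 := brs_mem_filB (α₀ := α₀) (M := filB P) (fun s s' l l' h h' => lie_mem_filt h h')
          (D_mem_filB (α₀ := α₀) a) l
        rw [map_cons, lnb_cons]
        have h4 : A = (a :: l).sum := by exact_mod_cast h1
        have h5 : P.wt a + wtW P l = wtW P (a :: l) := by simp [wtW]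
        have h6 : p - 1 < wtW P (a :: l) := by
          by_contra h7
          have h8 : wtW P (a :: l) * P.b ≤ (p - 1) * P.b := Nat.mul_le_mul_right _ (by omega)
          rw [← h4, length_cons] at h2
          have h9 : ((P.q * A : ℕ) : ℤ) < ((p - 1) * P.b : ℕ) := by exact_mod_cast by omega
          have h10 : ((p - 1 : ℕ) : ℤ) = (p - 2 : ℕ) + 1 := by omega
          rw [Nat.cast_mul (p - 1), h10] at h9
          push_cast at h9; simp only [hι, pow_zero, mul_one] at hge; linarith
        rw [h5] at h3
        refine kG_mono (fun l hl => ?_) h3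
        rw [filB, filt_eq_bot (by omega)] at hl
        rw [(mem_bot _).1 hl]; exact zero_mem _
      · exact zero_mem _
    · have h1 := FF_succ_mem hη he hs hsι
      rwa [co_sigmaK_of_not_dvd (Tser_mem he m), sub_zero] at h1
      intro hd
      rcases hprim with h2 | h2
      · omega
      · exact h2 (by exact_mod_cast hd)

/-- By the choice of `m_ι` the condition is an instance of the bound for `s = p - 2`. -/
theorem cond_of_coefBound (hη : η [] = 1) (he : IsGivenBy P α₀ η e) {mι : ℤ → ℕ}
    (hmι : ∀ ι ∈ P.A1p, ∀ n : ℕ, ι * (p : ℤ) ^ n ≤ ((p : ℤ) - 1) * P.b → n ≤ mι ι)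
    {I : LieIdeal (ZMod p) P.LBar} (hI : ∀ s, CoefBound e I s) : F0Cond η α₀ mι I := by
  intro ι hι m α hα hια
  obtain ⟨A, -, hA⟩ := (mem_ASet_iff hp.out.pos (by simp [ustar])).1 hα
  have hp2 := hp.out.two_le
  have hb := P.b_pos
  rw [F0_mem_iff hη he I hA]
  have h1 := hI (p - 2) (m + mι ι) (p ^ mι ι * A) (by
    have h7 : ¬ (ι * (p : ℤ) ^ (mι ι + 1) ≤ ((p : ℤ) - 1) * P.b) := fun h8 => by
      have := hmι ι hι (mι ι + 1) h8
      omega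
    have h2 : ι = P.q * A - P.b * (p : ℤ) ^ m := by
      rw [mul_assoc, ← hA] at hια
      have : (ι : ℚ) = ((P.q * A - P.b * (p : ℤ) ^ m : ℤ) : ℚ) := by rw [hια]; push_cast; ring
      exact_mod_cast this
    have h3 : p * (P.q * ((p : ℤ) ^ mι ι * A) - P.b * (p : ℤ) ^ (m + mι ι)) =
        ι * (p : ℤ) ^ (mι ι + 1) := by
      rw [h2]; ring
    rw [h3]
    have h4 : ((p - 2 : ℕ) : ℤ) = (p : ℤ) - 2 := by omega
    rw [h4]; nlinarith)
  rwa [filI_top (by omega)] at h1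

end Coeff

section SpecialQuot
variable {f : P.LDag →ₗ⁅ZMod p⁆ g} [NilLt p g]

/-! ### Computations in the quotient of special elements -/

instance : NilLt p (Spc P f) := NilLt.of_injective (Spc P f).incl Subtype.val_injective

variable (P f) in
/-- The projection onto the quotient. -/
def spqHom : Spc P f →ₗ⁅Fp⁆ SpQ P f where
  toFun := LieSubmodule.Quotient.mk (N := SpcKer P f)
  map_add' _ _ := rfl
  map_smul' _ _ := rfl
  map_lie' := rfl

instance : NilLt p (SpQ P f) := NilLt.of_surjective (spqHom P f) (mk_surjective _)

theorem spc_lie {x y : LK p k g} (hx : x ∈ Dg k (Sd P f 0)) (hy : y ∈ Dg k (Sd P f 0)) :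
    ⁅x, y⁆ ∈ Dg k (Sd P f 0) := (Spc P f).lie_mem hx hy

theorem bch_mem_Sd {j : ℕ} {x y : LK p k g} (hx : x ∈ Dg k (Sd P f j))
    (hy : y ∈ Dg k (Sd P f j)) : bch p x y ∈ Dg k (Sd P f j) :=
  bch_mem (fun _ h _ h' => Sd_mono (Nat.le_add_left _ _) (lie_mem_Sd h h')) hx hy

theorem bch_bch_congr {c x d c' x' d' : LK p k g} (hc : c ∈ Dg k (Sd P f 0))
    (hx : x ∈ Dg k (Sd P f 0)) (hd : d ∈ Dg k (Sd P f 0)) (hc' : c - c' ∈ Dg k (Nd P f (p - 1)))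
    (hx' : x - x' ∈ Dg k (Nd P f (p - 1))) (hd' : d - d' ∈ Dg k (Nd P f (p - 1))) :
    bch p (bch p c x) d - bch p (bch p c' x') d' ∈ Dg k (Nd P f (p - 1)) := by
  have h : ∀ {y y' : LK p k g}, y ∈ Dg k (Sd P f 0) → y - y' ∈ Dg k (Nd P f (p - 1)) →
      y' ∈ Dg k (Sd P f 0) := fun {y y'} h h' => by
    rw [← sub_sub_cancel y y']; exact sub_mem h (Dg_Nd_le_Sd h')
  have hS := fun x hx y hy => spc_lie (P := P) (f := f) (k := k) (x := x) (y := y) hx hy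
  have hW := fun x hx y hy => lie_mem_Nd (P := P) (f := f) (k := k) (j := 0) (x := x) (y := y) hx hy
  exact bch_congr hS hW (bch_mem_Sd hc hx) (bch_mem_Sd (h hc hc') (h hx hx')) hd (h hd hd')
    (bch_congr hS hW hc (h hc hc') hx (h hx hx') hc' hx') hd'

theorem spq_bch {x y : LK p k g} (hx : x ∈ Dg k (Sd P f 0)) (hy : y ∈ Dg k (Sd P f 0)) :
    bch p (spq x hx) (spq y hy) =
      spq (bch p x y) (bch_mem_Sd hx hy) := by
  have h1 := map_bch (spqHom P f) (⟨x, hx⟩ : Spc P f) ⟨y, hy⟩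
  have h2 := map_bch (Spc P f).incl (⟨x, hx⟩ : Spc P f) ⟨y, hy⟩
  refine h1.symm.trans (congrArg (spqHom P f) (Subtype.ext ?_))
  exact h2

theorem spq_rAd {x y : LK p k g} (hx : x ∈ Dg k (Sd P f 0)) (hy : y ∈ Dg k (Sd P f 0)) :
    rAd Fp p (spq x hx) (spq y hy) =
      spq (rAd Fp p x y) (rAd_mem _ (fun _ h => spc_lie h hx) hy) := by
  have h1 := map_rAd (F := Fp) (p := p) (spqHom P f) (⟨x, hx⟩ : Spc P f) ⟨y, hy⟩
  have h2 := map_rAd (F := Fp) (p := p) (Spc P f).incl (⟨x, hx⟩ : Spc P f) ⟨y, hy⟩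
  refine h1.symm.trans (congrArg (spqHom P f) (Subtype.ext ?_))
  exact h2

theorem spq_logD {x : LK p k g} (hx : x ∈ Dg k (Sd P f 0)) : logD Fp p (deQ P f) (spq x hx) =
      spq (logD Fp p (deK P g) x) (logD_mem _ (fun _ h => spc_lie h hx)
        (Sd_zero (deK_mem hx))) := by
  let δ : Spc P f → Spc P f := fun x => ⟨deK P g x, Sd_zero (deK_mem x.2)⟩
  have h1 := map_logD (F := Fp) (p := p) (spqHom P f) δ (deQ P f) (⟨x, hx⟩ : Spc P f) rfl
  have h2 := map_logD (F := Fp) (p := p) (Spc P f).incl δ (deK P g) (⟨x, hx⟩ : Spc P f) rfl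
  refine h1.symm.trans (congrArg (spqHom P f) (Subtype.ext ?_))
  exact h2

/-! ### Functoriality -/

variable {g' : Type*} [LieRing g'] [LieAlgebra (ZMod p) g'] (h : g →ₗ⁅ZMod p⁆ g')

theorem map_fil {s : ℕ} {l : g} (hl : l ∈ fil P f s) : h l ∈ fil P (h.comp f) s := by
  obtain ⟨x, hx, rfl⟩ := hl; exact ⟨x, hx, rfl⟩

theorem map_filG {s m : ℕ} {l : g} (hl : l ∈ filG P f s m) : h l ∈ filG P (h.comp f) s m := by
  obtain ⟨x, hx, rfl⟩ := hl; exact ⟨x, hx, rfl⟩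

theorem lT_mem_Nd {j : ℕ} {x : LK p k g} (hx : x ∈ Dg k (Nd P f j)) :
    lT k h x ∈ Dg k (Nd P (h.comp f) j) := by
  refine map_mem_Dg (lT k h : LK p k g →ₗ[Fp] LK p k g') ?_ hx
  rintro i c l ⟨s, h1, h2, h3⟩; exact mt_mem_Dg ⟨s, h1, h2, map_fil h h3⟩

theorem lT_mem_Sd {j : ℕ} {x : LK p k g} (hx : x ∈ Dg k (Sd P f j)) :
    lT k h x ∈ Dg k (Sd P (h.comp f) j) := by
  refine map_mem_Dg (lT k h : LK p k g →ₗ[Fp] LK p k g') ?_ hx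
  rintro i c l (⟨s, m, h1, h2, h3, h4, h5, h6⟩ | ⟨s, h1, h2, h3⟩)
  · exact mt_mem_Dg (Or.inl ⟨s, m, h1, h2, h3, h4, h5, map_filG h h6⟩)
  · exact mt_mem_Dg (Or.inr ⟨s, h1, h2, map_fil h h3⟩)

theorem lT_twK (γ : Fp) {x : LK p k g} {G : ℤ → g → Prop} (hx : x ∈ Dg k G) :
    lT k h (twK P g γ x) = twK P g' γ (lT k h x) := by
  induction hx using span_induction with
  | mem x hx =>
    obtain ⟨i, c, l, -, rfl⟩ := hx
    rw [lT_mt, twK_mt, twK_mt, map_sum]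
    refine sum_congr rfl fun j _ => ?_
    rw [map_smul, lT_mt]
  | _ => simp_all

/-! ### The spaces of the statement -/

theorem id_fil (s : ℕ) : fil P (LieHom.id : P.LDag →ₗ⁅Fp⁆ P.LDag) s = P.filtDag s :=
  Submodule.map_id _

theorem id_filG (s m : ℕ) : filG P (LieHom.id : P.LDag →ₗ⁅Fp⁆ P.LDag) s m =
    P.filtDag s ⊓ P.gradDag m :=
  Submodule.map_id _

theorem mem_NDag_iff {j : ℕ} {x : LK p k P.LDag} : x ∈ NDag P j ↔ x ∈ Dg k (Nd P LieHom.id j) := by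
  have h1 := mem_span_tneg_iff (p := p) (k := k) (I := ℕ × ℤ)
    (fun a => 1 ≤ a.1 ∧ a.2 + j * P.b < a.1 * P.b) (fun a => a.2) (fun a => P.filtDag a.1) x
  have h2 : {z | ∃ (s : ℕ) (a : ℤ), ∃ l ∈ (P.filtDag s).baseChange k,
      1 ≤ s ∧ a + j * P.b < s * P.b ∧ z = tneg p a l} =
      {z | ∃ a : ℕ × ℤ, (1 ≤ a.1 ∧ a.2 + j * P.b < a.1 * P.b) ∧
        ∃ l ∈ (P.filtDag a.1).baseChange k, z = tneg p a.2 l} := by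
    ext z
    constructor
    · rintro ⟨s, a, l, hl, h3, h4, h5⟩; exact ⟨(s, a), ⟨h3, h4⟩, l, hl, h5⟩
    · rintro ⟨a, ⟨h3, h4⟩, l, hl, h5⟩; exact ⟨a.1, a.2, l, hl, h3, h4, h5⟩
  rw [NDag, h2, h1]
  have h3 : (fun (i : ℤ) (l : P.LDag) => ∃ a : ℕ × ℤ, (1 ≤ a.1 ∧ a.2 + j * P.b < a.1 * P.b) ∧
      a.2 = i ∧ l ∈ P.filtDag a.1) = Nd P LieHom.id j := by
    ext i l
    simp only [Nd, id_fil]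
    constructor
    · rintro ⟨a, ⟨h3, h4⟩, rfl, hl⟩; exact ⟨a.1, h3, h4, hl⟩
    · rintro ⟨s, h3, h4, hl⟩; exact ⟨(s, i), ⟨h3, h4⟩, rfl, hl⟩
  rw [h3]

theorem mem_NSp_iff {j : ℕ} {x : LK p k P.LDag} : x ∈ NSp P j ↔ x ∈ Dg k (Spd P LieHom.id j) := by
  have h1 := mem_span_tneg_iff (p := p) (k := k) (I := ℕ × ℕ × ℤ)
    (fun a => 1 ≤ a.1 ∧ a.2.2 ∈ P.A0 ∧ a.2.2 + P.ch a.2.2 * P.b < a.1 * P.b ∧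
      a.2.1 + j ≤ P.ch a.2.2 ∧ (P.kap a.2.2 : ℤ) ≤ ((p : ℤ) - 3) * a.2.1 + a.1)
    (fun a => a.2.2) (fun a => P.filtDag a.1 ⊓ P.gradDag a.2.1) x
  refine Iff.trans (Eq.to_iff (congrArg (x ∈ ·) ?_)) (h1.trans (Eq.to_iff ?_))
  · refine congrArg (Submodule.span k) (Set.ext fun z => ?_)
    constructor
    · rintro ⟨s, m, i, l, hl, h2, h3, h4, h5, h6, h7⟩
      exact ⟨(s, m, i), ⟨h2, h3, h4, h5, h6⟩, l, hl, h7⟩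
    · rintro ⟨a, ⟨h2, h3, h4, h5, h6⟩, l, hl, h7⟩
      exact ⟨a.1, a.2.1, a.2.2, l, hl, h2, h3, h4, h5, h6, h7⟩
  · congr 2
    ext i l
    simp only [Spd, id_filG]
    constructor
    · rintro ⟨a, ⟨h2, h3, h4, h5, h6⟩, rfl, hl⟩; exact ⟨a.1, a.2.1, h2, h3, h4, h5, h6, hl⟩
    · rintro ⟨s, m, h2, h3, h4, h5, h6, hl⟩; exact ⟨(s, m, i), ⟨h2, h3, h4, h5, h6⟩, rfl, hl⟩

theorem mem_sup_iff {j : ℕ} {x : LK p k P.LDag} :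
    x ∈ NSp P j ⊔ NKer P ↔ x ∈ Dg k (Sd P LieHom.id j) := by
  unfold Sd
  rw [Dg_or, mem_sup, mem_sup]; simp only [mem_NSp_iff, mem_NDag_iff]

end SpecialQuot

section Section
variable {p : ℕ}

/-! ### The section of `𝒱` -/

theorem lnb_map_cases {S S' : Set ℤ} {N N' : ℕ} {w' : ℤ → ℕ} {f : Gen S N → TLie p S' N' w'}
    {R : Gen S N → Gen S' N' → Prop} (hf : ∀ x, f x = 0 ∨ ∃ y, f x = genElt p w' y ∧ R x y)
    (l : List (Gen S N)) : lnb (l.map f) = 0 ∨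
      ∃ l', List.Forall₂ R l l' ∧ lnb (l.map f) = lnb (l'.map (genElt p w')) := by
  by_cases h0 : (0 : TLie p S' N' w') ∈ l.map f
  · exact Or.inl (lnb_eq_zero_of_mem _ h0)
  · right
    suffices h : ∃ l', List.Forall₂ R l l' ∧ l.map f = l'.map (genElt p w') by
      obtain ⟨l', h1, h2⟩ := h; exact ⟨l', h1, by rw [h2]⟩
    induction l with
    | nil => exact ⟨[], List.Forall₂.nil, rfl⟩
    | cons x l ih =>
      simp only [map_cons, List.mem_cons, not_or] at h0
      obtain ⟨l', h1, h2⟩ := ih h0.2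
      rcases hf x with h | ⟨y, h3, h4⟩
      · exact absurd h.symm h0.1
      · exact ⟨y :: l', List.Forall₂.cons h4 h1, by simp [h2, h3]⟩

theorem wtSum_le_of_forall₂ {S S' : Set ℤ} {N N' : ℕ} {w w' : ℤ → ℕ} {l : List (Gen S N)}
    {l' : List (Gen S' N')} (h : List.Forall₂ (fun x y => w x.index ≤ w' y.index) l l') :
    wtSum w l ≤ wtSum w' l' := by
  induction h with
  | nil => rfl
  | cons h _ ih => simp only [wtSum_cons]; omega

namespace Params
variable {N₀ : ℕ} [hp : Fact p.Prime] (P : Params p N₀)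

open Classical in
/-- Values of the section on the free generators. -/
def sGen : Gen (Zp p) N₀ → P.LDag
  | none => genElt p P.wDag none
  | some (a, i) => xgen p P.Ap P.wDag (P.q * a) i

theorem lt_wt {a : ℕ} : (a : ℝ) < P.wt a * P.v₀ := by
  have := Nat.lt_floor_add_one ((a : ℝ) / P.v₀)
  rw [div_lt_iff₀ P.v₀_pos] at this
  simp only [wt, cast_natCast]
  push_cast; exact this

theorem lt_w_of_wt {a s : ℕ} (hs : s < p) (h : (a : ℝ) < s * P.v₀) : (a : ℝ) < P.w := by
  refine h.trans_le (mul_le_mul_of_nonneg_right ?_ P.v₀_pos.le)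
  have : ((s + 1 : ℕ) : ℝ) ≤ p := by exact_mod_cast hs
  push_cast at this; linarith

theorem q_mul_mem_A0 {a s : ℕ} (hs0 : 1 ≤ s) (hs : s < p) (h : (a : ℝ) < s * P.v₀) :
    (P.q * a : ℤ) ∈ P.A0 ∧ P.pa (P.q * a) = a ∧ P.pb (P.q * a) = 0 ∧ P.ch (P.q * a) = 0 ∧
      P.kap (P.q * a) = 1 := by
  refine P.single_spec (P.lt_w_of_wt hs h) ?_
  refine (P.q_mul_lt hs0 hs h).le.trans ?_
  rw [mul_comm]; exact Nat.mul_le_mul_left _ (by omega)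

theorem wt_le_w0 {a : ℕ} : P.wt a ≤ P.w0 (P.q * a) := by
  have h1 : ((P.q * a : ℕ) : ℤ) < P.w0 (P.q * a) * P.b := by push_cast; exact P.w0_le_iff.1 le_rfl
  have h2 := P.lt_of_q_mul_lt (s := P.w0 (P.q * a)) (a := a) (by exact_mod_cast h1)
  have h3 := (Nat.floor_lt (by have := P.v₀_pos; positivity)).2 ((div_lt_iff₀ P.v₀_pos).2 h2)
  simp only [wt, cast_natCast]; omega

theorem q_mul_mem_Ap {a : ℕ} (ha : (a : ℤ) ∈ Zp p) (h : P.wt a < p) : (P.q * a : ℤ) ∈ P.Ap := by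
  obtain ⟨h1, h2, h3, h4, h5⟩ := P.q_mul_mem_A0 (by simp [wt]) h P.lt_wt
  have h6 : P.w0 (P.q * a) ≤ P.wt a := P.w0_le_iff.2 (by
    exact_mod_cast P.q_mul_lt (by simp [wt]) h P.lt_wt)
  have h7 : (0 : ℤ) < P.q * a := mul_pos (by exact_mod_cast P.q_pos) ha.1
  refine ⟨h1, h7, ?_, by rw [h4]; omega, ?_⟩
  · rw [h2, h3, Nat.gcd_zero_right]; exact Nat.isCoprime_iff_coprime.1 ha.2
  · rw [h4, h5]
    have := P.w0_pos h7.le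
    omega

theorem sGen_spec (x : Gen (Zp p) N₀) : P.sGen x = 0 ∨ ∃ y : Gen P.Ap N₀,
    P.sGen x = genElt p P.wDag y ∧ P.wt x.index ≤ P.wDag y.index ∧ P.ch y.index = 0 := by
  rcases x with _ | ⟨⟨a, ha⟩, i⟩
  · refine Or.inr ⟨none, rfl, ?_, P.zero_spec.2.2.2.1⟩
    have := P.w0_pos le_rfl
    change P.wt 0 ≤ P.w0 0 + _
    have : P.wt 0 = 1 := by simp [wt]
    omega
  · obtain ⟨a, rfl⟩ := Int.eq_ofNat_of_zero_le ha.1.le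
    by_cases h : (P.q * a : ℤ) ∈ P.Ap
    · refine Or.inr ⟨some (⟨_, h⟩, i), by simp [sGen, xgen, h], ?_, ?_⟩
      · exact P.wt_le_w0.trans (Nat.le_add_right _ _)
      · by_cases h1 : P.wt a < p
        · exact (P.q_mul_mem_A0 (by simp [wt]) h1 P.lt_wt).2.2.2.1
        · exfalso
          have h2 := h.2.2.2.1
          have := P.wt_le_w0 (a := a)
          have := hp.out.pos
          omega
    · exact Or.inl (by simp [sGen, xgen, h])

/-- The section of `𝒱` with `D_{a n} ↦ D^†_{qa, n}`. -/
def sec : P.LBar →ₗ⁅ZMod p⁆ P.LDag :=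
  liftHom P.sGen fun x => (P.sGen_spec x).imp_right fun ⟨y, h1, h2, _⟩ => ⟨y, h1, h2⟩

theorem V_sec (x : P.LBar) : P.V (P.sec x) = x := by
  suffices h : P.V.comp P.sec = LieHom.id from LieHom.congr_fun h x
  refine TLie.hom_ext fun x => ?_
  rw [LieHom.comp_apply, sec, liftHom_genElt, LieHom.id_apply]
  rcases x with _ | ⟨⟨a, ha⟩, i⟩
  · exact liftHom_genElt _ _ _
  · obtain ⟨a, rfl⟩ := Int.eq_ofNat_of_zero_le ha.1.le
    have hq : (P.q : ℤ) ≠ 0 := by exact_mod_cast P.q_pos.ne'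
    by_cases h : P.wt a < p
    · have h1 := P.q_mul_mem_Ap ha h
      have h2 := (P.q_mul_mem_A0 (by simp [wt]) h P.lt_wt).2.2.2.1
      rw [show P.sGen (some (⟨(a : ℤ), ha⟩, i)) = genElt p P.wDag (some (⟨_, h1⟩, i)) by
        simp [sGen, xgen, h1], V, liftHom_genElt]
      have h3 : (P.q * a : ℤ) / P.q = a := Int.mul_ediv_cancel_left _ hq
      simp [vGen, h2, h3, xgen, ha]
    · have h1 : genElt p P.wt (some (⟨(a : ℤ), ha⟩, i) : Gen (Zp p) N₀) = 0 := by
        have := lnb_genElt_eq_zero p (Zp p) N₀ P.wt [some (⟨(a : ℤ), ha⟩, i)] (by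
          simpa [wtSum, Gen.index] using not_lt.1 h)
        simpa [lnb] using this
      have h2 : P.sGen (some (⟨(a : ℤ), ha⟩, i)) = 0 := by
        have h3 : (P.q * a : ℤ) ∉ P.Ap := fun h3 => by
          have h2 := h3.2.2.2.1
          have := P.wt_le_w0 (a := a)
          have := hp.out.pos
          omega
        simp [sGen, xgen, h3]
      rw [h1, h2, map_zero]

theorem V_mem_filt {s : ℕ} {x : P.LDag} (hx : x ∈ P.filtDag s) :
    P.V x ∈ filt p (Zp p) N₀ P.wt s := by
  induction hx using span_induction with
  | mem x hx =>
    obtain ⟨l, hl, rfl⟩ := hx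
    rw [map_lnb, map_map]
    have h1 : l.map (P.V ∘ genElt p P.wDag) = l.map P.vGen :=
      map_congr_left fun x _ => liftHom_genElt _ _ _
    rw [h1]
    rcases lnb_map_cases P.vGen_spec l with h | ⟨l', h2, h3⟩
    · rw [h]; exact zero_mem _
    · exact subset_span ⟨l', hl.trans (wtSum_le_of_forall₂ h2), h3⟩
  | _ => simp_all [add_mem, smul_mem]

theorem sec_lnb (l : List (Gen (Zp p) N₀)) : P.sec (lnb (l.map (genElt p P.wt))) = 0 ∨
    ∃ l' : List (Gen P.Ap N₀), wtSum P.wt l ≤ wtSum P.wDag l' ∧ wtSum P.ch l' = 0 ∧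
      P.sec (lnb (l.map (genElt p P.wt))) = lnb (l'.map (genElt p P.wDag)) := by
  rw [map_lnb, map_map]
  have h1 : l.map (P.sec ∘ genElt p P.wt) = l.map P.sGen :=
    map_congr_left fun x _ => liftHom_genElt _ _ _
  rw [h1]
  have h4 : ∀ (l : List (Gen (Zp p) N₀)) (l' : List (Gen P.Ap N₀)),
      List.Forall₂ (fun x y => P.wt x.index ≤ P.wDag y.index ∧ P.ch y.index = 0) l l' →
      wtSum P.ch l' = 0 := by
    intro l l' h
    induction h with
    | nil => rfl
    | cons h _ ih => rw [wtSum_cons, h.2, ih]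
  exact (lnb_map_cases P.sGen_spec l).imp_right fun ⟨l', h2, h3⟩ =>
    ⟨l', wtSum_le_of_forall₂ (h2.imp fun _ _ h => h.1), h4 _ _ h2, h3⟩

theorem sec_mem {s : ℕ} {x : P.LBar} (hx : x ∈ filt p (Zp p) N₀ P.wt s) :
    P.sec x ∈ P.filtDag s ⊓ P.gradDag 0 := by
  induction hx using span_induction with
  | mem x hx =>
    obtain ⟨l, hl, rfl⟩ := hx
    rcases P.sec_lnb l with h | ⟨l', h1, h2, h3⟩
    · rw [h]; exact zero_mem _
    · exact ⟨subset_span ⟨l', hl.trans h1, h3⟩, subset_span ⟨l', h2, h3⟩⟩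
  | _ => simp_all [add_mem, smul_mem]

end Params
end Section

section Subst

/-! ### Substitutions and shifts -/

variable (k) in
/-- The substitution `t ↦ t^q` as a homomorphism of algebras. -/
def substAlg (q : ℕ) (hq : 0 < q) : Laur k →ₐ[Fp] Laur k := AlgHom.ofLinearMap (substLin p q hq)
    ((substLin_mon (p := p) q hq 0 (1 : k)).trans (by rw [mul_zero]; rfl))
    (fun x y => HahnSeries.embDomain_mul (mulEmb q hq) (fun _ _ => mul_add _ _ _) x y)

theorem substK_lie (q : ℕ) (hq : 0 < q) (x y : LK p k L) :
    substK p q hq ⁅x, y⁆ = ⁅substK p q hq x, substK p q hq y⁆ :=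
  (LieAlgebra.ExtendScalars.map (substAlg k q hq) (LieHom.id : L →ₗ⁅Fp⁆ L)).map_lie x y

variable (k L) in
/-- The substitution `t ↦ t^q` as a homomorphism of Lie algebras. -/
def substL (q : ℕ) (hq : 0 < q) : LK p k L →ₗ⁅Fp⁆ LK p k L where
  toLinearMap := substK p q hq
  map_lie' {x y} := substK_lie q hq x y

theorem sigmaK_substK (q : ℕ) (hq : 0 < q) (x : LK p k L) :
    sigmaK p (substK p q hq x) = substK p q hq (sigmaK p x) := by
  induction x using TensorProduct.induction_on with
  | tmul u l =>
    have h : (substAlg k q hq u) ^ Fintype.card Fp =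
      substAlg (p := p) k q hq (u ^ Fintype.card Fp) := (map_pow _ _ _).symm
    exact congrArg (· ⊗ₜ[Fp] l) h
  | _ => simp_all

theorem sigmaK_smul (c : Laur k) (x : LK p k L) : sigmaK p (c • x) = c ^ p • sigmaK p x := by
  induction x using TensorProduct.induction_on with
  | tmul u l =>
    have h : (c * u) ^ Fintype.card Fp = c ^ p * u ^ Fintype.card Fp := by
      rw [ZMod.card, mul_pow]
    exact congrArg (· ⊗ₜ[Fp] l) h
  | _ => simp_all

theorem shiftK_eq (n : ℤ) (x : LK p k L) : shiftK p k L n x = mon n (1 : k) • x := by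
  induction x using TensorProduct.induction_on with
  | tmul u l => rfl
  | _ => simp_all

theorem co_shiftK (i n : ℤ) (x : LK p k L) : co p k i (shiftK p k L n x) = co p k (i + n) x := by
  rw [shiftK_eq, co_mon_smul, one_smul]

theorem sigmaK_shiftK (n : ℤ) (x : LK p k L) :
    sigmaK p (shiftK p k L n x) = shiftK p k L (p * n) (sigmaK p x) := by
  rw [shiftK_eq, shiftK_eq, sigmaK_smul, mon_pow, one_pow]

theorem brIt_shiftK (x : LK p k L) (m : ℕ) (n : ℤ) (y : LK p k L) :
    brIt x m (shiftK p k L n y) = shiftK p k L n (brIt x m y) := by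
  rw [shiftK_eq, shiftK_eq, brIt_smul]

theorem rAd_shiftK (x : LK p k L) (n : ℤ) (y : LK p k L) :
    rAd Fp p x (shiftK p k L n y) = shiftK p k L n (rAd Fp p x y) := by
  simp only [rAd, brIt_shiftK, map_sum, map_smul]

theorem logD_congr {δ δ' : L → L} {x : L} (h : δ x = δ' x) :
    logD Fp p δ x = logD Fp p δ' x := by
  simp only [logD, h]

theorem logD_shiftK (x : LK p k L) (n : ℤ) (y : LK p k L) :
    logD Fp p (fun _ => shiftK p k L n y) x =
      shiftK p k L n (logD Fp p (fun _ => y) x) := by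
  simp only [logD, brIt_shiftK, map_sum, map_smul]

theorem co_substK {q : ℕ} (hq : 0 < q) {G : ℤ → L → Prop} {x : LK p k L} (hx : x ∈ Dg k G)
    (i : ℤ) : co p k (q * i) (substK p q hq x) = co p k i x := by
  induction hx using span_induction with
  | mem x hx =>
    obtain ⟨j, c, l, -, rfl⟩ := hx
    rw [substK_mt, co_mt, co_mt]
    have : (q : ℤ) ≠ 0 := by exact_mod_cast hq.ne'
    simp only [mul_right_inj' this]
  | _ => simp_all

theorem co_substK_of_not_dvd {q : ℕ} (hq : 0 < q) {G : ℤ → L → Prop} {x : LK p k L}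
    (hx : x ∈ Dg k G) {i : ℤ} (hi : ¬ (q : ℤ) ∣ i) : co p k i (substK p q hq x) = 0 := by
  induction hx using span_induction with
  | mem x hx =>
    obtain ⟨j, c, l, -, rfl⟩ := hx
    rw [substK_mt, co_mt, if_neg]
    rintro rfl; exact hi (dvd_mul_right _ _)
  | _ => simp_all

end Subst

section Pieces

/-! ### The element `ē^{(q)}` -/

theorem index_lt_wt {l : List (Gen (Params.Zp p) (deg p k))} (hl : l ≠ []) :
    ((wtSum Int.toNat l : ℕ) : ℝ) < (wtSum P.wt l : ℕ) * P.v₀ := by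
  have h0 : ∀ x : Gen (Params.Zp p) (deg p k),
      ((x.index.toNat : ℕ) : ℝ) < (P.wt x.index : ℕ) * P.v₀ := by
    intro x
    have h1 : x.index = (x.index.toNat : ℕ) := by
      rcases x with _ | ⟨⟨a, ha⟩, i⟩
      · rfl
      · exact (Int.toNat_of_nonneg ha.1.le).symm
    conv_rhs => rw [h1]
    exact P.lt_wt
  induction l with
  | nil => exact absurd rfl hl
  | cons x l ih =>
    rw [wtSum_cons, wtSum_cons]
    push_cast
    rw [add_mul]
    by_cases h : l = []
    · subst h; simpa [wtSum] using h0 x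
    · exact add_lt_add (h0 x) (ih h)

/-- A nonzero bracket of total index `A` has a weight `s < p` with `A < s v₀`. -/
theorem lnb_cases (l : List (Gen (Params.Zp p) (deg p k))) :
    lnb (l.map (genElt p P.wt)) = 0 ∨ ∃ s : ℕ, 1 ≤ s ∧ s < p ∧
      ((wtSum Int.toNat l : ℕ) : ℝ) < s * P.v₀ ∧ lnb (l.map (genElt p P.wt)) ∈ filB P s := by
  by_cases h0 : l = []
  · subst h0; exact Or.inl rfl
  rcases lt_or_ge (wtSum P.wt l) p with h | h
  · refine Or.inr ⟨wtSum P.wt l, ?_, h, index_lt_wt h0, subset_span ⟨l, le_rfl, rfl⟩⟩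
    exact (List.length_pos_iff.2 h0).trans_le (length_le_wtSum P.one_le_wt l)
  · exact Or.inl (lnb_genElt_eq_zero _ _ _ _ _ h)

variable (P) in
/-- The special elements with exponents in `qℤ`. -/
def Eqd (f : P.LDag →ₗ⁅Fp⁆ g) (i : ℤ) (l : g) : Prop := Spd P f 0 i l ∧ P.pb i = 0 ∧ P.ch i = 0

variable {f : P.LDag →ₗ⁅ZMod p⁆ g}

theorem Eqd_word {l : List (Gen (Params.Zp p) (deg p k))} {s : ℕ} (hs : 1 ≤ s) (hsp : s < p)
    (h : ((wtSum Int.toNat l : ℕ) : ℝ) < s * P.v₀) (h' : lnb (l.map (genElt p P.wt)) ∈ filB P s) :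
    Eqd P f (P.q * (wtSum Int.toNat l : ℕ)) (f (P.sec (lnb (l.map (genElt p P.wt))))) := by
  obtain ⟨h1, h2, h3, h4, h5⟩ := P.q_mul_mem_A0 hs hsp h
  refine ⟨⟨s, 0, hs, h1, ?_, by omega, by rw [h5]; push_cast; omega,
    Submodule.mem_map_of_mem (P.sec_mem h')⟩, h3, h4⟩
  rw [h4, cast_zero, zero_mul, add_zero]; exact_mod_cast P.q_mul_lt hs hsp h

theorem substK_mem_Eqd {x : LK p k P.LBar} (hx : x ∈ Dg k (Ix P)) :
    lT k (f.comp P.sec) (substK p P.q P.q_pos x) ∈ Dg k (Eqd P f) := by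
  induction hx using span_induction with
  | mem x hx =>
    obtain ⟨i, c, l, ⟨A, rfl, hl⟩, rfl⟩ := hx
    rw [substK_mt, lT_mt]
    induction hl using span_induction with
    | mem x hx =>
      obtain ⟨l, rfl, rfl⟩ := hx
      rcases lnb_cases (P := P) l with h | ⟨s, h1, h2, h3, h4⟩
      · rw [h, map_zero, mt, tmul_zero]; exact zero_mem _
      · exact mt_mem_Dg (Eqd_word h1 h2 h3 h4)
    | zero => rw [map_zero, mt, tmul_zero]; exact zero_mem _
    | add x y _ _ hx hy => rw [map_add, mt, tmul_add]; exact add_mem hx hy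
    | smul a x _ hx => rw [map_smul, mt, tmul_smul]; exact smul_mem _ _ hx
  | _ => simp_all [add_mem, smul_mem]

theorem deK_substK {x : LK p k P.LBar} (hx : x ∈ Dg k (Ix P)) :
    deK P g (lT k (f.comp P.sec) (substK p P.q P.q_pos x)) =
      shiftK p k g P.b (lT k (f.comp P.sec) (substK p P.q P.q_pos (derZ (idxDer P) x))) := by
  induction hx using span_induction with
  | mem x hx =>
    obtain ⟨i, c, l, ⟨A, rfl, hl⟩, rfl⟩ := hx
    rw [substK_mt, lT_mt, deK_mt, derZ_mt, substK_mt, lT_mt, shiftK_mt]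
    induction hl using span_induction with
    | mem x hx =>
      obtain ⟨l, rfl, rfl⟩ := hx
      rcases lnb_cases (P := P) l with h | ⟨s, h1, h2, h3, h4⟩
      · simp only [h, map_zero, mt, tmul_zero]
      · obtain ⟨h5, h6, -⟩ := P.q_mul_mem_A0 h1 h2 h3
        rw [paE_of_mem h5, h6, idxDer, TLie.der_lnb]
        have h7 : (l.map fun x => ((x.index : ℤ) : Fp)).sum = ((wtSum Int.toNat l : ℕ) : Fp) := by
          clear h1 h2 h3 h4 h5 h6
          induction l with
          | nil => simp [wtSum]
          | cons x l ih =>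
            rw [map_cons, List.sum_cons, ih, wtSum_cons]
            have h1 : x.index = (x.index.toNat : ℕ) := by
              rcases x with _ | ⟨⟨a, ha⟩, i⟩
              · rfl
              · exact (Int.toNat_of_nonneg ha.1.le).symm
            conv_lhs => rw [h1]
            push_cast; rfl
        rw [h7, map_smul, mt, mt, tmul_smul, Nat.cast_smul_eq_nsmul]
        have h8 : mon (-(P.q * (wtSum Int.toNat l : ℕ) - P.b)) (((wtSum Int.toNat l : ℕ) : k) * c) =
            wtSum Int.toNat l • mon (-(P.q * (wtSum Int.toNat l : ℕ) - P.b)) c := by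
          rw [← nsmul_eq_mul (wtSum Int.toNat l) c]; exact map_nsmul (monLin p (k := k) _) _ _
        rw [h8, smul_tmul']
    | zero => simp only [map_zero, mt, tmul_zero]
    | add x y _ _ hx hy =>
      simp only [map_add, mt, tmul_add] at hx hy ⊢
      rw [hx, hy]
    | smul a x _ hx =>
      simp only [map_smul, mt, tmul_smul] at hx ⊢
      rw [hx]
  | _ => simp_all

/-! ### The terms of the solution of the linearized equation -/

variable (P) in
/-- The image of `ē^{(q)}`. -/
def xq (e : LK p k P.LBar) (π : P.LBar →ₗ⁅Fp⁆ g) : LK p k g := lT k π (substK p P.q P.q_pos e)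

variable (P) in
/-- The elements `t^{b p^N} T_N(t^q)`. -/
def tm (e : LK p k P.LBar) (π : P.LBar →ₗ⁅Fp⁆ g) (N : ℕ) : LK p k g :=
  shiftK p k g (P.b * (p : ℤ) ^ N) (lT k π (substK p P.q P.q_pos (Tser e N)))

variable (π : P.LBar →ₗ⁅ZMod p⁆ g)

theorem comp_V_sec : (π.comp P.V).comp P.sec = π := by
  ext x
  simp only [LieHom.comp_apply, P.V_sec]

theorem xq_mem (he : IsGivenBy P α₀ η e) : xq P e π ∈ Dg k (Eqd P (π.comp P.V)) := by
  have h := substK_mem_Eqd (f := π.comp P.V) (given_mem he)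
  rwa [comp_V_sec] at h

theorem logD_xq (he : IsGivenBy P α₀ η e) : logD Fp p (deK P g) (xq P e π) = tm P e π 0 := by
  have h := deK_substK (f := π.comp P.V) (given_mem he)
  rw [comp_V_sec] at h
  rw [xq, logD_congr (δ' := fun _ => _) h, logD_shiftK, tm, pow_zero, mul_one, Tser]
  congr 1
  rw [← map_logD (lT k π) (fun _ => substK p P.q P.q_pos (derZ (idxDer P) e)) _ _ rfl]
  congr 1
  exact (map_logD (substL k P.LBar P.q P.q_pos) (derZ (idxDer P))
    (fun _ => substK p P.q P.q_pos (derZ (idxDer P) e)) e rfl).symm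

theorem rAd_tm (N : ℕ) : rAd Fp p (xq P e π) (sigmaK p (tm P e π N)) = tm P e π (N + 1) := by
  rw [tm, sigmaK_shiftK, rAd_shiftK, ← lT_sigmaK, sigmaK_substK, xq, ← map_rAd, tm, Tser]
  have h : (p : ℤ) * (P.b * (p : ℤ) ^ N) = P.b * (p : ℤ) ^ (N + 1) := by ring
  rw [h]
  congr 2
  exact (map_rAd (F := Fp) (p := p) (substL k P.LBar P.q P.q_pos) e _).symm

theorem co_tm (he : IsGivenBy P α₀ η e) (N : ℕ) (A : ℤ) :
    co p k (P.q * A - P.b * (p : ℤ) ^ N) (tm P e π N) = kTm k π (FF e N A) := by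
  rw [tm, co_shiftK, sub_add_cancel, co_lT, co_substK _ (Tser_mem he N)]; rfl

theorem co_tm_eq_zero (he : IsGivenBy P α₀ η e) {N : ℕ} {i : ℤ}
    (hi : ∀ A : ℤ, i ≠ P.q * A - P.b * (p : ℤ) ^ N) : co p k i (tm P e π N) = 0 := by
  rw [tm, co_shiftK, co_lT, co_substK_of_not_dvd _ (Tser_mem he N), map_zero]
  rintro ⟨A, hA⟩; exact hi A (by rw [← hA]; ring)

theorem tm_true (he : IsGivenBy P α₀ η e) (N : ℕ) :
    tm P e π N ∈ Dg k (fun (_ : ℤ) (_ : g) => True) := by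
  refine map_mem_Dg (shiftK p k g _ ∘ₗ (lT k π : LK p k P.LBar →ₗ[Fp] LK p k g) ∘ₗ
    substK p P.q P.q_pos) (fun i c l _ => ?_) (Tser_mem he N)
  have h : (shiftK p k g (P.b * (p : ℤ) ^ N) ∘ₗ (lT k π : LK p k P.LBar →ₗ[Fp] LK p k g) ∘ₗ
    substK p P.q P.q_pos) (mt p i c l) = shiftK p k g (P.b * (p : ℤ) ^ N)
      (lT k π (substK p P.q P.q_pos (mt p i c l))) := rfl
  rw [h, substK_mt, lT_mt, shiftK_mt]; exact mt_mem_Dg trivial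

theorem ker_kTm {x : k ⊗[Fp] P.LBar} (hx : kTm k π x = 0) : x ∈ kG k (· ∈ π.ker) := by
  have h1 := (Module.Flat.lTensor_exact k (LinearMap.exact_subtype_ker_map
    (π : P.LBar →ₗ[Fp] g))) x
  rw [kTm_eq] at hx
  obtain ⟨y, rfl⟩ := h1.1 hx
  clear hx h1
  induction y using TensorProduct.induction_on with
  | tmul c l => exact subset_span ⟨c, l, LieHom.mem_ker.2 l.2, rfl⟩
  | _ => simp_all [add_mem]

theorem kTm_mem_filG {x : k ⊗[Fp] P.LBar} {s : ℕ} (hx : x ∈ kG k (· ∈ filI P π.ker s)) :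
    kTm k π x ∈ kG k (· ∈ filG P (π.comp P.V) s 0) := by
  induction hx using span_induction with
  | mem x hx =>
    obtain ⟨c, l, hl, rfl⟩ := hx
    refine subset_span ⟨c, π l, ?_, rfl⟩
    obtain ⟨y, hy, z, hz, rfl⟩ := mem_sup.1 hl
    refine ⟨P.sec z, P.sec_mem hz, ?_⟩
    rw [map_add, LieHom.mem_ker.1 hy, zero_add]; exact congrArg π (P.V_sec z)
  | _ => simp_all [add_mem, smul_mem]

theorem mem_filI_of_kTm {x : k ⊗[Fp] P.LBar} {s : ℕ}
    (hx : kTm k π x ∈ kG k (· ∈ fil P (π.comp P.V) s)) : x ∈ kG k (· ∈ filI P π.ker s) := by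
  suffices h : ∃ y ∈ kG k (· ∈ filB P s), kTm k π y = kTm k π x by
    obtain ⟨y, hy, h⟩ := h
    have h1 := ker_kTm π (x := x - y) (by rw [map_sub, h, sub_self])
    rw [← sub_add_cancel x y]
    exact add_mem (kG_mono (fun l hl => mem_sup_left hl) h1)
      (kG_mono (fun l hl => mem_sup_right hl) hy)
  generalize kTm k π x = z at hx
  induction hx using span_induction with
  | mem x hx =>
    obtain ⟨c, l, ⟨m, hm, rfl⟩, rfl⟩ := hx
    exact ⟨c ⊗ₜ P.V m, subset_span ⟨c, _, P.V_mem_filt hm, rfl⟩, rfl⟩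
  | zero => exact ⟨0, zero_mem _, map_zero _⟩
  | add x y _ _ hx hy =>
    obtain ⟨a, ha, rfl⟩ := hx
    obtain ⟨b, hb, rfl⟩ := hy; exact ⟨a + b, add_mem ha hb, map_add _ _ _⟩
  | smul c x _ hx => obtain ⟨a, ha, rfl⟩ := hx; exact ⟨c • a, smul_mem _ _ ha, map_smul _ _ _⟩

end Pieces

section Linear
variable [NilLt p g]
  (π : P.LBar →ₗ⁅ZMod p⁆ g)

/-! ### The linearized equation and the bounds on the coefficients -/

/-- The linearized equation `logD Δ x̄ = Ad(-x̄) σ c - c`, for the image `x̄` of `ē^{(q)}` in `g`. -/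
def LinCond (P : Params p (deg p k)) (e : LK p k P.LBar) (π : P.LBar →ₗ⁅Fp⁆ g) : Prop :=
  ∃ c ∈ Dg k (Sd P (π.comp P.V) 1), sigmaK p c ∈ Dg k (Sd P (π.comp P.V) 1) ∧
    tm P e π 0 - (rAd Fp p (xq P e π) (sigmaK p c) - c) ∈ Dg k (Nd P (π.comp P.V) (p - 1))

theorem Pr_of_RepA {N u A : ℕ} (h : RepA p P.w N u A) (hu : u < p) :
    P.Pr (P.q * A - P.b * (p : ℤ) ^ N) N u 1 A (p ^ N) :=
  ⟨h.one_le, lt_ustar hu, h, Or.inr ⟨[N], rfl, hp.out.one_lt, by simp, by simp, by simp⟩,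
    by push_cast; rfl⟩

theorem kTm_FF_mem (hη : η [] = 1) (he : IsGivenBy P α₀ η e)
    (hC : ∀ s, CoefBound e π.ker s) {N : ℕ} {A i n : ℤ}
    (hi : i = P.q * A - P.b * (p : ℤ) ^ N) (hn : n = i ∨ n = p * i) :
    kTm k π (FF e N A) ∈ kG k (Sd P (π.comp P.V) 1 n) := by
  by_cases hF : FF e N A = 0
  · rw [hF, map_zero]; exact zero_mem _
  obtain ⟨A, u, rfl, hR, hu⟩ := exists_RepA_of_FF hη he hF
  have hp1 : (1 : ℤ) ≤ p := by exact_mod_cast hp.out.one_le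
  have hp2 := hp.out.two_le
  have hb := P.b_pos_int
  have hpc : ((p - 2 : ℕ) : ℤ) = (p : ℤ) - 2 := by omega
  have hone : FF e N A ∈ kG k (· ∈ filI P π.ker 1) :=
    kG_mono (fun l _ => mem_sup_right (filB_one l)) (FF_mem_RepL hη he N A)
  have hni : 0 ≤ n → 0 ≤ i ∧ n ≤ p * i := by
    rcases hn with rfl | rfl
    · intro h; exact ⟨h, le_mul_of_one_le_left h hp1⟩
    · intro h; exact ⟨nonneg_of_mul_nonneg_right h (by omega), le_rfl⟩
  rcases le_or_gt n (-(P.b * ((p : ℤ) - 1))) with h1 | h1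
  · refine kG_mono (fun l hl => ?_) (kTm_mem_filG π hone)
    refine Or.inr (Nd.of_lt (j := 0) (i := 0) ⟨1, le_rfl, ?_, filG_le_fil hl⟩ h1)
    push_cast; linarith
  rcases le_or_gt n (P.b * ((p : ℤ) - 1)) with h2 | h2
  · have habs : |n| ≤ P.b * ((p : ℤ) - 1) := abs_le.2 ⟨h1.le, h2⟩
    have habs' : |i| ≤ P.b * ((p : ℤ) - 1) := by
      rcases hn with rfl | rfl
      · exact habs
      · exact P.abs_le_of_abs_mul_le habs
    have hPr := Pr_of_RepA hR hu
    rw [← hi] at hPr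
    have hA0 := hPr.mem_A0 habs'
    obtain ⟨-, -, hch, -⟩ := hPr.spec habs'
    obtain ⟨hnA, hnc, hnk⟩ : n ∈ P.A0 ∧ P.ch n = 1 ∧ P.kap n = P.kap i := by
      rcases hn with rfl | rfl
      · exact ⟨hA0, hch, rfl⟩
      · obtain ⟨h3, -, -, h4, h5⟩ := P.A0_mul hA0 habs; exact ⟨h3, h4.trans hch, h5⟩
    have hkap : FF e N A ∈ kG k (· ∈ filI P π.ker (P.kap i)) := by
      refine kG_mono (fun l => ?_) (FF_mem_RepL hη he N A)
      rintro ⟨A', u', hA', hR', hl⟩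
      refine mem_sup_right ?_
      obtain rfl : A = A' := by exact_mod_cast hA'
      rcases lt_or_ge u' p with h3 | h3
      · have := Pr_of_RepA hR' h3
        rw [← hi] at this; exact filt_anti (this.spec habs').2.2.2 hl
      · rw [filB, filt_eq_bot h3] at hl
        rw [(mem_bot _).1 hl]; exact zero_mem _
    obtain ⟨t, ht1, ht2, ht3⟩ : ∃ t : ℕ, 1 ≤ t ∧ n + P.b < t * P.b ∧
        FF e N A ∈ kG k (· ∈ filI P π.ker t) := by
      rcases lt_or_ge n 0 with h3 | h3
      · exact ⟨1, le_rfl, by push_cast; linarith, hone⟩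
      · obtain ⟨s, hs⟩ := Int.eq_ofNat_of_zero_le (Int.ediv_nonneg h3 hb.le)
        refine ⟨s + 2, by omega, ?_, hC s N A ?_⟩
        · have := Int.lt_ediv_add_one_mul_self n hb
          rw [hs] at this
          push_cast; linarith
        · have := Int.ediv_mul_le n hb.ne'
          rw [hs] at this
          rw [← hi]; exact this.trans (hni h3).2
    have hmax : FF e N A ∈ kG k (· ∈ filI P π.ker (max (P.kap i) t)) := by
      rcases max_cases (P.kap i) t with h | h <;> rw [h.1] <;> assumption
    refine kG_mono (fun l hl => Or.inl ⟨max (P.kap i) t, 0, by omega, hnA, ?_, by omega, ?_, hl⟩)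
      (kTm_mem_filG π hmax)
    · rw [hnc, Nat.cast_one, one_mul]
      exact ht2.trans_le (mul_le_mul_of_nonneg_right (by exact_mod_cast le_max_right _ _) hb.le)
    · rw [hnk]
      push_cast
      have := le_max_left (P.kap i : ℤ) t
      omega
  · have h3 := hC (p - 2) N A (by
      have h4 := hni (by nlinarith)
      rw [← hi, hpc]; nlinarith)
    refine kG_mono (fun l hl => ?_) (kTm_mem_filG π h3)
    rw [fil_eq_zero (by omega) (filG_le_fil hl)]; exact Or.inr (Nd.zero _ _)

theorem tm_mem (hη : η [] = 1) (he : IsGivenBy P α₀ η e) (hC : ∀ s, CoefBound e π.ker s)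
    (N : ℕ) : tm P e π N ∈ Dg k (Sd P (π.comp P.V) 1) := by
  refine (mem_Dg_iff_co (tm_true π he N)).2 fun i => ?_
  by_cases h : ∃ A : ℤ, i = P.q * A - P.b * (p : ℤ) ^ N
  · obtain ⟨A, hA⟩ := h
    have := kTm_FF_mem π hη he hC hA (Or.inl rfl)
    rwa [← co_tm π he, ← hA] at this
  · push Not at h
    rw [co_tm_eq_zero π he h]; exact zero_mem _

theorem sigmaK_tm_mem (hη : η [] = 1) (he : IsGivenBy P α₀ η e)
    (hC : ∀ s, CoefBound e π.ker s) (N : ℕ) :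
    sigmaK p (tm P e π N) ∈ Dg k (Sd P (π.comp P.V) 1) := by
  refine (mem_Dg_iff_co (sigmaK_true (tm_true π he N))).2 fun n => ?_
  by_cases hd : (p : ℤ) ∣ n
  · obtain ⟨i, rfl⟩ := hd
    rw [co_sigmaK (tm_true π he N)]
    by_cases h : ∃ A : ℤ, i = P.q * A - P.b * (p : ℤ) ^ N
    · obtain ⟨A, hA⟩ := h
      have := frobT_mem_kG (kTm_FF_mem π hη he hC hA (Or.inr rfl))
      rwa [← co_tm π he, ← hA] at this
    · push Not at h
      rw [co_tm_eq_zero π he h, map_zero]; exact zero_mem _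
  · rw [co_sigmaK_of_not_dvd (tm_true π he N) hd]; exact zero_mem _

theorem tm_mem_Nd (hη : η [] = 1) (he : IsGivenBy P α₀ η e) (hC : ∀ s, CoefBound e π.ker s)
    {N : ℕ} (hN : P.q < p ^ (N + 1)) : tm P e π N ∈ Dg k (Nd P (π.comp P.V) (p - 1)) := by
  refine (mem_Dg_iff_co (tm_true π he N)).2 fun i => ?_
  by_cases hi : i ∈ P.A0
  · by_cases h : ∃ A : ℤ, i = P.q * A - P.b * (p : ℤ) ^ N
    · obtain ⟨A, hA⟩ := h
      have hF : FF e N A = 0 := by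
        by_contra hF
        obtain ⟨A, u, rfl, hR, hu⟩ := exists_RepA_of_FF hη he hF
        have hPr := Pr_of_RepA hR hu
        rw [← hA] at hPr
        have := (hPr.bound hi.1 (pow_ne_zero _ hp.out.ne_zero)).1
        omega
      rw [hA, co_tm π he, hF, map_zero]; exact zero_mem _
    · push Not at h
      rw [co_tm_eq_zero π he h]; exact zero_mem _
  · exact kG_mono (fun l hl => Sd.nd_of_notMem hl hi) (co_mem_kG (tm_mem π hη he hC N) i)

theorem rAd_sum {L : Type*} [LieRing L] [LieAlgebra Fp L] (x : L) {I : Type*}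
    (s : Finset I) (y : I → L) :
    rAd Fp p x (∑ i ∈ s, y i) = ∑ i ∈ s, rAd Fp p x (y i) := by
  classical
  induction s using Finset.induction_on with
  | empty => simp [rAd_zero_right]
  | insert i s hi ih => rw [Finset.sum_insert hi, Finset.sum_insert hi, rAd_add, ih]

/-- The sum `c = -∑ T_j` is a solution: the equation telescopes, up to a term of large index, which
is negligible. -/
theorem linCond_of_coefBound (hη : η [] = 1) (he : IsGivenBy P α₀ η e)
    (hC : ∀ s, CoefBound e π.ker s) : LinCond P e π := by
  obtain ⟨J, hJ⟩ : ∃ J, P.q < p ^ (J + 1) :=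
    ⟨P.M, Nat.pow_lt_pow_right hp.out.one_lt (Nat.lt_succ_self _)⟩
  refine ⟨-∑ j ∈ range J, tm P e π j, neg_mem (sum_mem fun j _ => tm_mem π hη he hC j), ?_, ?_⟩
  · rw [map_neg, map_sum]; exact neg_mem (sum_mem fun j _ => sigmaK_tm_mem π hη he hC j)
  · rw [map_neg, map_sum, ← neg_one_smul Fp, rAd_smul, rAd_sum, neg_one_smul]
    simp only [rAd_tm]
    have h1 := sum_range_succ' (tm P e π) J
    have h2 := sum_range_succ (tm P e π) J
    have h3 : tm P e π 0 - (-∑ j ∈ range J, tm P e π (j + 1) -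
        -∑ j ∈ range J, tm P e π j) = tm P e π J := by
      rw [h1] at h2
      rw [sub_neg_eq_add, neg_add_eq_sub, sub_sub_eq_add_sub, add_comm, h2, add_sub_cancel_left]
    rw [h3]; exact tm_mem_Nd π hη he hC hJ

/-! ### The components of the solution -/

variable {f : P.LDag →ₗ⁅ZMod p⁆ g}

open Classical in
variable (P) in
/-- The indicator of the exponents `ι = qA - bB` of a given `B`. -/
def indB (B : ℕ) (i : ℤ) : ℕ := if i ∈ P.A0 ∧ P.pb i = B then 1 else 0

variable (P g) in
/-- The projection onto the exponents `ι = qA - bB` of a given `B`. -/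
def prK (B : ℕ) : LK p k g →ₗ[Fp] LK p k g := rTensor g (diagK p (indB P B))

theorem prK_mt (B : ℕ) (i : ℤ) (c : k) (l : g) :
    prK P g B (mt p i c l) = mt p i ((indB P B i : k) * c) l := by
  have := diagK_mon (p := p) (indB P B) (-i) c
  rw [neg_neg] at this; exact congrArg (· ⊗ₜ[Fp] l) this

theorem prK_mem (B : ℕ) {G : ℤ → g → Prop} {x : LK p k g} (hx : x ∈ Dg k G) :
    prK P g B x ∈ Dg k G :=
  map_mem_Dg _ (fun i c l h => by rw [prK_mt]; exact mt_mem_Dg h) hx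

theorem co_prK (B : ℕ) {G : ℤ → g → Prop} {x : LK p k g} (hx : x ∈ Dg k G) (i : ℤ) :
    co p k i (prK P g B x) = indB P B i • co p k i x := by
  induction hx using span_induction with
  | zero => simp
  | add a b _ _ ha hb => simp only [map_add, ha, hb, smul_add]
  | smul c a _ ha => simp only [map_smul, ha]; rw [smul_comm]
  | mem x hx =>
    obtain ⟨j, c, l, hl, rfl⟩ := hx
    rw [prK_mt, co_mt, co_mt]
    split_ifs with h
    · subst h
      rw [← nsmul_eq_mul, smul_tmul']
    · simp

theorem prK_lie (B : ℕ) {x y : LK p k g} (hx : x ∈ Dg k (Eqd P f)) (hy : y ∈ Dg k (Sd P f 0)) :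
    prK P g B ⁅y, x⁆ - ⁅prK P g B y, x⁆ ∈ Dg k (Nd P f (p - 1)) := by
  induction hx using span_induction with
  | mem x hx =>
    obtain ⟨i', c', l', hl', rfl⟩ := hx
    induction hy using span_induction with
    | mem y hy =>
      obtain ⟨i, c, l, hl, rfl⟩ := hy
      rw [prK_mt, mt_lie, mt_lie, prK_mt, mul_assoc, ← mt_sub_left, ← sub_mul]
      rcases hl with hl | hl
      · rcases hl.lie hl'.1 with h | ⟨h, h1, -⟩
        · exact mt_mem_Dg h
        · obtain ⟨-, -, -, hA', -⟩ := hl'.1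
          obtain ⟨-, -, -, hA, -⟩ := hl
          obtain ⟨-, -, -, hA'', -⟩ := h
          have h2 : P.pb (i + i') = P.pb i := by
            have e1 := P.A0_eq hA''
            have e2 := P.A0_eq hA
            have e3 := P.A0_eq hA'
            rw [h1] at e1
            rw [hl'.2.1] at e3
            have hb : (P.b : ℤ) ≠ 0 := by exact_mod_cast P.b_pos.ne'
            push_cast at e1 e3
            have : (P.b : ℤ) * P.pb (i + i') = P.b * P.pb i := by linarith
            exact_mod_cast mul_left_cancel₀ hb this
          have h3 : indB P B (i + i') = indB P B i := by simp only [indB, hA, hA'', h2]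
          rw [h3, sub_self, zero_mul, mt_zero_left]; exact zero_mem _
      · exact mt_mem_Dg (by simpa using hl.lie hl'.1.nd_zero)
    | zero => simp only [map_zero, zero_lie, sub_zero]; exact zero_mem _
    | add y z _ _ hy hz =>
      rw [add_lie, map_add, map_add, add_lie, add_sub_add_comm]; exact add_mem hy hz
    | smul a y _ hy =>
      rw [smul_lie, map_smul, map_smul, smul_lie, ← smul_sub]; exact smul_mem _ _ hy
  | zero => simp only [map_zero, lie_zero, sub_zero]; exact zero_mem _
  | add x z _ _ hx hz => rw [lie_add, map_add, lie_add, add_sub_add_comm]; exact add_mem hx hz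
  | smul a x _ hx => rw [lie_smul, map_smul, lie_smul, ← smul_sub]; exact smul_mem _ _ hx

theorem Eqd_le : Dg (p := p) k (Eqd P f) ≤ Dg k (Sd P f 0) := Dg_mono fun _ _ h => Or.inl h.1

theorem lie_Nd_right {x y : LK p k g} (hx : x ∈ Dg k (Sd P f 0))
    (hy : y ∈ Dg k (Nd P f (p - 1))) : ⁅y, x⁆ ∈ Dg k (Nd P f (p - 1)) := by
  have h := neg_mem (lie_mem_Nd (j := 0) hx hy)
  rwa [lie_skew] at h

theorem prK_rAd (B : ℕ) {x y : LK p k g} (hx : x ∈ Dg k (Eqd P f)) (hy : y ∈ Dg k (Sd P f 0)) :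
    prK P g B (rAd Fp p x y) - rAd Fp p x (prK P g B y) ∈ Dg k (Nd P f (p - 1)) := by
  have hx' := Eqd_le hx
  rw [rAd, rAd, map_sum, ← sum_sub_distrib]
  refine sum_mem fun m hm => ?_
  clear hm
  rw [map_smul, ← smul_sub]
  refine smul_mem _ _ ?_
  induction m with
  | zero => simp
  | succ m ih =>
    rw [brIt_succ, brIt_succ]
    have h1 := prK_lie B hx (brIt_mem _ (fun _ h => lie_mem_Sd (j' := 0) h hx') hy m)
    have h2 := lie_Nd_right hx' ih
    rw [sub_lie] at h2
    have := add_mem h1 h2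
    rwa [sub_add_sub_cancel] at this

theorem prK_sigmaK {B : ℕ} {x : LK p k g} (hx : x ∈ Dg k (Sd P f 0))
    (hx' : sigmaK p x ∈ Dg k (Sd P f 0)) :
    prK P g (p * B) (sigmaK p x) - sigmaK p (prK P g B x) ∈ Dg k (Nd P f (p - 1)) := by
  refine (mem_Dg_iff_co (sub_mem (prK_mem _ (sigmaK_true hx)) (sigmaK_true (prK_mem _ hx)))).2 ?_
  intro j
  rw [map_sub, co_prK _ hx']
  by_cases hj : (p : ℤ) ∣ j
  · obtain ⟨i, rfl⟩ := hj
    rw [co_sigmaK (prK_mem _ hx), co_sigmaK hx, co_prK _ hx, map_nsmul]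
    by_cases hi : i ∈ P.A0
    · by_cases hi' : (p : ℤ) * i ∈ P.A0
      · have h : indB P (p * B) (p * i) = indB P B i := by
          simp only [indB, hi, hi', (P.A0_mul hi hi'.1).2.2.1, true_and,
            mul_right_inj' hp.out.ne_zero]
        rw [h, sub_self]; exact zero_mem _
      · have h1 := co_mem_kG hx' (p * i)
        rw [co_sigmaK hx] at h1
        have h2 := kG_mono (fun l (hl : Sd P f 0 (p * i) l) => hl.nd_of_notMem hi') h1
        exact sub_mem (nsmul_mem h2 _) (nsmul_mem h2 _)
    · have h2 := kG_mono (fun l (hl : Sd P f 0 i l) => (hl.nd_of_notMem hi).mul)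
        (frobT_mem_kG (co_mem_kG hx i))
      exact sub_mem (nsmul_mem h2 _) (nsmul_mem h2 _)
  · rw [co_sigmaK_of_not_dvd (prK_mem _ hx) hj, co_sigmaK_of_not_dvd hx hj]; simp

theorem prK_sigmaK_of_not_dvd {B : ℕ} (hB : ¬ p ∣ B) {x : LK p k g} (hx : x ∈ Dg k (Sd P f 0)) :
    prK P g B (sigmaK p x) ∈ Dg k (Nd P f (p - 1)) := by
  refine (mem_Dg_iff_co (prK_mem _ (sigmaK_true hx))).2 fun j => ?_
  rw [co_prK _ (sigmaK_true hx)]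
  by_cases hj : (p : ℤ) ∣ j
  · obtain ⟨i, rfl⟩ := hj
    rw [co_sigmaK hx]
    by_cases hi : i ∈ P.A0
    · have h : indB P B (p * i) = 0 := by
        refine if_neg ?_
        rintro ⟨hi', h⟩
        rw [(P.A0_mul hi hi'.1).2.2.1] at h; exact hB ⟨_, h.symm⟩
      rw [h, zero_smul]; exact zero_mem _
    · exact nsmul_mem (kG_mono (fun l (hl : Sd P f 0 i l) => (hl.nd_of_notMem hi).mul)
        (frobT_mem_kG (co_mem_kG hx i))) _
  · rw [co_sigmaK_of_not_dvd hx hj, smul_zero]; exact zero_mem _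

set_option maxHeartbeats 400000 in
/-- Modulo the kernel, `T_j` is a component of `-c`, so that its coefficients satisfy the bounds for
special elements. -/
theorem coefBound_of_linCond (hη : η [] = 1) (he : IsGivenBy P α₀ η e) (h : LinCond P e π)
    (s : ℕ) : CoefBound e π.ker s := by
  obtain ⟨c, hc, hσ, hT⟩ := h
  set f := π.comp P.V
  set x := xq P e π
  have hx : x ∈ Dg k (Eqd P f) := xq_mem π he
  have hx0 := Eqd_le hx
  have hc0 := Sd_zero hc
  have hσ0 := Sd_zero hσ
  have hrA : ∀ {j y}, y ∈ Dg k (Sd P f j) → rAd Fp p x y ∈ Dg k (Sd P f j) :=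
    fun hy => rAd_mem _ (fun z hz => lie_mem_Sd (j' := 0) hz hx0) hy
  have hrN : ∀ {y}, y ∈ Dg k (Nd P f (p - 1)) → rAd Fp p x y ∈ Dg k (Nd P f (p - 1)) :=
    fun hy => rAd_mem _ (fun z hz => lie_Nd_right hx0 hz) hy
  have ht0 : tm P e π 0 ∈ Dg k (Sd P f 0) := by
    have := add_mem (Dg_Nd_le_Sd hT) (sub_mem (hrA hσ0) hc0)
    rwa [sub_add_cancel] at this
  -- away from `B = 1` the element `T₀` is negligible
  have hcoef : ∀ i ∈ P.A0, P.pb i ≠ 1 → co p k i (tm P e π 0) = 0 := by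
    intro i hi hpb
    by_cases h : ∃ A : ℤ, i = P.q * A - P.b * (p : ℤ) ^ 0
    · obtain ⟨A, hA⟩ := h
      have hF : FF e 0 A = 0 := by
        by_contra hF
        obtain ⟨A, u, rfl, hR, hu⟩ := exists_RepA_of_FF hη he hF
        have hPr := Pr_of_RepA hR hu
        rw [← hA] at hPr; exact hpb (by simpa using (hPr.spec hi.1).2.1)
      rw [hA, co_tm π he, hF, map_zero]
    · push Not at h
      rw [co_tm_eq_zero π he h]
  have hind : ∀ {B i}, indB P B i ≠ 0 → i ∈ P.A0 ∧ P.pb i = B := fun {B i} h => by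
    by_contra h'
    exact h (if_neg h')
  have h1 : tm P e π 0 - prK P g 1 (tm P e π 0) ∈ Dg k (Nd P f (p - 1)) := by
    refine (mem_Dg_iff_co (sub_mem ht0 (prK_mem _ ht0))).2 fun i => ?_
    rw [map_sub, co_prK _ ht0]
    by_cases hi : i ∈ P.A0
    · by_cases hpb : P.pb i = 1
      · rw [indB, if_pos ⟨hi, hpb⟩, one_smul, sub_self]; exact zero_mem _
      · rw [hcoef i hi hpb, smul_zero, sub_zero]; exact zero_mem _
    · have h2 := kG_mono (fun l hl => Sd.nd_of_notMem hl hi) (co_mem_kG ht0 i)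
      exact sub_mem h2 (nsmul_mem h2 _)
  have h2 : ∀ B, B ≠ 1 → prK P g B (tm P e π 0) = 0 := by
    intro B hB
    refine eq_of_co_eq (prK_mem _ ht0) (zero_mem (Dg k (Sd P f 0))) fun i => ?_
    rw [co_prK _ ht0, map_zero]
    by_cases hi : indB P B i = 0
    · rw [hi, zero_smul]
    · obtain ⟨h3, h4⟩ := hind hi
      rw [hcoef i h3 (h4 ▸ hB), smul_zero]
  -- the component of `c` at `p^j` is `-Φ^j(T₀)`, where `Φ = Ad(-ē) σ`
  have key : ∀ j, tm P e π j + prK P g (p ^ j) c ∈ Dg k (Nd P f (p - 1)) := by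
    intro j
    induction j with
    | zero =>
      have h3 := prK_mem (P := P) 1 hT
      rw [map_sub, map_sub] at h3
      have h4 := prK_rAd 1 hx hσ0
      have h5 := hrN (prK_sigmaK_of_not_dvd (P := P) (fun h => hp.out.one_lt.ne (Nat.dvd_one.1 h).symm) hc0)
      have := add_mem (add_mem h1 h3) (add_mem h4 h5)
      rw [pow_zero]
      convert this using 1
      generalize prK P g 1 (tm P e π 0) = a, prK P g 1 c = b,
        prK P g 1 (rAd Fp p x (sigmaK p c)) = d
      abel
    | succ j ih =>
      have h3 := prK_mem (P := P) (p ^ (j + 1)) hT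
      have hne : p ^ (j + 1) ≠ 1 := (Nat.one_lt_pow (by omega) hp.out.one_lt).ne'
      rw [map_sub, map_sub, h2 _ hne, zero_sub] at h3
      have h4 := prK_rAd (p ^ (j + 1)) hx hσ0
      have h5 := hrN (prK_sigmaK (B := p ^ j) hc0 hσ0)
      have h6 := hrN (sigmaK_mem ih)
      rw [← pow_succ', rAd_sub] at h5
      rw [map_add, rAd_add, rAd_tm] at h6
      have := add_mem (add_mem (add_mem h3 h4) h5) h6
      convert this using 1
      generalize prK P g (p ^ (j + 1)) c = b, sigmaK p (prK P g (p ^ j) c) = v,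
        prK P g (p ^ (j + 1)) (rAd Fp p x (sigmaK p c)) = a
      abel
  intro N A hA
  set i : ℤ := P.q * A - P.b * (p : ℤ) ^ N with hi
  have h3 : sigmaK p (tm P e π N) ∈ Dg k (Sd P f 1) := by
    have h4 := Dg_Nd_le_Sd (j := 1) (sigmaK_mem (key N))
    have h5 := Dg_Nd_le_Sd (j := 1) (prK_sigmaK (B := p ^ N) hc0 hσ0)
    have h6 := prK_mem (P := P) (p * p ^ N) hσ
    have := sub_mem (add_mem h4 h5) h6
    rw [map_add] at this
    convert this using 1
    abel
  have h4 := co_mem_kG h3 (p * i)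
  rw [co_sigmaK (tm_true π he N), frobT_mem_kG_iff, co_tm π he] at h4
  refine mem_filI_of_kTm π (kG_mono (fun l hl => ?_) h4)
  have hb := P.b_pos_int
  rcases hl with ⟨s', m, -, -, h5, h6, -, h7⟩ | h5
  · refine fil_anti ?_ (filG_le_fil h7)
    have h8 : ((s + 1 : ℕ) : ℤ) * P.b < s' * P.b := by
      refine lt_of_le_of_lt ?_ h5
      have : (1 : ℤ) ≤ P.ch (p * i) := by exact_mod_cast (by omega)
      push_cast; nlinarith
    have := lt_of_mul_lt_mul_right h8 hb.le
    omega
  · rcases h5.neg with h6 | h6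
    · have : (0 : ℤ) ≤ (s : ℤ) * P.b := by positivity
      omega
    · rw [h6]; exact zero_mem _

end Linear

section Central
variable [NilLt p L]

/-- The projection onto the quotient by an ideal. -/
def mkL {L : Type*} [LieRing L] [LieAlgebra Fp L] (I : LieIdeal Fp L) :
    L →ₗ⁅Fp⁆ L ⧸ I where
  toFun := LieSubmodule.Quotient.mk (N := I)
  map_add' _ _ := rfl
  map_smul' _ _ := rfl
  map_lie' := rfl

theorem mkL_eq_zero {L : Type*} [LieRing L] [LieAlgebra Fp L] {I : LieIdeal Fp L}
    {x : L} : mkL I x = 0 ↔ x ∈ I := mk_eq_zero' (N := I)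

theorem mkL_surjective {L : Type*} [LieRing L] [LieAlgebra Fp L] (I : LieIdeal Fp L) :
    Function.Surjective (mkL I) := mk_surjective _

/-- If `x` and `z` commute modulo an ideal, their composition is the sum modulo this ideal. -/
theorem bch_add_mem {S W : Submodule Fp L} (hS : ∀ x ∈ S, ∀ y ∈ S, ⁅x, y⁆ ∈ S)
    (hW : ∀ x ∈ S, ∀ y ∈ W, ⁅x, y⁆ ∈ W) {x z : L} (hx : x ∈ S) (hz : z ∈ S)
    (h : ⁅x, z⁆ ∈ W) : bch p x z - (x + z) ∈ W := by
  let S' : LieSubalgebra Fp L := { S with lie_mem' := fun hx hy => hS _ hx _ hy }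
  let W' : LieIdeal Fp S' :=
    { W.comap S'.toSubmodule.subtype with lie_mem := fun {x m} hm => hW _ x.2 _ hm }
  have : NilLt p S' := NilLt.of_injective S'.incl Subtype.val_injective
  have : NilLt p (S' ⧸ W') := NilLt.of_surjective (mkL W') (mkL_surjective W')
  have h1 : ⁅mkL W' ⟨x, hx⟩, mkL W' ⟨z, hz⟩⁆ = 0 := by rw [← LieHom.map_lie]; exact mkL_eq_zero.2 h
  have h2 := map_bch (p := p) (mkL W') ⟨x, hx⟩ ⟨z, hz⟩
  rw [bch_of_lie_eq_zero h1, ← map_add, ← sub_eq_zero, ← map_sub] at h2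
  have h3 := mkL_eq_zero.1 h2
  have h4 := map_bch (p := p) S'.incl ⟨x, hx⟩ ⟨z, hz⟩
  change S'.incl (bch p ⟨x, hx⟩ ⟨z, hz⟩) - (x + z) ∈ W at h3; rwa [h4] at h3

end Central

section Rigid

/-! ### Rigidity -/

/-- The brackets span the commutator subalgebra over the prime field. -/
theorem commutator_induction {L : Type*} [LieRing L] [LieAlgebra Fp L] {x : LK p k L}
    (hx : x ∈ ⁅(⊤ : LieIdeal (Laur k) (LK p k L)), (⊤ : LieIdeal (Laur k) (LK p k L))⁆) :
    x ∈ Submodule.span Fp {z | ∃ a b : LK p k L, z = ⁅a, b⁆} := by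
  rw [← LieSubmodule.mem_toSubmodule, LieSubmodule.lieIdeal_oper_eq_linear_span'] at hx
  induction hx using span_induction with
  | mem x hx => obtain ⟨a, -, b, -, rfl⟩ := hx; exact subset_span ⟨a, b, rfl⟩
  | smul c x _ hx =>
    rename_i h
    clear h
    induction hx using span_induction with
    | mem x hx => obtain ⟨a, b, rfl⟩ := hx; exact subset_span ⟨c • a, b, (smul_lie c a b).symm⟩
    | zero => rw [smul_zero]; exact zero_mem _
    | add x y _ _ hx hy => rw [smul_add]; exact add_mem hx hy
    | smul a x _ hx => rw [smul_comm]; exact smul_mem _ _ hx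
  | _ => simp_all [add_mem]

/-- A homomorphism is determined by the images of the `D_{ι 0}`. -/
theorem eq_on_xgen {S : Set ℤ} {w : ℤ → ℕ} {f f' : TLie p S (deg p k) w →ₗ⁅Fp⁆ g} {a : ℤ}
    (ha : a ≠ 0) (h : kTm k f (Dgen p S w α₀ a 0) = kTm k f' (Dgen p S w α₀ a 0))
    (i : Fin (deg p k)) : f (xgen p S w a i) = f' (xgen p S w a i) := by
  have h1 : ∀ f : TLie p S (deg p k) w →ₗ⁅Fp⁆ g,
      evalFst ((finBasis Fp k).coord i) (kTm k f (Dgen p S w α₀ a 0)) =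
        f (xgen p S w a i) := by
    intro f
    rw [Dgen, if_neg ha, map_sum, map_sum]
    simp only [kTm_tmul, evalFst_tmul, frobPow_zero, Module.Basis.coord_apply,
      Module.Basis.repr_self, Finsupp.single_apply, ite_smul, one_smul, zero_smul]
    simp
  rw [← h1, ← h1, h]

/-- The equation `x = σ z - z` for special elements forces `x = 0` and `z = 0` in degrees `≥ 0`,
since `p 𝔄⁰ ∩ 𝔄⁺(p) = ∅`. -/
theorem sigma_sub_rigid {f : P.LDag →ₗ⁅Fp⁆ g} {x z : LK p k g}
    (hxA : ∀ i, i ∉ P.Ap → co p k i x = 0) (hz : z ∈ Dg k (Sd P f 1))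
    (h : x - (sigmaK p z - z) ∈ Dg k (Nd P f (p - 1))) :
    (∀ i, co p k i x = 0) ∧ z ∈ Dg k (Nd P f (p - 1)) := by
  have hpz : (0 : ℤ) < p := by exact_mod_cast hp.out.pos
  have hN : ∀ i, 0 ≤ i → ∀ y ∈ kG (p := p) k (Nd P f (p - 1) i), y = 0 := fun i hi y hy =>
    kG_eq_zero (fun l hl => hl.neg.resolve_left (not_lt.2 hi)) hy
  have hco : ∀ i, co p k i x - (co p k i (sigmaK p z) - co p k i z) ∈
      kG k (Nd P f (p - 1) i) := fun i => by
    have := co_mem_kG h i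
    rwa [map_sub, map_sub] at this
  have hzA : ∀ i, 0 ≤ i → co p k i z ≠ 0 → i ∈ P.A0 := fun i hi h0 => by
    by_contra hA
    exact h0 (hN i hi _ (kG_mono (fun l hl => Sd.nd_of_notMem hl hA) (co_mem_kG hz i)))
  have hz0 : co p k 0 z = 0 := by
    refine hN 0 le_rfl _ (kG_mono (fun l hl => ?_) (co_mem_kG hz 0))
    rcases hl with ⟨s, m, -, -, -, h1, -⟩ | hl
    · rw [P.zero_spec.2.2.2.1] at h1; omega
    · exact hl
  -- a nonzero coefficient in a positive degree `i` would give one in degree `p i`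
  have hpos : ∀ n : ℕ, ∀ i, 0 < i → P.b * ((p : ℤ) - 1) < i + n → co p k i z = 0 := by
    intro n
    induction n with
    | zero =>
      intro i hi hb
      by_contra h0
      have := (abs_le.1 (hzA i hi.le h0).1).2
      rw [cast_zero, add_zero] at hb; linarith
    | succ n ih =>
      intro i hi hb
      by_contra h0
      have hA := hzA i hi.le h0
      have h1 : i + 1 ≤ p * i := by
        have : (2 : ℤ) ≤ p := by exact_mod_cast hp.out.two_le
        nlinarith
      have h2 := hN _ (by positivity) _ (hco (p * i))
      rw [hxA, co_sigmaK hz, ih (p * i) (by positivity) (by push_cast at hb; linarith), sub_zero,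
        zero_sub, neg_eq_zero] at h2
      · obtain ⟨n, hn⟩ := exists_frobT_iterate (p := p) (k := k) (L := g)
        refine h0 ?_
        rw [← hn (co p k i z), iterate_succ_apply, h2]
        exact iterate_mem_of_mem (W := fun y : k ⊗[Fp] g => y = 0)
          (fun y hy => by rw [hy, map_zero]) rfl n
      · exact fun h3 => P.mul_notMem_of_primitive hA h3.1 h3.2.2.1
  have hz' : ∀ i, 0 ≤ i → co p k i z = 0 := by
    intro i hi
    rcases hi.eq_or_lt with rfl | hi
    · exact hz0
    · exact hpos (P.b * ((p : ℤ) - 1)).toNat i hi (by have := self_le_toNat (P.b * ((p : ℤ) - 1)); linarith)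
  refine ⟨fun i => ?_, (mem_Dg_iff_co hz).2 fun i => ?_⟩
  · rcases lt_or_ge i 0 with hi | hi
    · exact hxA i fun h1 => by have := h1.2.1; omega
    · have h1 := hN i hi _ (hco i)
      have h2 : co p k i (sigmaK p z) = 0 := by
        by_cases hd : (p : ℤ) ∣ i
        · obtain ⟨j, rfl⟩ := hd
          rw [co_sigmaK hz, hz' j (nonneg_of_mul_nonneg_right hi hpz), map_zero]
        · exact co_sigmaK_of_not_dvd hz hd
      rwa [h2, hz' i hi, sub_zero, sub_zero] at h1
  · suffices h1 : ∀ (n : ℕ) (i : ℤ), -i ≤ n → co p k i z ∈ kG k (Nd P f (p - 1) i) from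
      h1 _ i (self_le_toNat _)
    intro n
    induction n with
    | zero => intro i hi; rw [hz' i (by simpa using hi)]; exact zero_mem _
    | succ n ih =>
      intro i hi
      rcases lt_or_ge i 0 with h0 | h0
      · have h1 := hco i
        rw [hxA i fun h1 => by have := h1.2.1; omega, zero_sub, neg_sub] at h1
        have h2 : co p k i (sigmaK p z) ∈ kG k (Nd P f (p - 1) i) := by
          by_cases hd : (p : ℤ) ∣ i
          · obtain ⟨j, rfl⟩ := hd
            rw [co_sigmaK hz]
            have : (2 : ℤ) ≤ p := by exact_mod_cast hp.out.two_le
            have hj : j < 0 := by by_contra hj; push Not at hj; nlinarith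
            exact frobT_mem_kG (kG_mono (fun l hl => Nd.mul hl)
              (ih j (by push_cast at hi; nlinarith)))
          · rw [co_sigmaK_of_not_dvd hz hd]; exact zero_mem _
        have := add_mem h1 h2
        rwa [sub_add_cancel] at this
      · rw [hz' i h0]; exact zero_mem _

theorem lT_center {y z : LK p k g} (hz : lT k (mkL (LieAlgebra.center Fp g)) z = 0) :
    ⁅y, z⁆ = 0 := by
  have h1 := (Module.Flat.lTensor_exact (Laur k) (LinearMap.exact_subtype_ker_map
    (mkL (LieAlgebra.center Fp g)).toLinearMap)) z
  rw [lT_eq] at hz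
  obtain ⟨z, rfl⟩ := h1.1 hz
  clear hz h1
  induction z using TensorProduct.induction_on with
  | tmul c l =>
    induction y using TensorProduct.induction_on with
    | tmul d m =>
      have h2 : ⁅m, (l : g)⁆ = 0 :=
        (LieModule.mem_maxTrivSubmodule Fp g g (l : g)).1 (mkL_eq_zero.1 (mem_ker.1 l.2)) m
      rw [LinearMap.lTensor_tmul, Submodule.subtype_apply, lie_tmul, h2, tmul_zero]
    | _ => simp_all
  | _ => simp_all

theorem nilLt_quot_center {c : ℕ} (h : NilLt (c + 1) g) :
    NilLt c (g ⧸ LieAlgebra.center Fp g) := by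
  refine ⟨fun l hl => ?_⟩
  obtain ⟨l, rfl⟩ := (List.map_surjective_iff.2 (mkL_surjective (LieAlgebra.center Fp g))) l
  rw [← map_lnb]
  refine mkL_eq_zero.2 ((LieModule.mem_maxTrivSubmodule Fp g g _).2 fun y => ?_)
  have h1 := h.lnb_zero (l ++ [y]) (by simpa using hl)
  cases l with
  | nil => exact lie_zero _
  | cons x l =>
    rw [cons_append, lnb_cons, brs_append, brs_cons, brs_nil, ← lnb_cons] at h1
    rw [← lie_skew, h1, neg_zero]

/-- Two homomorphisms which agree on the generators with `ch = 0` and carry `ẽ^{sp}` to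
conjugate elements coincide. -/
theorem rigid {e : LK p k P.LBar} {E : LK p k P.LDag} (hE : IsSpecial P α₀ e E) (c : ℕ)
    {g : Type*} [LieRing g] [LieAlgebra Fp g] [NilLt p g] (hc : NilLt c g)
    {f₀ f f' : P.LDag →ₗ⁅Fp⁆ g}
    (hff : ∀ x : Gen P.Ap (deg p k), P.ch x.index = 0 →
      f (genElt p P.wDag x) = f' (genElt p P.wDag x))
    (hf : lT k f E ∈ Dg k (Sd P f₀ 0)) {d : LK p k g} (hd : d ∈ Dg k (Sd P f₀ 1))
    (hσ : sigmaK p d ∈ Dg k (Sd P f₀ 1))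
    (h : lT k f' E - bch p (bch p (sigmaK p d) (lT k f E)) (-d) ∈ Dg k (Nd P f₀ (p - 1))) :
    f = f' := by
  suffices h' : f = f' ∧ d ∈ Dg k (Nd P f₀ (p - 1)) from h'.1
  induction c generalizing g with
  | zero =>
    have h0 : ∀ x : g, x = 0 := fun x => hc.lnb_zero [x] (Nat.zero_le _)
    refine ⟨LieHom.ext fun x => by rw [h0 (f x), h0 (f' x)], ?_⟩
    exact Dg_mono (fun i l _ => by rw [h0 l]; exact Nd.zero _ _) hd
  | succ c ih =>
    set ψ := mkL (LieAlgebra.center Fp g)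
    have : NilLt p (g ⧸ LieAlgebra.center Fp g) := NilLt.of_surjective ψ (mkL_surjective _)
    obtain ⟨h1, h2⟩ := ih (nilLt_quot_center hc) (f₀ := ψ.comp f₀) (f := ψ.comp f)
      (f' := ψ.comp f') (d := lT k ψ d) (fun x hx => by simp only [LieHom.comp_apply, hff x hx])
      (by rw [lT_comp]; exact lT_mem_Sd ψ hf) (lT_mem_Sd ψ hd)
      (by rw [← lT_sigmaK]; exact lT_mem_Sd ψ hσ) (by
        have := lT_mem_Nd ψ h
        rwa [map_sub, map_bch, map_bch, map_neg, lT_sigmaK, ← lT_comp, ← lT_comp] at this)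
    obtain ⟨d₀, hd₀, h3⟩ : ∃ d₀ ∈ Dg k (Nd P f₀ (p - 1)), lT k ψ d₀ = lT k ψ d := by
      refine span_le (p := (Dg k (Nd P f₀ (p - 1))).map (lT k ψ : LK p k g →ₗ[Fp] _)) |>.2 ?_ h2
      rintro _ ⟨i, c, l, ⟨s, h3, h4, x, hx, rfl⟩, rfl⟩
      exact ⟨mt p i c (f₀ x), mt_mem_Dg ⟨s, h3, h4, x, hx, rfl⟩, rfl⟩
    -- by induction `d` is negligible modulo the center, and can be replaced by a central `z`
    set z := d - d₀ with hz
    have hz0 : lT k ψ z = 0 := by rw [hz, map_sub, h3, sub_self]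
    have hzS : z ∈ Dg k (Sd P f₀ 1) := sub_mem hd (Dg_Nd_le_Sd hd₀)
    -- `z` is central, so that the composition is a sum
    have h4 : bch p (bch p (sigmaK p z) (lT k f E)) (-z) = sigmaK p z + lT k f E - z := by
      rw [bch_of_lie_eq_zero (x := sigmaK p z), bch_of_lie_eq_zero, sub_eq_add_neg]
      · rw [lie_neg, lT_center hz0, neg_zero]
      · rw [← lie_skew, lT_center (by rw [lT_sigmaK, hz0, map_zero]), neg_zero]
    have h5 : bch p (bch p (sigmaK p d) (lT k f E)) (-d) -
        bch p (bch p (sigmaK p z) (lT k f E)) (-z) ∈ Dg k (Nd P f₀ (p - 1)) := by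
      refine bch_bch_congr (Sd_zero hσ) hf (neg_mem (Sd_zero hd)) ?_ (by simp) ?_
      · rw [← map_sub, hz, sub_sub_cancel]; exact sigmaK_mem hd₀
      · rw [neg_sub_neg, hz, sub_sub_cancel_left]; exact neg_mem hd₀
    rw [h4] at h5
    have h6 : ∀ x, ψ (f x) = ψ (f' x) := fun x => LieHom.congr_fun h1 x
    have h7 : ∀ x y : P.LDag, f ⁅x, y⁆ = f' ⁅x, y⁆ := by
      have hcen : ∀ x y, ⁅y, f' x - f x⁆ = 0 := fun x y =>
        (LieModule.mem_maxTrivSubmodule Fp g g _).1 (mkL_eq_zero.1 (by rw [map_sub]; exact sub_eq_zero.2 (h6 x).symm)) y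
      intro x y
      have e1 := hcen y (f' x)
      have e2 := hcen x (f y)
      rw [lie_sub, sub_eq_zero] at e1 e2
      rw [LieHom.map_lie, LieHom.map_lie, e1, ← lie_skew (f x), ← lie_skew (f' x), e2]
    -- `f` and `f'` agree on commutators, so that only the linear part of `E` matters
    have h8 : lT k f' E - lT k f E = ∑ ι ∈ Icc (0 : ℤ) (P.b * ((p : ℤ) - 1)),
        tneg p ι (kTm k f' (DDag P α₀ ι 0) - kTm k f (DDag P α₀ ι 0)) := by
      have h9 : ∀ x ∈ ⁅(⊤ : LieIdeal (Laur k) (LK p k P.LDag)),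
          (⊤ : LieIdeal (Laur k) (LK p k P.LDag))⁆, lT k f' x = lT k f x := by
        intro x hx
        replace hx := commutator_induction hx
        induction hx using span_induction with
        | mem x hx =>
          obtain ⟨a, b, rfl⟩ := hx
          induction a using TensorProduct.induction_on with
          | tmul u l =>
            induction b using TensorProduct.induction_on with
            | tmul v m => exact congrArg ((u * v) ⊗ₜ[Fp] ·) (h7 l m).symm
            | _ => simp_all
          | _ => simp_all
        | _ => simp_all
      have := h9 _ hE.lin
      rw [map_sub, map_sub, map_sum, map_sum, sub_eq_sub_iff_sub_eq_sub, ← sum_sub_distrib] at this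
      rw [this]
      refine sum_congr rfl fun ι _ => ?_
      rw [lT_tneg, lT_tneg, map_sub]
    set x := lT k f' E - lT k f E with hx
    have h10 : ∀ i, i ∉ P.Ap → kTm k f' (DDag P α₀ i 0) - kTm k f (DDag P α₀ i 0) = 0 := by
      intro i hi
      by_cases h0 : i = 0
      · have h1 := hff none P.zero_spec.2.2.2.1
        simp only [DDag, Dgen, if_pos h0, kTm_tmul]
        rw [h1, sub_self]
      · simp only [DDag, Dgen, if_neg h0, xgen, dif_neg hi, tmul_zero,
          Finset.sum_const_zero, map_zero, sub_zero]
    have hco : ∀ i, co p k i x = if i ∈ Icc (0 : ℤ) (P.b * ((p : ℤ) - 1)) then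
        kTm k f' (DDag P α₀ i 0) - kTm k f (DDag P α₀ i 0) else 0 := by
      intro i
      rw [h8, map_sum]; simp only [co_tneg, Finset.sum_ite_eq]
    obtain ⟨h11, h12⟩ := sigma_sub_rigid (f := f₀) (x := x) (z := z) (fun i hi => by
        rw [hco]
        split_ifs
        · exact h10 i hi
        · rfl) hzS (by
        have := add_mem h h5
        rw [sub_add_sub_cancel] at this
        convert this using 1
        rw [hx]; abel)
    refine ⟨TLie.hom_ext fun y => ?_, by
      have := add_mem h12 hd₀
      rwa [hz, sub_add_cancel] at this⟩
    rcases y with _ | ⟨⟨ι, hι⟩, i⟩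
    · exact hff none P.zero_spec.2.2.2.1
    · have h13 := h11 ι
      rw [hco, if_pos (mem_Icc.2 ⟨hι.2.1.le, (abs_le.1 hι.1.1).2⟩), sub_eq_zero] at h13
      have := eq_on_xgen hι.2.1.ne' h13.symm i
      simpa [xgen, hι] using this

end Rigid

section Conj
variable {E : LK p k P.LDag} {γ : ZMod p} {A : P.LDag ≃ₗ⁅ZMod p⁆ P.LDag}
variable [NilLt p g]

/-! ### Automorphisms conjugate to `Ω_γ` -/

theorem IsSpecial.mem_Sd (hE : IsSpecial P α₀ e E) : E ∈ Dg k (Sd P LieHom.id 0) :=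
  mem_sup_iff.1 hE.sp

variable (P) in
/-- The elements `x` and `y` are conjugate by some `c` with `c, σ c ∈ 𝒩̃^{sp}⟨1⟩`. -/
def CongrConj (f : P.LDag →ₗ⁅Fp⁆ g) (x y : LK p k g) : Prop :=
  ∃ c ∈ Dg k (Sd P f 1), sigmaK p c ∈ Dg k (Sd P f 1) ∧
    x - bch p (bch p (sigmaK p c) y) (-c) ∈ Dg k (Nd P f (p - 1))

theorem CongrConj.conj (hE : lT k A.toLieHom E ∈ Dg k (Sd P LieHom.id 0))
    (h : CongrConj P LieHom.id (twK P P.LDag γ E) (lT k A.toLieHom E)) :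
    ∃ c ∈ NSp P 1, sigmaK p c ∈ NSp P 1 ⊔ NKer P ∧ ∃ Y X : LK p k P.LDag,
      IsCH (Laur k) p (sigmaK p c) (lTensor (Laur k) (A : P.LDag →ₗ[Fp] P.LDag) E) Y ∧
      IsCH (Laur k) p Y (-c) X ∧ Omega P γ E - X ∈ NKer P := by
  have hl : lTensor (Laur k) (A : P.LDag →ₗ[Fp] P.LDag) E = lT k A.toLieHom E :=
    (lT_eq _ _).symm
  simp only [hl, isCH_iff P.one_le_wDag, mem_NSp_iff, mem_sup_iff, NKer, mem_NDag_iff]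
  obtain ⟨c, h1, h2, h3⟩ := h
  obtain ⟨c₁, h4, c₂, h5, rfl⟩ := mem_sup.1 (Dg_or.le h1)
  have h6 : sigmaK p c₁ ∈ Dg k (Sd P LieHom.id 1) := by
    have := sub_mem h2 (Dg_Nd_le_Sd (sigmaK_mem h5))
    rwa [map_add, add_sub_cancel_right] at this
  refine ⟨c₁, h4, h6, _, _, rfl, rfl, ?_⟩
  have h7 := bch_bch_congr (Sd_zero h2) hE (neg_mem (Sd_zero h1)) (c' := sigmaK p c₁)
    (d' := -c₁) (by simpa using sigmaK_mem h5) (x' := lT k A.toLieHom E) (by simp)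
    (by simpa using h5)
  have := add_mem h3 h7
  rwa [sub_add_sub_cancel] at this

theorem CongrConj.symm {f : P.LDag →ₗ⁅Fp⁆ g} {x y : LK p k g} (h : CongrConj P f x y)
    (hx : x ∈ Dg k (Sd P f 0)) : y ∈ Dg k (Sd P f 0) ∧ CongrConj P f y x := by
  obtain ⟨c, hc, hσ, h⟩ := h
  have hX := sub_mem hx (Dg_Nd_le_Sd h)
  rw [sub_sub_cancel] at hX
  have e1 : y = bch p (bch p (-sigmaK p c) (bch p (bch p (sigmaK p c) y) (-c))) c := by
    rw [bch_assoc (sigmaK p c), neg_bch_bch, bch_bch_neg]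
  have hy : y ∈ Dg k (Sd P f 0) := by rw [e1]; exact bch_mem_Sd (bch_mem_Sd (neg_mem (Sd_zero hσ)) hX) (Sd_zero hc)
  refine ⟨hy, -c, neg_mem hc, by rw [map_neg]; exact neg_mem hσ, ?_⟩
  rw [map_neg, neg_neg]
  nth_rewrite 1 [e1]
  exact bch_bch_congr (neg_mem (Sd_zero hσ)) hX (Sd_zero hc) (by simp)
    (by rw [← neg_sub]; exact neg_mem h) (by simp)

theorem CongrConj.trans {f : P.LDag →ₗ⁅Fp⁆ g} {x y z : LK p k g} (h : CongrConj P f x y)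
    (h' : CongrConj P f y z) (hx : x ∈ Dg k (Sd P f 0)) : CongrConj P f x z := by
  have hy := (h.symm hx).1
  have hz := (h'.symm hy).1
  obtain ⟨c, hc, hσ, h⟩ := h
  obtain ⟨d, hd, hτ, h'⟩ := h'
  have h1 : sigmaK p (bch p c d) = bch p (sigmaK p c) (sigmaK p d) := map_bch (sigmaL p k g) c d
  refine ⟨bch p c d, bch_mem_Sd hc hd, by rw [h1]; exact bch_mem_Sd hσ hτ, ?_⟩
  rw [h1, neg_bch, ← bch_assoc, bch_assoc (sigmaK p c), bch_assoc (sigmaK p c)]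
  have h2 := bch_bch_congr (Sd_zero hσ) hy (neg_mem (Sd_zero hc)) (c' := sigmaK p c) (by simp) h'
    (d' := -c) (by simp)
  have := add_mem h h2
  rwa [sub_add_sub_cancel] at this

theorem CongrConj.map {L : Type*} [LieRing L] [LieAlgebra Fp L] [NilLt p L]
    {f₀ : P.LDag →ₗ⁅Fp⁆ L} {x y : LK p k L} (h : CongrConj P f₀ x y) (f : L →ₗ⁅Fp⁆ g) :
    CongrConj P (f.comp f₀) (lT k f x) (lT k f y) := by
  obtain ⟨c, hc, hσ, h⟩ := h
  refine ⟨lT k f c, lT_mem_Sd f hc, by rw [← lT_sigmaK]; exact lT_mem_Sd f hσ, ?_⟩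
  have := lT_mem_Nd f h
  rwa [map_sub, map_bch, map_bch, map_neg, lT_sigmaK] at this

theorem IsConj.congrConj (h : IsConj P α₀ E γ A) :
    CongrConj P LieHom.id (twK P P.LDag γ E) (lT k A.toLieHom E) := by
  obtain ⟨c, h1, h2, Y, X, hY, hX, h3⟩ := h.conj
  rw [isCH_iff P.one_le_wDag] at hX hY
  rw [mem_sup_iff] at h2
  rw [NKer, mem_NDag_iff] at h3
  rw [mem_NSp_iff] at h1
  subst hX hY
  refine ⟨c, Dg_mono (fun _ _ => Or.inl) h1, h2, ?_⟩
  rw [lT_eq]; exact h3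

/-- The equation for `A`, in a quotient of `ℒ̄^†`. -/
theorem IsConj.map (h : IsConj P α₀ E γ A) (hE : IsSpecial P α₀ e E) (f : P.LDag →ₗ⁅Fp⁆ g) :
    CongrConj P f (twK P g γ (lT k f E)) (lT k (f.comp A.toLieHom) E) := by
  have h1 := h.congrConj.map f
  rw [lT_twK f γ hE.mem_Sd, ← lT_comp] at h1; exact h1

theorem kTm_id (x : k ⊗[Fp] g) : kTm k (LieHom.id : g →ₗ⁅Fp⁆ g) x = x := by
  rw [kTm_eq]; exact LinearMap.lTensor_id_apply _ _ _

/-- A conjugate of `Ω_γ` fixes the generators with `ch = 0`. -/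
theorem IsConj.gen_eq (hα₀ : Algebra.trace Fp k α₀ = 1) (h : IsConj P α₀ E γ A)
    (x : Gen P.Ap (deg p k)) (hx : P.ch x.index = 0) :
    A (genElt p P.wDag x) = genElt p P.wDag x := by
  have h1 := h.unip x.index (by rcases x with _ | ⟨⟨ι, hι⟩, i⟩; exacts [Or.inr rfl, Or.inl hι])
  have : IsEmpty (Fin (P.ch x.index)) := by rw [hx]; infer_instance
  rw [iSup_of_empty, mem_bot, sub_eq_zero] at h1
  have h2 := (kTm_eq A.toLieHom _).trans h1
  rcases x with _ | ⟨⟨ι, hι⟩, i⟩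
  · have h3 := congrArg (evalFst (Algebra.trace Fp k)) h2
    simp only [Gen.index, DDag, Dgen, if_true, kTm_tmul, evalFst_tmul, frobPow_zero, hα₀,
      one_smul] at h3
    exact h3
  · have h3 := eq_on_xgen (p := p) (k := k) (S := P.Ap) (w := P.wDag) (α₀ := α₀) (a := ι)
      (f := A.toLieHom) (f' := LieHom.id) hι.2.1.ne'
      (h2.trans (kTm_id (DDag P α₀ ι 0)).symm) i
    simpa [xgen, hι] using h3

theorem eq_of_congrConj (hE : IsSpecial P α₀ e E) {f₀ f f' : P.LDag →ₗ⁅Fp⁆ g}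
    (hff : ∀ x : Gen P.Ap (deg p k), P.ch x.index = 0 →
      f (genElt p P.wDag x) = f' (genElt p P.wDag x)) {X : LK p k g} (hX : X ∈ Dg k (Sd P f₀ 0))
    (h : CongrConj P f₀ X (lT k f E)) (h' : CongrConj P f₀ X (lT k f' E)) : f = f' := by
  have h1 := h'.symm hX
  obtain ⟨d, hd, hσ, h2⟩ := h1.2.trans h h1.1; exact rigid hE p ‹_› hff (h.symm hX).1 hd hσ h2

theorem IsConj.unique (hα₀ : Algebra.trace Fp k α₀ = 1) (hE : IsSpecial P α₀ e E)
    {A' : P.LDag ≃ₗ⁅Fp⁆ P.LDag} (h : IsConj P α₀ E γ A) (h' : IsConj P α₀ E γ A') : A = A' := by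
  have h1 := eq_of_congrConj (f₀ := LieHom.id) (f := A.toLieHom) (f' := A'.toLieHom) hE
    (fun x hx => (h.gen_eq hα₀ x hx).trans (h'.gen_eq hα₀ x hx).symm)
    (twK_mem γ hE.mem_Sd) h.congrConj h'.congrConj
  exact LieEquiv.ext fun x => LieHom.congr_fun h1 x

/-! ### The ramification ideal -/

section Ram
variable (π : P.LBar →ₗ⁅ZMod p⁆ g)

/-- The data of `Ω` for the quotient `π(ℒ̄)`. -/
abbrev quotData : ConjData p (SpQ P (π.comp P.V)) := conjData P (π.comp P.V)

/-- The class of `x̄` in the quotient of special elements. -/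
def xQ (he : IsGivenBy P α₀ η e) : SpQ P (π.comp P.V) := spq (xq P e π) (Eqd_le (xq_mem π he))

theorem thQ_xq (he : IsGivenBy P α₀ η e) :
    thQ P (π.comp P.V) (xQ π he) = 0 := by
  rw [xQ, thQ_spq, spq_eq_zero]
  have h := xq_mem π he
  generalize xq P e π = x at h
  induction h using span_induction with
  | mem x hx =>
    obtain ⟨i, c, l, hl, rfl⟩ := hx
    rw [thK_mt, hl.2.2, cast_zero, zero_mul, mt_zero_left]; exact zero_mem _
  | _ => simp_all [add_mem, smul_mem]

/-- The linearized equation, as a statement about the quotient by the kernel. -/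
theorem linCond_iff (he : IsGivenBy P α₀ η e) : LinCond P e π ↔
    ∃ z ∈ (quotData π).Γ, logD Fp p (quotData π).Δ (xQ π he) = rAd Fp p (xQ π he) z.2 - z.1 := by
  have key : ∀ c (hc : c ∈ Dg k (Sd P (π.comp P.V) 1)) (hσ : sigmaK p c ∈ Dg k (Sd P (π.comp P.V) 1)),
      (logD Fp p (quotData π).Δ (xQ π he) = rAd Fp p (xQ π he) (spq (sigmaK p c) (Sd_zero hσ)) -
          spq c (Sd_zero hc)) ↔ tm P e π 0 - (rAd Fp p (xq P e π) (sigmaK p c) - c) ∈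
      Dg k (Nd P (π.comp P.V) (p - 1)) := by
    intro c hc hσ
    change logD Fp p (deQ P _) _ = _ ↔ _
    rw [xQ, spq_logD, spq_rAd, spq_sub, spq_eq_iff, logD_xq π he]
  constructor
  · rintro ⟨c, hc, hσ, h⟩; exact ⟨_, ⟨c, hc, hσ, rfl⟩, (key c hc hσ).2 h⟩
  · rintro ⟨_, ⟨c, hc, hσ, rfl⟩, h⟩; exact ⟨c, hc, hσ, (key c hc hσ).1 h⟩

theorem congrConj_iff (he : IsGivenBy P α₀ η e) (γ : Fp) :
    CongrConj P (π.comp P.V) (twK P g γ (xq P e π)) (xq P e π) ↔ ∃ z ∈ (quotData π).Γ,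
      (quotData π).Om γ (xQ π he) = bch p (bch p z.2 (xQ π he)) (-z.1) := by
  have key : ∀ c (hc : c ∈ Dg k (Sd P (π.comp P.V) 1)) (hσ : sigmaK p c ∈ Dg k (Sd P (π.comp P.V) 1)),
      ((quotData π).Om γ (xQ π he) =
        bch p (bch p (spq (sigmaK p c) (Sd_zero hσ)) (xQ π he)) (-spq c (Sd_zero hc))) ↔
        twK P g γ (xq P e π) - bch p (bch p (sigmaK p c) (xq P e π)) (-c) ∈
          Dg k (Nd P (π.comp P.V) (p - 1)) := by
    intro c hc hσ
    rw [xQ, Om_spq, spq_bch, spq_neg, spq_bch, spq_eq_iff]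
  constructor
  · rintro ⟨c, hc, hσ, h⟩; exact ⟨_, ⟨c, hc, hσ, rfl⟩, (key c hc hσ).2 h⟩
  · rintro ⟨_, ⟨c, hc, hσ, rfl⟩, h⟩; exact ⟨c, hc, hσ, (key c hc hσ).1 h⟩

/-- The linearized equation holds in `π(ℒ̄)` if and only if `π 𝒱 A_γ = π 𝒱` for all `γ`. -/
theorem linCond_iff_comp (hα₀ : Algebra.trace Fp k α₀ = 1) (he : IsGivenBy P α₀ η e)
    (hE : IsSpecial P α₀ e E) {A : Fp → (P.LDag ≃ₗ⁅Fp⁆ P.LDag)}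
    (hA : ∀ γ, IsConj P α₀ E γ (A γ)) : LinCond P e π ↔
      ∀ γ, (π.comp P.V).comp (A γ).toLieHom = π.comp P.V := by
  have h0 : lT k (π.comp P.V) E = xq P e π := by rw [lT_comp, lT_eq P.V, hE.compat]; rfl
  have hx := Eqd_le (xq_mem π he)
  constructor
  · intro h γ
    have h1 := (congrConj_iff π he γ).2
      ((quotData π).exists_conj (thQ_xq π he) γ ((linCond_iff π he).1 h))
    have h2 := (hA γ).map hE (π.comp P.V)
    rw [h0] at h2
    rw [← h0] at h1
    nth_rewrite 1 [h0] at h1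
    exact eq_of_congrConj hE (fun x hx => by
      rw [LieHom.comp_apply]; exact congrArg _ ((hA γ).gen_eq hα₀ x hx)) (twK_mem γ hx) h2 h1
  · intro h
    refine (linCond_iff π he).2 ((quotData π).exists_linear (thQ_xq π he) ?_)
    have h2 := (hA 1).map hE (π.comp P.V)
    rw [h 1, h0] at h2; exact (congrConj_iff π he 1).1 h2

end Ram

theorem mkL_ker {L : Type*} [LieRing L] [LieAlgebra Fp L] (I : LieIdeal Fp L) :
    (mkL I).ker = I := by
  ext x
  exact LieHom.mem_ker.trans mkL_eq_zero

/-- For an ideal `I`, the conditions on the `ℱ⁰` are equivalent to `A_γ (Ker 𝒱) ⊆ 𝒱⁻¹(I)` for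
all `γ`. -/
theorem isLeast_ramIdeal (hα₀ : Algebra.trace Fp k α₀ = 1) (hη : IsStructural p η)
    (he : IsGivenBy P α₀ η e) {mι : ℤ → ℕ}
    (hmι : ∀ ι ∈ P.A1p, ∀ n : ℕ, ι * (p : ℤ) ^ n ≤ ((p : ℤ) - 1) * P.b → n ≤ mι ι)
    (hE : IsSpecial P α₀ e E) {A : Fp → (P.LDag ≃ₗ⁅Fp⁆ P.LDag)}
    (hA : ∀ γ, IsConj P α₀ E γ (A γ)) : IsLeast {I | F0Cond η α₀ mι I} (ramIdeal P A) := by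
  have key : ∀ I : LieIdeal Fp P.LBar, F0Cond η α₀ mι I ↔
      ∀ γ, ((mkL I).comp P.V).comp (A γ).toLieHom = (mkL I).comp P.V := by
    intro I
    have : NilLt p (P.LBar ⧸ I) := NilLt.of_surjective (mkL I) (mkL_surjective I)
    rw [← linCond_iff_comp (mkL I) hα₀ he hE hA]
    constructor
    · intro h
      refine linCond_of_coefBound _ hη.nil he fun s => ?_
      rw [mkL_ker]; exact coefBound_of_cond hη.nil he hmι h s
    · intro h
      have h1 := coefBound_of_linCond _ hη.nil he h
      rw [mkL_ker] at h1; exact cond_of_coefBound hη.nil he hmι h1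
  refine ⟨(key _).2 fun γ => TLie.hom_ext fun x => ?_, fun I hI => ?_⟩
  · by_cases hx : P.ch x.index = 0
    · exact congrArg ((mkL (ramIdeal P A)).comp P.V) ((hA γ).gen_eq hα₀ x hx)
    · have h1 : P.V (genElt p P.wDag x) = 0 := by
        rw [Params.V, liftHom_genElt]
        rcases x with _ | ⟨ι, i⟩
        · exact absurd P.zero_spec.2.2.2.1 hx
        · exact if_neg hx
      rw [LieHom.comp_apply, LieHom.comp_apply, LieHom.comp_apply, h1, map_zero]
      exact mkL_eq_zero.2 (LieIdeal.mem_map (LieSubmodule.subset_lieSpan ⟨γ, _, h1, rfl⟩))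
  · refine LieIdeal.map_le_iff_le_comap.2 (lieSpan_le.2 ?_)
    rintro _ ⟨γ, l, hl, rfl⟩
    have h1 := LieHom.congr_fun ((key I).1 hI γ) l
    rw [LieHom.comp_apply, LieHom.comp_apply, LieHom.comp_apply, hl, map_zero] at h1
    exact (mkL_eq_zero (I := I)).1 h1

end Conj

section Solve

/-! ### The equation modulo the part with exponents in `𝔄⁺(p)` -/

variable (P) in
/-- The condition that `t^{-i} l` is a generator of `𝒩̃^{sp}⟨1⟩` with `l` of weight `≥ s`. -/
def Sg (s : ℕ) (i : ℤ) (l : P.LDag) : Prop :=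
  (Spd P LieHom.id 1 i l ∧ l ∈ P.filtDag s) ∨ Nd P LieHom.id (p - 1) i l

variable (P) in
/-- The generators of `𝒩̃^{sp}⟨1⟩` with exponent in `𝔄⁺(p)`. -/
def Spa (i : ℤ) (l : P.LDag) : Prop := Spd P LieHom.id 1 i l ∧ i ∈ P.Ap

variable (P) in
/-- `x` is `σ z - z`, up to a combination of monomials with exponents in `𝔄⁺(p)`. -/
def Dec (s : ℕ) (x : LK p k P.LDag) : Prop :=
  ∃ z ∈ Dg k (Sg P s), sigmaK p z ∈ Dg k (Sg P s) ∧ ∃ y ∈ Dg k (Spa P),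
    x - (sigmaK p z - z) - y ∈ Dg k (Nd P LieHom.id (p - 1))

theorem Dec.of_Nd {s : ℕ} {x : LK p k P.LDag} (h : x ∈ Dg k (Nd P LieHom.id (p - 1))) :
    Dec P s x :=
  ⟨0, zero_mem _, by simp, 0, zero_mem _, by simpa using h⟩

theorem Dec.add {s : ℕ} {x x' : LK p k P.LDag} : Dec P s x → Dec P s x' → Dec P s (x + x') := by
  rintro ⟨z, h1, h2, y, h3, h4⟩ ⟨z', h1', h2', y', h3', h4'⟩
  refine ⟨z + z', add_mem h1 h1', by rw [map_add]; exact add_mem h2 h2', y + y', add_mem h3 h3', ?_⟩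
  convert add_mem h4 h4' using 1
  rw [map_add]; abel

theorem Dec.smul {s : ℕ} {x : LK p k P.LDag} (c : Fp) : Dec P s x → Dec P s (c • x) := by
  rintro ⟨z, h1, h2, y, h3, h4⟩
  refine ⟨c • z, smul_mem _ c h1, by rw [map_smul]; exact smul_mem _ c h2,
    c • y, smul_mem _ c h3, ?_⟩
  rw [map_smul, ← smul_sub, ← smul_sub, ← smul_sub]; exact smul_mem _ c h4

theorem Dec.sigma_iff {s : ℕ} {x : LK p k P.LDag} (hx : x ∈ Dg k (Sg P s))
    (hσ : sigmaK p x ∈ Dg k (Sg P s)) : Dec P s (sigmaK p x) ↔ Dec P s x := by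
  constructor
  · rintro ⟨z, h1, h2, y, h3, h4⟩
    refine ⟨z - x, sub_mem h1 hx, by rw [map_sub]; exact sub_mem h2 hσ, y, h3, ?_⟩
    convert h4 using 1
    rw [map_sub]; abel
  · rintro ⟨z, h1, h2, y, h3, h4⟩
    refine ⟨z + x, add_mem h1 hx, by rw [map_add]; exact add_mem h2 hσ, y, h3, ?_⟩
    convert h4 using 1
    rw [map_add]; abel

theorem Sg.mul {s : ℕ} {i : ℤ} {l : P.LDag} (h : Sg P s i l) (hi : i < 0) : Sg P s (p * i) l := by
  rcases h with ⟨h, hs⟩ | h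
  · have hp1 : (1 : ℤ) < p := by exact_mod_cast hp.out.one_lt
    rcases le_or_gt (p * i) (-(P.b * ((p : ℤ) - 1))) with hb | hb
    · exact Or.inr (h.nd_zero.of_lt hb)
    · obtain ⟨s', m, h1, h2, h3, h4, h5, h6⟩ := h
      obtain ⟨e1, -, -, e2, e3⟩ := P.A0_mul h2 (by rw [abs_of_neg (by nlinarith)]; linarith)
      exact Or.inl ⟨⟨s', m, h1, e1, by rw [e2]; nlinarith, by rwa [e2], by rwa [e3], h6⟩, hs⟩
  · exact Or.inr h.mul

/-- Negative exponents are multiplied by `p` until the monomial is in the kernel. -/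
theorem dec_neg {s : ℕ} (n : ℕ) (i : ℤ) (c : k) {l : P.LDag} (hi : i < 0)
    (hn : P.b * ((p : ℤ) - 1) + i ≤ n) (h : Sg P s i l) : Dec P s (mt p i c l) := by
  induction n generalizing i c with
  | zero =>
    refine Dec.of_Nd (mt_mem_Dg ?_)
    rcases h with ⟨h, -⟩ | h
    · exact h.nd_zero.of_lt (by rw [cast_zero] at hn; linarith)
    · exact h
  | succ n ih =>
    have hp1 : (2 : ℤ) ≤ p := by exact_mod_cast hp.out.two_le
    have h1 := h.mul hi
    refine (Dec.sigma_iff (mt_mem_Dg h) (by rw [sigmaK_mt]; exact mt_mem_Dg h1)).1 ?_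
    rw [sigmaK_mt]; exact ih _ _ (by nlinarith) (by push_cast at hn; nlinarith) h1

/-- Special exponents not divisible by `p` in `𝔄⁰` belong to `𝔄⁺(p)`. -/
theorem Spd.mem_Ap {i : ℤ} {l : P.LDag} (h : Spd P LieHom.id 1 i l) (hi : 0 < i)
    (hd : ¬(p ∣ P.pa i ∧ p ∣ P.pb i)) (hl : l ≠ 0) : i ∈ P.Ap := by
  obtain ⟨s, m, h1, h2, h3, h4, h5, h6⟩ := h
  have hb := P.b_pos_int
  have hsp : s < p := by
    by_contra hs
    exact hl (fil_eq_zero (not_lt.1 hs) (filG_le_fil h6))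
  have hcs : P.ch i < s := by
    by_contra hc
    have : (s : ℤ) * P.b ≤ P.ch i * P.b := by gcongr; omega
    linarith
  have hw : P.w0 i ≤ s - P.ch i := P.w0_le_iff.2 (by rw [Nat.cast_sub hcs.le, sub_mul]; linarith)
  have hw1 := P.w0_pos hi.le
  refine ⟨h2, hi, ?_, by omega, ?_⟩
  · exact ((Nat.Prime.coprime_iff_not_dvd hp.out).2 (by rwa [Nat.dvd_gcd_iff])).symm
  · have hp2 := hp.out.two_le
    zify [hp2]
    rcases hp2.eq_or_lt with h7 | h7
    · have h8 : (p : ℤ) = 2 := by exact_mod_cast h7.symm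
      rw [h8] at h5 ⊢; omega
    · have h8 : ((p : ℤ) - 3) * m ≤ ((p : ℤ) - 3) * (P.ch i - 1) :=
        mul_le_mul_of_nonneg_left (by omega) (by omega)
      have h9 : ((p : ℤ) - 3) * (P.ch i - 1) = (p - 2) * P.ch i - P.ch i - p + 3 := by ring
      omega

theorem exists_pow_eq (c : k) : ∃ d : k, d ^ p = c := by
  obtain ⟨d, hd⟩ := (FiniteField.frobeniusAlgEquivOfAlgebraic Fp k).surjective c
  exact ⟨d, by simpa [ZMod.card] using hd⟩

/-- Positive exponents are divided by `p` until they are in `𝔄⁺(p)`. -/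
theorem dec_pos {s : ℕ} (n : ℕ) (i : ℤ) (c : k) {l : P.LDag} (hi : 0 < i) (hn : i ≤ n)
    (h : Spd P LieHom.id 1 i l) (hs : l ∈ P.filtDag s) : Dec P s (mt p i c l) := by
  induction n generalizing i c with
  | zero => rw [cast_zero] at hn; omega
  | succ n ih =>
    by_cases hl : l = 0
    · subst hl; exact Dec.of_Nd (mt_mem_Dg (Nd.zero _ _))
    by_cases hd : p ∣ P.pa i ∧ p ∣ P.pb i
    · obtain ⟨s', m, h1, h2, h3, h4, h5, h6⟩ := id h
      obtain ⟨j, rfl, hj, hk⟩ := P.A0_div h2 hd.1 hd.2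
      have hp1 : (2 : ℤ) ≤ p := by exact_mod_cast hp.out.two_le
      have hj0 : 0 < j := by by_contra hj0; nlinarith
      have hch := (P.A0_mul hj h2.1).2.2.2.1
      have h7 : Spd P LieHom.id 1 j l := ⟨s', m, h1, hj, by rw [← hch]; nlinarith, by rwa [← hch],
          le_trans (by exact_mod_cast hk) h5, h6⟩
      obtain ⟨d, rfl⟩ := exists_pow_eq (p := p) c
      rw [← sigmaK_mt]
      refine (Dec.sigma_iff (mt_mem_Dg (Or.inl ⟨h7, hs⟩)) ?_).2
        (ih j d hj0 (by push_cast at hn; nlinarith) h7)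
      rw [sigmaK_mt]; exact mt_mem_Dg (Or.inl ⟨h, hs⟩)
    · exact ⟨0, zero_mem _, by simp, _,
        mt_mem_Dg ⟨h, h.mem_Ap hi hd hl⟩, by
          rw [map_zero, sub_zero, sub_zero, sub_self]; exact zero_mem _⟩

theorem not_spd_zero {l : P.LDag} : ¬ Spd P LieHom.id 1 0 l := by
  rintro ⟨s, m, h1, h2, h3, h4, -⟩
  rw [P.zero_spec.2.2.2.1] at h4; omega

theorem dec_of_mem {s : ℕ} {x : LK p k P.LDag} (hx : x ∈ Dg k (Sg P s)) : Dec P s x := by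
  induction hx using span_induction with
  | mem x hx =>
    obtain ⟨i, c, l, h, rfl⟩ := hx
    rcases lt_trichotomy i 0 with hi | rfl | hi
    · exact dec_neg _ i c hi (self_le_toNat _) h
    · exact Dec.of_Nd (mt_mem_Dg (h.resolve_left fun h => not_spd_zero h.1))
    · rcases h with h | h
      · exact dec_pos _ i c hi (self_le_toNat _) h.1 h.2
      · exact Dec.of_Nd (mt_mem_Dg h)
  | zero => exact Dec.of_Nd (zero_mem _)
  | add x y _ _ hx hy => exact hx.add hy
  | smul a x _ hx => exact hx.smul a

theorem Dg_Sg_le {s : ℕ} : Dg (p := p) k (Sg P s) ≤ Dg k (Sd P LieHom.id 1) :=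
  Dg_mono fun _ _ h => h.imp_left And.left

theorem lie_mem_Sg {s : ℕ} {x y : LK p k P.LDag} (hx : x ∈ Dg k (Sd P LieHom.id 0))
    (hy : y ∈ Dg k (Sg P s)) : ⁅x, y⁆ ∈ Dg k (Sg P (s + 1)) :=
  lie_mem_Dg (fun i i' l l' h h' => by
    rcases h' with h' | h'
    · refine (h.lie (Or.inl h'.1)).imp_left fun h1 => ⟨h1, ?_⟩
      rw [add_comm s]; exact lie_mem_filt (mem_filt_one P.one_le_wDag l) h'.2
    · have := h.nd_zero.lie h'
      rw [zero_add] at this; exact Or.inr this) hx hy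

/-- Every element congruent to `E` modulo `𝒩̃^{sp}⟨1⟩` is conjugate to the sum of `E` and a
combination of monomials with exponents in `𝔄⁺(p)`. The terms of higher and higher weight are
brought to this form, by solving `R = σ z - z + Y`. -/
theorem exists_congrConj {X E : LK p k P.LDag} (hE : E ∈ Dg k (Sd P LieHom.id 0))
    (h : E - X ∈ Dg k (Sd P LieHom.id 1)) :
    ∃ Y ∈ Dg k (Spa P), CongrConj P LieHom.id (E + Y) X := by
  have hS : ∀ {j}, ∀ x ∈ Dg k (Sd P LieHom.id j), ∀ y ∈ Dg k (Sd P LieHom.id j),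
      ⁅x, y⁆ ∈ Dg k (Sd P (LieHom.id : P.LDag →ₗ⁅Fp⁆ _) j) :=
    fun _ hx _ hy => Sd_mono (by omega) (lie_mem_Sd hx hy)
  have key : ∀ s : ℕ, ∃ Y ∈ Dg k (Spa P), ∃ c ∈ Dg k (Sd P LieHom.id 1),
      sigmaK p c ∈ Dg k (Sd P LieHom.id 1) ∧
        E + Y - bch p (bch p (sigmaK p c) X) (-c) ∈ Dg k (Sg P (s + 1)) := by
    intro s
    induction s with
    | zero =>
      refine ⟨0, zero_mem _, 0, zero_mem _, by simp, ?_⟩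
      rw [map_zero, neg_zero, zero_bch, bch_zero, add_zero]
      exact Dg_mono (fun i l h => h.imp_left fun h => ⟨h, mem_filt_one P.one_le_wDag l⟩) h
    | succ s ih =>
      obtain ⟨Y, hY, c, hc, hσ, hR⟩ := ih
      set x := bch p (bch p (sigmaK p c) X) (-c) with hx
      have hY0 : Y ∈ Dg k (Sd P LieHom.id 0) :=
        Dg_mono (fun _ _ h => Or.inl (h.1.anti (Nat.zero_le 1))) hY
      have hx0 : x ∈ Dg k (Sd P LieHom.id 0) := by
        have := sub_mem (add_mem hE hY0) (Sd_zero (Dg_Sg_le hR))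
        rwa [sub_sub_cancel] at this
      obtain ⟨z, hz, hz', y, hy, h1⟩ := dec_of_mem hR
      have hz1 := Dg_Sg_le hz
      have hz1' := Dg_Sg_le hz'
      have hz0 := Sd_zero hz1
      have hz0' := Sd_zero hz1'
      have hW : ∀ x ∈ Dg k (Sd P LieHom.id 0), ∀ y ∈ Dg k (Sg P (s + 1 + 1)),
          ⁅x, y⁆ ∈ Dg k (Sg P (s + 1 + 1)) := fun x hx y hy => by
        refine Dg_mono (fun i l h => h.imp_left fun h => ⟨h.1, ?_⟩) (lie_mem_Sg hx hy)
        exact filt_anti (le_succ _) h.2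
      have h2 := bch_add_mem hS hW hz0' hx0
        (by rw [← lie_skew]; exact neg_mem (lie_mem_Sg hx0 hz'))
      have h3 := bch_add_mem hS hW (bch_mem hS hz0' hx0) (neg_mem hz0)
        (by rw [lie_neg]; exact neg_mem (lie_mem_Sg (bch_mem hS hz0' hx0) hz))
      refine ⟨Y - y, sub_mem hY hy, bch p z c, bch_mem hS hz1 hc, ?_⟩
      have e1 : sigmaK p (bch p z c) = bch p (sigmaK p z) (sigmaK p c) :=
        map_bch (sigmaL p k P.LDag) z c
      have e2 : bch p (bch p (sigmaK p (bch p z c)) X) (-bch p z c) =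
          bch p (bch p (sigmaK p z) x) (-z) := by
        rw [e1, neg_bch, ← bch_assoc, bch_assoc (sigmaK p z), bch_assoc (sigmaK p z)]
      refine ⟨by rw [e1]; exact bch_mem hS hz1' hσ, ?_⟩
      rw [e2]
      have h4 := sub_mem (sub_mem (Dg_mono (G' := Sg P (s + 1 + 1)) (fun _ _ => Or.inr) h1) h2) h3
      refine (congrArg (· ∈ Dg k (Sg P (s + 1 + 1))) ?_).mp h4
      abel
  obtain ⟨Y, hY, c, hc, hσ, h1⟩ := key (p - 1)
  refine ⟨Y, hY, c, hc, hσ, Dg_mono (fun i l h => ?_) h1⟩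
  rcases h with h | h
  · have h2 : l ∈ fil P LieHom.id (p - 1 + 1) := by rw [id_fil]; exact h.2
    rw [fil_eq_zero (by omega) h2]; exact Nd.zero _ _
  · exact h

end Solve

section Exists

section Comm
variable {L L' : Type*} [LieRing L] [LieAlgebra (ZMod p) L] [LieRing L'] [LieAlgebra (ZMod p) L']

/-! ### The linear part of a special lift -/

variable (p k L) in
/-- The commutator subalgebra of `L_𝒦`. -/
abbrev C2 : LieIdeal (Laur k) (LK p k L) :=
  ⁅(⊤ : LieIdeal (Laur k) (LK p k L)), (⊤ : LieIdeal (Laur k) (LK p k L))⁆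

theorem lie_mem_C2 (x y : LK p k L) : ⁅x, y⁆ ∈ C2 p k L := LieSubmodule.lie_mem_lie trivial trivial

theorem smul_mem_C2 (c : Fp) {x : LK p k L} (hx : x ∈ C2 p k L) : c • x ∈ C2 p k L := by
  rw [← algebraMap_smul (Laur k) c x]; exact (C2 p k L).smul_mem _ hx

theorem map_mem_C2 (φ : LK p k L →ₗ⁅Fp⁆ LK p k L') {x : LK p k L} (hx : x ∈ C2 p k L) :
    φ x ∈ C2 p k L' := by
  replace hx := commutator_induction hx
  induction hx using span_induction with
  | mem x hx =>
    obtain ⟨a, b, rfl⟩ := hx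
    rw [LieHom.map_lie]; exact lie_mem_C2 _ _
  | zero => rw [map_zero]; exact zero_mem _
  | add x y _ _ hx hy => rw [map_add]; exact add_mem hx hy
  | smul c x _ hx => rw [map_smul]; exact smul_mem_C2 c hx

theorem lenDer_sub_mem {S : Set ℤ} {N : ℕ} {w : ℤ → ℕ} (x : LK p k (TLie p S N w)) :
    baseDer (Laur k) TLie.lenDer x - x ∈ C2 p k (TLie p S N w) := by
  induction x using TensorProduct.induction_on with
  | zero => rw [map_zero, sub_zero]; exact zero_mem _
  | add x y hx hy => rw [map_add, add_sub_add_comm]; exact add_mem hx hy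
  | tmul u x =>
    change u ⊗ₜ TLie.lenDer x - u ⊗ₜ x ∈ _
    have h := TLie.mem_span_lnb x
    induction h using span_induction with
    | mem x hx =>
      obtain ⟨l, rfl⟩ := hx
      rw [TLie.lenDer_lnb]
      rcases l with _ | ⟨x, l⟩
      · simp [lnb]
      induction l using reverseRecOn with
      | nil => simp
      | append_singleton l y _ =>
        rw [← tmul_sub, map_cons, map_append, lnb_cons, map_singleton,
          brs_concat, tmul_sub, tmul_smul, ← mul_one u, ← lie_tmul]
        exact sub_mem (smul_mem_C2 _ (lie_mem_C2 _ _)) (lie_mem_C2 _ _)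
    | zero => simp
    | add x y _ _ hx hy => rw [map_add, tmul_add, tmul_add, add_sub_add_comm]; exact add_mem hx hy
    | smul c x _ hx => rw [map_smul, tmul_smul, tmul_smul, ← smul_sub]; exact smul_mem_C2 c hx

theorem logD_sub_mem_C2 (δ : LK p k L → LK p k L) (x : LK p k L) :
    logD Fp p δ x - δ x ∈ C2 p k L := by
  rw [logD_eq hp.out.two_le, add_sub_cancel_left]
  refine sum_mem fun m _ => smul_mem_C2 _ ?_
  rw [brIt_succ]; exact lie_mem_C2 _ _

end Comm

theorem lenDer_tneg {S : Set ℤ} {w : ℤ → ℕ} (α₀ : k) (i a : ℤ) :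
    baseDer (Laur k) (TLie.lenDer (p := p) (S := S) (N := deg p k) (w := w))
        (tneg p i (Dgen p S w α₀ a 0)) = tneg p i (Dgen p S w α₀ a 0) := by
  have h := Dgen_mem (p := p) (S := S) (w := w) (α₀ := α₀) a 0
  generalize Dgen p S w α₀ a 0 = x at h
  induction h using span_induction with
  | mem x hx =>
    obtain ⟨c, l, hl, rfl⟩ := hx
    refine congrArg (mon (-i) c ⊗ₜ[Fp] ·) (?_ : TLie.lenDer l = l)
    rcases hl with rfl | ⟨x, -, rfl⟩
    · exact map_zero _
    · rw [TLie.lenDer, TLie.der_genElt, one_smul]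
  | zero => rw [map_zero, map_zero]
  | add x y _ _ hx hy => rw [map_add, map_add, hx, hy]
  | smul c x _ hx =>
    rw [map_smul]
    exact ((derZ (k := k) (TLie.lenDer (p := p) (S := S) (N := deg p k) (w := w))).map_smul c
      (tneg p i x)).trans (congrArg (c • ·) hx)

theorem mon_smul_tneg {L : Type*} [LieRing L] [LieAlgebra Fp L] (i : ℤ) (x : k ⊗[Fp] L) :
    mon (-i) (1 : k) • tneg p 0 x = tneg p i x := by
  induction x using TensorProduct.induction_on with
  | tmul c l =>
    change (mon (-i) (1 : k) * mon (-0) c) ⊗ₜ l = mon (-i) c ⊗ₜ[Fp] l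
    rw [mon_mul, one_mul, neg_zero, add_zero]
  | _ => simp_all

theorem substK_tneg {L : Type*} [LieRing L] [LieAlgebra Fp L] (q : ℕ) (hq : 0 < q) (i : ℤ)
    (x : k ⊗[Fp] L) : substK p q hq (tneg p i x) = tneg p (q * i) x := by
  induction x using TensorProduct.induction_on with
  | tmul c l => exact substK_mt q hq i c l
  | _ => simp_all

open Classical in
/-- The element `ē` modulo commutators. -/
theorem given_sub_mem_C2 (hη : IsStructural p η) (he : IsGivenBy P α₀ η e) :
    e - ∑ a ∈ alph P, tneg p (a : ℤ) (D P α₀ a 0) ∈ C2 p k P.LBar := by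
  set δ := baseDer (Laur k) (TLie.lenDer (w := P.wt) (p := p) (S := Params.Zp p) (N := deg p k))
  have h1 := add_mem (lenDer_sub_mem e) (logD_sub_mem_C2 δ e)
  have hδ : ∀ a, δ (DK P α₀ a) = DK P α₀ a := fun a => lenDer_tneg α₀ 0 a
  have h2 : logD Fp p δ e - ∑ a ∈ alph P, tneg p (a : ℤ) (D P α₀ a 0) ∈ C2 p k P.LBar := by
    let G : List ℕ → LK p k P.LBar := fun l =>
      if l.length = 1 then tneg p (l.sum : ℕ) (D P α₀ (l.sum : ℕ) 0) else 0
    have h4 : ∑ a ∈ alph P, tneg p (a : ℤ) (D P α₀ a 0) = ∑ l ∈ words (alph P) p with l ≠ [], G l := by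
      rw [← sum_subset (s₁ := (alph P).image fun a => [a])]
      · rw [sum_image fun a _ b _ h => (List.cons.inj h).1]
        exact sum_congr rfl fun a _ => by simp [G]
      · rintro _ h
        obtain ⟨a, ha, rfl⟩ := mem_image.1 h
        exact Finset.mem_filter.2 ⟨mem_words.2 ⟨hp.out.one_lt, by simpa using ha⟩, by simp⟩
      · intro l hl hl'
        refine if_neg fun h => hl' ?_
        obtain ⟨a, rfl⟩ := List.length_eq_one_iff.1 h
        exact Finset.mem_image_of_mem _ ((mem_words.1 (Finset.mem_filter.1 hl).1).2 a (by simp))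
    rw [logD_given he, h4, ← sum_sub_distrib]
    refine sum_mem fun l hl => ?_
    obtain ⟨hl, h0⟩ := Finset.mem_filter.1 hl
    rcases l with _ | ⟨a, l⟩
    · exact absurd rfl h0
    rcases List.eq_nil_or_concat l with rfl | ⟨l, b, rfl⟩
    · have ha : a ∈ Z0 p := (Finset.mem_filter.1 ((mem_words.1 hl).2 a (by simp))).2
      have h5 : mon (-(a : ℤ)) (η [a]) • δ (DK P α₀ a) = tneg p (a : ℤ) (D P α₀ a 0) := by
        rw [hδ, hη.one a ha, DK, mon_smul_tneg]
      simp only [headBr, map_nil, brs_nil, List.sum_singleton, G, List.length_singleton,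
        if_true, h5, sub_self]
      exact zero_mem _
    · simp only [headBr, List.concat_eq_append, map_append, map_singleton, brs_concat,
        G, length_cons, length_append, List.length_nil]
      rw [if_neg (by omega), sub_zero]; exact (C2 p k P.LBar).smul_mem _ (lie_mem_C2 _ _)
  have h3 := sub_mem h2 h1
  convert h3 using 1
  abel

/-! ### Construction of a special lift -/

open Classical in
variable (P α₀) in
/-- The sum of the `t^{-ι} D^†_{ι 0}` with `ch(ι) ≥ 1`. -/
def linCh : LK p k P.LDag := ∑ ι ∈ Icc (0 : ℤ) (P.b * ((p : ℤ) - 1)) with ι ∈ P.Ap ∧ P.ch ι ≠ 0,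
    tneg p ι (DDag P α₀ ι 0)

variable (P α₀ e) in
/-- A special lift of `ē^{(q)}`. -/
def eLift : LK p k P.LDag := lT k P.sec (substK p P.q P.q_pos e) + linCh P α₀

theorem DDag_mem_Sd {ι : ℤ} (h : ι ∈ P.Ap) : DDag P α₀ ι 0 ∈ kG k (Sd P LieHom.id 0 ι) := by
  refine kG_mono (fun l hl => ?_) (Dgen_mem (S := P.Ap) (w := P.wDag) (α₀ := α₀) ι 0)
  rcases hl with rfl | ⟨x, rfl, rfl⟩
  · exact Or.inr (Nd.zero _ _)
  · have h1 := P.w0_le_iff.1 (le_refl (P.w0 x.index))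
    have hp2 := hp.out.two_le
    have h2 := h.2.2.2.2
    zify [hp2] at h2
    refine Or.inl ⟨P.wDag x.index, P.ch x.index, P.one_le_wDag x, h.1, ?_, le_rfl, ?_, ?_⟩
    · rw [Params.wDag]; push_cast; linarith
    · rw [Params.wDag]; push_cast; linarith
    · rw [id_filG]; exact ⟨genElt_mem_filt x, genElt_mem_grad x⟩

open Classical in
theorem eLift_mem (he : IsGivenBy P α₀ η e) : eLift P α₀ e ∈ Dg k (Sd P LieHom.id 0) :=
  add_mem (Eqd_le (substK_mem_Eqd (f := LieHom.id) (given_mem he)))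
    (sum_mem fun _ hι => tneg_mem_Dg (DDag_mem_Sd (Finset.mem_filter.1 hι).2.1))

theorem kTm_DDag {L : Type*} [LieRing L] [LieAlgebra Fp L] (f : P.LDag →ₗ⁅Fp⁆ L) {ι : ℤ}
    (h : ι ∈ P.Ap) : kTm k f (DDag P α₀ ι 0) = ∑ i : Fin (deg p k),
      (finBasis Fp k i) ⊗ₜ f (genElt p P.wDag (some (⟨ι, h⟩, i))) := by
  simp only [DDag, Dgen, if_neg h.2.1.ne', map_sum, kTm_tmul, frobPow_zero, xgen, dif_pos h]

theorem kTm_sec_D {a : ℕ} (ha : a ∈ Z0 p) : kTm k P.sec (D P α₀ a 0) = DDag P α₀ (P.q * a) 0 := by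
  rcases Nat.eq_zero_or_pos a with rfl | h0
  · simp only [D, DDag, Dgen, cast_zero, mul_zero, if_true, kTm_tmul, Params.sec, liftHom_genElt]
    rfl
  · have h1 : (a : ℤ) ∈ Params.Zp p :=
      ⟨by exact_mod_cast h0, by exact_mod_cast Nat.isCoprime_iff_coprime.2 (ha.resolve_left h0.ne')⟩
    have h2 : (P.q * a : ℤ) ≠ 0 := by have := P.q_pos; positivity
    simp only [D, DDag, Dgen, if_neg h1.1.ne', if_neg h2, map_sum, kTm_tmul, xgen, dif_pos h1,
      Params.sec, liftHom_genElt]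
    rfl

theorem DDag_eq_zero {ι : ℤ} (h0 : ι ≠ 0) (h : ι ∉ P.Ap) : DDag P α₀ ι 0 = 0 := by
  simp only [DDag, Dgen, if_neg h0, xgen, dif_neg h, tmul_zero, Finset.sum_const_zero]

open Classical in
theorem eLift_special (hη : IsStructural p η) (he : IsGivenBy P α₀ η e) :
    IsSpecial P α₀ e (eLift P α₀ e) where
  mem := mem_NDag_iff.2 (Dg_mono (fun _ _ h => h.nd_zero) (eLift_mem he))
  sp := mem_sup_iff.2 (eLift_mem he)
  compat := by
    have h1 : ∀ x : LK p k P.LBar, lT k P.V (lT k P.sec x) = x := by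
      intro x
      induction x using TensorProduct.induction_on with
      | tmul u l => exact congrArg (u ⊗ₜ[ZMod p] ·) (P.V_sec l)
      | _ => simp_all
    rw [← lT_eq, eLift, map_add, h1, linCh, map_sum, sum_eq_zero, add_zero]
    · rfl
    · intro ι hι
      have h2 := (Finset.mem_filter.1 hι).2
      rw [lT_tneg, kTm_DDag _ h2.1, sum_eq_zero, map_zero]
      intro i _
      rw [Params.V, liftHom_genElt, Params.vGen, if_neg h2.2, tmul_zero]
  lin := by
    have h1 := map_mem_C2 ((lT k P.sec).comp (substL k P.LBar P.q P.q_pos)) (given_sub_mem_C2 hη he)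
    have h2 : ((lT k P.sec).comp (substL k P.LBar P.q P.q_pos))
        (∑ a ∈ alph P, tneg p (a : ℤ) (D P α₀ a 0)) =
        ∑ a ∈ alph P, tneg p (P.q * a) (DDag P α₀ (P.q * a) 0) := by
      rw [map_sum]
      refine sum_congr rfl fun a ha => ?_
      refine (congrArg (lT k P.sec) (substK_tneg P.q P.q_pos a _)).trans ?_
      rw [lT_tneg, kTm_sec_D (Finset.mem_filter.1 ha).2]
    have hpc : ((p - 1 : ℕ) : ℝ) = p - 1 := by rw [Nat.cast_sub hp.out.one_le, Nat.cast_one]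
    have hp2 := hp.out.two_le
    have h3 : ∑ a ∈ alph P, tneg p (P.q * a : ℤ) (DDag P α₀ (P.q * a) 0) =
        ∑ ι ∈ Icc (0 : ℤ) (P.b * ((p : ℤ) - 1)) with ¬(ι ∈ P.Ap ∧ P.ch ι ≠ 0),
          tneg p ι (DDag P α₀ ι 0) := by
      rw [← sum_subset (s₁ := (alph P).image fun a : ℕ => (P.q * a : ℤ)),
        sum_image fun a _ b _ h => by simpa [P.q_pos.ne'] using h]
      · intro ι hι
        obtain ⟨a, ha, rfl⟩ := mem_image.1 hι
        have h4 : (a : ℝ) < (p - 1 : ℕ) * P.v₀ := by rw [hpc]; exact lt_of_mem_alph ha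
        have h5 := P.q_mul_mem_A0 (by omega) (by omega) h4
        exact Finset.mem_filter.2 ⟨mem_Icc.2 ⟨by positivity, (abs_le.1 h5.1.1).2⟩,
          fun h => h.2 h5.2.2.2.1⟩
      · intro ι hι hι'
        rw [DDag_eq_zero, map_zero]
        · rintro rfl
          refine hι' (mem_image.2 ⟨0, Finset.mem_filter.2 ⟨mem_range.2 ?_, Or.inl rfl⟩, by simp⟩)
          exact Nat.ceil_pos.2 P.w_pos
        · intro hA
          have h4 : P.ch ι = 0 := by_contra fun h => (Finset.mem_filter.1 hι).2 ⟨hA, h⟩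
          have h5 := (P.ch_eq_zero_iff hA.1).1 h4
          have h6 := P.A0_get_of_pb hA.1 h5
          refine hι' (mem_image.2 ⟨P.pa ι, Finset.mem_filter.2
            ⟨mem_range.2 (Nat.lt_ceil.2 h6.1), Or.inr ?_⟩, h6.2.1.symm⟩)
          have h7 := hA.2.2.1
          rwa [h5, Nat.gcd_zero_right] at h7
    rw [map_sub, h2, h3] at h1
    have h4 := Finset.sum_filter_add_sum_filter_not (Icc (0 : ℤ) (P.b * ((p : ℤ) - 1)))
      (fun ι => ι ∈ P.Ap ∧ P.ch ι ≠ 0) (fun ι => tneg p ι (DDag P α₀ ι 0))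
    rw [eLift, linCh, ← h4, add_comm, add_sub_add_left_eq_sub]; exact h1

end Exists

/-! ### Unipotent automorphisms -/

section Unip
variable {p : ℕ} {S : Set ℤ} {N : ℕ} {w d : ℤ → ℕ}

variable (p S N w d) in
/-- The span of the brackets of degree `< n`. -/
def Glt (n : ℕ) : Submodule (ZMod p) (TLie p S N w) :=
  Submodule.span (ZMod p) {z | ∃ l : List (Gen S N), wtSum d l < n ∧ z = lnb (l.map (genElt p w))}

theorem Glt_mono {m n : ℕ} (h : m ≤ n) : Glt p S N w d m ≤ Glt p S N w d n :=
  span_mono fun _ ⟨l, hl, hx⟩ => ⟨l, hl.trans_le h, hx⟩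

theorem lie_mem_Glt {a b n : ℕ} (h : a + b ≤ n + 1) {x y : TLie p S N w}
    (hx : x ∈ Glt p S N w d a) (hy : y ∈ Glt p S N w d b) : ⁅x, y⁆ ∈ Glt p S N w d n :=
  lie_mem_span_words (fun l l' l'' h1 h2 h' => by
    rw [wtSum_perm d h', wtSum_append]; omega) hx hy

theorem lnb_mem_Glt (l : List (Gen S N)) :
    lnb (l.map (genElt p w)) ∈ Glt p S N w d (wtSum d l + 1) :=
  subset_span ⟨l, Nat.lt_succ_self _, rfl⟩

theorem map_lnb_sub_mem {f : TLie p S N w →ₗ⁅ZMod p⁆ TLie p S N w}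
    (hf : ∀ g, f (genElt p w g) - genElt p w g ∈ Glt p S N w d (d g.index)) (l : List (Gen S N)) :
    f (lnb (l.map (genElt p w))) - lnb (l.map (genElt p w)) ∈ Glt p S N w d (wtSum d l) := by
  induction l using reverseRecOn with
  | nil => change f 0 - 0 ∈ _; rw [map_zero, sub_zero]; exact zero_mem _
  | append_singleton l y ih =>
    rcases eq_or_ne l [] with rfl | hl
    · have h := hf y
      have h1 : wtSum d ([] ++ [y]) = d y.index := by simp [wtSum]
      rw [h1]; exact h
    have h1 : wtSum d (l ++ [y]) = wtSum d l + d y.index := by simp [wtSum]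
    have hy : genElt p w y ∈ Glt p S N w d (d y.index + 1) :=
      subset_span ⟨[y], by simp [wtSum], rfl⟩
    rw [map_append, map_singleton, lnb_append_singleton _ (by simpa using hl), LieHom.map_lie, h1]
    set x := lnb (l.map (genElt p w))
    have h2 := lie_mem_Glt (n := wtSum d l + d y.index) (by omega) ih hy
    have h3 := lie_mem_Glt (n := wtSum d l + d y.index) (by omega)
      (add_mem (Glt_mono (le_succ _) ih) (lnb_mem_Glt l)) (hf y)
    have h4 := add_mem h2 h3
    rwa [sub_add_cancel, sub_lie, lie_sub, sub_add_sub_cancel'] at h4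

/-- A unipotent endomorphism is bijective. -/
theorem bijective_of_unip (hd : ∀ g : Gen S N, d g.index ≤ w g.index)
    {f : TLie p S N w →ₗ⁅ZMod p⁆ TLie p S N w}
    (hf : ∀ g, f (genElt p w g) - genElt p w g ∈ Glt p S N w d (d g.index)) :
    Function.Bijective f := by
  set n : Module.End (ZMod p) (TLie p S N w) := (f : TLie p S N w →ₗ[ZMod p] TLie p S N w) - 1
  have h1 : ∀ m, ∀ x ∈ Glt p S N w d (m + 1), n x ∈ Glt p S N w d m := by
    intro m x hx
    induction hx using span_induction with
    | mem x hx =>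
      obtain ⟨l, hl, rfl⟩ := hx; exact Glt_mono (Nat.lt_succ_iff.1 hl) (map_lnb_sub_mem hf l)
    | _ => simp_all [add_mem, smul_mem]
  have h2 : ∀ m, ∀ x ∈ Glt p S N w d m, (n ^ m) x = 0 := by
    intro m
    induction m with
    | zero =>
      intro x hx
      have h : Glt p S N w d 0 = ⊥ := span_eq_bot.2 fun _ ⟨_, hl, _⟩ => by omega
      rw [h] at hx; exact hx
    | succ m ih =>
      intro x hx
      rw [pow_succ, Module.End.mul_apply]; exact ih _ (h1 m x hx)
  have h3 : ∀ x : TLie p S N w, x ∈ Glt p S N w d p := by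
    intro x
    have := TLie.mem_span_lnb x
    refine span_le.2 ?_ this
    rintro _ ⟨l, rfl⟩
    rcases lt_or_ge (wtSum w l) p with h | h
    · refine subset_span ⟨l, lt_of_le_of_lt ?_ h, rfl⟩
      exact List.sum_le_sum fun g _ => hd g
    · rw [lnb_genElt_eq_zero p S N w l h]; exact zero_mem _
  have h4 : IsUnit (1 + n) := IsNilpotent.isUnit_one_add ⟨p, LinearMap.ext fun x => h2 p x (h3 x)⟩
  have h5 := (Module.End.isUnit_iff _).1 h4
  rwa [add_sub_cancel] at h5

theorem lnb_map_mem_filt {f : Gen S N → TLie p S N w} (hf : ∀ g, f g ∈ filt p S N w (w g.index))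
    (l : List (Gen S N)) (hl : l ≠ []) : lnb (l.map f) ∈ filt p S N w (wtSum w l) := by
  induction l using reverseRecOn with
  | nil => exact absurd rfl hl
  | append_singleton l y ih =>
    rcases eq_or_ne l [] with rfl | hl
    · have h1 : wtSum w ([] ++ [y]) = w y.index := by simp [wtSum]
      rw [h1]; exact hf y
    · rw [map_append, map_singleton, lnb_append_singleton _ (by simpa using hl), wtSum_append]
      refine lie_mem_filt (ih hl) ?_
      have h1 : wtSum w [y] = w y.index := by simp [wtSum]
      rw [h1]; exact hf y

/-- Automorphisms with prescribed unipotent values on the free generators. -/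
theorem exists_unip [hp : Fact p.Prime] (hd : ∀ g : Gen S N, d g.index ≤ w g.index)
    {v : Gen S N → TLie p S N w} (hv : ∀ g, v g ∈ filt p S N w (w g.index))
    (hv' : ∀ g, v g ∈ Glt p S N w d (d g.index)) :
    ∃ A : TLie p S N w ≃ₗ⁅ZMod p⁆ TLie p S N w,
      ∀ g, A.toLieHom (genElt p w g) = genElt p w g + v g := by
  have h0 : ∀ l : List (Gen S N), p ≤ wtSum w l →
      lnb (l.map fun g => genElt p w g + v g) = 0 := fun l hl => by
    have h := lnb_map_mem_filt (fun g => add_mem (genElt_mem_filt g) (hv g)) l (by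
      rintro rfl; exact absurd hl (not_le.2 hp.out.pos))
    rwa [filt_eq_bot hl] at h
  refine ⟨LieEquiv.ofBijective (tLift _ h0) (bijective_of_unip hd fun g => ?_),
    fun g => tLift_genElt _ h0 g⟩
  rw [tLift_genElt, add_sub_cancel_left]; exact hv' g

end Unip

section Exists

/-! ### Existence of the conjugates -/

theorem evalFst_mem {L : Type*} [LieRing L] [LieAlgebra Fp L] {G : L → Prop}
    {M : Submodule Fp L} (h : ∀ l, G l → l ∈ M) (φ : k →ₗ[Fp] Fp)
    {x : k ⊗[Fp] L} (hx : x ∈ kG k G) : evalFst φ x ∈ M := by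
  induction hx using span_induction with
  | mem x hx =>
    obtain ⟨c, l, hl, rfl⟩ := hx
    rw [evalFst_tmul]; exact smul_mem _ _ (h l hl)
  | _ => simp_all [add_mem, smul_mem]

theorem sum_tmul_evalFst {L : Type*} [LieRing L] [LieAlgebra Fp L] (x : k ⊗[Fp] L) :
    ∑ i : Fin (deg p k), (finBasis Fp k i) ⊗ₜ[Fp]
      evalFst ((finBasis Fp k).coord i) x = x := by
  induction x using TensorProduct.induction_on with
  | zero => simp only [map_zero, tmul_zero, Finset.sum_const_zero]
  | add x y hx hy => simp only [map_add, tmul_add, sum_add_distrib, hx, hy]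
  | tmul c l =>
    simp only [evalFst_tmul, ← TensorProduct.smul_tmul, ← sum_tmul, Module.Basis.coord_apply]
    rw [Module.Basis.sum_repr]

/-- The generators of `𝒩̃^{sp}⟨1⟩` with exponent `ι ∈ 𝔄⁺(p)` have weight at least that of
`D^†_{ι n}`. -/
theorem Spd.mem_filt_wDag {i : ℤ} {l : P.LDag} (h : Spd P LieHom.id 1 i l) (hi : 0 < i) :
    l ∈ P.filtDag (P.wDag i) ∧ l ∈ Glt p P.Ap (deg p k) P.wDag P.ch (P.ch i) := by
  obtain ⟨s, m, h1, h2, h3, h4, h5, h6⟩ := h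
  have hb := P.b_pos_int
  rw [id_filG] at h6
  constructor
  · have hcs : P.ch i < s := by
      by_contra hc
      have : (s : ℤ) * P.b ≤ P.ch i * P.b := by gcongr; omega
      linarith
    have hw : P.w0 i ≤ s - P.ch i := P.w0_le_iff.2 (by rw [Nat.cast_sub hcs.le, sub_mul]; linarith)
    exact filt_anti (by rw [Params.wDag]; omega) h6.1
  · exact span_mono (by rintro _ ⟨l, hl, rfl⟩; exact ⟨l, by omega, rfl⟩) h6.2

/-- Every element of the span of the monomials with exponents in `𝔄⁺(p)` is the change of
`ẽ^{sp}` under a unipotent automorphism. -/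
theorem exists_lT_eq_add {Y : LK p k P.LDag} (hY : Y ∈ Dg k (Spa P)) :
    ∃ A : P.LDag ≃ₗ⁅Fp⁆ P.LDag, lT k A.toLieHom (eLift P α₀ e) = eLift P α₀ e + Y ∧
      ∀ ι : ℤ, (ι ∈ P.Ap ∨ ι = 0) →
        lTensor k (A : P.LDag →ₗ[Fp] P.LDag) (DDag P α₀ ι 0) - DDag P α₀ ι 0 ∈
          ⨆ m : Fin (P.ch ι), (P.gradDag m).baseChange k := by
  classical
  have hco : ∀ ι, co p k ι Y ∈ kG k (Spa P ι) := co_mem_kG hY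
  let v : Gen P.Ap (deg p k) → P.LDag := fun g => g.elim 0 fun x =>
    evalFst ((finBasis Fp k).coord x.2) (co p k x.1 Y)
  have hv : ∀ g, v g ∈ filt p P.Ap (deg p k) P.wDag (P.wDag g.index) := by
    rintro (_ | ⟨ι, i⟩)
    · exact zero_mem _
    · exact evalFst_mem (fun l hl => (hl.1.mem_filt_wDag hl.2.2.1).1) _ (hco ι)
  have hv' : ∀ g, v g ∈ Glt p P.Ap (deg p k) P.wDag P.ch (P.ch g.index) := by
    rintro (_ | ⟨ι, i⟩)
    · exact zero_mem _
    · exact evalFst_mem (fun l hl => (hl.1.mem_filt_wDag hl.2.2.1).2) _ (hco ι)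
  obtain ⟨A, hA⟩ := exists_unip (d := P.ch) (fun g => Nat.le_add_left _ _) hv hv'
  obtain ⟨f, hfA⟩ : ∃ f : P.LDag →ₗ⁅Fp⁆ P.LDag, A.toLieHom = f := ⟨_, rfl⟩
  have hf : ∀ g, f (genElt p P.wDag g) = genElt p P.wDag g + v g := fun g => hfA ▸ hA g
  have hD : ∀ ι ∈ P.Ap, kTm k f (DDag P α₀ ι 0) = DDag P α₀ ι 0 + co p k ι Y := by
    intro ι hι
    have h1 := kTm_DDag (α₀ := α₀) (LieHom.id : P.LDag →ₗ⁅Fp⁆ P.LDag) hι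
    rw [kTm_id] at h1
    have h2 : ∑ i, (finBasis Fp k i) ⊗ₜ[Fp] v (some (⟨ι, hι⟩, i)) = co p k ι Y :=
      sum_tmul_evalFst (co p k ι Y)
    rw [kTm_DDag f hι, h1, ← h2, ← sum_add_distrib]
    refine sum_congr rfl fun i _ => ?_
    rw [hf, tmul_add, LieHom.id_apply]
  refine ⟨A, ?_, fun ι hι => ?_⟩
  · rw [hfA]
    have h1 : f.comp P.sec = P.sec := TLie.hom_ext fun x => by
      rw [LieHom.comp_apply, Params.sec, liftHom_genElt]
      rcases P.sGen_spec x with h | ⟨y, h, -, h2⟩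
      · rw [h, map_zero]
      · have h3 := hv' y
        have h4 : Glt p P.Ap (deg p k) P.wDag P.ch 0 = ⊥ :=
          span_eq_bot.2 fun _ ⟨_, hl, _⟩ => by omega
        rw [h2, h4] at h3
        rw [h, hf, (mem_bot _).1 h3, add_zero]
    have h2 : ∑ ι ∈ Icc (0 : ℤ) (P.b * ((p : ℤ) - 1)) with ι ∈ P.Ap ∧ P.ch ι ≠ 0,
        tneg p ι (co p k ι Y) = Y := by
      refine eq_of_co_eq (sum_mem fun ι _ => tneg_mem_Dg (hco ι)) hY fun j => ?_
      rw [map_sum]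
      simp only [co_tneg, Finset.sum_ite_eq]
      refine ite_eq_left_iff.2 fun hj => (kG_eq_zero (fun l hl => ?_) (hco j)).symm
      refine absurd (Finset.mem_filter.2 ⟨mem_Icc.2 ⟨hl.2.2.1.le, ?_⟩, hl.2, ?_⟩) hj
      · exact (abs_le.1 hl.2.1.1).2
      · obtain ⟨_, _, _, _, _, h4, _⟩ := hl.1; omega
    rw [eLift, map_add, ← lT_comp, h1, add_assoc]
    congr 1
    refine Eq.trans ?_ (congrArg (linCh P α₀ + ·) h2)
    rw [linCh, map_sum, ← sum_add_distrib]
    refine sum_congr rfl fun ι hι => ?_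
    rw [lT_tneg, hD ι (Finset.mem_filter.1 hι).2.1, map_add]
  · have h0 : lTensor k (A : P.LDag →ₗ[Fp] P.LDag) (DDag P α₀ ι 0) =
        kTm k f (DDag P α₀ ι 0) := hfA ▸ (kTm_eq A.toLieHom _).symm
    rw [h0]
    rcases hι with hι | rfl
    · rw [hD ι hι, add_sub_cancel_left]
      suffices h : kG k (Spa P ι) ≤ (⨆ m : Fin (P.ch ι),
        (P.gradDag m).baseChange k).restrictScalars Fp from h (hco ι)
      refine span_le.2 ?_
      rintro _ ⟨c, l, hl, rfl⟩
      obtain ⟨s, m, -, -, -, h4, -, h6⟩ := hl.1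
      rw [id_filG] at h6
      exact Submodule.mem_iSup_of_mem (⟨m, h4⟩ : Fin (P.ch ι))
        (Submodule.tmul_mem_baseChange_of_mem c h6.2)
    · have h1 : f (genElt p P.wDag none) = genElt p P.wDag none := (hf none).trans (add_zero _)
      simp only [DDag, Dgen, if_true, kTm_tmul, h1, sub_self]; exact zero_mem _

/-- The twist changes the special lift by an element of `𝒩̃^{sp}⟨1⟩`. The change is moved by a
conjugation to the exponents in `𝔄⁺(p)`, where an automorphism produces it. -/
theorem exists_isConj (he : IsGivenBy P α₀ η e) (γ : Fp) :
    ∃ A, IsConj P α₀ (eLift P α₀ e) γ A := by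
  have hE := eLift_mem he
  have h1 : eLift P α₀ e - twK P P.LDag γ (eLift P α₀ e) ∈ Dg k (Sd P LieHom.id 1) := by
    obtain ⟨x, hx, h⟩ := (conjData P LieHom.id).Om_sub_mem γ (spq _ hE)
    rw [Om_spq] at h
    have h2 := Dg_Nd_le_Sd (j := 1) (spq_eq_iff.1 (sub_eq_iff_eq_add.1 h :
      spq _ _ = spq (x + eLift P α₀ e) (add_mem (Sd_zero hx) hE)))
    have h3 := neg_mem (add_mem h2 hx)
    refine (congrArg (· ∈ Dg k (Sd P LieHom.id 1)) ?_).mp h3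
    abel
  obtain ⟨Y, hY, h2⟩ := exists_congrConj hE h1
  obtain ⟨A, hA, hA'⟩ := exists_lT_eq_add hY
  have hm : eLift P α₀ e + Y ∈ Dg k (Sd P LieHom.id 0) :=
    add_mem hE (Dg_mono (fun _ _ h => Or.inl (h.1.anti (Nat.zero_le 1))) hY)
  have h3 := (h2.symm hm).2
  rw [← hA] at h3 hm; exact ⟨A, h3.conj hm, hA'⟩

end Exists

end

end NilpAS

open scoped TensorProduct in
theorem theorem4p1 (p : ℕ) [Fact p.Prime] (k : Type*) [Field k] [Finite k] [Algebra (ZMod p) k]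
    (α₀ : k) (hα₀ : Algebra.trace (ZMod p) k α₀ = 1)
    (P : NilpAS.Params p (NilpAS.deg p k))
    (η : List ℕ → k) (hη : NilpAS.IsStructural p η)
    (e : NilpAS.LK p k P.LBar) (he : NilpAS.IsGivenBy P α₀ η e)
    (mι : ℤ → ℕ)
    (hmι : ∀ ι ∈ P.A1p, ∀ n : ℕ, ι * (p : ℤ) ^ n ≤ ((p : ℤ) - 1) * P.b → n ≤ mι ι) :
    (∃ E, NilpAS.IsSpecial P α₀ e E ∧ ∀ γ : ZMod p, ∃! A, NilpAS.IsConj P α₀ E γ A) ∧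
    ∀ E, NilpAS.IsSpecial P α₀ e E →
      ∀ A : ZMod p → (P.LDag ≃ₗ⁅ZMod p⁆ P.LDag), (∀ γ, NilpAS.IsConj P α₀ E γ (A γ)) →
        IsLeast {I : LieIdeal (ZMod p) P.LBar |
            ∀ ι ∈ P.A1p, ∀ (m : ℕ) (α : ℚ), α ∈ NilpAS.ASet p P.w (NilpAS.ustar p) m →
              (ι : ℚ) = P.q * (p : ℚ) ^ m * α - (p : ℚ) ^ m * P.b →
                NilpAS.F0 P α₀ η α (m + mι ι) ∈ I.toSubmodule.baseChange k}
          (NilpAS.ramIdeal P A) := by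
  exact ⟨⟨NilpAS.eLift P α₀ e, NilpAS.eLift_special hη he, fun γ =>
    (NilpAS.exists_isConj he γ).imp fun _ h => ⟨h, fun _ h' =>
      NilpAS.IsConj.unique hα₀ (NilpAS.eLift_special hη he) h' h⟩⟩,
    fun E hE A hA => NilpAS.isLeast_ramIdeal hα₀ hη he hmι hE hA⟩
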